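/- Fix the following data. * A commutative integral domain $R$, integers $n,\ell\ge 0$, and a symmetrizable oriented quiver $\Gamma=(I,E)$ attached to a symmetrizable generalized Cartan matrix $(a_{ij})_{i,j\in I}$ with symmetrizer $(d_i)_{i\in I}$, $d_i\in\mathbb{Z}_{>0}$: if $i\ne j$ and $a_{ij}\neq 0$, then either $a_{ij}a_{ji}<4$ and $i,j$ are joined by exactly one edge (multiple edges count as one), or $a_{ij}=a_{ji}=-2$ and there is one edge in each direction (affine $A_1$); otherwise there are no edges between $i$ and $j$. * A ghost shift $\sigma\colon E\to\mathbb{R}_{\ne 0}$. An edge $\epsilon$ is *owned* by its source if $\sigma_\epsilon>0$ and by its target if $\sigma_\epsilon<0$; the other end is its *partner*. Every vertex owns only finitely many edges. * Red positions $\kappa_1<\dots<\kappa_\ell$ in $\mathbb{R}$ with labels $\rho_1,\dots,\rho_\ell\in I$. * Polynomials $Q_{ij}(u,v)\in R[u,v]$ with $Q_{ii}=0$ and, for $i\ne j$, $Q_{ij}(u,v)=Q_{ji}(v,u)$; $Q_{ij}$ invertible if $i,j$ are not joined by an edge; and $Q_{ij}$ non-zero and homogeneous of degree $-2d_ia_{ij}$,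 where $\deg u=2d_i$, $\deg v=2d_j$, with all its non-zero coefficients units. Put $Q_{i,j,i}(u,v,w)=\frac{Q_{ij}(u,v)-Q_{ij}(w,v)}{w-u}$. * $\beta=\sum_i b_i\alpha_i$ with $b_i\in\mathbb{Z}_{\geq 0}$ and $\sum_i b_i=n$, and $I^\beta=\{\mathbf i\in I^n\mid\sum_k\alpha_{i_k}=\beta\}$. * A finite non-empty set $X\subset\mathbb{R}^n$ of loadings (for the fixed charge $\kappa$): for $x\in X$ and any residues $\mathbf i\in I^n$, the positions $x_k$ of the solid strings, $x_k+|\sigma_\epsilon|$ of the ghost strings ($\epsilon$ owned by $i_k$), and $\kappa_m$ of the red strings are pairwise distinct. A *weighted KLRW diagram* from $(x,\mathbf i)$ (bottom) to $(y,\mathbf j)$ (top), with $x,y\in X$ and $\mathbf i,\mathbf j\in I^\beta$, is a string diagram in $\mathbb{R}\times[0,1]$ considered up to isotopy. It consists of solid strings, the $k$th of residue $i_k$ and running from $x_k$ to $y_{w(k)}$ for some $w\in S_n$ with $\mathbf j=w\cdot\mathbf i$ (that is, $j_{w(k)}=i_k$); of a ghost, shifted by $|\sigma_\epsilon|$ to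 the right, of every solid $i$-string for every edge $\epsilon$ owned by $i$; and of vertical red strings at the $\kappa_m$. No string turns back, and the only intersections are transverse crossings of two strings. Solid strings may carry dots, which also appear on their ghosts. In particular, $1_{x,\mathbf i}$ is the diagram with vertical strings and no dots, and $y_1^{a_1}\cdots y_n^{a_n}1_{x,\mathbf i}$ has in addition $a_k$ dots on the $k$th solid string. The *weighted KLRW algebra* $W_\beta(X)$ is the unital associative $R$-algebra generated by these diagrams, where $ED$ is the diagram with $E$ on top of $D$ if the end points match and $ED=0$ otherwise, $1=\sum_{x,\mathbf i}1_{x,\mathbf i}$, and subject to the following relations, each applied simultaneously near all strings that move with the solid strings involved. Say that a ghost string attached to $\epsilon$ and a solid string *interact* if the residue of the latter is the partner of $\epsilon$. * Dots pass through all crossings, except that for a crossing $\psi$ of two solid strings of the same residue $y_{L}\psi-\psi y_{R}=1=\psi y_{L}-y_{R}\psi$. Here $y_L,y_R$ are a dot on the left and on the right string above (if written before $\psi$) or below (if written after $\psi$) the crossing, and $1$ is the resolved crossing. * A double crossing of two strings can be removed (Reidemeister II), except that it is $0$ for two solid strings of the same residue, it equals $Q_{ij}(y_r,y_s)$ times the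 uncrossed diagram if a ghost of the $r$th solid string, of residue $i$, interacts with the $s$th solid string, of residue $j$, and it equals a dot on the solid string if a solid and a red string of the same label are involved. * Three strings satisfy Reidemeister III, except in the following three cases, where LHS (respectively RHS) is the diagram in which the middle string passes to the left (respectively right) of the crossing of the other two, $\mathrm{Id}$ is the diagram without these crossings, and $r,s,t$ number the solid strings that the three strings belong to, from left to right at the bottom: $\mathrm{LHS}=\mathrm{RHS}-Q_{i,j,i}(y_r,y_s,y_t)\,\mathrm{Id}$ for a solid $j$-string between two ghosts of $i$-strings attached to the same edge with which it interacts; $\mathrm{LHS}=\mathrm{RHS}-Q_{j,i,j}(y_r,y_s,y_t)\,\mathrm{Id}$ for a ghost of an $i$-string between two solid $j$-strings with which it interacts; $\mathrm{LHS}=\mathrm{RHS}+\mathrm{Id}$ for a red $i$-string between two solid $i$-strings. Diagrams have degrees, which are the sums of the degrees of their dots and crossings: $2d_i$ for a dot on a solid $i$-string, $-2d_i$ for a crossing of two solid $i$-strings, $-d_ia_{ij}$ for a crossing of a ghost $i$-string with a solid $j$-string with which it interacts, $d_i$ for a crossing of a solid and a red $i$-string, and $0$ for all other crossings. A *permutation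 diagram* for $w\in S_n$ is a diagram $D(w)=D_{x,\mathbf i}^{y,\mathbf j}(w)$ without dots from $(x,\mathbf i)$ to $(y,\mathbf j)$, $\mathbf j=w\cdot\mathbf i$, whose solid strings realize $w$ and in which any two strings cross at most once. **Proposition.** The degree makes $W_\beta(X)$ a $\mathbb{Z}$-graded algebra. Permutation diagrams $D_{x,\mathbf i}^{y,\mathbf j}(w)$ exist for all $x,y\in X$, $\mathbf i,\mathbf j\in I^\beta$ and $w\in S_n$ with $\mathbf j=w\cdot\mathbf i$, and for every choice of them $W_\beta(X)$ is free as an $R$-module with homogeneous basis $$\{\,1_{y,\mathbf j}\,D_{x,\mathbf i}^{y,\mathbf j}(w)\,y_1^{a_1}\cdots y_n^{a_n}\,1_{x,\mathbf i}\mid x,y\in X,\ \mathbf i,\mathbf j\in I^\beta,\ w\in S_n,\ \mathbf j=w\cdot\mathbf i,\ a_1,\dots,a_n\in\mathbb{Z}_{\ge 0}\,\}.$$ -/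

import Mathlib

open scoped BigOperators

noncomputable section

namespace WeightedKLRW

/-! ### Quivers, ghost shifts and `Q`-polynomials -/

/-- A symmetrizable oriented quiver with vertex set `I` and edge set `E`: a symmetrizable
generalized Cartan matrix with symmetrizer `d`, such that two distinct vertices `i`, `j` with
`a_ij ≠ 0` either satisfy `a_ij a_ji < 4` and are joined by exactly one edge (edges of higher
multiplicity count as one edge; the orientation is arbitrary), or form the affine `A₁` quiver and
are joined by exactly two edges, one in each direction. -/
structure SymQuiver (I E : Type*) where
  cartan : I → I → ℤ
  d : I → ℕ
  src : E → I
  tgt : E → I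
  cartan_diag : ∀ i, cartan i i = 2
  cartan_nonpos : ∀ i j, i ≠ j → cartan i j ≤ 0
  cartan_zero : ∀ i j, cartan i j = 0 → cartan j i = 0
  d_pos : ∀ i, 0 < d i
  symm : ∀ i j, (d i : ℤ) * cartan i j = (d j : ℤ) * cartan j i
  edge_adj : ∀ e, src e ≠ tgt e ∧ cartan (src e) (tgt e) ≠ 0
  adj_edge : ∀ i j, i ≠ j → cartan i j ≠ 0 →
    (cartan i j * cartan j i < 4 ∧
      ∃! e, (src e = i ∧ tgt e = j) ∨ (src e = j ∧ tgt e = i)) ∨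
    (cartan i j = -2 ∧ cartan j i = -2 ∧
      (∃! e, src e = i ∧ tgt e = j) ∧ (∃! e, src e = j ∧ tgt e = i))

/-- The polynomial `Q_{i,j,i}(u,v,w) = (Q(u,v) - Q(w,v)) / (w - u)` attached to `Q = Q_{ij}`, in the
variables `u = X 0`, `v = X 1`, `w = X 2`; see `divDiff_spec`. -/
def divDiff {R : Type*} [CommRing R] (Q : MvPolynomial (Fin 2) R) : MvPolynomial (Fin 3) R :=
  -∑ m ∈ Q.support, MvPolynomial.C (Q.coeff m) * MvPolynomial.X 1 ^ m 1 *
    ∑ p ∈ Finset.range (m 0), MvPolynomial.X 2 ^ p * MvPolynomial.X 0 ^ (m 0 - 1 - p)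

theorem divDiff_spec {R : Type*} [CommRing R] (Q : MvPolynomial (Fin 2) R) :
    divDiff Q * (MvPolynomial.X 2 - MvPolynomial.X 0) =
      MvPolynomial.aeval ![MvPolynomial.X 0, MvPolynomial.X 1] Q -
      MvPolynomial.aeval ![(MvPolynomial.X 2 : MvPolynomial (Fin 3) R), MvPolynomial.X 1] Q := by
  rw [MvPolynomial.aeval_def, MvPolynomial.aeval_def, MvPolynomial.eval₂_eq',
    MvPolynomial.eval₂_eq', divDiff, neg_mul, Finset.sum_mul, ← Finset.sum_sub_distrib,
    ← Finset.sum_neg_distrib]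
  refine Finset.sum_congr rfl fun m _ => ?_
  have h := Commute.geom_sum₂_mul
    (Commute.all (MvPolynomial.X 2 : MvPolynomial (Fin 3) R) (MvPolynomial.X 0)) (m 0)
  rw [mul_assoc, h]
  simp only [MvPolynomial.algebraMap_eq, Fin.prod_univ_two, Matrix.cons_val_zero,
    Matrix.cons_val_one]
  ring

/-- All the data on which a weighted KLRW algebra depends (with a fixed charge). -/
structure Datum (R : Type*) [CommRing R] (I E : Type*) (n l : ℕ) where
  quiver : SymQuiver I E
  /-- the ghost shift -/
  shift : E → ℝ
  shift_ne : ∀ e, shift e ≠ 0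
  /-- every string has only finitely many ghosts -/
  finite_ghosts : ∀ i, {e | (if 0 < shift e then quiver.src e else quiver.tgt e) = i}.Finite
  /-- positions and labels of the red strings -/
  charge : Fin l → ℝ
  charge_strictMono : StrictMono charge
  rho : Fin l → I
  /-- the polynomials `Q_ij(u,v)`, with `u = X 0` and `v = X 1` -/
  Q : I → I → MvPolynomial (Fin 2) R
  Q_diag : ∀ i, Q i i = 0
  Q_unit : ∀ i j, i ≠ j → quiver.cartan i j = 0 → IsUnit (Q i j)
  /-- `u` and `v` have degrees `2 d_i` and `2 d_j`, and `Q_ij` has degree `-2 d_i a_ij`, which is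
  twice the degree of the crossing of a ghost `i`-string and a solid `j`-string. -/
  Q_homogeneous : ∀ i j, i ≠ j → MvPolynomial.IsWeightedHomogeneous
    (![2 * (quiver.d i : ℤ), 2 * (quiver.d j : ℤ)] : Fin 2 → ℤ) (Q i j)
    (-2 * ((quiver.d i : ℤ) * quiver.cartan i j))
  Q_ne_zero : ∀ i j, i ≠ j → Q i j ≠ 0
  Q_coeff : ∀ i j, i ≠ j → ∀ m ∈ (Q i j).support, IsUnit ((Q i j).coeff m)
  Q_symm : ∀ i j, i ≠ j → Q j i = MvPolynomial.rename (Equiv.swap 0 1) (Q i j)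
  /-- an element of the positive root lattice of height `n`: the labels of the solid strings -/
  beta : I →₀ ℕ
  beta_height : (beta.sum fun _ b => b) = n
  /-- the positioning: a finite set of solid positions -/
  X : Finset (Fin n → ℝ)
  X_nonempty : X.Nonempty
  /-- every element of `X` is a loading: whatever the residues of the solid strings are, the
  positions of all (solid, ghost and red) strings are pairwise distinct. A solid string of residue
  `i` at `x` has a ghost at `x + |shift e|` for every edge `e` that starts at `i` and has positive
  shift and for every edge `e` that ends at `i` and has negative shift. -/
  X_loading : ∀ x ∈ X,
    (∀ k k', x k = x k' → k = k') ∧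
    (∀ k k' e, x k ≠ x k' + |shift e|) ∧
    (∀ k m, x k ≠ charge m) ∧
    (∀ k e m, x k + |shift e| ≠ charge m) ∧
    (∀ k k' e e', k ≠ k' → x k + |shift e| ≠ x k' + |shift e'|) ∧
    (∀ (_ : Fin n) e e',
      (if 0 < shift e then quiver.src e else quiver.tgt e) =
        (if 0 < shift e' then quiver.src e' else quiver.tgt e') →
      |shift e| = |shift e'| → e = e')

/-- Labels for the strings of a diagram: solid strings, ghosts (of the `k`th solid string, attached
to an edge) and red strings. Solid strings are labelled from the bottom of the diagram. -/
inductive Str (n l : ℕ) (E : Type*)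
  | solid (k : Fin n) : Str n l E
  | ghost (k : Fin n) (e : E) : Str n l E
  | red (m : Fin l) : Str n l E

/-- The solid string that a string moves with (`none` for the red strings). -/
def Str.carrier {n l : ℕ} {E : Type*} : Str n l E → Option (Fin n)
  | .solid k => some k
  | .ghost k _ => some k
  | .red _ => none

/-- A horizontal slice of a diagram: the positions of the solid strings and the number of dots that
each of them carries at this height (every dot comes with ghost dots on all ghosts). -/
@[ext] structure Slice (n : ℕ) where
  pos : Fin n → ℝ
  dots : Fin n → ℕ

/-- Renaming the solid strings of a slice. -/
def Slice.relabel {n : ℕ} (w : Equiv.Perm (Fin n)) (s : Slice n) : Slice n :=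
  ⟨s.pos ∘ w, s.dots ∘ w⟩

namespace Datum

variable {R : Type*} [CommRing R] {I E : Type*} {n l : ℕ} (K : Datum R I E n l)

/-- The vertex whose strings have a ghost attached to the edge `e`. -/
def owner (e : E) : I := if 0 < K.shift e then K.quiver.src e else K.quiver.tgt e

/-- The other end of the edge `e`. -/
def partner (e : E) : I := if 0 < K.shift e then K.quiver.tgt e else K.quiver.src e

/-- The strings that occur if the solid strings have residues `res`. -/
def Active (res : Fin n → I) : Str n l E → Prop
  | .solid _ => True
  | .ghost k e => K.owner e = res k
  | .red _ => True

/-- The horizontal position of a string if the solid strings are at positions `z`. -/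
def strPos (z : Fin n → ℝ) : Str n l E → ℝ
  | .solid k => z k
  | .ghost k e => z k + |K.shift e|
  | .red m => K.charge m

/-- All strings are at different positions. -/
def Generic (res : Fin n → I) (z : Fin n → ℝ) : Prop :=
  ∀ a b, K.Active res a → K.Active res b → K.strPos z a = K.strPos z b → a = b

/-- The crossings on the way from the slice `z` up to the slice `z'`, the strings being straight
between the two slices: the pairs `(a, b)` such that `a` starts to the left of `b` and ends to the
right of it. -/
def crossings (res : Fin n → I) (z z' : Fin n → ℝ) : Set (Str n l E × Str n l E) :=
  {c | K.Active res c.1 ∧ K.Active res c.2 ∧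
    K.strPos z c.1 < K.strPos z c.2 ∧ K.strPos z' c.2 < K.strPos z' c.1}

/-- At most one crossing takes place between two slices, together with those crossings that are
bound to happen at the same height, because they involve strings that move with the same solid
strings and that are the same distance apart. -/
def Simple (res : Fin n → I) (z z' : Fin n → ℝ) : Prop :=
  ∀ c ∈ K.crossings res z z', ∀ c' ∈ K.crossings res z z',
    c.1.carrier = c'.1.carrier ∧ c.2.carrier = c'.2.carrier ∧
    K.strPos z c.2 - K.strPos z c.1 = K.strPos z c'.2 - K.strPos z c'.1

/-- The residue sequences `I^β`. -/
def ResSeq : Type _ := {i : Fin n → I // ∑ k, Finsupp.single (i k) 1 = K.beta}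

/-- The pairs `(x, i)` of a loading `x` in `X` and a residue sequence `i` in `I^β`. -/
structure Obj where
  loading : K.X
  resSeq : K.ResSeq

variable {K}

def Obj.pos (p : K.Obj) : Fin n → ℝ := p.loading.1
def Obj.res (p : K.Obj) : Fin n → I := p.resSeq.1

theorem Obj.generic (p : K.Obj) : K.Generic p.res p.pos := by
  obtain ⟨h1, h2, h3, h4, h5, h6⟩ := K.X_loading p.loading.1 p.loading.2
  rintro (k | ⟨k, e⟩ | m) (k' | ⟨k', e'⟩ | m') ha hb h
  · exact congrArg _ (h1 _ _ h)
  · exact absurd h (h2 _ _ _)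
  · exact absurd h (h3 _ _)
  · exact absurd h.symm (h2 _ _ _)
  · by_cases hk : k = k'
    · subst hk
      have := h6 k e e' (Eq.trans ha (Eq.symm hb)) (add_left_cancel h)
      rw [this]
    · exact absurd h (h5 _ _ _ _ hk)
  · exact absurd h (h4 _ _ _)
  · exact absurd h.symm (h3 _ _)
  · exact absurd h.symm (h4 _ _ _)
  · exact congrArg _ (K.charge_strictMono.injective h)

variable (K)

instance : Finite K.ResSeq := by
  have key : ∀ (i : K.ResSeq) (k : Fin n), i.1 k ∈ K.beta.support := by
    intro i k
    have hi : ∑ k, Finsupp.single (i.1 k) 1 = K.beta := i.2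
    have hk : (∑ k', Finsupp.single (i.1 k') 1 : I →₀ ℕ) (i.1 k) = K.beta (i.1 k) := by rw [hi]
    rw [Finsupp.mem_support_iff, ← hk, Finsupp.finsetSum_apply]
    intro h
    have := (Finset.sum_eq_zero_iff.mp h) k (Finset.mem_univ k)
    simp at this
  refine Finite.of_injective
    (fun (i : K.ResSeq) (k : Fin n) => (⟨i.1 k, key i k⟩ : K.beta.support)) ?_
  intro i j h
  refine Subtype.ext (funext fun k => ?_)
  exact congrArg Subtype.val (congrFun h k)

instance : Finite K.Obj :=
  Finite.of_injective (fun p : K.Obj => (p.loading, p.resSeq)) (by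
    rintro ⟨a, b⟩ ⟨c, d⟩ h
    simp only [Prod.mk.injEq] at h
    obtain ⟨rfl, rfl⟩ := h
    rfl)

instance : Fintype K.Obj := Fintype.ofFinite _

/-! ### Diagrams -/

/-- A weighted KLRW diagram from `(x, i)` at the bottom to `(y, j)` at the top. Up to isotopy, all
strings may be taken to be piecewise linear, with crossings at different heights (except for those
that a solid string and its ghosts force to be at the same height), and only such diagrams are used.
A diagram is then given by finitely many horizontal slices, listed from bottom to top. Between consecutive
slices the strings are straight and at most one crossing takes place. In every slice the positions
of the solid strings determine those of the ghosts; the red strings are vertical. The `k`th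
solid string runs from `x k` to `y (w k)`, where `w` is the permutation `perm`. -/
@[ext] structure Diagram (p q : K.Obj) where
  perm : Equiv.Perm (Fin n)
  slices : List (Slice n)
  res_eq : ∀ k, q.res (perm k) = p.res k
  bottom : (slices.map Slice.pos).head? = some p.pos
  top : (slices.map Slice.pos).getLast? = some (q.pos ∘ perm)
  generic : ∀ z ∈ slices.map Slice.pos, K.Generic p.res z
  simple : (slices.map Slice.pos).IsChain (K.Simple p.res)

variable {K}

/-- The idempotent diagram `1_{x,i}` with `a k` dots on the `k`th solid string, that is,
`y_1^{a_1} ⋯ y_n^{a_n} 1_{x,i}`. -/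
def dottedIdempotent (p : K.Obj) (a : Fin n → ℕ) : K.Diagram p p where
  perm := 1
  slices := [⟨p.pos, a⟩]
  res_eq _ := rfl
  bottom := rfl
  top := rfl
  generic := by
    intro z hz
    simp only [List.map_cons, List.map_nil, List.mem_singleton] at hz
    subst hz
    exact p.generic
  simple := by simp

/-- The idempotent diagram `1_{x,i}`. -/
def idempotent (p : K.Obj) : K.Diagram p p := dottedIdempotent p 0

/-- Renaming strings. -/
def Str.rename (w : Equiv.Perm (Fin n)) : Str n l E → Str n l E
  | .solid k => .solid (w k)
  | .ghost k e => .ghost (w k) e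
  | .red m => .red m

theorem Str.rename_injective (w : Equiv.Perm (Fin n)) :
    Function.Injective (Str.rename (l := l) (E := E) w) := by
  rintro (k | ⟨k, e⟩ | m) (k' | ⟨k', e'⟩ | m') h <;> simp_all [Str.rename]

theorem strPos_comp (w : Equiv.Perm (Fin n)) (z : Fin n → ℝ) (a : Str n l E) :
    K.strPos (z ∘ w) a = K.strPos z (Str.rename w a) := by
  cases a <;> rfl

theorem active_rename {w : Equiv.Perm (Fin n)} {r r' : Fin n → I} (h : ∀ k, r' (w k) = r k)
    (a : Str n l E) : K.Active r' (Str.rename w a) ↔ K.Active r a := by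
  cases a <;> simp [Str.rename, Active, h]

theorem carrier_rename (w : Equiv.Perm (Fin n)) (a : Str n l E) :
    (Str.rename w a).carrier = a.carrier.map w := by
  cases a <;> rfl

theorem Generic.relabel {w : Equiv.Perm (Fin n)} {r r' : Fin n → I} (h : ∀ k, r' (w k) = r k)
    {z : Fin n → ℝ} (hz : K.Generic r' z) : K.Generic r (z ∘ w) := by
  intro a b ha hb hab
  rw [strPos_comp, strPos_comp] at hab
  exact Str.rename_injective w (hz _ _ ((active_rename h a).2 ha) ((active_rename h b).2 hb) hab)

theorem Simple.relabel {w : Equiv.Perm (Fin n)} {r r' : Fin n → I} (h : ∀ k, r' (w k) = r k)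
    {z z' : Fin n → ℝ} (hz : K.Simple r' z z') : K.Simple r (z ∘ w) (z' ∘ w) := by
  have key : ∀ c ∈ K.crossings r (z ∘ w) (z' ∘ w),
      (Str.rename w c.1, Str.rename w c.2) ∈ K.crossings r' z z' := by
    rintro c ⟨h1, h2, h3, h4⟩
    simp only [strPos_comp] at h3 h4
    exact ⟨(active_rename h _).2 h1, (active_rename h _).2 h2, h3, h4⟩
  intro c hc c' hc'
  obtain ⟨h1, h2, h3⟩ := hz _ (key c hc) _ (key c' hc')
  simp only [carrier_rename] at h1 h2
  simp only [strPos_comp]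
  exact ⟨Option.map_injective w.injective h1, Option.map_injective w.injective h2, h3⟩

theorem map_relabel (w : Equiv.Perm (Fin n)) (L : List (Slice n)) :
    (L.map (Slice.relabel w)).map Slice.pos = (L.map Slice.pos).map (fun z => z ∘ w) := by
  simp [Function.comp_def, Slice.relabel]

theorem Simple.refl (r : Fin n → I) (z : Fin n → ℝ) : K.Simple r z z := by
  rintro c ⟨_, _, h1, h2⟩
  exact absurd h1 (lt_asymm h2)

/-- The diagram `E ∘ D`, obtained by gluing `D` under `E`. -/
def Diagram.comp {p q r : K.Obj} (F : K.Diagram q r) (D : K.Diagram p q) : K.Diagram p r where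
  perm := F.perm * D.perm
  slices := D.slices ++ F.slices.map (Slice.relabel D.perm)
  res_eq k := by rw [Equiv.Perm.mul_apply, F.res_eq, D.res_eq]
  bottom := by rw [List.map_append, List.head?_append, D.bottom]; rfl
  top := by
    rw [List.map_append, List.getLast?_append, map_relabel, List.getLast?_map, F.top]; rfl
  generic := by
    intro z hz
    rw [List.map_append, List.mem_append, map_relabel] at hz
    rcases hz with hz | hz
    · exact D.generic z hz
    · obtain ⟨z', hz', rfl⟩ := List.mem_map.1 hz
      exact (F.generic z' hz').relabel D.res_eq
  simple := by
    rw [List.map_append, List.isChain_append]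
    refine ⟨D.simple, ?_, ?_⟩
    · rw [map_relabel, List.isChain_map]
      exact F.simple.imp fun _ _ h => h.relabel D.res_eq
    · intro z hz z' hz'
      rw [D.top] at hz
      rw [map_relabel, List.head?_map, F.bottom] at hz'
      obtain rfl : q.pos ∘ D.perm = z := by simpa using hz
      obtain rfl : q.pos ∘ D.perm = z' := by simpa using hz'
      exact Simple.refl _ _

theorem map_pos_modify (L : List (Slice n)) (m : ℕ) (e : Fin n → ℕ) :
    (L.modify m fun s => ⟨s.pos, s.dots + e⟩).map Slice.pos = L.map Slice.pos := by
  induction L generalizing m with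
  | nil => simp
  | cons s L ih => cases m <;> simp [ih]

/-- Adding `e k` dots on the `k`th solid string in the slice number `m` (counted from `0`). -/
def Diagram.addDots {p q : K.Obj} (D : K.Diagram p q) (m : ℕ) (e : Fin n → ℕ) :
    K.Diagram p q where
  perm := D.perm
  slices := D.slices.modify m fun s => ⟨s.pos, s.dots + e⟩
  res_eq := D.res_eq
  bottom := by rw [map_pos_modify]; exact D.bottom
  top := by rw [map_pos_modify]; exact D.top
  generic := by rw [map_pos_modify]; exact D.generic
  simple := by rw [map_pos_modify]; exact D.simple

variable (K)

/-! ### The algebra -/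

/-- The generators of the algebra: all diagrams with end points in `X × I^β`. -/
def Gen : Type _ := Σ p q : K.Obj, K.Diagram p q

variable {K}

/-- A diagram as an element of the free algebra. -/
def gen {p q : K.Obj} (D : K.Diagram p q) : FreeAlgebra R K.Gen :=
  FreeAlgebra.ι R (⟨p, q, D⟩ : K.Gen)

/-- The linear combination of diagrams obtained from `D` by putting the polynomial `f` in the dots
`y_1, …, y_n` on the solid strings in the slice number `m`. -/
def insertPoly {p q : K.Obj} (D : K.Diagram p q) (m : ℕ) (f : MvPolynomial (Fin n) R) :
    FreeAlgebra R K.Gen :=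
  ∑ e ∈ f.support, f.coeff e • gen (D.addDots m e)

variable (K)

/-- The strings `a` and `b` cross between the slices `z` and `z'`. -/
def Cross (res : Fin n → I) (z z' : Fin n → ℝ) (a b : Str n l E) : Prop :=
  (a, b) ∈ K.crossings res z z' ∨ (b, a) ∈ K.crossings res z z'

/-- Two solid strings of the same residue. -/
def SolidSolid (res : Fin n → I) (a b : Str n l E) : Prop :=
  ∃ k k', a = .solid k ∧ b = .solid k' ∧ k ≠ k' ∧ res k = res k'

/-- A ghost `a` attached to an edge `i ⇝ j` (or `j ⇝ i`) of a solid `i`-string and a solid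
`j`-string `b`. -/
def GhostSolid (res : Fin n → I) (a b : Str n l E) : Prop :=
  ∃ k e k', a = .ghost k e ∧ b = .solid k' ∧ K.owner e = res k ∧ K.partner e = res k'

/-- A solid string `a` and a red string `b` of the same residue. -/
def SolidRed (res : Fin n → I) (a b : Str n l E) : Prop :=
  ∃ k m, a = .solid k ∧ b = .red m ∧ res k = K.rho m

/-- Three strings, numbered from left to right at the bottom, for which the Reidemeister III
relation has an error term: ghost-solid-ghost, solid-ghost-solid and solid-red-solid. -/
def ExceptionalTriple (res : Fin n → I) (a b c : Str n l E) : Prop :=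
  (∃ k k' e, a = .ghost k e ∧ c = .ghost k' e ∧ K.GhostSolid res a b ∧ K.GhostSolid res c b) ∨
  (SolidSolid res a c ∧ K.GhostSolid res b a ∧ K.GhostSolid res b c) ∨
  (SolidSolid res a c ∧ K.SolidRed res a b ∧ K.SolidRed res c b)

/-- `Q_ij(y_k, y_k')` where `i`, `j` are the residues of the `k`th and the `k'`th string. -/
def QPoly (res : Fin n → I) (k k' : Fin n) : MvPolynomial (Fin n) R :=
  MvPolynomial.aeval ![MvPolynomial.X k, MvPolynomial.X k'] (K.Q (res k) (res k'))

/-- `Q_{i,j,i}(y_k, y_k', y_k'')` where `i`, `j` are the residues of the `k`th and the `k'`th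
string. -/
def QPoly₃ (res : Fin n → I) (k k' k'' : Fin n) : MvPolynomial (Fin n) R :=
  MvPolynomial.aeval ![MvPolynomial.X k, MvPolynomial.X k', MvPolynomial.X k'']
    (divDiff (K.Q (res k) (res k')))

/-- `D'` is obtained from `D` by leaving everything below the part `T` as it is, and exchanging the
roles of the strings `k` and `k'` from the slices `T` on (which resolves a crossing of these two
strings just before `T`). Here `B` is the new list of slices up to `T`. -/
def Resolves {p q : K.Obj} (D D' : K.Diagram p q) (k k' : Fin n) (B T : List (Slice n)) : Prop :=
  D'.perm = D.perm * Equiv.swap k k' ∧ D'.slices = B ++ T.map (Slice.relabel (Equiv.swap k k'))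

/-- The defining relations of the weighted KLRW algebra. -/
inductive Rel : FreeAlgebra R K.Gen → FreeAlgebra R K.Gen → Prop
  /- The multiplication and the unit. -/
  | one : Rel (∑ p : K.Obj, gen (idempotent p)) 1
  | mul {p q r : K.Obj} (F : K.Diagram q r) (D : K.Diagram p q) :
      Rel (gen F * gen D) (gen (F.comp D))
  | mul_zero {p q q' r : K.Obj} (F : K.Diagram q' r) (D : K.Diagram p q) (h : q ≠ q') :
      Rel (gen F * gen D) 0
  /- Isotopy: a slice without dots may be removed (or inserted) as long as this does not change
  the crossings, dots move along straight strings (see also `dot_pass`), and crossings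
  that do not interact may change their heights (see `commute`, and `braid` if three crossings
  are involved). -/
  | straighten {p q : K.Obj} (D D' : K.Diagram p q) (P S : List (Slice n)) (s t : Slice n)
      (z : Fin n → ℝ) (hw : D'.perm = D.perm)
      (h : D.slices = P ++ s :: ⟨z, 0⟩ :: t :: S) (h' : D'.slices = P ++ s :: t :: S)
      (hz : K.crossings p.res s.pos z = ∅ ∨ K.crossings p.res z t.pos = ∅) :
      Rel (gen D) (gen D')
  | merge {p q : K.Obj} (D D' : K.Diagram p q) (P S : List (Slice n))
      (z : Fin n → ℝ) (a b : Fin n → ℕ) (hw : D'.perm = D.perm)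
      (h : D.slices = P ++ ⟨z, a⟩ :: ⟨z, b⟩ :: S) (h' : D'.slices = P ++ ⟨z, a + b⟩ :: S) :
      Rel (gen D) (gen D')
  | commute {p q : K.Obj} (D D' : K.Diagram p q) (P S : List (Slice n)) (s t : Slice n)
      (z z' : Fin n → ℝ) (hw : D'.perm = D.perm)
      (h : D.slices = P ++ s :: ⟨z, 0⟩ :: t :: S) (h' : D'.slices = P ++ s :: ⟨z', 0⟩ :: t :: S)
      (h₁ : K.crossings p.res s.pos z = K.crossings p.res z' t.pos)
      (h₂ : K.crossings p.res z t.pos = K.crossings p.res s.pos z') :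
      Rel (gen D) (gen D')
  /- Dots pass through all crossings, except for those of solid strings of the same residue. -/
  | dot_pass {p q : K.Obj} (D : K.Diagram p q) (P S : List (Slice n)) (s t : Slice n)
      (h : D.slices = P ++ s :: t :: S) (k : Fin n)
      (hk : ∀ b, SolidSolid p.res (.solid k) b → ¬ K.Cross p.res s.pos t.pos (.solid k) b) :
      Rel (gen (D.addDots P.length (Pi.single k 1))) (gen (D.addDots (P.length + 1) (Pi.single k 1)))
  /- The string `k` goes from left to right and the string `k'` from right to left. -/
  | dot_left {p q : K.Obj} (D D₀ : K.Diagram p q) (P S : List (Slice n)) (s t : Slice n)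
      (h : D.slices = P ++ s :: t :: S) (k k' : Fin n) (hk : p.res k = p.res k')
      (hc : (Str.solid k, Str.solid k') ∈ K.crossings p.res s.pos t.pos)
      (h₀ : K.Resolves D D₀ k k' (P ++ [s]) (t :: S)) :
      Rel (gen (D.addDots P.length (Pi.single k 1)))
        (gen (D.addDots (P.length + 1) (Pi.single k 1)) + gen D₀)
  | dot_right {p q : K.Obj} (D D₀ : K.Diagram p q) (P S : List (Slice n)) (s t : Slice n)
      (h : D.slices = P ++ s :: t :: S) (k k' : Fin n) (hk : p.res k = p.res k')
      (hc : (Str.solid k, Str.solid k') ∈ K.crossings p.res s.pos t.pos)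
      (h₀ : K.Resolves D D₀ k k' (P ++ [s]) (t :: S)) :
      Rel (gen (D.addDots (P.length + 1) (Pi.single k' 1)))
        (gen (D.addDots P.length (Pi.single k' 1)) + gen D₀)
  /- Reidemeister II: the crossing between `s` and `z` is undone between `z` and `t`. -/
  | reid₂ {p q : K.Obj} (D D₀ : K.Diagram p q) (P S : List (Slice n)) (s t : Slice n)
      (z : Fin n → ℝ) (hw : D₀.perm = D.perm)
      (h : D.slices = P ++ s :: ⟨z, 0⟩ :: t :: S) (h₀ : D₀.slices = P ++ s :: t :: S)
      (hst : K.crossings p.res s.pos t.pos = ∅)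
      (hc : ∀ a b, K.Cross p.res s.pos z a b →
        ¬ SolidSolid p.res a b ∧ ¬ K.GhostSolid p.res a b ∧ ¬ K.SolidRed p.res a b) :
      Rel (gen D) (gen D₀)
  | reid₂_solidSolid {p q : K.Obj} (D : K.Diagram p q) (P S : List (Slice n)) (s t : Slice n)
      (z : Fin n → ℝ) (h : D.slices = P ++ s :: ⟨z, 0⟩ :: t :: S)
      (hst : K.crossings p.res s.pos t.pos = ∅) (a b : Str n l E)
      (hab : SolidSolid p.res a b) (hc : K.Cross p.res s.pos z a b) :
      Rel (gen D) 0
  | reid₂_ghostSolid {p q : K.Obj} (D D₀ : K.Diagram p q) (P S : List (Slice n)) (s t : Slice n)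
      (z : Fin n → ℝ) (hw : D₀.perm = D.perm)
      (h : D.slices = P ++ s :: ⟨z, 0⟩ :: t :: S) (h₀ : D₀.slices = P ++ s :: t :: S)
      (hst : K.crossings p.res s.pos t.pos = ∅) (k k' : Fin n) (e : E)
      (hab : K.GhostSolid p.res (.ghost k e) (.solid k'))
      (hc : K.Cross p.res s.pos z (.ghost k e) (.solid k')) :
      Rel (gen D) (insertPoly D₀ P.length (K.QPoly p.res k k'))
  | reid₂_solidRed {p q : K.Obj} (D D₀ : K.Diagram p q) (P S : List (Slice n)) (s t : Slice n)
      (z : Fin n → ℝ) (hw : D₀.perm = D.perm)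
      (h : D.slices = P ++ s :: ⟨z, 0⟩ :: t :: S) (h₀ : D₀.slices = P ++ s :: t :: S)
      (hst : K.crossings p.res s.pos t.pos = ∅) (k : Fin n) (m : Fin l)
      (hab : K.SolidRed p.res (.solid k) (.red m))
      (hc : K.Cross p.res s.pos z (.solid k) (.red m)) :
      Rel (gen D) (gen (D₀.addDots P.length (Pi.single k 1)))
  /- Reidemeister III: three crossings in opposite orders. -/
  | braid {p q : K.Obj} (D D' : K.Diagram p q) (P S : List (Slice n)) (s t : Slice n)
      (z₁ z₂ z₁' z₂' : Fin n → ℝ) (hw : D'.perm = D.perm)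
      (h : D.slices = P ++ s :: ⟨z₁, 0⟩ :: ⟨z₂, 0⟩ :: t :: S)
      (h' : D'.slices = P ++ s :: ⟨z₁', 0⟩ :: ⟨z₂', 0⟩ :: t :: S)
      (h₁ : K.crossings p.res s.pos z₁ = K.crossings p.res z₂' t.pos)
      (h₂ : K.crossings p.res z₁ z₂ = K.crossings p.res z₁' z₂')
      (h₃ : K.crossings p.res z₂ t.pos = K.crossings p.res s.pos z₁')
      (hc : ∀ a b c, K.ExceptionalTriple p.res a b c → ¬
        ((a, c) ∈ K.crossings p.res z₁ z₂ ∧ K.Cross p.res s.pos t.pos a b ∧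
          K.Cross p.res s.pos t.pos b c)) :
      Rel (gen D) (gen D')
  /- In the exceptional cases the middle string `b` first goes to the left in `D`, and first goes
  to the right in `D'`; in `D₀` the strings `a`, `b`, `c` do not cross. -/
  | braid_ghostSolidGhost {p q : K.Obj} (D D' D₀ : K.Diagram p q) (P S : List (Slice n))
      (s t : Slice n) (z₁ z₂ z₁' z₂' : Fin n → ℝ) (hw : D'.perm = D.perm)
      (h : D.slices = P ++ s :: ⟨z₁, 0⟩ :: ⟨z₂, 0⟩ :: t :: S)
      (h' : D'.slices = P ++ s :: ⟨z₁', 0⟩ :: ⟨z₂', 0⟩ :: t :: S)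
      (h₁ : K.crossings p.res s.pos z₁ = K.crossings p.res z₂' t.pos)
      (h₂ : K.crossings p.res z₁ z₂ = K.crossings p.res z₁' z₂')
      (h₃ : K.crossings p.res z₂ t.pos = K.crossings p.res s.pos z₁')
      (k k' k'' : Fin n) (e : E)
      (hab : K.GhostSolid p.res (.ghost k e) (.solid k'))
      (hcb : K.GhostSolid p.res (.ghost k'' e) (.solid k'))
      (h_ab : (Str.ghost k e, Str.solid k') ∈ K.crossings p.res s.pos z₁)
      (h_ac : (Str.ghost k e, Str.ghost k'' e) ∈ K.crossings p.res z₁ z₂)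
      (h_bc : (Str.solid k', Str.ghost k'' e) ∈ K.crossings p.res z₂ t.pos)
      (h₀ : K.Resolves D D₀ k k'' (P ++ [s]) (t :: S)) :
      Rel (gen D) (gen D' - insertPoly D₀ P.length (K.QPoly₃ p.res k k' k''))
  | braid_solidGhostSolid {p q : K.Obj} (D D' D₀ : K.Diagram p q) (P S : List (Slice n))
      (s t : Slice n) (z₁ z₂ z₁' z₂' : Fin n → ℝ) (hw : D'.perm = D.perm)
      (h : D.slices = P ++ s :: ⟨z₁, 0⟩ :: ⟨z₂, 0⟩ :: t :: S)
      (h' : D'.slices = P ++ s :: ⟨z₁', 0⟩ :: ⟨z₂', 0⟩ :: t :: S)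
      (h₁ : K.crossings p.res s.pos z₁ = K.crossings p.res z₂' t.pos)
      (h₂ : K.crossings p.res z₁ z₂ = K.crossings p.res z₁' z₂')
      (h₃ : K.crossings p.res z₂ t.pos = K.crossings p.res s.pos z₁')
      (k k' k'' : Fin n) (e : E)
      (hba : K.GhostSolid p.res (.ghost k' e) (.solid k))
      (hbc : K.GhostSolid p.res (.ghost k' e) (.solid k''))
      (h_ab : (Str.solid k, Str.ghost k' e) ∈ K.crossings p.res s.pos z₁)
      (h_ac : (Str.solid k, Str.solid k'') ∈ K.crossings p.res z₁ z₂)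
      (h_bc : (Str.ghost k' e, Str.solid k'') ∈ K.crossings p.res z₂ t.pos)
      (h₀ : K.Resolves D D₀ k k'' (P ++ [s]) (t :: S)) :
      Rel (gen D) (gen D' - insertPoly D₀ P.length (K.QPoly₃ p.res k k' k''))
  | braid_solidRedSolid {p q : K.Obj} (D D' D₀ : K.Diagram p q) (P S : List (Slice n))
      (s t : Slice n) (z₁ z₂ z₁' z₂' : Fin n → ℝ) (hw : D'.perm = D.perm)
      (h : D.slices = P ++ s :: ⟨z₁, 0⟩ :: ⟨z₂, 0⟩ :: t :: S)
      (h' : D'.slices = P ++ s :: ⟨z₁', 0⟩ :: ⟨z₂', 0⟩ :: t :: S)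
      (h₁ : K.crossings p.res s.pos z₁ = K.crossings p.res z₂' t.pos)
      (h₂ : K.crossings p.res z₁ z₂ = K.crossings p.res z₁' z₂')
      (h₃ : K.crossings p.res z₂ t.pos = K.crossings p.res s.pos z₁')
      (k k'' : Fin n) (m : Fin l)
      (hab : K.SolidRed p.res (.solid k) (.red m))
      (hcb : K.SolidRed p.res (.solid k'') (.red m))
      (h_ab : (Str.solid k, Str.red m) ∈ K.crossings p.res s.pos z₁)
      (h_ac : (Str.solid k, Str.solid k'') ∈ K.crossings p.res z₁ z₂)
      (h_bc : (Str.red m, Str.solid k'') ∈ K.crossings p.res z₂ t.pos)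
      (h₀ : K.Resolves D D₀ k k'' (P ++ [s]) (t :: S)) :
      Rel (gen D) (gen D' + gen D₀)

/-- The weighted KLRW algebra `W_β(X)`. -/
def Alg : Type _ := RingQuot K.Rel

instance : Ring K.Alg := inferInstanceAs (Ring (RingQuot K.Rel))
instance : Algebra R K.Alg := inferInstanceAs (Algebra R (RingQuot K.Rel))

variable {K}

/-- The class of a diagram in the weighted KLRW algebra. -/
def Diagram.toAlg {p q : K.Obj} (D : K.Diagram p q) : K.Alg :=
  RingQuot.mkAlgHom R K.Rel (gen D)

variable (K)

/-! ### The grading -/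

open Classical in
/-- The degree of a crossing of two strings. -/
def crossingDegree (res : Fin n → I) : Str n l E → Str n l E → ℤ
  | .solid k, .solid k' => if res k = res k' then -2 * (K.quiver.d (res k) : ℤ) else 0
  | .ghost k e, .solid k' => if K.partner e = res k' then
      -((K.quiver.d (res k) : ℤ) * K.quiver.cartan (res k) (res k')) else 0
  | .solid k', .ghost k e => if K.partner e = res k' then
      -((K.quiver.d (res k) : ℤ) * K.quiver.cartan (res k) (res k')) else 0
  | .solid k, .red m => if res k = K.rho m then (K.quiver.d (res k) : ℤ) else 0
  | .red m, .solid k => if res k = K.rho m then (K.quiver.d (res k) : ℤ) else 0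
  | _, _ => 0

/-- The sum of the degrees of all crossings between two slices. -/
def stepDegree (res : Fin n → I) (s t : Slice n) : ℤ :=
  ∑ᶠ c ∈ K.crossings res s.pos t.pos, K.crossingDegree res c.1 c.2

variable {K}

/-- The degree of a diagram: the sum of the degrees `2 d_i` of all dots on solid strings and of the
degrees of all crossings. -/
def Diagram.degree {p q : K.Obj} (D : K.Diagram p q) : ℤ :=
  (D.slices.map fun s => ∑ k, (s.dots k : ℤ) * (2 * (K.quiver.d (p.res k) : ℤ))).sum +
    (List.zipWith (K.stepDegree p.res) D.slices D.slices.tail).sum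

variable (K)

/-- The homogeneous component of degree `m`: the span of the diagrams of degree `m`. -/
def component (m : ℤ) : Submodule R K.Alg :=
  Submodule.span R {a | ∃ (p q : K.Obj) (D : K.Diagram p q), D.degree = m ∧ a = D.toAlg}

variable {K}

/-! ### The basis -/

/-- `D` is a permutation diagram `D(w)`: it realizes the permutation `w`, it has no dots, and any
two strings cross at most once. In particular, reading the crossings of the solid strings from
bottom to top gives a reduced expression for `w`. -/
def Diagram.IsPermutationDiagram {p q : K.Obj} (D : K.Diagram p q) (w : Equiv.Perm (Fin n)) :
    Prop :=
  D.perm = w ∧ (∀ s ∈ D.slices, s.dots = 0) ∧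
  ∀ s₁ s₂ s₃, [s₁, s₂, s₃].Sublist D.slices → ∀ a b, K.Active p.res a → K.Active p.res b →
    ¬ (K.strPos s₁.pos a < K.strPos s₁.pos b ∧ K.strPos s₂.pos b < K.strPos s₂.pos a ∧
      K.strPos s₃.pos a < K.strPos s₃.pos b)

variable (K)

/-- The pairs of a bottom `(x, i)` and a top `(y, j)` and a permutation `w` with `j = w · i`. -/
structure PermIndex where
  bot : K.Obj
  top : K.Obj
  w : Equiv.Perm (Fin n)
  res_eq : ∀ k, top.res (w k) = bot.res k

end Datum

end WeightedKLRW

end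

open scoped BigOperators

noncomputable section

namespace WeightedKLRW

open MvPolynomial

/-! ### Divided differences on polynomial rings -/

section DividedDifference

variable {R : Type*} [CommRing R] {n : ℕ}

/-! The proof has three parts: independence comes from a polynomial representation, spanning from a
normal form for diagrams up to Reidemeister III, and the grading from the homogeneity of the
relations.

Representation. The algebra acts on a direct sum of polynomial rings, one for each pair of a loading
and a residue sequence, the variables following the solid strings. Between two consecutive slices at
most one crossing is non-trivial (`interact_unique`). A crossing of solid strings of equal residue
acts by a divided difference, a ghost that passes to the right of an interacting solid string
multiplies by `Q_ij`, a solid string that passes to the right of a red string of its label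
multiplies by its variable, and everything else acts trivially. The error terms in the relations are
exactly the terms of the twisted Leibniz rule `divided_mul`; the relations are checked in
`freeRep_rel`, where the delicate case is the error-free Reidemeister III move
(`Hexagon.stepOp_braid`).

Independence. After clearing denominators, the operator of a diagram is a combination of
permutations of the variables. For a permutation diagram of `w` the coefficient of `w` is non-zero,
and all other permutations that occur need strictly fewer crossings (`exists_op_eq_sum`). Dedekind's
independence of characters turns this triangularity into linear independence over the polynomials
(`eq_zero_of_sum_op_eq_zero`).

Spanning. The induction is on the number of crossings. Modulo diagrams with fewer crossings, dots
slide to the bottom, Reidemeister III has no error term and double crossings vanish. What remains is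
geometry: the positions of the solid strings form a point of `ℝⁿ`, each pair of strings is an affine
hyperplane, and a diagram is a path through the chambers. Every path to a fixed end point `b` can be
deformed, by isotopies, commutations and Reidemeister III moves, either into a perturbed straight
path or into a path with a bigon (`exists_normalForm`). Normalize the functions of the hyperplanes
to take the value `-1` at `b`; then the straight path from `u` meets them in the order of their
values at `u`. If `u` crosses a single wall of the finer arrangement `orderMaps`, either one
crossing is added to or removed from the straight path, or some crossings change their order. In the
second case no chain of four successively inverted crossings exists, because each crossing involves
only two carriers, so the change is a product of commutations and Reidemeister III moves
(`equiv_of_passed_eq`, `Gallery.equiv`). A permutation diagram has the minimal number of crossings,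
so it never acquires a bigon and is equivalent to the normal form.

Grading. Each relation is homogeneous (`exists_isHom`), so the decomposition of the generators by
degree descends to the quotient. -/

theorem X_sub_X_dvd_sub_rename (k k' : Fin n) (f : MvPolynomial (Fin n) R) :
    (X k - X k' : MvPolynomial (Fin n) R) ∣ f - rename (Equiv.swap k k') f := by
  induction f using MvPolynomial.induction_on with
  | C a => simp
  | add f g hf hg =>
    rw [map_add, add_sub_add_comm]
    exact dvd_add hf hg
  | mul_X f i hf =>
    have hX : (X k - X k' : MvPolynomial (Fin n) R) ∣ X i - X (Equiv.swap k k' i) := by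
      rcases eq_or_ne i k with rfl | h1
      · simp
      rcases eq_or_ne i k' with rfl | h2
      · rw [Equiv.swap_apply_right]
        exact ⟨-1, by ring⟩
      · simp [Equiv.swap_apply_of_ne_of_ne h1 h2]
    rw [map_mul, rename_X]
    have : f * X i - rename (Equiv.swap k k') f * X (Equiv.swap k k' i) =
        (f - rename (Equiv.swap k k') f) * X i +
          rename (Equiv.swap k k') f * (X i - X (Equiv.swap k k' i)) := by ring
    rw [this]
    exact dvd_add (hf.mul_right _) (hX.mul_left _)

theorem X_sub_X_ne_zero [Nontrivial R] {k k' : Fin n} (h : k ≠ k') :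
    (X k - X k' : MvPolynomial (Fin n) R) ≠ 0 :=
  sub_ne_zero.2 fun h' => h (X_injective h')

theorem rename_swap_rename_swap (k k' : Fin n) (f : MvPolynomial (Fin n) R) :
    rename (Equiv.swap k k') (rename (Equiv.swap k k') f) = f := by
  rw [rename_rename, ← Equiv.Perm.coe_mul, Equiv.swap_mul_self, Equiv.Perm.coe_one, rename_id]
  rfl

variable [IsDomain R]

/-- The divided difference `f ↦ (f - s f) / (y_k - y_k')`, where `s` swaps `y_k` and `y_k'`. -/
def divided (k k' : Fin n) : MvPolynomial (Fin n) R →ₗ[R] MvPolynomial (Fin n) R :=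
  if h : k = k' then 0 else
  { toFun := fun f => (X_sub_X_dvd_sub_rename k k' f).choose
    map_add' := fun f g => by
      apply mul_left_cancel₀ (X_sub_X_ne_zero (R := R) h)
      rw [mul_add, ← (X_sub_X_dvd_sub_rename k k' f).choose_spec,
        ← (X_sub_X_dvd_sub_rename k k' g).choose_spec,
        ← (X_sub_X_dvd_sub_rename k k' (f + g)).choose_spec, map_add]
      ring
    map_smul' := fun c f => by
      apply mul_left_cancel₀ (X_sub_X_ne_zero (R := R) h)
      rw [RingHom.id_apply, mul_smul_comm, ← (X_sub_X_dvd_sub_rename k k' f).choose_spec,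
        ← (X_sub_X_dvd_sub_rename k k' (c • f)).choose_spec, map_smul, smul_sub] }

theorem mul_divided {k k' : Fin n} (h : k ≠ k') (f : MvPolynomial (Fin n) R) :
    (X k - X k') * divided k k' f = f - rename (Equiv.swap k k') f := by
  rw [divided, dif_neg h]
  exact (X_sub_X_dvd_sub_rename k k' f).choose_spec.symm

/-- Polynomials over a domain have no zero divisors, so identities between divided differences can
be verified after clearing the denominator. This is how the identities below are obtained. -/
theorem divided_eq_of_mul_eq {k k' : Fin n} (h : k ≠ k') {f g : MvPolynomial (Fin n) R}
    (hg : (X k - X k') * g = f - rename (Equiv.swap k k') f) : divided k k' f = g :=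
  mul_left_cancel₀ (X_sub_X_ne_zero (R := R) h) ((mul_divided h f).trans hg.symm)

theorem rename_divided {k k' : Fin n} (h : k ≠ k') (w : Equiv.Perm (Fin n))
    (f : MvPolynomial (Fin n) R) :
    rename w (divided k k' f) = divided (w k) (w k') (rename w f) := by
  refine (divided_eq_of_mul_eq (w.injective.ne h) ?_).symm
  have := congrArg (rename w) (mul_divided h f)
  simp only [map_mul, map_sub, rename_X] at this
  rw [this, rename_rename, rename_rename]
  congr 3
  ext i
  simp only [Function.comp_apply]
  rw [Equiv.swap_apply_apply]
  simp

theorem rename_swap_divided {k k' : Fin n} (h : k ≠ k') (f : MvPolynomial (Fin n) R) :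
    rename (Equiv.swap k k') (divided k k' f) = divided k k' f := by
  symm
  apply divided_eq_of_mul_eq h
  have := congrArg (rename (Equiv.swap k k')) (mul_divided h f)
  simp only [map_mul, map_sub, rename_X, Equiv.swap_apply_left, Equiv.swap_apply_right,
    rename_swap_rename_swap] at this
  linear_combination -this

theorem divided_eq_zero {k k' : Fin n} (h : k ≠ k') {f : MvPolynomial (Fin n) R}
    (hf : rename (Equiv.swap k k') f = f) : divided k k' f = 0 :=
  divided_eq_of_mul_eq h (by rw [hf]; ring)

/-- The twisted Leibniz rule. Its first summand is the source of the error terms in the relations: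
taking for `g` a variable or a polynomial `Q_ij` yields the terms with a resolved crossing. -/
theorem divided_mul {k k' : Fin n} (h : k ≠ k') (g f : MvPolynomial (Fin n) R) :
    divided k k' (g * f) =
      divided k k' g * rename (Equiv.swap k k') f + g * divided k k' f := by
  apply divided_eq_of_mul_eq h
  rw [map_mul]
  linear_combination rename (Equiv.swap k k') f * mul_divided h g + g * mul_divided h f

theorem divided_mul_of_symm {k k' : Fin n} (h : k ≠ k') {g : MvPolynomial (Fin n) R}
    (hg : rename (Equiv.swap k k') g = g) (f : MvPolynomial (Fin n) R) :
    divided k k' (g * f) = g * divided k k' f := by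
  rw [divided_mul h, divided_eq_zero h hg]
  ring

theorem divided_X_left {k k' : Fin n} (h : k ≠ k') :
    divided k k' (X k : MvPolynomial (Fin n) R) = 1 :=
  divided_eq_of_mul_eq h (by rw [rename_X, Equiv.swap_apply_left]; ring)

theorem divided_X_right {k k' : Fin n} (h : k ≠ k') :
    divided k k' (X k' : MvPolynomial (Fin n) R) = -1 :=
  divided_eq_of_mul_eq h (by rw [rename_X, Equiv.swap_apply_right]; ring)

theorem divided_comm {k k' m m' : Fin n} (h : k ≠ k') (h' : m ≠ m') (h1 : k ≠ m) (h2 : k ≠ m')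
    (h3 : k' ≠ m) (h4 : k' ≠ m') (f : MvPolynomial (Fin n) R) :
    divided k k' (divided m m' f) = divided m m' (divided k k' f) := by
  apply divided_eq_of_mul_eq h
  rw [rename_divided h', Equiv.swap_apply_of_ne_of_ne h1.symm h3.symm,
    Equiv.swap_apply_of_ne_of_ne h2.symm h4.symm, ← map_sub, ← mul_divided h,
    divided_mul_of_symm h']
  rw [map_sub, rename_X, rename_X, Equiv.swap_apply_of_ne_of_ne h1 h2,
    Equiv.swap_apply_of_ne_of_ne h3 h4]

/-- Both sides are the alternating sum of `f` over the six permutations of the three variables,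
divided by their Vandermonde product. This expression does not depend on which of the two sides it
was computed from. -/
theorem divided_braid {a b c : Fin n} (hab : a ≠ b) (hac : a ≠ c) (hbc : b ≠ c)
    (f : MvPolynomial (Fin n) R) :
    divided b c (divided a c (divided a b f)) = divided a b (divided a c (divided b c f)) := by
  have key : ∀ {a b c : Fin n} (hab : a ≠ b) (hac : a ≠ c) (hbc : b ≠ c),
      (X a - X b) * (X a - X c) * (X b - X c) * divided b c (divided a c (divided a b f)) =
        f - rename (Equiv.swap a b) f - rename (Equiv.swap b c) f - rename (Equiv.swap a c) f +
        rename (Equiv.swap b c * Equiv.swap a b) f + rename (Equiv.swap a b * Equiv.swap b c) f := by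
    intro a b c hab hac hbc
    have hr : ∀ (u v : Equiv.Perm (Fin n)) (g : MvPolynomial (Fin n) R),
        rename u (rename v g) = rename (u * v) g := fun u v g => by
      rw [rename_rename]; rfl
    have e1 : Equiv.swap a c * Equiv.swap a b = Equiv.swap a b * Equiv.swap b c := by
      ext i; simp only [Equiv.Perm.mul_apply, Equiv.swap_apply_def]; grind
    have e2 : Equiv.swap b c * Equiv.swap a c = Equiv.swap a b * Equiv.swap b c := by
      ext i; simp only [Equiv.Perm.mul_apply, Equiv.swap_apply_def]; grind
    have e3 : Equiv.swap b c * (Equiv.swap a b * Equiv.swap b c) = Equiv.swap a c := by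
      ext i; simp only [Equiv.Perm.mul_apply, Equiv.swap_apply_def]; grind
    set h := divided a b f with hh
    set g := divided a c h with hg
    have s1 := mul_divided hbc g
    have s2 := mul_divided hac h
    have s3 := mul_divided hab f
    have t2 := congrArg (rename (Equiv.swap b c)) s2
    have t3 := congrArg (rename (Equiv.swap b c)) s3
    have u3 := congrArg (rename (Equiv.swap a c)) s3
    have v3 := congrArg (rename (Equiv.swap b c * Equiv.swap a c)) s3
    simp only [← hh, ← hg] at s1 s2 s3 t2 t3 u3 v3
    simp only [map_mul, map_sub, rename_X, hr, Equiv.Perm.mul_apply, Equiv.swap_apply_left,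
      Equiv.swap_apply_right, Equiv.swap_apply_of_ne_of_ne hab hac,
      Equiv.swap_apply_of_ne_of_ne hab.symm hbc, mul_assoc, e1] at t2 t3 u3 v3
    rw [e2] at v3 t2
    rw [e3] at v3
    apply mul_left_cancel₀ (X_sub_X_ne_zero (R := R) hbc)
    linear_combination (X b - X c) * (X a - X b) * (X a - X c) * s1 + (X b - X c) * (X a - X b) * s2
      - (X b - X c) * (X a - X c) * t2 + (X b - X c) * s3 - (X b - X c) * t3 + (X a - X b) * u3 +
      (X a - X c) * v3
  have k1 := key hab hac hbc
  -- The same formula with `a` and `c` exchanged describes the other side; `hs` accounts for the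
  -- three reversed divided differences.
  have k2 := key hbc.symm hac.symm hab.symm
  rw [Equiv.swap_comm c b, Equiv.swap_comm b a, Equiv.swap_comm c a] at k2
  have hs : ∀ {k k' : Fin n}, k ≠ k' → ∀ f : MvPolynomial (Fin n) R,
      divided k' k f = - divided k k' f := fun h f =>
    divided_eq_of_mul_eq h.symm (by
      rw [Equiv.swap_comm]; linear_combination mul_divided h f)
  rw [hs hab, hs hac, hs hbc] at k2
  simp only [map_neg, neg_neg] at k2
  apply mul_left_cancel₀ (mul_ne_zero (mul_ne_zero (X_sub_X_ne_zero (R := R) hab)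
    (X_sub_X_ne_zero hac)) (X_sub_X_ne_zero hbc))
  linear_combination k1 - k2

end DividedDifference

namespace Datum

/-! ### Combinatorics of crossings between slices -/

section Crossings

variable {R : Type*} [CommRing R] {I E : Type*} {n l : ℕ} (K : Datum R I E n l)

/-- The distance of a string from the solid string it moves with (its position if it is red). -/
def off : Str n l E → ℝ
  | .solid _ => 0
  | .ghost _ e => |K.shift e|
  | .red m => K.charge m

/-- The positions of the solid strings, extended by `0` at `none`. -/
def coord (z : Fin n → ℝ) : Option (Fin n) → ℝ := fun o => o.elim 0 z

/-- Separates the moving part of a position from a constant offset. The distance of two strings thus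
depends only on their carriers and on the difference of their offsets, which explains why parallel
pairs cross simultaneously. -/
theorem strPos_eq (z : Fin n → ℝ) (a : Str n l E) :
    K.strPos z a = coord z a.carrier + K.off a := by
  cases a <;> simp [strPos, coord, off, Str.carrier]

theorem off_rename (w : Equiv.Perm (Fin n)) (a : Str n l E) :
    K.off (Str.rename w a) = K.off a := by
  cases a <;> rfl

variable {K} {res : Fin n → I} {x y z z' s t : Fin n → ℝ}

theorem rename_swap_of_ne {k k' : Fin n} {a : Str n l E} (h : a.carrier ≠ some k)
    (h' : a.carrier ≠ some k') : Str.rename (Equiv.swap k k') a = a := by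
  cases a <;> simp_all [Str.rename, Str.carrier, Equiv.swap_apply_of_ne_of_ne]

theorem res_swap {k k' : Fin n} (h : res k = res k') (m : Fin n) :
    res (Equiv.swap k k' m) = res m := by
  rw [Equiv.swap_apply_def]; split_ifs <;> simp_all

theorem active_rename_swap {k k' : Fin n} (h : res k = res k') {a : Str n l E} :
    K.Active res (Str.rename (Equiv.swap k k') a) ↔ K.Active res a :=
  active_rename (res_swap h) a

theorem finite_active (res : Fin n → I) : {a : Str n l E | K.Active res a}.Finite := by
  have h : {a : Str n l E | K.Active res a} ⊆
      Set.range Str.solid ∪ Set.range Str.red ∪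
        ⋃ k : Fin n, (Str.ghost k) '' {e | K.owner e = res k} := by
    rintro (k | ⟨k, e⟩ | m) ha
    · exact Or.inl (Or.inl ⟨k, rfl⟩)
    · exact Or.inr (Set.mem_iUnion.2 ⟨k, e, ha, rfl⟩)
    · exact Or.inl (Or.inr ⟨m, rfl⟩)
  exact (((Set.finite_range _).union (Set.finite_range _)).union
    (Set.finite_iUnion fun k => (K.finite_ghosts (res k)).image _)).subset h

theorem finite_crossings (res : Fin n → I) (z z' : Fin n → ℝ) : (K.crossings res z z').Finite :=
  ((finite_active res).prod (finite_active res)).subset fun _ h => ⟨h.1, h.2.1⟩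

theorem crossings_self (res : Fin n → I) (z : Fin n → ℝ) : K.crossings res z z = ∅ :=
  Set.eq_empty_of_forall_notMem fun _ h => lt_asymm h.2.2.1 h.2.2.2

theorem mem_crossings_symm {a b : Str n l E} :
    (a, b) ∈ K.crossings res z z' ↔ (b, a) ∈ K.crossings res z' z :=
  ⟨fun h => ⟨h.2.1, h.1, h.2.2.2, h.2.2.1⟩, fun h => ⟨h.2.1, h.1, h.2.2.2, h.2.2.1⟩⟩

theorem crossings_symm_eq_empty (h : K.crossings res z z' = ∅) : K.crossings res z' z = ∅ :=
  Set.eq_empty_of_forall_notMem fun c hc => by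
    have : (c.2, c.1) ∈ K.crossings res z z' := mem_crossings_symm.2 hc
    rw [h] at this; exact this

theorem strPos_ne (hz : K.Generic res z) {a b : Str n l E} (ha : K.Active res a)
    (hb : K.Active res b) (h : a ≠ b) : K.strPos z a ≠ K.strPos z b :=
  fun h' => h (hz a b ha hb h')

theorem ne_of_mem_crossings {c : Str n l E × Str n l E} (h : c ∈ K.crossings res z z') :
    c.1 ≠ c.2 := fun h' => by
  have := h.2.2.1; rw [h'] at this; exact lt_irrefl _ this

/-- A solid string and its ghosts move rigidly, and red strings do not move at all, so strings with
a common carrier keep their distance. -/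
theorem carrier_ne_of_mem_crossings {c : Str n l E × Str n l E}
    (h : c ∈ K.crossings res z z') : c.1.carrier ≠ c.2.carrier := fun h' => by
  have h1 := h.2.2.1
  have h2 := h.2.2.2
  rw [strPos_eq, strPos_eq, h'] at h1 h2
  linarith

theorem mem_crossings_or (hy : K.Generic res y) {c : Str n l E × Str n l E}
    (h : c ∈ K.crossings res x z) : c ∈ K.crossings res x y ∨ c ∈ K.crossings res y z := by
  rcases lt_or_gt_of_ne (strPos_ne hy h.1 h.2.1 (ne_of_mem_crossings h)) with h1 | h1
  · exact Or.inr ⟨h.1, h.2.1, h1, h.2.2.2⟩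
  · exact Or.inl ⟨h.1, h.2.1, h.2.2.1, h1⟩

/-- Strings that do not cross keep their order. -/
theorem strPos_lt_iff (hz : K.Generic res z) (hz' : K.Generic res z') {a b : Str n l E}
    (ha : K.Active res a) (hb : K.Active res b) (h : (a, b) ∉ K.crossings res z z')
    (h' : (b, a) ∉ K.crossings res z z') :
    K.strPos z a < K.strPos z b ↔ K.strPos z' a < K.strPos z' b := by
  rcases eq_or_ne a b with rfl | hab
  · simp
  constructor
  · intro h1
    by_contra h2
    exact h ⟨ha, hb, h1, lt_of_le_of_ne (not_lt.1 h2) (strPos_ne hz' hb ha hab.symm)⟩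
  · intro h1
    by_contra h2
    exact h' ⟨hb, ha, lt_of_le_of_ne (not_lt.1 h2) (strPos_ne hz hb ha hab.symm), h1⟩

theorem strPos_lt_iff_of_empty (hz : K.Generic res z) (hz' : K.Generic res z')
    {a b : Str n l E} (ha : K.Active res a) (hb : K.Active res b)
    (h : K.crossings res z z' = ∅) :
    K.strPos z a < K.strPos z b ↔ K.strPos z' a < K.strPos z' b :=
  strPos_lt_iff hz hz' ha hb (by simp [h]) (by simp [h])

/-- The crossings only depend on the order of the strings. -/
theorem crossings_congr_right (hz : K.Generic res z) (hz' : K.Generic res z')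
    (h : K.crossings res z z' = ∅) : K.crossings res x z = K.crossings res x z' := by
  ext c
  constructor <;> rintro ⟨h1, h2, h3, h4⟩ <;> refine ⟨h1, h2, h3, ?_⟩
  · exact (strPos_lt_iff_of_empty hz hz' h2 h1 h).1 h4
  · exact (strPos_lt_iff_of_empty hz hz' h2 h1 h).2 h4

theorem crossings_congr_left (hz : K.Generic res z) (hz' : K.Generic res z')
    (h : K.crossings res z z' = ∅) : K.crossings res z x = K.crossings res z' x := by
  ext c
  constructor <;> rintro ⟨h1, h2, h3, h4⟩ <;> refine ⟨h1, h2, ?_, h4⟩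
  · exact (strPos_lt_iff_of_empty hz hz' h1 h2 h).1 h3
  · exact (strPos_lt_iff_of_empty hz hz' h1 h2 h).2 h3

/-- Once the carriers agree, their coordinates cancel from the comparison of distances. Simplicity
therefore depends only on the set of crossings, as `simple_of_subset` uses. -/
theorem simple_iff : K.Simple res z z' ↔
    ∀ c ∈ K.crossings res z z', ∀ c' ∈ K.crossings res z z',
      c.1.carrier = c'.1.carrier ∧ c.2.carrier = c'.2.carrier ∧
        K.off c.2 - K.off c.1 = K.off c'.2 - K.off c'.1 := by
  refine forall₂_congr fun c _ => forall₂_congr fun c' _ => ?_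
  refine and_congr_right fun h1 => and_congr_right fun h2 => ?_
  simp only [strPos_eq, h1, h2]
  constructor <;> intro h <;> linarith

theorem simple_of_subset (h : K.Simple res z z')
    (hs : K.crossings res s t ⊆ K.crossings res z z') : K.Simple res s t :=
  simple_iff.2 fun c hc c' hc' => simple_iff.1 h c (hs hc) c' (hs hc')

theorem simple_of_empty (h : K.crossings res z z' = ∅) : K.Simple res z z' := by
  intro c hc; rw [h] at hc; exact hc.elim

theorem mem_crossings_of_parallel {c c' : Str n l E × Str n l E}
    (h : c ∈ K.crossings res z z') (h1 : K.Active res c'.1) (h2 : K.Active res c'.2)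
    (h3 : c.1.carrier = c'.1.carrier) (h4 : c.2.carrier = c'.2.carrier)
    (h5 : K.off c.2 - K.off c.1 = K.off c'.2 - K.off c'.1) : c' ∈ K.crossings res z z' := by
  obtain ⟨-, -, h6, h7⟩ := h
  simp only [strPos_eq, h3, h4] at h6 h7
  refine ⟨h1, h2, ?_, ?_⟩ <;> simp only [strPos_eq] <;> linarith

/-- The crossings of a simple step are determined by one of them. -/
theorem crossings_eq_of_mem {c : Str n l E × Str n l E} (h : K.Simple res z z')
    (h' : K.Simple res s t) (hc : c ∈ K.crossings res z z') (hc' : c ∈ K.crossings res s t) :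
    K.crossings res z z' = K.crossings res s t := by
  ext d
  constructor <;> intro hd
  · obtain ⟨h1, h2, h3⟩ := simple_iff.1 h c hc d hd
    exact mem_crossings_of_parallel hc' hd.1 hd.2.1 h1 h2 h3
  · obtain ⟨h1, h2, h3⟩ := simple_iff.1 h' c hc' d hd
    exact mem_crossings_of_parallel hc hd.1 hd.2.1 h1 h2 h3

/-- Two ghosts of one solid string never coincide in a loading, and `X` contains a loading. The
argument `_k` provides a solid string, without which that condition is empty. -/
theorem edge_eq_of_shift (_k : Fin n) {e e' : E} (h : K.owner e = K.owner e')
    (h' : |K.shift e| = |K.shift e'|) : e = e' := by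
  obtain ⟨x, hx⟩ := K.X_nonempty
  exact (K.X_loading x hx).2.2.2.2.2 _k e e' h h'

theorem owner_ne_partner (e : E) : K.owner e ≠ K.partner e := by
  have := (K.quiver.edge_adj e).1
  rw [owner, partner]; split_ifs
  · exact this
  · exact this.symm

variable (K) in
/-- The crossing of the strings `a` and `b` has a non-trivial degree. -/
def Interact (res : Fin n → I) (a b : Str n l E) : Prop :=
  SolidSolid res a b ∨ K.GhostSolid res a b ∨ K.GhostSolid res b a ∨
    K.SolidRed res a b ∨ K.SolidRed res b a

theorem Interact.symm {a b : Str n l E} (h : K.Interact res a b) : K.Interact res b a := by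
  rcases h with ⟨k, k', h1, h2, h3, h4⟩ | h | h | h | h
  · exact Or.inl ⟨k', k, h2, h1, h3.symm, h4.symm⟩
  · exact Or.inr (Or.inr (Or.inl h))
  · exact Or.inr (Or.inl h)
  · exact Or.inr (Or.inr (Or.inr (Or.inr h)))
  · exact Or.inr (Or.inr (Or.inr (Or.inl h)))

/-- At most one crossing of a simple step is non-trivial. -/
theorem interact_unique (h : K.Simple res z z') {c c' : Str n l E × Str n l E}
    (hc : c ∈ K.crossings res z z') (hc' : c' ∈ K.crossings res z z')
    (hi : K.Interact res c.1 c.2) (hi' : K.Interact res c'.1 c'.2) : c = c' := by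
  obtain ⟨h1, h2, h3⟩ := simple_iff.1 h c hc c' hc'
  obtain ⟨a, b⟩ := c
  obtain ⟨a', b'⟩ := c'
  -- The offset difference is zero for solid-solid, negative for ghost-solid and positive for
  -- solid-ghost crossings, so these types exclude each other; within a type, the edge or the red
  -- string is recovered from the offset.
  have hs : ∀ e, 0 < |K.shift e| := fun e => abs_pos.2 (K.shift_ne e)
  rcases hi with ⟨k, k', rfl, rfl, -, -⟩ | ⟨k, e, k', rfl, rfl, g1, -⟩ |
    ⟨k, e, k', rfl, rfl, g1, -⟩ | ⟨k, m, rfl, rfl, -⟩ | ⟨k, m, rfl, rfl, -⟩ <;>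
  rcases hi' with ⟨j, j', rfl, rfl, -, -⟩ | ⟨j, e', j', rfl, rfl, g2, -⟩ |
    ⟨j, e', j', rfl, rfl, g2, -⟩ | ⟨j, m', rfl, rfl, -⟩ | ⟨j, m', rfl, rfl, -⟩ <;>
  simp only [Str.carrier, off, Option.some.injEq, reduceCtorEq] at h1 h2 h3 <;>
  first
  | (subst h1 h2; rfl)
  | (subst h1 h2
     obtain rfl := edge_eq_of_shift k (g1.trans g2.symm) (by linarith)
     rfl)
  | (exfalso; linarith [hs e, hs e'])
  | (exfalso; linarith [hs e])
  | (exfalso; linarith [hs e'])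
  | (subst h1
     obtain rfl := K.charge_strictMono.injective (show K.charge m = K.charge m' by linarith)
     rfl)
  | (subst h2
     obtain rfl := K.charge_strictMono.injective (show K.charge m = K.charge m' by linarith)
     rfl)

theorem strPos_swap_left {k k' : Fin n} {a : Str n l E} (h : a.carrier = some k)
    (z : Fin n → ℝ) : K.strPos z (Str.rename (Equiv.swap k k') a) = z k' + K.off a := by
  rw [strPos_eq, carrier_rename, h, off_rename]; simp [coord]

theorem strPos_swap_right {k k' : Fin n} {a : Str n l E} (h : a.carrier = some k')
    (z : Fin n → ℝ) : K.strPos z (Str.rename (Equiv.swap k k') a) = z k + K.off a := by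
  rw [strPos_eq, carrier_rename, h, off_rename]; simp [coord]

theorem strPos_of_carrier {k : Fin n} {a : Str n l E} (h : a.carrier = some k)
    (z : Fin n → ℝ) : K.strPos z a = z k + K.off a := by
  rw [strPos_eq, h]; simp [coord]

/-- Exchanging two strings of the same residue after they have crossed leaves no crossings, if all
other strings keep their order relative to both of them, or pass between the two. -/
theorem crossings_swap_eq_empty {k k' : Fin n} (hres : res k = res k')
    (hk : (Str.solid k, Str.solid k') ∈ K.crossings res s t)
    (h₁ : ∀ c ∈ K.crossings res s t, c.1.carrier = some k → c.2.carrier = some k' →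
      K.off c.1 = K.off c.2)
    (h₂ : ∀ a b, K.Active res a → K.Active res b → a.carrier = some k → b.carrier ≠ some k →
      b.carrier ≠ some k' →
      ((K.strPos s a < K.strPos s b ↔ K.strPos t a < K.strPos t b) ∧
        (s k' + K.off a < K.strPos s b ↔ t k' + K.off a < K.strPos t b)) ∨
      (K.strPos s a < K.strPos s b ∧ K.strPos s b < s k' + K.off a ∧
        t k' + K.off a < K.strPos t b ∧ K.strPos t b < K.strPos t a))
    (h₃ : ∀ c ∈ K.crossings res s t, ¬ (c.1.carrier ≠ some k ∧ c.1.carrier ≠ some k' ∧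
      c.2.carrier ≠ some k ∧ c.2.carrier ≠ some k')) :
    K.crossings res s (t ∘ Equiv.swap k k') = ∅ := by
  have hst : s k < s k' ∧ t k' < t k := ⟨hk.2.2.1, hk.2.2.2⟩
  have hne : k ≠ k' := fun h => by rw [h] at hst; exact lt_irrefl _ hst.1
  have hne' : (some k : Option (Fin n)) ≠ some k' := fun h => hne (Option.some.inj h)
  -- a string `a` moving with `k`, its twin, and a third string `b`
  have key : ∀ a b, K.Active res a → K.Active res b → a.carrier = some k → b.carrier ≠ some k →
      b.carrier ≠ some k' →
      (s k + K.off a < K.strPos s b ↔ t k' + K.off a < K.strPos t b) ∧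
        (s k' + K.off a < K.strPos s b ↔ t k + K.off a < K.strPos t b) := by
    intro a b ha hb h1 h2 h3
    have := h₂ a b ha hb h1 h2 h3
    rw [strPos_of_carrier h1, strPos_of_carrier h1] at this
    rcases this with ⟨h4, h5⟩ | ⟨h4, h5, h6, h7⟩
    · constructor
      · constructor
        · intro h; have := h4.1 h; linarith [hst.2]
        · intro h
          have := h5.2 h; linarith [hst.1]
      · constructor
        · intro h; have h' : s k + K.off a < K.strPos s b := by linarith [hst.1]
          exact h4.1 h'
        · intro h; have h' : t k' + K.off a < K.strPos t b := by linarith [hst.2]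
          exact h5.2 h'
    · exact ⟨⟨fun _ => h6, fun _ => h4⟩, ⟨fun h => absurd h (not_lt.2 h5.le),
        fun h => absurd h (not_lt.2 h7.le)⟩⟩
  -- the same for a string `a` moving with `k` or with `k'`
  have key2 : ∀ a b, K.Active res a → K.Active res b → (a.carrier = some k ∨ a.carrier = some k') →
      b.carrier ≠ some k → b.carrier ≠ some k' →
      (K.strPos s a < K.strPos s b ↔
        K.strPos t (Str.rename (Equiv.swap k k') a) < K.strPos t b) := by
    intro a b ha hb h1 h2 h3
    rcases h1 with h1 | h1
    · rw [strPos_swap_left h1, strPos_of_carrier h1]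
      exact (key a b ha hb h1 h2 h3).1
    · rw [strPos_swap_right h1, strPos_of_carrier h1]
      have := (key (Str.rename (Equiv.swap k k') a) b ((active_rename_swap hres).2 ha) hb
        (by rw [carrier_rename, h1]; simp) h2 h3).2
      rwa [off_rename] at this
  rw [Set.eq_empty_iff_forall_notMem]
  rintro ⟨a, b⟩ ⟨ha, hb, h1, h2⟩
  simp only [strPos_comp] at ha hb h1 h2
  by_cases hak : a.carrier = some k ∨ a.carrier = some k'
  · by_cases hbk : b.carrier = some k ∨ b.carrier = some k'
    · rcases hak with hak | hak <;> rcases hbk with hbk | hbk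
      · rw [strPos_swap_left hbk, strPos_swap_left hak] at h2
        rw [strPos_of_carrier hbk, strPos_of_carrier hak] at h1
        linarith
      · rw [strPos_swap_right hbk, strPos_swap_left hak] at h2
        rw [strPos_of_carrier hbk, strPos_of_carrier hak] at h1
        by_cases hc : (a, b) ∈ K.crossings res s t
        · have := h₁ _ hc hak hbk
          simp only at this
          linarith
        · have h3 : K.strPos t a ≤ K.strPos t b := by
            by_contra h4
            refine hc ⟨ha, hb, ?_, not_le.1 h4⟩
            rw [strPos_of_carrier hbk, strPos_of_carrier hak]
            exact h1
          rw [strPos_of_carrier hbk, strPos_of_carrier hak] at h3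
          linarith
      · rw [strPos_swap_left hbk, strPos_swap_right hak] at h2
        rw [strPos_of_carrier hbk, strPos_of_carrier hak] at h1
        have hc : (Str.rename (Equiv.swap k k') a, Str.rename (Equiv.swap k k') b) ∈
            K.crossings res s t := by
          refine ⟨(active_rename_swap hres).2 ha, (active_rename_swap hres).2 hb, ?_, ?_⟩
          · rw [strPos_swap_left hbk, strPos_swap_right hak]; linarith
          · rw [strPos_swap_left hbk, strPos_swap_right hak]; exact h2
        have := h₁ _ hc (by rw [carrier_rename, hak]; simp) (by rw [carrier_rename, hbk]; simp)
        simp only [off_rename] at this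
        linarith
      · rw [strPos_swap_right hbk, strPos_swap_right hak] at h2
        rw [strPos_of_carrier hbk, strPos_of_carrier hak] at h1
        linarith
    · rw [not_or] at hbk
      rw [rename_swap_of_ne hbk.1 hbk.2] at h2
      exact lt_asymm h2 ((key2 a b ha hb hak hbk.1 hbk.2).1 h1)
  · rw [not_or] at hak
    rw [rename_swap_of_ne hak.1 hak.2] at h2
    by_cases hbk : b.carrier = some k ∨ b.carrier = some k'
    · exact lt_asymm h1 ((key2 b a hb ha hbk hak.1 hak.2).2 h2)
    · rw [not_or] at hbk
      rw [rename_swap_of_ne hbk.1 hbk.2] at h2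
      exact h₃ (a, b) ⟨ha, hb, h1, h2⟩ ⟨hak.1, hak.2, hbk.1, hbk.2⟩

/-- In a simple step that contains a solid-solid crossing, only strings carried by `k` and `k'` with
equal offsets cross. Exchanging the two carriers undoes all of these crossings, and no third string
is affected. -/
theorem crossings_swap_eq_empty_of_simple {k k' : Fin n} (hres : res k = res k')
    (hs : K.Generic res s) (ht : K.Generic res t) (h : K.Simple res s t)
    (hk : (Str.solid k, Str.solid k') ∈ K.crossings res s t) :
    K.crossings res s (t ∘ Equiv.swap k k') = ∅ := by
  have key : ∀ c ∈ K.crossings res s t, c.1.carrier = some k ∧ c.2.carrier = some k' ∧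
      K.off c.1 = K.off c.2 := fun c hc => by
    obtain ⟨h1, h2, h3⟩ := simple_iff.1 h _ hk c hc
    refine ⟨h1.symm, h2.symm, ?_⟩
    change (0 : ℝ) - 0 = _ at h3
    linarith
  refine crossings_swap_eq_empty hres hk (fun c hc _ _ => (key c hc).2.2) ?_
    (fun c hc h => h.1 (key c hc).1)
  intro a b ha hb h1 h2 h3
  left
  constructor
  · exact strPos_lt_iff hs ht ha hb (fun hc => h3 (key _ hc).2.1) (fun hc => h2 (key _ hc).1)
  · rw [← strPos_swap_left h1, ← strPos_swap_left h1]
    exact strPos_lt_iff hs ht ((active_rename_swap hres).2 ha) hb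
      (fun hc => h3 (key _ hc).2.1) (fun hc => h2 (key _ hc).1)

variable (K) in
/-- Two sequences of three steps with the same crossings in opposite orders. -/
structure Hexagon (res : Fin n → I) (s t z₁ z₂ z₁' z₂' : Fin n → ℝ) : Prop where
  gs : K.Generic res s
  gt : K.Generic res t
  g₁ : K.Generic res z₁
  g₂ : K.Generic res z₂
  g₁' : K.Generic res z₁'
  g₂' : K.Generic res z₂'
  s₁ : K.Simple res s z₁
  s₂ : K.Simple res z₁ z₂
  s₃ : K.Simple res z₂ t
  h₁ : K.crossings res s z₁ = K.crossings res z₂' t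
  h₂ : K.crossings res z₁ z₂ = K.crossings res z₁' z₂'
  h₃ : K.crossings res z₂ t = K.crossings res s z₁'

theorem Hexagon.symm {z₁ z₂ z₁' z₂' : Fin n → ℝ} (H : K.Hexagon res s t z₁ z₂ z₁' z₂') :
    K.Hexagon res s t z₁' z₂' z₁ z₂ where
  gs := H.gs
  gt := H.gt
  g₁ := H.g₁'
  g₂ := H.g₂'
  g₁' := H.g₁
  g₂' := H.g₂
  s₁ := simple_of_subset H.s₃ H.h₃.symm.subset
  s₂ := simple_of_subset H.s₂ H.h₂.symm.subset
  s₃ := simple_of_subset H.s₁ H.h₁.symm.subset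
  h₁ := H.h₃.symm
  h₂ := H.h₂.symm
  h₃ := H.h₁.symm

theorem Hexagon.mem_or {z₁ z₂ z₁' z₂' : Fin n → ℝ} (H : K.Hexagon res s t z₁ z₂ z₁' z₂')
    {c : Str n l E × Str n l E} (hc : c ∈ K.crossings res s t) :
    c ∈ K.crossings res s z₁ ∨ c ∈ K.crossings res z₁ z₂ ∨ c ∈ K.crossings res z₂ t := by
  rcases mem_crossings_or H.g₁ hc with h | h
  · exact Or.inl h
  · exact Or.inr (mem_crossings_or H.g₂ h)

/-- The strings `a` and `c` of the same residue, with a third string `b` between them. -/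
theorem Hexagon.crossings_swap {z₁ z₂ z₁' z₂' : Fin n → ℝ}
    (H : K.Hexagon res s t z₁ z₂ z₁' z₂') {k k' : Fin n} {a b c : Str n l E}
    (hres : res k = res k') (ha : a.carrier = some k) (hc : c.carrier = some k')
    (hoff : K.off a = K.off c) (h_ab : (a, b) ∈ K.crossings res s z₁)
    (h_ac : (a, c) ∈ K.crossings res z₁ z₂) (h_bc : (b, c) ∈ K.crossings res z₂ t) :
    K.crossings res s (t ∘ Equiv.swap k k') = ∅ := by
  have hb1 : some k ≠ b.carrier := ha ▸ carrier_ne_of_mem_crossings h_ab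
  have hb2 : b.carrier ≠ some k' := hc ▸ carrier_ne_of_mem_crossings h_bc
  have hkk : some k ≠ some k' := by
    have := carrier_ne_of_mem_crossings h_ac; simp only [ha, hc] at this; exact this
  have k1 : ∀ d ∈ K.crossings res s z₁, d.1.carrier = some k ∧ d.2.carrier = b.carrier ∧
      K.off b - K.off a = K.off d.2 - K.off d.1 := fun d hd => by
    obtain ⟨h1, h2, h3⟩ := simple_iff.1 H.s₁ _ h_ab d hd
    exact ⟨h1.symm.trans ha, h2.symm, h3⟩
  have k2 : ∀ d ∈ K.crossings res z₁ z₂, d.1.carrier = some k ∧ d.2.carrier = some k' ∧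
      K.off d.1 = K.off d.2 := fun d hd => by
    obtain ⟨h1, h2, h3⟩ := simple_iff.1 H.s₂ _ h_ac d hd
    refine ⟨h1.symm.trans ha, h2.symm.trans hc, ?_⟩
    simp only at h3; linarith
  have k3 : ∀ d ∈ K.crossings res z₂ t, d.1.carrier = b.carrier ∧ d.2.carrier = some k' ∧
      K.off c - K.off b = K.off d.2 - K.off d.1 := fun d hd => by
    obtain ⟨h1, h2, h3⟩ := simple_iff.1 H.s₃ _ h_bc d hd
    exact ⟨h1.symm, h2.symm.trans hc, h3⟩
  -- The order of the three strings is `a`, `b`, `c` at `s` and `c`, `b`, `a` at `t` (`o1` to `o4`):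
  -- the middle string passes between the outer ones.
  have o1 : K.strPos s a < K.strPos s b := h_ab.2.2.1
  have o2 : K.strPos s b < K.strPos s c := by
    rw [strPos_lt_iff H.gs H.g₁ h_ab.2.1 h_ac.2.1 (fun h => hb1 (k1 _ h).1.symm)
      (fun h => hkk ((k1 _ h).1.symm.trans hc)), strPos_lt_iff H.g₁ H.g₂ h_ab.2.1 h_ac.2.1
      (fun h => hb1 (k2 _ h).1.symm) (fun h => hb2 (k2 _ h).2.1)]
    exact h_bc.2.2.1
  have o3 : K.strPos t c < K.strPos t b := h_bc.2.2.2
  have o4 : K.strPos t b < K.strPos t a := by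
    rw [← strPos_lt_iff H.g₂ H.gt h_ab.2.1 h_ab.1 (fun h => hkk (ha.symm.trans (k3 _ h).2.1))
      (fun h => hb1 (ha.symm.trans (k3 _ h).1)), ← strPos_lt_iff H.g₁ H.g₂ h_ab.2.1 h_ab.1
      (fun h => hb1 (k2 _ h).1.symm) (fun h => hb2 (k2 _ h).2.1)]
    exact h_ab.2.2.2
  have o5 : K.strPos s a < K.strPos s c := o1.trans o2
  have o6 : K.strPos t c < K.strPos t a := o3.trans o4
  refine crossings_swap_eq_empty hres ⟨trivial, trivial, ?_, ?_⟩ ?_ ?_ ?_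
  · rw [strPos_of_carrier ha, strPos_of_carrier hc] at o5
    simp only [strPos]; linarith
  · rw [strPos_of_carrier ha, strPos_of_carrier hc] at o6
    simp only [strPos]; linarith
  · intro d hd h1 h2
    rcases H.mem_or hd with h | h | h
    · exact absurd ((k1 _ h).2.1.symm.trans h2) hb2
    · exact (k2 _ h).2.2
    · exact absurd (h1.symm.trans (k3 _ h).1) hb1
  · intro x y hx hy h1 h2 h3
    -- A string `y` placed relative to `x` as `b` is relative to `a` passes between the twins, like
    -- `b` itself. Any other third string keeps its order relative to both twins.
    by_cases hy' : y.carrier = b.carrier ∧ K.off y - K.off x = K.off b - K.off a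
    · right
      obtain ⟨h4, h5⟩ := hy'
      simp only [strPos_eq, ha, hc, h1, h4] at o1 o2 o3 o4 ⊢
      simp only [coord, Option.elim] at o1 o2 o3 o4 ⊢
      refine ⟨?_, ?_, ?_, ?_⟩ <;> linarith
    · left
      have hn : ∀ x', K.Active res x' → (x'.carrier = some k ∨ x'.carrier = some k') →
          K.off x' = K.off x →
          (K.strPos s x' < K.strPos s y ↔ K.strPos t x' < K.strPos t y) := by
        intro x' hx' h4 h5
        refine strPos_lt_iff H.gs H.gt hx' hy (fun h => ?_) (fun h => ?_) <;>
          rcases H.mem_or h with h | h | h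
        · exact hy' ⟨(k1 _ h).2.1, by have := (k1 _ h).2.2; simp only at this; linarith⟩
        · exact h3 (k2 _ h).2.1
        · exact h3 (k3 _ h).2.1
        · exact h2 (k1 _ h).1
        · exact h2 (k2 _ h).1
        · exact hy' ⟨(k3 _ h).1, by have := (k3 _ h).2.2; simp only at this; linarith⟩
      refine ⟨hn x hx (Or.inl h1) rfl, ?_⟩
      rw [← strPos_swap_left h1, ← strPos_swap_left h1]
      exact hn _ ((active_rename_swap hres).2 hx) (Or.inr (by rw [carrier_rename, h1]; simp))
        (off_rename _ _ _)
  · rintro d hd ⟨h1, h2, h3, h4⟩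
    rcases H.mem_or hd with h | h | h
    · exact h1 (k1 _ h).1
    · exact h1 (k2 _ h).1
    · exact h4 (k3 _ h).2.1

end Crossings

end Datum

namespace Datum

/-! ### Crossings linked through strings of equal residue -/

section Linked

variable {R : Type*} [CommRing R] {I E : Type*} {n l : ℕ} {K : Datum R I E n l}
  {res : Fin n → I} {s t z z' z₁ z₂ z₁' z₂' : Fin n → ℝ}

theorem Cross.symm {a b : Str n l E} (h : K.Cross res z z' a b) : K.Cross res z z' b a :=
  Or.symm h

theorem Cross.active {a b : Str n l E} (h : K.Cross res z z' a b) :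
    K.Active res a ∧ K.Active res b :=
  h.elim (fun h => ⟨h.1, h.2.1⟩) fun h => ⟨h.2.1, h.1⟩

theorem Cross.carrier_ne {a b : Str n l E} (h : K.Cross res z z' a b) :
    a.carrier ≠ b.carrier :=
  h.elim carrier_ne_of_mem_crossings fun h => (carrier_ne_of_mem_crossings h).symm

theorem Cross.carriers (h : K.Simple res z z') {a b c d : Str n l E}
    (hab : K.Cross res z z' a b) (hcd : K.Cross res z z' c d) :
    (a.carrier = c.carrier ∧ b.carrier = d.carrier) ∨
      (a.carrier = d.carrier ∧ b.carrier = c.carrier) := by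
  rw [simple_iff] at h
  rcases hab with hab | hab <;> rcases hcd with hcd | hcd <;> have := h _ hab _ hcd <;> tauto

theorem Cross.lt_iff {a b : Str n l E} (h : K.Cross res z z' a b) :
    K.strPos z' a < K.strPos z' b ↔ ¬ K.strPos z a < K.strPos z b := by
  rcases h with h | h
  · exact iff_of_false (not_lt.2 h.2.2.2.le) (not_not.2 h.2.2.1)
  · exact iff_of_true h.2.2.2 (not_lt.2 h.2.2.1.le)

theorem lt_iff_of_not_cross (hz : K.Generic res z) (hz' : K.Generic res z') {a b : Str n l E}
    (ha : K.Active res a) (hb : K.Active res b) (h : ¬ K.Cross res z z' a b) :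
    K.strPos z' a < K.strPos z' b ↔ K.strPos z a < K.strPos z b := by
  rw [Cross, not_or] at h
  exact (strPos_lt_iff hz hz' ha hb h.1 h.2).symm

theorem cross_of_eq (h : K.crossings res z z' = K.crossings res s t) {a b : Str n l E} :
    K.Cross res z z' a b ↔ K.Cross res s t a b := by
  rw [Cross, Cross, h]

theorem mem_of_cross {a b : Str n l E} (h : K.Cross res z z' a b)
    (h' : K.strPos z a < K.strPos z b) : (a, b) ∈ K.crossings res z z' :=
  h.resolve_right fun h => lt_asymm h' h.2.2.1

/-- Strings of the same carrier offset cross together with the solid strings they move with. -/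
theorem cross_twin {k k' : Fin n} (hres : res k = res k')
    (h : (Str.solid k, Str.solid k') ∈ K.crossings res z z') {x : Str n l E}
    (hx : K.Active res x) (hc : x.carrier = some k ∨ x.carrier = some k') :
    K.Cross res z z' x (Str.rename (Equiv.swap k k') x) := by
  have hx' := (active_rename_swap (k := k) (k' := k') hres).2 hx
  have h1 : z k < z k' := h.2.2.1
  have h2 : z' k' < z' k := h.2.2.2
  rcases hc with hc | hc
  · refine Or.inl ⟨hx, hx', ?_, ?_⟩ <;> simp only [strPos_swap_left hc, strPos_of_carrier hc] <;>
      linarith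
  · refine Or.inr ⟨hx', hx, ?_, ?_⟩ <;> simp only [strPos_swap_right hc, strPos_of_carrier hc] <;>
      linarith

theorem twin_carrier_ne {k k' : Fin n} (hk : k ≠ k') {x : Str n l E}
    (hc : x.carrier = some k ∨ x.carrier = some k') :
    x.carrier ≠ (Str.rename (Equiv.swap k k') x).carrier := by
  rw [carrier_rename]
  rcases hc with hc | hc <;> rw [hc] <;> simp [hk, hk.symm]

/-- The carrier of a string is one of two given solid strings. -/
def Touches (k k' : Fin n) (a : Str n l E) : Prop := a.carrier = some k ∨ a.carrier = some k'

theorem touches_twin {k k' : Fin n} {x : Str n l E} (hc : Touches k k' x) :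
    Touches k k' (Str.rename (Equiv.swap k k') x) := by
  rw [Touches, carrier_rename]
  rcases hc with hc | hc <;> rw [hc] <;> simp

/-- If two strings of the same residue interact, they are solid. -/
theorem interact_of_touches {k k' : Fin n} (hres : res k = res k') {a b : Str n l E}
    (h : K.Interact res a b) (ha : Touches k k' a) (hb : Touches k k' b) :
    (a = .solid k ∧ b = .solid k') ∨ (a = .solid k' ∧ b = .solid k) := by
  have ho : ∀ e, K.owner e = res k → K.partner e = res k → False := fun e h1 h2 =>
    owner_ne_partner e (h1.trans h2.symm)
  rcases h with ⟨j, j', rfl, rfl, h3, -⟩ | ⟨j, e, j', rfl, rfl, h3, h4⟩ |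
    ⟨j, e, j', rfl, rfl, h3, h4⟩ | ⟨j, m, rfl, rfl, -⟩ | ⟨j, m, rfl, rfl, -⟩ <;>
  simp only [Touches, Str.carrier, Option.some.injEq, reduceCtorEq, or_self] at ha hb
  · grind
  · exfalso; apply ho e <;> grind
  · exfalso; apply ho e <;> grind

theorem interact_rename {w : Equiv.Perm (Fin n)} {r r' : Fin n → I} (h : ∀ k, r' (w k) = r k)
    {a b : Str n l E} :
    K.Interact r' (Str.rename w a) (Str.rename w b) ↔ K.Interact r a b := by
  have h1 : ∀ {a b : Str n l E}, SolidSolid r' (Str.rename w a) (Str.rename w b) ↔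
      SolidSolid r a b := by
    intro a b
    constructor
    · rintro ⟨k, k', h1, h2, h3, h4⟩
      cases a <;> cases b <;> simp [Str.rename] at h1 h2
      subst h1 h2
      exact ⟨_, _, rfl, rfl, fun h' => h3 (by rw [h']), by rwa [h, h] at h4⟩
    · rintro ⟨k, k', rfl, rfl, h3, h4⟩
      exact ⟨_, _, rfl, rfl, w.injective.ne h3, by rwa [h, h]⟩
  have h2 : ∀ {a b : Str n l E}, K.GhostSolid r' (Str.rename w a) (Str.rename w b) ↔
      K.GhostSolid r a b := by
    intro a b
    constructor
    · rintro ⟨k, e, k', h1, h2, h3, h4⟩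
      cases a <;> cases b <;> simp [Str.rename] at h1 h2
      obtain ⟨rfl, rfl⟩ := h1
      subst h2
      exact ⟨_, _, _, rfl, rfl, by rwa [h] at h3, by rwa [h] at h4⟩
    · rintro ⟨k, e, k', rfl, rfl, h3, h4⟩
      exact ⟨_, _, _, rfl, rfl, by rwa [h], by rwa [h]⟩
  have h3 : ∀ {a b : Str n l E}, K.SolidRed r' (Str.rename w a) (Str.rename w b) ↔
      K.SolidRed r a b := by
    intro a b
    constructor
    · rintro ⟨k, m, h1, h2, h3⟩
      cases a <;> cases b <;> simp [Str.rename] at h1 h2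
      subst h1 h2
      exact ⟨_, _, rfl, rfl, by rwa [h] at h3⟩
    · rintro ⟨k, m, rfl, rfl, h3⟩
      exact ⟨_, _, rfl, rfl, by rwa [h]⟩
  rw [Interact, Interact, h1, h2, h2, h3, h3]

variable (K) in
/-- Two sequences of two steps with the same crossings in opposite orders. -/
structure Square (res : Fin n → I) (s t z z' : Fin n → ℝ) : Prop where
  gs : K.Generic res s
  gt : K.Generic res t
  g : K.Generic res z
  g' : K.Generic res z'
  s₁ : K.Simple res s z
  s₂ : K.Simple res z t
  h₁ : K.crossings res s z = K.crossings res z' t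
  h₂ : K.crossings res z t = K.crossings res s z'

theorem Square.symm (H : K.Square res s t z z') : K.Square res s t z' z where
  gs := H.gs
  gt := H.gt
  g := H.g'
  g' := H.g
  s₁ := simple_of_subset H.s₂ H.h₂.symm.subset
  s₂ := simple_of_subset H.s₁ H.h₁.symm.subset
  h₁ := H.h₂.symm
  h₂ := H.h₁.symm

theorem Square.not_both (H : K.Square res s t z z') {a b : Str n l E}
    (h : K.Cross res s z a b) (h' : K.Cross res z t a b) : False := by
  wlog hc : (a, b) ∈ K.crossings res s z generalizing a b
  · exact this h.symm h'.symm (h.resolve_left hc)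
  have h1 := hc.2.2
  rcases h' with h' | h'
  · exact lt_asymm h1.2 h'.2.2.1
  · rw [H.h₂] at h'
    exact lt_asymm h1.1 h'.2.2.1

/-- Two steps that can be exchanged are not linked by strings of the same residue. -/
theorem Square.not_touches (H : K.Square res s t z z') {k k' : Fin n} (hres : res k = res k')
    (h : (Str.solid k, Str.solid k') ∈ K.crossings res s z) {a b : Str n l E}
    (hab : K.Cross res z t a b) (hi : K.Interact res a b) : ¬ Touches k k' a := by
  intro ha
  have hk : k ≠ k' := fun h' => ne_of_mem_crossings h (by rw [h'])
  by_cases hb : Touches k k' b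
  · rcases interact_of_touches hres hi ha hb with ⟨rfl, rfl⟩ | ⟨rfl, rfl⟩
    · exact H.not_both (Or.inl h) hab
    · exact H.not_both (Or.inr h) hab
  -- The twin `a'` crosses `a` in the first step, and `a` crosses `b` in the second. Simplicity
  -- prevents `a'` and `b` from crossing at all, and then the orders of `a`, `a'`, `b` at the four
  -- slices contradict transitivity.
  set a' := Str.rename (Equiv.swap k k') a with ha'
  have hca := twin_carrier_ne hk ha
  rw [← ha'] at hca
  have hta : Touches k k' a' := touches_twin ha
  have hx : K.Cross res s z a a' := cross_twin hres h hab.active.1 ha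
  have hx' : K.Cross res z' t a a' := (cross_of_eq H.h₁).1 hx
  have hy' : K.Cross res s z' a b := (cross_of_eq H.h₂).1 hab
  have hx2 : ¬ K.Cross res z t a a' := fun h => H.not_both hx h
  have hx2' : ¬ K.Cross res s z' a a' := fun h => hx2 ((cross_of_eq H.h₂).2 h)
  have hy1 : ¬ K.Cross res s z a b := fun h => H.not_both h hab
  have hy1' : ¬ K.Cross res z' t a b := fun h => hy1 ((cross_of_eq H.h₁).2 h)
  have hn : b.carrier ≠ a'.carrier := fun h => hb (by rw [Touches, h]; exact hta)
  have hz1 : ¬ K.Cross res s z a' b := fun h => by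
    have := Cross.carriers H.s₁ hx h
    have := hab.carrier_ne
    grind
  have hz2 : ¬ K.Cross res z t a' b := fun h => by
    have := Cross.carriers H.s₂ hab h
    grind
  have hz1' : ¬ K.Cross res z' t a' b := fun h => hz1 ((cross_of_eq H.h₁).2 h)
  have hz2' : ¬ K.Cross res s z' a' b := fun h => hz2 ((cross_of_eq H.h₂).2 h)
  have A := hab.active.1
  have A' := hx.active.2
  have B := hab.active.2
  have e1 := hx.lt_iff
  have e2 := lt_iff_of_not_cross H.g H.gt A A' hx2
  have e3 := lt_iff_of_not_cross H.gs H.g' A A' hx2'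
  have f1 := hab.lt_iff
  have f2 := lt_iff_of_not_cross H.gs H.g A B hy1
  have f3 := hy'.lt_iff
  have g1 := lt_iff_of_not_cross H.gs H.g A' B hz1
  have g2 := lt_iff_of_not_cross H.g H.gt A' B hz2
  have g3 := lt_iff_of_not_cross H.gs H.g' A' B hz2'
  have tr : ∀ u : Fin n → ℝ,
      (K.strPos u a < K.strPos u a' → K.strPos u a' < K.strPos u b →
        K.strPos u a < K.strPos u b) ∧
      (¬ K.strPos u a < K.strPos u a' → K.strPos u a < K.strPos u b →
        K.strPos u a' < K.strPos u b) :=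
    fun u => ⟨lt_trans, fun h1 h2 => (not_lt.1 h1).trans_lt h2⟩
  have t1 := tr s
  have t2 := tr z
  have t3 := tr t
  have t4 := tr z'
  clear tr
  grind

theorem Cross.lt_iff_of_eq (h : K.crossings res z z' = K.crossings res s t) {a b : Str n l E}
    (hc : K.Cross res z z' a b) :
    K.strPos z a < K.strPos z b ↔ K.strPos s a < K.strPos s b := by
  rcases hc with hc | hc
  · exact iff_of_true hc.2.2.1 (h ▸ hc : (a, b) ∈ K.crossings res s t).2.2.1
  · exact iff_of_false (not_lt.2 hc.2.2.1.le)
      (not_lt.2 (h ▸ hc : (b, a) ∈ K.crossings res s t).2.2.1.le)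

/-- A pair that crosses in two of the steps would have to start one of these crossings from the
wrong side when the crossings are read in the opposite order. If the two outer steps have equal
crossings, the reversed sequence is the same and the braid identity of the operators is trivial, so
that case can be left aside. -/
theorem Hexagon.not_both (H : K.Hexagon res s t z₁ z₂ z₁' z₂')
    (hne : K.crossings res s z₁ ≠ K.crossings res z₂ t) {a b : Str n l E} :
    (K.Cross res s z₁ a b → ¬ K.Cross res z₁ z₂ a b ∧ ¬ K.Cross res z₂ t a b) ∧
      (K.Cross res z₁ z₂ a b → ¬ K.Cross res z₂ t a b) := by
  have h13 : ∀ {a b}, (a, b) ∈ K.crossings res s z₁ → ¬ K.Cross res z₂ t a b := by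
    rintro a b h (h' | h')
    · exact hne (crossings_eq_of_mem H.s₁ H.s₃ h h')
    · rw [H.h₁] at h
      exact lt_asymm h.2.2.2 h'.2.2.2
  have h13' : K.Cross res s z₁ a b → ¬ K.Cross res z₂ t a b :=
    fun h h' => h.elim (fun h => h13 h h') fun h => h13 h h'.symm
  by_cases ha : K.Active res a ∧ K.Active res b
  swap
  · exact ⟨fun h => absurd h.active ha, fun h => absurd h.active ha⟩
  have e1 := fun h : ¬ K.Cross res z₂ t a b =>
    lt_iff_of_not_cross H.gs H.g₁' ha.1 ha.2 (fun h' => h ((cross_of_eq H.h₃).2 h'))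
  have e2 := fun h : ¬ K.Cross res s z₁ a b =>
    lt_iff_of_not_cross H.g₂' H.gt ha.1 ha.2 (fun h' => h ((cross_of_eq H.h₁).2 h'))
  constructor
  · refine fun h1 => ⟨fun h2 => ?_, h13' h1⟩
    have := e1 (h13' h1)
    have := h1.lt_iff
    have := h2.lt_iff_of_eq H.h₂
    tauto
  · intro h2 h3
    have := e2 (fun h => h13' h h3)
    have := h2.lt_iff
    have := ((cross_of_eq H.h₂).1 h2).lt_iff
    have := h2.lt_iff_of_eq H.h₂
    have := h3.lt_iff
    tauto

theorem Hexagon.ne_symm (H : K.Hexagon res s t z₁ z₂ z₁' z₂')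
    (hne : K.crossings res s z₁ ≠ K.crossings res z₂ t) :
    K.crossings res s z₁' ≠ K.crossings res z₂' t := by
  rw [← H.h₁, ← H.h₃]; exact hne.symm

/-- The order of two strings that cross at most in the first step. -/
theorem Hexagon.order₁ (H : K.Hexagon res s t z₁ z₂ z₁' z₂')
    (hne : K.crossings res s z₁ ≠ K.crossings res z₂ t) {a b : Str n l E}
    (h : K.Cross res s z₁ a b) :
    let L := fun u => K.strPos u a < K.strPos u b
    (L z₁ ↔ ¬ L s) ∧ (L z₂ ↔ ¬ L s) ∧ (L t ↔ ¬ L s) ∧ (L z₁' ↔ L s) ∧ (L z₂' ↔ L s) := by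
  obtain ⟨h2, h3⟩ := (H.not_both hne).1 h
  obtain ⟨ha, hb⟩ := h.active
  have e1 := h.lt_iff
  have e2 := lt_iff_of_not_cross H.g₁ H.g₂ ha hb h2
  have e3 := lt_iff_of_not_cross H.g₂ H.gt ha hb h3
  have e4 := lt_iff_of_not_cross H.gs H.g₁' ha hb (fun h' => h3 ((cross_of_eq H.h₃).2 h'))
  have e5 := lt_iff_of_not_cross H.g₁' H.g₂' ha hb (fun h' => h2 ((cross_of_eq H.h₂).2 h'))
  simp only
  tauto

theorem Hexagon.order₂ (H : K.Hexagon res s t z₁ z₂ z₁' z₂')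
    (hne : K.crossings res s z₁ ≠ K.crossings res z₂ t) {a b : Str n l E}
    (h : K.Cross res z₁ z₂ a b) :
    let L := fun u => K.strPos u a < K.strPos u b
    (L z₁ ↔ L s) ∧ (L z₂ ↔ ¬ L s) ∧ (L t ↔ ¬ L s) ∧ (L z₁' ↔ L s) ∧ (L z₂' ↔ ¬ L s) := by
  have h1 : ¬ K.Cross res s z₁ a b := fun h' => ((H.not_both hne).1 h').1 h
  have h3 := (H.not_both hne).2 h
  obtain ⟨ha, hb⟩ := h.active
  have e1 := lt_iff_of_not_cross H.gs H.g₁ ha hb h1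
  have e2 := h.lt_iff
  have e3 := lt_iff_of_not_cross H.g₂ H.gt ha hb h3
  have e4 := lt_iff_of_not_cross H.gs H.g₁' ha hb (fun h' => h3 ((cross_of_eq H.h₃).2 h'))
  have e5 := ((cross_of_eq H.h₂).1 h).lt_iff
  simp only
  tauto

theorem Hexagon.order₃ (H : K.Hexagon res s t z₁ z₂ z₁' z₂')
    (hne : K.crossings res s z₁ ≠ K.crossings res z₂ t) {a b : Str n l E}
    (h : K.Cross res z₂ t a b) :
    let L := fun u => K.strPos u a < K.strPos u b
    (L z₁ ↔ L s) ∧ (L z₂ ↔ L s) ∧ (L t ↔ ¬ L s) ∧ (L z₁' ↔ ¬ L s) ∧ (L z₂' ↔ ¬ L s) := by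
  have := H.symm.order₁ (H.ne_symm hne) ((cross_of_eq H.h₃).1 h)
  simp only at this ⊢
  tauto

theorem Hexagon.order₀ (H : K.Hexagon res s t z₁ z₂ z₁' z₂') {a b : Str n l E}
    (ha : K.Active res a) (hb : K.Active res b) (h1 : ¬ K.Cross res s z₁ a b)
    (h2 : ¬ K.Cross res z₁ z₂ a b) (h3 : ¬ K.Cross res z₂ t a b) :
    let L := fun u => K.strPos u a < K.strPos u b
    (L z₁ ↔ L s) ∧ (L z₂ ↔ L s) ∧ (L t ↔ L s) ∧ (L z₁' ↔ L s) ∧ (L z₂' ↔ L s) := by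
  have e1 := lt_iff_of_not_cross H.gs H.g₁ ha hb h1
  have e2 := lt_iff_of_not_cross H.g₁ H.g₂ ha hb h2
  have e3 := lt_iff_of_not_cross H.g₂ H.gt ha hb h3
  have e4 := lt_iff_of_not_cross H.gs H.g₁' ha hb (fun h' => h3 ((cross_of_eq H.h₃).2 h'))
  have e5 := lt_iff_of_not_cross H.g₁' H.g₂' ha hb (fun h' => h2 ((cross_of_eq H.h₂).2 h'))
  simp only
  tauto

theorem lt_transitivity (a a' b : Str n l E) (u : Fin n → ℝ) :
      (K.strPos u a < K.strPos u a' → K.strPos u a' < K.strPos u b →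
        K.strPos u a < K.strPos u b) ∧
      (¬ K.strPos u a < K.strPos u a' → K.strPos u a < K.strPos u b →
        K.strPos u a' < K.strPos u b) :=
  ⟨lt_trans, fun h1 h2 => (not_lt.1 h1).trans_lt h2⟩

/-- If two strings of the same residue cross in the first step, and one of them crosses a third
string in the second step, then so does the other one in the third step. -/
theorem Hexagon.twin₁₂ (H : K.Hexagon res s t z₁ z₂ z₁' z₂')
    (hne : K.crossings res s z₁ ≠ K.crossings res z₂ t) {a a' b : Str n l E}
    (hx : K.Cross res s z₁ a a') (hy : K.Cross res z₁ z₂ a b)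
    (hb : b.carrier ≠ a'.carrier) :
    K.Cross res z₂ t a' b ∧ (K.strPos z₁ a < K.strPos z₁ b ↔ K.strPos z₂ a' < K.strPos z₂ b) := by
  have hca := hx.carrier_ne
  have hab := hy.carrier_ne
  have hz1 : ¬ K.Cross res s z₁ a' b := fun h => by
    have := Cross.carriers H.s₁ hx h; grind
  have hz2 : ¬ K.Cross res z₁ z₂ a' b := fun h => by
    have := Cross.carriers H.s₂ hy h; grind
  have e := H.order₁ hne hx
  have f := H.order₂ hne hy
  have t0 := lt_transitivity (K := K) a a' b s
  have t1 := lt_transitivity (K := K) a a' b z₁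
  have t2 := lt_transitivity (K := K) a a' b z₂
  have t3 := lt_transitivity (K := K) a a' b t
  have t4 := lt_transitivity (K := K) a a' b z₁'
  have t5 := lt_transitivity (K := K) a a' b z₂'
  -- The first two steps are occupied by other pairs of carriers. If `a'` and `b` did not cross in
  -- the third step either, the order of `a`, `a'`, `b` would be cyclic at some slice.
  by_cases hz3 : K.Cross res z₂ t a' b
  · have g := H.order₃ hne hz3
    refine ⟨hz3, ?_⟩
    simp only at e f g
    grind
  · have g := H.order₀ hx.active.2 hy.active.2 hz1 hz2 hz3
    simp only at e f g
    grind

theorem Hexagon.twin₁₃ (H : K.Hexagon res s t z₁ z₂ z₁' z₂')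
    (hne : K.crossings res s z₁ ≠ K.crossings res z₂ t) {a a' b : Str n l E}
    (hx : K.Cross res s z₁ a a') (hy : K.Cross res z₂ t a b)
    (hb : b.carrier ≠ a'.carrier) :
    K.Cross res z₁ z₂ a' b ∧ (K.strPos z₂ a < K.strPos z₂ b ↔ K.strPos z₁ a' < K.strPos z₁ b) := by
  have hca := hx.carrier_ne
  have hab := hy.carrier_ne
  have hz1 : ¬ K.Cross res s z₁ a' b := fun h => by
    have := Cross.carriers H.s₁ hx h; grind
  have hz3 : ¬ K.Cross res z₂ t a' b := fun h => by
    have := Cross.carriers H.s₃ hy h; grind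
  have e := H.order₁ hne hx
  have f := H.order₃ hne hy
  have t0 := lt_transitivity (K := K) a a' b s
  have t1 := lt_transitivity (K := K) a a' b z₁
  have t2 := lt_transitivity (K := K) a a' b z₂
  have t3 := lt_transitivity (K := K) a a' b t
  have t4 := lt_transitivity (K := K) a a' b z₁'
  have t5 := lt_transitivity (K := K) a a' b z₂'
  by_cases hz2 : K.Cross res z₁ z₂ a' b
  · have g := H.order₂ hne hz2
    refine ⟨hz2, ?_⟩
    simp only at e f g
    grind
  · have g := H.order₀ hx.active.2 hy.active.2 hz1 hz2 hz3
    simp only at e f g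
    grind

/-- Again forced by transitivity of the order of three strings: when the twins cross in the middle,
one of them must meet the third string before and the other one after this crossing. -/
theorem Hexagon.twin₂₁ (H : K.Hexagon res s t z₁ z₂ z₁' z₂')
    (hne : K.crossings res s z₁ ≠ K.crossings res z₂ t) {a a' b : Str n l E}
    (hx : K.Cross res z₁ z₂ a a') (hy : K.Cross res s z₁ a b)
    (hb : b.carrier ≠ a'.carrier) : K.Cross res z₂ t a' b := by
  have hca := hx.carrier_ne
  have hab := hy.carrier_ne
  have hz1 : ¬ K.Cross res s z₁ a' b := fun h => by
    have := Cross.carriers H.s₁ hy h; grind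
  have hz2 : ¬ K.Cross res z₁ z₂ a' b := fun h => by
    have := Cross.carriers H.s₂ hx h; grind
  have e := H.order₂ hne hx
  have f := H.order₁ hne hy
  have t0 := lt_transitivity (K := K) a a' b s
  have t1 := lt_transitivity (K := K) a a' b z₁
  have t2 := lt_transitivity (K := K) a a' b z₂
  have t3 := lt_transitivity (K := K) a a' b t
  have t4 := lt_transitivity (K := K) a a' b z₁'
  have t5 := lt_transitivity (K := K) a a' b z₂'
  by_contra hz3
  have g := H.order₀ hx.active.2 hy.active.2 hz1 hz2 hz3
  simp only at e f g
  grind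

end Linked

end Datum

namespace Datum

/-! ### Operators attached to single steps -/

section Operators

open MvPolynomial

variable {R : Type*} [CommRing R] {I E : Type*} {n l : ℕ} (K : Datum R I E n l)

open Classical in
/-- The polynomial by which a crossing of strings of different residues acts. -/
def weight (res : Fin n → I) : Str n l E × Str n l E → MvPolynomial (Fin n) R
  -- The first string of the pair moves to the right. Only one of the two directions carries a
  -- polynomial, so that a double crossing yields `Q_ij`, or a dot, exactly once.
  | (.ghost k e, .solid k') => if K.partner e = res k' then K.QPoly res k k' else 1
  | (.solid k, .red m) => if res k = K.rho m then MvPolynomial.X k else 1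
  | _ => 1

/-- The product of the polynomials of all crossings of a step. -/
def totalWeight (res : Fin n → I) (C : Set (Str n l E × Str n l E)) : MvPolynomial (Fin n) R :=
  ∏ᶠ c ∈ C, K.weight res c

variable {K} {res : Fin n → I} {s t z z' z₁ z₂ z₁' z₂' : Fin n → ℝ}

theorem weight_eq_one {c : Str n l E × Str n l E} (h1 : K.Active res c.1)
    (h : ¬ K.Interact res c.1 c.2) : K.weight res c = 1 := by
  obtain ⟨a, b⟩ := c
  cases a <;> cases b <;> simp only [weight]
  · rw [if_neg]; exact fun h' => h (Or.inr (Or.inr (Or.inr (Or.inl ⟨_, _, rfl, rfl, h'⟩))))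
  · rw [if_neg]; exact fun h' => h (Or.inr (Or.inl ⟨_, _, _, rfl, rfl, h1, h'⟩))

/-- By `interact_unique` the product has at most one factor different from `1`. -/
theorem totalWeight_eq (h : K.Simple res z z') {c : Str n l E × Str n l E}
    (hc : c ∈ K.crossings res z z') (hi : K.Interact res c.1 c.2) :
    K.totalWeight res (K.crossings res z z') = K.weight res c := by
  classical
  rw [totalWeight, finprod_eq_single _ c]
  · exact finprod_eq_if.trans (if_pos hc)
  · intro d hd
    rw [finprod_eq_if]
    split_ifs with hd'
    · exact weight_eq_one hd'.1 fun h' => hd (interact_unique h hd' hc h' hi)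
    · rfl

theorem totalWeight_eq_one (h : ∀ c ∈ K.crossings res z z', ¬ K.Interact res c.1 c.2) :
    K.totalWeight res (K.crossings res z z') = 1 :=
  finprod_mem_of_eqOn_one fun c hc => weight_eq_one hc.1 (h c hc)

theorem weight_rename {w : Equiv.Perm (Fin n)} {r r' : Fin n → I} (h : ∀ k, r' (w k) = r k)
    (a b : Str n l E) :
    K.weight r' (Str.rename w a, Str.rename w b) = rename w (K.weight r (a, b)) := by
  have hQ : ∀ k k', K.QPoly r' (w k) (w k') = rename w (K.QPoly r k k') := by
    intro k k'
    have : (rename w : MvPolynomial (Fin n) R →ₐ[R] _).comp (aeval ![MvPolynomial.X k, MvPolynomial.X k']) =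
        aeval ![MvPolynomial.X (w k), MvPolynomial.X (w k')] := by
      ext i; fin_cases i <;> simp
    rw [QPoly, QPoly, h, h, ← this]; rfl
  cases a <;> cases b <;> simp only [weight, Str.rename, h, hQ, map_one] <;> split_ifs <;>
    first | rfl | (rw [map_one]; done) | (rw [rename_X]; done) | (exfalso; grind)

theorem mem_crossings_comp {w : Equiv.Perm (Fin n)} {r r' : Fin n → I} (h : ∀ k, r' (w k) = r k)
    {a b : Str n l E} : (a, b) ∈ K.crossings r (z ∘ w) (z' ∘ w) ↔
      (Str.rename w a, Str.rename w b) ∈ K.crossings r' z z' := by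
  simp only [crossings, Set.mem_ofPred_eq, strPos_comp, active_rename h]

theorem exists_rename (w : Equiv.Perm (Fin n)) (a : Str n l E) : ∃ b, Str.rename w b = a := by
  cases a with
  | solid k => exact ⟨.solid (w.symm k), by simp [Str.rename]⟩
  | ghost k e => exact ⟨.ghost (w.symm k) e, by simp [Str.rename]⟩
  | red m => exact ⟨.red m, rfl⟩

theorem totalWeight_comp {w : Equiv.Perm (Fin n)} {r r' : Fin n → I} (h : ∀ k, r' (w k) = r k)
    (hs : K.Simple r' z z') :
    K.totalWeight r' (K.crossings r' z z') =
      rename w (K.totalWeight r (K.crossings r (z ∘ w) (z' ∘ w))) := by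
  by_cases hc : ∃ c ∈ K.crossings r (z ∘ w) (z' ∘ w), K.Interact r c.1 c.2
  · obtain ⟨⟨a, b⟩, hc, hi⟩ := hc
    rw [totalWeight_eq (hs.relabel h) hc hi,
      totalWeight_eq hs ((mem_crossings_comp h).1 hc) ((interact_rename h).2 hi), weight_rename h]
  · push Not at hc
    rw [totalWeight_eq_one hc, totalWeight_eq_one, map_one]
    rintro ⟨a, b⟩ hab hi
    obtain ⟨a, rfl⟩ := exists_rename w a
    obtain ⟨b, rfl⟩ := exists_rename w b
    exact hc _ ((mem_crossings_comp h).2 hab) ((interact_rename h).1 hi)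

/-- The polynomial of a step that does not involve `k` and `k'` is symmetric in them. -/
theorem rename_totalWeight {k k' : Fin n} (hres : res k = res k') (hs : K.Simple res z z')
    (h : ∀ c ∈ K.crossings res z z', K.Interact res c.1 c.2 →
      ¬ Touches k k' c.1 ∧ ¬ Touches k k' c.2) :
    rename (Equiv.swap k k') (K.totalWeight res (K.crossings res z z')) =
      K.totalWeight res (K.crossings res z z') := by
  by_cases hc : ∃ c ∈ K.crossings res z z', K.Interact res c.1 c.2
  · obtain ⟨⟨a, b⟩, hc, hi⟩ := hc
    obtain ⟨h1, h2⟩ := h _ hc hi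
    simp only [Touches, not_or] at h1 h2
    rw [totalWeight_eq hs hc hi, ← weight_rename (res_swap hres), rename_swap_of_ne h1.1 h1.2,
      rename_swap_of_ne h2.1 h2.2]
  · push Not at hc
    rw [totalWeight_eq_one hc, map_one]

theorem solid_ne {k k' : Fin n}
    (h : (Str.solid k, Str.solid k') ∈ K.crossings res z z') : k ≠ k' :=
  fun h' => ne_of_mem_crossings h (by rw [h'])

theorem interact_solid {k k' : Fin n} (hr : res k = res k')
    (h : (Str.solid k, Str.solid k') ∈ K.crossings res z z') :
    K.Interact res (.solid k) (.solid k') := Or.inl ⟨k, k', rfl, rfl, solid_ne h, hr⟩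

variable (K) in
/-- The two ways in which a step can act. -/
theorem stepOp_cases (res : Fin n → I) (z z' : Fin n → ℝ) :
    (∃ k k', res k = res k' ∧ (Str.solid k, Str.solid k') ∈ K.crossings res z z') ∨
      ∀ k k', res k = res k' → (Str.solid k, Str.solid k') ∉ K.crossings res z z' := by
  by_cases h : ∃ k k', res k = res k' ∧ (Str.solid k, Str.solid k') ∈ K.crossings res z z'
  · exact Or.inl h
  · push Not at h
    exact Or.inr h

theorem Square.rename_weight (H : K.Square res s t z z') {k k' : Fin n} (hr : res k = res k')
    (h : (Str.solid k, Str.solid k') ∈ K.crossings res s z) :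
    rename (Equiv.swap k k') (K.totalWeight res (K.crossings res z t)) =
      K.totalWeight res (K.crossings res z t) :=
  rename_totalWeight hr H.s₂ fun _ hc hi =>
    ⟨H.not_touches hr h (Or.inl hc) hi, H.not_touches hr h (Or.inr hc) hi.symm⟩

theorem not_touches_of_interact {u v : Fin n → ℝ} {k k' : Fin n} (hr : res k = res k') {a b : Str n l E} (hc : K.Cross res u v a b)
    (hi : K.Interact res a b) (ha : Touches k k' a)
    (hn : ¬ K.Cross res u v (.solid k) (.solid k')) : ¬ Touches k k' b := by
  intro hb
  rcases interact_of_touches hr hi ha hb with ⟨rfl, rfl⟩ | ⟨rfl, rfl⟩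
  · exact hn hc
  · exact hn hc.symm

theorem rename_of_not_touches {k k' : Fin n} {b : Str n l E} (hb : ¬ Touches k k' b) :
    Str.rename (Equiv.swap k k') b = b := by
  rw [Touches, not_or] at hb; exact rename_swap_of_ne hb.1 hb.2

theorem carrier_ne_twin {k k' : Fin n} {a b : Str n l E} (ha : Touches k k' a)
    (hb : ¬ Touches k k' b) : b.carrier ≠ (Str.rename (Equiv.swap k k') a).carrier := fun h' =>
  hb (by rw [Touches, h']; exact touches_twin ha)

/-- The second and the third crossing of a triangle whose first crossing is that of `k` and `k'` are
interchanged by the swap of these strings. Hence so are the polynomials by which they act. -/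
theorem Hexagon.twin_mem₁₂ (H : K.Hexagon res s t z₁ z₂ z₁' z₂')
    (hne : K.crossings res s z₁ ≠ K.crossings res z₂ t) {k k' : Fin n} (hr : res k = res k')
    (h : (Str.solid k, Str.solid k') ∈ K.crossings res s z₁) {a b : Str n l E}
    (hc : (a, b) ∈ K.crossings res z₁ z₂) (hi : K.Interact res a b)
    (ht : Touches k k' a ∨ Touches k k' b) :
    (Str.rename (Equiv.swap k k') a, Str.rename (Equiv.swap k k') b) ∈
      K.crossings res z₂ t := by
  have hn := ((H.not_both hne).1 (Or.inl h)).1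
  have key : ∀ {a b}, K.Cross res z₁ z₂ a b → K.Interact res a b → Touches k k' a → _ :=
    fun {a b} hc hi ha => H.twin₁₂ hne (cross_twin hr h hc.active.1 ha) hc
      (carrier_ne_twin ha (not_touches_of_interact hr hc hi ha hn))
  rcases ht with ht | ht
  · rw [rename_of_not_touches (not_touches_of_interact hr (Or.inl hc) hi ht hn)]
    obtain ⟨h1, h2⟩ := key (Or.inl hc) hi ht
    exact mem_of_cross h1 (h2.1 hc.2.2.1)
  · rw [rename_of_not_touches (not_touches_of_interact hr (Or.inr hc) hi.symm ht hn)]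
    obtain ⟨h1, h2⟩ := key (Or.inr hc) hi.symm ht
    refine h1.resolve_left fun h3 => ?_
    exact lt_asymm (h2.2 h3.2.2.1) hc.2.2.1

theorem Hexagon.twin_mem₁₃ (H : K.Hexagon res s t z₁ z₂ z₁' z₂')
    (hne : K.crossings res s z₁ ≠ K.crossings res z₂ t) {k k' : Fin n} (hr : res k = res k')
    (h : (Str.solid k, Str.solid k') ∈ K.crossings res s z₁) {a b : Str n l E}
    (hc : (a, b) ∈ K.crossings res z₂ t) (hi : K.Interact res a b)
    (ht : Touches k k' a ∨ Touches k k' b) :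
    (Str.rename (Equiv.swap k k') a, Str.rename (Equiv.swap k k') b) ∈
      K.crossings res z₁ z₂ := by
  have hn := ((H.not_both hne).1 (Or.inl h)).2
  have key : ∀ {a b}, K.Cross res z₂ t a b → K.Interact res a b → Touches k k' a → _ :=
    fun {a b} hc hi ha => H.twin₁₃ hne (cross_twin hr h hc.active.1 ha) hc
      (carrier_ne_twin ha (not_touches_of_interact hr hc hi ha hn))
  rcases ht with ht | ht
  · rw [rename_of_not_touches (not_touches_of_interact hr (Or.inl hc) hi ht hn)]
    obtain ⟨h1, h2⟩ := key (Or.inl hc) hi ht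
    exact mem_of_cross h1 (h2.1 hc.2.2.1)
  · rw [rename_of_not_touches (not_touches_of_interact hr (Or.inr hc) hi.symm ht hn)]
    obtain ⟨h1, h2⟩ := key (Or.inr hc) hi.symm ht
    refine h1.resolve_left fun h3 => ?_
    exact lt_asymm (h2.2 h3.2.2.1) hc.2.2.1

theorem Hexagon.twin_cross₂₁ (H : K.Hexagon res s t z₁ z₂ z₁' z₂')
    (hne : K.crossings res s z₁ ≠ K.crossings res z₂ t) {k k' : Fin n} (hr : res k = res k')
    (h : (Str.solid k, Str.solid k') ∈ K.crossings res z₁ z₂) {a b : Str n l E}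
    (hc : K.Cross res s z₁ a b) (hi : K.Interact res a b) (ht : Touches k k' a) :
    ¬ Touches k k' b ∧ K.Cross res z₂ t (Str.rename (Equiv.swap k k') a) b := by
  have hb := not_touches_of_interact hr hc hi ht fun h' => ((H.not_both hne).1 h').1 (Or.inl h)
  exact ⟨hb, H.twin₂₁ hne (cross_twin hr h hc.active.1 ht) hc (carrier_ne_twin ht hb)⟩

/-- The swap either exchanges the two factors, if they belong to a triangle with the first crossing,
or it fixes each of them. In both cases the divided difference of the first step commutes with
multiplication by the product. -/
theorem Hexagon.rename_weight₁ (H : K.Hexagon res s t z₁ z₂ z₁' z₂')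
    (hne : K.crossings res s z₁ ≠ K.crossings res z₂ t) {k k' : Fin n} (hr : res k = res k')
    (h : (Str.solid k, Str.solid k') ∈ K.crossings res s z₁) :
    rename (Equiv.swap k k') (K.totalWeight res (K.crossings res z₁ z₂) *
      K.totalWeight res (K.crossings res z₂ t)) =
      K.totalWeight res (K.crossings res z₁ z₂) * K.totalWeight res (K.crossings res z₂ t) := by
  by_cases hc : ∃ c ∈ K.crossings res z₁ z₂, K.Interact res c.1 c.2 ∧
    (Touches k k' c.1 ∨ Touches k k' c.2)
  · obtain ⟨⟨a, b⟩, hc, hi, ht⟩ := hc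
    rw [totalWeight_eq H.s₂ hc hi, totalWeight_eq H.s₃ (H.twin_mem₁₂ hne hr h hc hi ht)
      ((interact_rename (res_swap hr)).2 hi), weight_rename (res_swap hr), map_mul,
      rename_swap_rename_swap, mul_comm]
  · push Not at hc
    rw [map_mul, rename_totalWeight hr H.s₂ hc, rename_totalWeight hr H.s₃]
    rintro ⟨a, b⟩ hd hi
    by_contra ht
    have ht : Touches k k' a ∨ Touches k k' b := by
      rwa [← not_or, not_not] at ht
    have h1 := hc _ (H.twin_mem₁₃ hne hr h hd hi ht) ((interact_rename (res_swap hr)).2 hi)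
    rcases ht with ht | ht
    · exact h1.1 (touches_twin ht)
    · exact h1.2 (touches_twin ht)

variable (K) in
/-- The crossings of the three steps do not belong to an exceptional triple. -/
def Unexceptional (res : Fin n → I) (s t z₁ z₂ : Fin n → ℝ) : Prop :=
  ∀ a b c, K.ExceptionalTriple res a b c →
    ¬ ((a, c) ∈ K.crossings res z₁ z₂ ∧ K.Cross res s t a b ∧ K.Cross res s t b c)

theorem cross_of_lt_iff {a b : Str n l E} (ha : K.Active res a) (hb : K.Active res b)
    (hz' : K.Generic res z') (hab : a ≠ b)
    (h : K.strPos z' a < K.strPos z' b ↔ ¬ K.strPos z a < K.strPos z b)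
    (hz : K.Generic res z) : K.Cross res z z' a b := by
  by_cases h1 : K.strPos z a < K.strPos z b
  · exact Or.inl ⟨ha, hb, h1, lt_of_le_of_ne (not_lt.1 fun h2 => h.1 h2 h1)
      (strPos_ne hz' hb ha hab.symm)⟩
  · exact Or.inr ⟨hb, ha, lt_of_le_of_ne (not_lt.1 h1) (strPos_ne hz hb ha hab.symm), h.2 h1⟩

/-- An interacting crossing with `k` or `k'` in the first step is repeated by the twin in the third
one. Together with the middle crossing this forms an exceptional triple, which is excluded. -/
theorem Hexagon.not_touches₂ (H : K.Hexagon res s t z₁ z₂ z₁' z₂')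
    (hne : K.crossings res s z₁ ≠ K.crossings res z₂ t)
    (hex : K.Unexceptional res s t z₁ z₂) {k k' : Fin n} (hr : res k = res k')
    (h : (Str.solid k, Str.solid k') ∈ K.crossings res z₁ z₂) {a b : Str n l E}
    (hc : K.Cross res s z₁ a b) (hi : K.Interact res a b) (hs : ¬ SolidSolid res a b) :
    ¬ Touches k k' a := by
  intro ht
  obtain ⟨hb, h3⟩ := H.twin_cross₂₁ hne hr h hc hi ht
  have hx := cross_twin hr h hc.active.1 ht
  set a' := Str.rename (Equiv.swap k k') a with ha'
  have hab : K.Cross res s t a b := cross_of_lt_iff hc.active.1 hc.active.2 H.gt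
    (fun h' => hc.carrier_ne (by rw [h'])) (H.order₁ hne hc).2.2.1 H.gs
  have hab' : K.Cross res s t a' b := cross_of_lt_iff h3.active.1 h3.active.2 H.gt
    (fun h' => h3.carrier_ne (by rw [h'])) (H.order₃ hne h3).2.2.1 H.gs
  have hi' : K.Interact res a' b := by
    have := (interact_rename (res_swap hr)).2 hi
    rwa [← ha', rename_of_not_touches hb] at this
  have hkk := solid_ne h
  -- Both orientations are needed, since `a` may be on either side of its twin before the middle
  -- crossing.
  have hexc : K.ExceptionalTriple res a b a' ∧ K.ExceptionalTriple res a' b a := by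
    have hra : a'.carrier ≠ a.carrier := hx.carrier_ne.symm
    have hres' : ∀ j, res (Equiv.swap k k' j) = res j := res_swap hr
    rcases hi with hi | ⟨j, e, j', rfl, rfl, g1, g2⟩ | ⟨j, e, j', rfl, rfl, g1, g2⟩ |
      ⟨j, m, rfl, rfl, g⟩ | ⟨j, m, rfl, rfl, g⟩
    · exact absurd hi hs
    · constructor <;> refine Or.inl ⟨_, _, e, rfl, rfl, ?_, ?_⟩ <;>
        refine ⟨_, _, _, rfl, rfl, ?_, g2⟩ <;> simp only [hres', g1]
    · have hj : j' ≠ Equiv.swap k k' j' := fun h' => hra (by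
        rw [ha']; simp only [Str.rename, Str.carrier, ← h'])
      constructor <;> refine Or.inr (Or.inl ⟨⟨_, _, rfl, rfl, ?_, ?_⟩,
        ⟨_, _, _, rfl, rfl, g1, ?_⟩, ⟨_, _, _, rfl, rfl, g1, ?_⟩⟩) <;>
        simp only [hres', g2, ne_eq, hj, hj.symm, not_false_eq_true]
    · have hj : j ≠ Equiv.swap k k' j := fun h' => hra (by
        rw [ha']; simp only [Str.rename, Str.carrier, ← h'])
      constructor <;> refine Or.inr (Or.inr ⟨⟨_, _, rfl, rfl, ?_, ?_⟩,
        ⟨_, _, rfl, rfl, ?_⟩, ⟨_, _, rfl, rfl, ?_⟩⟩) <;>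
        simp only [hres', g, ne_eq, hj, hj.symm, not_false_eq_true]
    · rcases ht with ht | ht <;> simp [Str.carrier] at ht
  rcases hx with hx | hx
  · exact hex _ _ _ hexc.1 ⟨hx, hab, hab'.symm⟩
  · exact hex _ _ _ hexc.2 ⟨hx, hab', hab.symm⟩

theorem Hexagon.rename_weight₂ (H : K.Hexagon res s t z₁ z₂ z₁' z₂')
    (hne : K.crossings res s z₁ ≠ K.crossings res z₂ t)
    (hex : K.Unexceptional res s t z₁ z₂) {k k' : Fin n} (hr : res k = res k')
    (h : (Str.solid k, Str.solid k') ∈ K.crossings res z₁ z₂)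
    (hs : ∀ k k', res k = res k' → (Str.solid k, Str.solid k') ∉ K.crossings res s z₁) :
    rename (Equiv.swap k k') (K.totalWeight res (K.crossings res s z₁)) =
      K.totalWeight res (K.crossings res s z₁) := by
  have hs' : ∀ a b, K.Cross res s z₁ a b → ¬ SolidSolid res a b := by
    rintro a b hc ⟨j, j', rfl, rfl, -, hj⟩
    exact hc.elim (hs _ _ hj) (hs _ _ hj.symm)
  exact rename_totalWeight hr H.s₁ fun c hc hi =>
    ⟨H.not_touches₂ hne hex hr h (Or.inl hc) hi (hs' _ _ (Or.inl hc)),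
      H.not_touches₂ hne hex hr h (Or.inr hc) hi.symm (hs' _ _ (Or.inr hc))⟩

theorem Hexagon.unexceptional_symm (H : K.Hexagon res s t z₁ z₂ z₁' z₂')
    (hex : K.Unexceptional res s t z₁ z₂) : K.Unexceptional res s t z₁' z₂' := by
  rw [Unexceptional, ← H.h₂]; exact hex

variable [IsDomain R]

variable (K) in
open Classical in
/-- The operator on polynomials by which a step with crossings `C` acts. -/
def stepOp (res : Fin n → I) (C : Set (Str n l E × Str n l E)) :
    MvPolynomial (Fin n) R →ₗ[R] MvPolynomial (Fin n) R :=
  -- For the crossings of a simple step the chosen pair is the only one; see `stepOp_divided`.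
  if h : ∃ c : Fin n × Fin n, res c.1 = res c.2 ∧ (Str.solid c.1, Str.solid c.2) ∈ C then
    divided h.choose.1 h.choose.2
  else LinearMap.mulLeft R (K.totalWeight res C)

theorem stepOp_divided (hs : K.Simple res z z') {k k' : Fin n} (hr : res k = res k')
    (h : (Str.solid k, Str.solid k') ∈ K.crossings res z z') :
    K.stepOp res (K.crossings res z z') = divided k k' := by
  have h' : ∃ c : Fin n × Fin n, res c.1 = res c.2 ∧
    (Str.solid c.1, Str.solid c.2) ∈ K.crossings res z z' := ⟨(k, k'), hr, h⟩
  rw [stepOp, dif_pos h']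
  have := interact_unique hs h h'.choose_spec.2 (interact_solid hr h)
    (interact_solid h'.choose_spec.1 h'.choose_spec.2)
  simp only [Prod.mk.injEq, Str.solid.injEq] at this
  rw [← this.1, ← this.2]

theorem stepOp_mul (h : ∀ k k', res k = res k' →
    (Str.solid k, Str.solid k') ∉ K.crossings res z z') :
    K.stepOp res (K.crossings res z z') =
      LinearMap.mulLeft R (K.totalWeight res (K.crossings res z z')) := by
  rw [stepOp, dif_neg]
  rintro ⟨c, h1, h2⟩
  exact h _ _ h1 h2

theorem stepOp_interact (hs : K.Simple res z z') {c : Str n l E × Str n l E}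
    (hc : c ∈ K.crossings res z z') (hi : K.Interact res c.1 c.2)
    (h : ¬ SolidSolid res c.1 c.2) :
    K.stepOp res (K.crossings res z z') = LinearMap.mulLeft R (K.weight res c) := by
  rw [stepOp_mul, totalWeight_eq hs hc hi]
  intro k k' hr hk
  obtain rfl := interact_unique hs hc hk hi (interact_solid hr hk)
  exact h ⟨k, k', rfl, rfl, solid_ne hk, hr⟩

theorem stepOp_id (h : ∀ c ∈ K.crossings res z z', ¬ K.Interact res c.1 c.2) :
    K.stepOp res (K.crossings res z z') = LinearMap.id := by
  rw [stepOp_mul fun k k' hr hk => h _ hk (interact_solid hr hk), totalWeight_eq_one h]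
  ext; simp

theorem stepOp_empty (h : K.crossings res z z' = ∅) :
    K.stepOp res (K.crossings res z z') = LinearMap.id :=
  stepOp_id (by simp [h])

theorem rename_stepOp {w : Equiv.Perm (Fin n)} {r r' : Fin n → I} (h : ∀ k, r' (w k) = r k)
    (hs : K.Simple r' z z') (f : MvPolynomial (Fin n) R) :
    rename w (K.stepOp r (K.crossings r (z ∘ w) (z' ∘ w)) f) =
      K.stepOp r' (K.crossings r' z z') (rename w f) := by
  by_cases hc : ∃ c : Fin n × Fin n, r c.1 = r c.2 ∧
    (Str.solid c.1, Str.solid c.2) ∈ K.crossings r (z ∘ w) (z' ∘ w)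
  · obtain ⟨⟨k, k'⟩, hr, hk⟩ := hc
    rw [stepOp_divided (hs.relabel h) hr hk,
      stepOp_divided hs (by rwa [h, h] : r' (w k) = r' (w k')) ((mem_crossings_comp h).1 hk),
      rename_divided (solid_ne hk)]
  · push Not at hc
    rw [stepOp_mul fun k k' hr => hc (k, k') hr, stepOp_mul, totalWeight_comp h hs]
    · simp
    · intro k k' hr hk
      refine hc (w.symm k, w.symm k') ?_ ((mem_crossings_comp h).2 ?_)
      · rw [← h, ← h]; simpa
      · simpa [Str.rename] using hk

theorem divided_mulLeft {k k' : Fin n} (h : k ≠ k') {g : MvPolynomial (Fin n) R}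
    (hg : rename (Equiv.swap k k') g = g) (f : MvPolynomial (Fin n) R) :
    divided k k' (LinearMap.mulLeft R g f) = LinearMap.mulLeft R g (divided k k' f) :=
  divided_mul_of_symm h hg f

/-- By `Square.not_touches`, a divided difference in one step either involves variables disjoint
from a divided difference in the other step, or is linear over the polynomial of that step. -/
theorem Square.stepOp_comm (H : K.Square res s t z z') (f : MvPolynomial (Fin n) R) :
    K.stepOp res (K.crossings res z t) (K.stepOp res (K.crossings res s z) f) =
      K.stepOp res (K.crossings res s z) (K.stepOp res (K.crossings res z t) f) := by
  rcases stepOp_cases K res s z with ⟨k, k', hr, hk⟩ | h1 <;>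
    rcases stepOp_cases K res z t with ⟨m, m', hr', hm⟩ | h2
  · rw [stepOp_divided H.s₁ hr hk, stepOp_divided H.s₂ hr' hm]
    have i1 := H.not_touches hr hk (Or.inl hm) (interact_solid hr' hm)
    have i2 := H.not_touches hr hk (Or.inr hm) (interact_solid hr' hm).symm
    simp only [Touches, Str.carrier, Option.some.injEq, not_or] at i1 i2
    exact divided_comm (solid_ne hm) (solid_ne hk) i1.1 i1.2 i2.1 i2.2 f
  · rw [stepOp_divided H.s₁ hr hk, stepOp_mul h2, divided_mulLeft (solid_ne hk)]
    exact H.rename_weight hr hk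
  · rw [stepOp_divided H.s₂ hr' hm, stepOp_mul h1, divided_mulLeft (solid_ne hm)]
    rw [H.h₁]
    exact H.symm.rename_weight hr' (by rwa [← H.h₂])
  · rw [stepOp_mul h1, stepOp_mul h2]
    simp only [LinearMap.mulLeft_apply]
    ring

/-- If the middle step is a divided difference as well, linking it with the first one would force a
divided difference in the third step, so the three operators commute. Otherwise the product of the
two multiplications is symmetric in `k` and `k'` by `Hexagon.rename_weight₁`. -/
theorem stepOp_braid_aux (H : K.Hexagon res s t z₁ z₂ z₁' z₂')
    (hne : K.crossings res s z₁ ≠ K.crossings res z₂ t) {k k' : Fin n} (hr : res k = res k')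
    (hk : (Str.solid k, Str.solid k') ∈ K.crossings res s z₁)
    (h₃ : ∀ k k', res k = res k' → (Str.solid k, Str.solid k') ∉ K.crossings res z₂ t)
    (f : MvPolynomial (Fin n) R) :
    K.stepOp res (K.crossings res z₂ t) (K.stepOp res (K.crossings res z₁ z₂)
      (K.stepOp res (K.crossings res s z₁) f)) =
    K.stepOp res (K.crossings res s z₁) (K.stepOp res (K.crossings res z₁ z₂)
      (K.stepOp res (K.crossings res z₂ t) f)) := by
  rw [stepOp_divided H.s₁ hr hk, stepOp_mul h₃]
  have hk' := solid_ne hk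
  rcases stepOp_cases K res z₁ z₂ with ⟨m, m', hr', hm⟩ | h₂
  · -- the first two crossings are not linked, and the third one is linked to none of them
    have hres := res_swap hr
    have hnt : ¬ (Touches k k' (.solid m : Str n l E) ∨ Touches k k' (.solid m' : Str n l E)) :=
      fun ht => h₃ _ _ (by rw [hres, hres, hr'])
        (H.twin_mem₁₂ hne hr hk hm (interact_solid hr' hm) ht)
    simp only [Touches, Str.carrier, Option.some.injEq, not_or] at hnt
    rw [stepOp_divided H.s₂ hr' hm]
    have hw₁ : rename (Equiv.swap k k') (K.totalWeight res (K.crossings res z₂ t)) =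
        K.totalWeight res (K.crossings res z₂ t) := by
      refine rename_totalWeight hr H.s₃ fun c hc hi => ?_
      by_contra ht
      rw [← not_or, not_not] at ht
      have h1 := H.twin_mem₁₃ hne hr hk hc hi ht
      have h2 := interact_unique H.s₂ h1 hm ((interact_rename hres).2 hi) (interact_solid hr' hm)
      simp only [Prod.mk.injEq] at h2
      rcases ht with ht | ht
      · have := touches_twin ht
        rw [h2.1] at this
        simp only [Touches, Str.carrier, Option.some.injEq] at this
        exact this.elim hnt.1.1 hnt.1.2
      · have := touches_twin ht
        rw [h2.2] at this
        simp only [Touches, Str.carrier, Option.some.injEq] at this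
        exact this.elim hnt.2.1 hnt.2.2
    have hw₂ : rename (Equiv.swap m m') (K.totalWeight res (K.crossings res z₂ t)) =
        K.totalWeight res (K.crossings res z₂ t) := by
      have key : ∀ {a b}, K.Cross res z₂ t a b → K.Interact res a b → ¬ Touches m m' a := by
        intro a b hc hi ht
        rw [cross_of_eq H.h₃] at hc
        obtain ⟨hb, h3⟩ := H.symm.twin_cross₂₁ (H.ne_symm hne) hr' (by rwa [← H.h₂]) hc hi ht
        rw [← cross_of_eq H.h₁] at h3
        have hi' := (interact_rename (res_swap hr')).2 hi
        rw [rename_of_not_touches hb] at hi'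
        have ht' := touches_twin ht
        rcases h3 with h3 | h3
        · have := interact_unique H.s₁ h3 hk hi' (interact_solid hr hk)
          simp only [Prod.mk.injEq] at this
          rw [this.1] at ht'
          simp only [Touches, Str.carrier, Option.some.injEq] at ht'
          exact ht'.elim (fun h => hnt.1.1 h.symm) (fun h => hnt.2.1 h.symm)
        · have := interact_unique H.s₁ h3 hk hi'.symm (interact_solid hr hk)
          simp only [Prod.mk.injEq] at this
          rw [this.2] at ht'
          simp only [Touches, Str.carrier, Option.some.injEq] at ht'
          exact ht'.elim (fun h => hnt.1.2 h.symm) (fun h => hnt.2.2 h.symm)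
      exact rename_totalWeight hr' H.s₃ fun c hc hi =>
        ⟨key (Or.inl hc) hi, key (Or.inr hc) hi.symm⟩
    rw [divided_mulLeft (solid_ne hm) hw₂, divided_mulLeft hk' hw₁,
      divided_comm (solid_ne hm) hk' hnt.1.1 hnt.1.2 hnt.2.1 hnt.2.2]
  · rw [stepOp_mul h₂]
    have := divided_mul_of_symm hk' (H.rename_weight₁ hne hr hk) f
    simp only [LinearMap.mulLeft_apply, ← mul_assoc, this]
    ring

/-- The operators of three steps with opposite crossings agree, except for exceptional triples. -/
theorem Hexagon.stepOp_braid (H : K.Hexagon res s t z₁ z₂ z₁' z₂')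
    (hex : K.Unexceptional res s t z₁ z₂) (f : MvPolynomial (Fin n) R) :
    K.stepOp res (K.crossings res z₂ t) (K.stepOp res (K.crossings res z₁ z₂)
      (K.stepOp res (K.crossings res s z₁) f)) =
    K.stepOp res (K.crossings res s z₁) (K.stepOp res (K.crossings res z₁ z₂)
      (K.stepOp res (K.crossings res z₂ t) f)) := by
  by_cases hne : K.crossings res s z₁ = K.crossings res z₂ t
  · rw [hne]
  rcases stepOp_cases K res s z₁ with ⟨k, k', hr, hk⟩ | h₁ <;>
    rcases stepOp_cases K res z₂ t with ⟨j, j', hr', hj⟩ | h₃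
  · have hres := res_swap hr
    have hij := interact_solid hr' hj
    rcases stepOp_cases K res z₁ z₂ with ⟨m, m', hr'', hm⟩ | h₂
    · have him := interact_solid hr'' hm
      rw [stepOp_divided H.s₁ hr hk, stepOp_divided H.s₂ hr'' hm, stepOp_divided H.s₃ hr' hj]
      have hkk := solid_ne hk
      have hmm := solid_ne hm
      -- If the first two crossings share a string, the third one is the twin of the second and the
      -- three form a triangle, which is the braid relation. Otherwise all three divided differences
      -- commute.
      by_cases ht : Touches k k' (.solid m : Str n l E) ∨ Touches k k' (.solid m' : Str n l E)
      · have h1 := H.twin_mem₁₂ hne hr hk hm him ht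
        have h2 := interact_unique H.s₃ h1 hj ((interact_rename hres).2 him) hij
        simp only [Str.rename, Prod.mk.injEq, Str.solid.injEq] at h2
        obtain ⟨rfl, rfl⟩ := h2
        have hn := ((H.not_both hne).1 (Or.inl hk)).1
        have p1 := hk.2.2.2
        have p2 := hm.2.2
        have p3 := hj.2.2
        have p4 := (H.order₁ hne (Or.inl hk)).2.1.trans (H.order₁ hne (Or.inl hk)).1.symm
        simp only [strPos] at p1 p2 p3 p4
        simp only [Touches, Str.carrier, Option.some.injEq] at ht
        -- The common string is the left one in both crossings or the right one in both; these are
        -- the two sides of `divided_braid`. The mixed cases are incompatible with the positions at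
        -- `z₂`.
        by_cases e1 : m = k
        · subst e1
          have e2 : m' ≠ k' := fun h => hn (by rw [← h]; exact Or.inl hm)
          rw [Equiv.swap_apply_left, Equiv.swap_apply_of_ne_of_ne hmm.symm e2]
          exact divided_braid hkk hmm e2.symm f
        by_cases e2 : m' = k'
        · subst e2
          rw [Equiv.swap_apply_right, Equiv.swap_apply_of_ne_of_ne e1 hmm]
          exact (divided_braid e1 hmm hkk f).symm
        exfalso
        rcases ht with (ht | ht) | (ht | ht)
        · exact e1 ht
        · subst ht
          have e3 : m' ≠ k := fun h => hn (by rw [← h]; exact Or.inr hm)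
          rw [Equiv.swap_apply_right, Equiv.swap_apply_of_ne_of_ne e3 hmm.symm] at p3
          have : ¬ z₂ k < z₂ m := fun h => lt_asymm (p4.1 h) p1
          linarith [p3.1, p2.2]
        · subst ht
          have e3 : m ≠ k' := fun h => hn (by rw [← h]; exact Or.inr hm)
          rw [Equiv.swap_apply_left, Equiv.swap_apply_of_ne_of_ne hmm e3] at p3
          have : ¬ z₂ m' < z₂ k' := fun h => lt_asymm (p4.1 h) p1
          linarith [p3.1, p2.2]
        · exact e2 ht
      · simp only [Touches, Str.carrier, Option.some.injEq, not_or] at ht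
        have ht2 : ¬ (Touches k k' (.solid j : Str n l E) ∨
            Touches k k' (.solid j' : Str n l E)) := fun ht' => by
          have h1 := H.twin_mem₁₃ hne hr hk hj hij ht'
          have h2 := interact_unique H.s₂ h1 hm ((interact_rename hres).2 hij) him
          simp only [Prod.mk.injEq] at h2
          rcases ht' with ht' | ht'
          · have := touches_twin ht'
            rw [h2.1] at this
            simp only [Touches, Str.carrier, Option.some.injEq] at this
            exact this.elim ht.1.1 ht.1.2
          · have := touches_twin ht'
            rw [h2.2] at this
            simp only [Touches, Str.carrier, Option.some.injEq] at this
            exact this.elim ht.2.1 ht.2.2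
        have ht3 : ¬ (Touches j j' (.solid m : Str n l E) ∨
            Touches j j' (.solid m' : Str n l E)) := fun ht' => by
          have h1 := H.symm.twin_mem₁₂ (H.ne_symm hne) hr' (by rwa [← H.h₃]) (by rwa [← H.h₂])
            him ht'
          rw [← H.h₁] at h1
          have h2 := interact_unique H.s₁ h1 hk ((interact_rename (res_swap hr')).2 him)
            (interact_solid hr hk)
          simp only [Prod.mk.injEq] at h2
          simp only [Touches, Str.carrier, Option.some.injEq, not_or] at ht2
          rcases ht' with ht' | ht'
          · have := touches_twin ht'
            rw [h2.1] at this
            simp only [Touches, Str.carrier, Option.some.injEq] at this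
            grind
          · have := touches_twin ht'
            rw [h2.2] at this
            simp only [Touches, Str.carrier, Option.some.injEq] at this
            grind
        simp only [Touches, Str.carrier, Option.some.injEq, not_or] at ht2 ht3
        have hjj := solid_ne hj
        rw [divided_comm hmm hkk ht.1.1 ht.1.2 ht.2.1 ht.2.2,
          divided_comm hjj hkk ht2.1.1 ht2.1.2 ht2.2.1 ht2.2.2,
          divided_comm hmm hjj ht3.1.1 ht3.1.2 ht3.2.1 ht3.2.2]
    · have ht : ¬ (Touches k k' (.solid j : Str n l E) ∨ Touches k k' (.solid j' : Str n l E)) :=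
        fun ht => h₂ _ _ (by rw [hres, hres, hr']) (H.twin_mem₁₃ hne hr hk hj hij ht)
      simp only [Touches, Str.carrier, Option.some.injEq, not_or] at ht
      have hw₁ : rename (Equiv.swap k k') (K.totalWeight res (K.crossings res z₁ z₂)) =
          K.totalWeight res (K.crossings res z₁ z₂) := by
        refine rename_totalWeight hr H.s₂ fun c hc hi => ?_
        by_contra ht'
        rw [← not_or, not_not] at ht'
        have h1 := H.twin_mem₁₂ hne hr hk hc hi ht'
        have h2 := interact_unique H.s₃ h1 hj ((interact_rename hres).2 hi) hij
        simp only [Prod.mk.injEq] at h2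
        rcases ht' with ht' | ht'
        · have := touches_twin ht'
          rw [h2.1] at this
          simp only [Touches, Str.carrier, Option.some.injEq] at this
          exact this.elim ht.1.1 ht.1.2
        · have := touches_twin ht'
          rw [h2.2] at this
          simp only [Touches, Str.carrier, Option.some.injEq] at this
          exact this.elim ht.2.1 ht.2.2
      have hw₃ : rename (Equiv.swap j j') (K.totalWeight res (K.crossings res z₁ z₂)) =
          K.totalWeight res (K.crossings res z₁ z₂) := by
        refine rename_totalWeight hr' H.s₂ fun c hc hi => ?_
        by_contra ht'
        rw [← not_or, not_not] at ht'
        have h1 := H.symm.twin_mem₁₂ (H.ne_symm hne) hr' (by rwa [← H.h₃]) (by rwa [← H.h₂])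
          hi ht'
        rw [← H.h₁] at h1
        have h2 := interact_unique H.s₁ h1 hk ((interact_rename (res_swap hr')).2 hi)
          (interact_solid hr hk)
        simp only [Prod.mk.injEq] at h2
        rcases ht' with ht' | ht'
        · have := touches_twin ht'
          rw [h2.1] at this
          simp only [Touches, Str.carrier, Option.some.injEq] at this
          exact this.elim (fun h => ht.1.1 h.symm) fun h => ht.2.1 h.symm
        · have := touches_twin ht'
          rw [h2.2] at this
          simp only [Touches, Str.carrier, Option.some.injEq] at this
          exact this.elim (fun h => ht.1.2 h.symm) fun h => ht.2.2 h.symm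
      rw [stepOp_divided H.s₁ hr hk, stepOp_mul h₂, stepOp_divided H.s₃ hr' hj,
        divided_mulLeft (solid_ne hj) hw₃, divided_mulLeft (solid_ne hk) hw₁,
        divided_comm (solid_ne hj) (solid_ne hk) ht.1.1 ht.1.2 ht.2.1 ht.2.2]
  · exact stepOp_braid_aux H hne hr hk h₃ f
  · have := stepOp_braid_aux H.symm (H.ne_symm hne) hr' (by rwa [← H.h₃]) (by rwa [← H.h₁]) f
    rw [← H.h₁, ← H.h₂, ← H.h₃] at this
    exact this.symm
  · rcases stepOp_cases K res z₁ z₂ with ⟨m, m', hr'', hm⟩ | h₂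
    · have hw₁ := H.rename_weight₂ hne hex hr'' hm h₁
      have hw₃ := H.symm.rename_weight₂ (H.ne_symm hne) (H.unexceptional_symm hex) hr''
        (by rwa [← H.h₂]) (by rwa [← H.h₃])
      rw [← H.h₃] at hw₃
      rw [stepOp_mul h₁, stepOp_divided H.s₂ hr'' hm, stepOp_mul h₃,
        divided_mulLeft (solid_ne hm) hw₁, divided_mulLeft (solid_ne hm) hw₃]
      simp only [LinearMap.mulLeft_apply]
      ring
    · rw [stepOp_mul h₁, stepOp_mul h₂, stepOp_mul h₃]
      simp only [LinearMap.mulLeft_apply]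
      ring

end Operators

end Datum

namespace Datum

/-! ### The operator of a diagram -/

section Representation

open MvPolynomial

theorem modify_length_append {α : Type*} (P : List α) (s : α) (T : List α) (g : α → α) :
    (P ++ s :: T).modify P.length g = P ++ g s :: T := by
  induction P with
  | nil => simp
  | cons u P ih => simp [ih]

variable {R : Type*} [CommRing R] {I E : Type*} {n l : ℕ} {K : Datum R I E n l}

theorem Diagram.step_of_slices {p q : K.Obj} (D : K.Diagram p q) {P S : List (Slice n)}
    {s t : Slice n} (h : D.slices = P ++ s :: t :: S) :
    K.Generic p.res s.pos ∧ K.Generic p.res t.pos ∧ K.Simple p.res s.pos t.pos ∧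
      (((t :: S).map Slice.pos).IsChain (K.Simple p.res)) := by
  have hg := D.generic
  have hs := D.simple
  rw [h] at hg hs
  simp only [List.map_append, List.map_cons, List.isChain_append, List.isChain_cons_cons] at hs
  refine ⟨hg _ (by simp), hg _ (by simp), hs.2.1.1, ?_⟩
  simpa using hs.2.1.2

/-- The monomial of a number of dots on each string. -/
def dotPoly (R : Type*) [CommRing R] (a : Fin n → ℕ) : MvPolynomial (Fin n) R :=
  ∏ k, MvPolynomial.X k ^ a k

theorem dotPoly_zero : dotPoly R (0 : Fin n → ℕ) = 1 := by simp [dotPoly]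

theorem dotPoly_add (a b : Fin n → ℕ) : dotPoly R (a + b) = dotPoly R a * dotPoly R b := by
  simp [dotPoly, pow_add, Finset.prod_mul_distrib]

theorem dotPoly_single (k : Fin n) :
    dotPoly R (Pi.single k 1 : Fin n → ℕ) = MvPolynomial.X k := by
  rw [dotPoly, Finset.prod_eq_single k]
  · simp
  · intro j _ hj; simp [hj]
  · simp

theorem rename_dotPoly (w : Equiv.Perm (Fin n)) (a : Fin n → ℕ) :
    rename w (dotPoly R (a ∘ w)) = dotPoly R a := by
  simp only [dotPoly, map_prod, map_pow, rename_X, Function.comp_apply]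
  exact Equiv.prod_comp w fun k => (MvPolynomial.X k : MvPolynomial (Fin n) R) ^ a k

theorem sum_dotPoly (f : MvPolynomial (Fin n) R) :
    ∑ e ∈ f.support, f.coeff e • dotPoly R (e : Fin n → ℕ) = f := by
  conv_rhs => rw [f.as_sum]
  refine Finset.sum_congr rfl fun e _ => ?_
  rw [monomial_eq, Finsupp.prod_fintype _ _ fun _ => pow_zero _, smul_eq_C_mul, dotPoly]

variable (K) in
open Classical in
/-- The operator of a diagram between the summands of the direct sum of polynomial rings. -/
def blockOp (p q : K.Obj) (φ : MvPolynomial (Fin n) R →ₗ[R] MvPolynomial (Fin n) R) :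
    Module.End R (K.Obj → MvPolynomial (Fin n) R) :=
  LinearMap.single R (fun _ : K.Obj => MvPolynomial (Fin n) R) q ∘ₗ φ ∘ₗ LinearMap.proj p

open Classical in
theorem blockOp_apply (p q : K.Obj) (φ : MvPolynomial (Fin n) R →ₗ[R] MvPolynomial (Fin n) R)
    (v : K.Obj → MvPolynomial (Fin n) R) :
    K.blockOp p q φ v = Pi.single q (φ (v p)) := rfl

theorem blockOp_sub (p q : K.Obj) (φ ψ : MvPolynomial (Fin n) R →ₗ[R] MvPolynomial (Fin n) R) :
    K.blockOp p q (φ - ψ) = K.blockOp p q φ - K.blockOp p q ψ := by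
  simp only [blockOp, LinearMap.sub_comp, LinearMap.comp_sub]

theorem blockOp_add (p q : K.Obj) (φ ψ : MvPolynomial (Fin n) R →ₗ[R] MvPolynomial (Fin n) R) :
    K.blockOp p q (φ + ψ) = K.blockOp p q φ + K.blockOp p q ψ := by
  simp only [blockOp, LinearMap.add_comp, LinearMap.comp_add]

theorem blockOp_smul (p q : K.Obj) (c : R)
    (φ : MvPolynomial (Fin n) R →ₗ[R] MvPolynomial (Fin n) R) :
    K.blockOp p q (c • φ) = c • K.blockOp p q φ := by
  simp only [blockOp, LinearMap.smul_comp, LinearMap.comp_smul]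

theorem blockOp_sum (p q : K.Obj) {ι : Type*} (T : Finset ι)
    (φ : ι → (MvPolynomial (Fin n) R →ₗ[R] MvPolynomial (Fin n) R)) :
    K.blockOp p q (∑ i ∈ T, φ i) = ∑ i ∈ T, K.blockOp p q (φ i) :=
  map_sum (AddMonoidHom.mk' (K.blockOp p q) (blockOp_add p q)) φ T

variable [IsDomain R]

variable (K) in
/-- The operator of a sequence of slices, the variables being labelled by the strings. -/
def opL (res : Fin n → I) : List (Slice n) →
    (MvPolynomial (Fin n) R →ₗ[R] MvPolynomial (Fin n) R)
  | [] => LinearMap.id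
  | [s] => LinearMap.mulLeft R (dotPoly R s.dots)
  | s :: t :: L => opL res (t :: L) ∘ₗ K.stepOp res (K.crossings res s.pos t.pos) ∘ₗ
      LinearMap.mulLeft R (dotPoly R s.dots)

variable {res : Fin n → I}

theorem opL_singleton (s : Slice n) (f : MvPolynomial (Fin n) R) :
    K.opL res [s] f = dotPoly R s.dots * f := rfl

theorem opL_cons_cons (s t : Slice n) (L : List (Slice n)) (f : MvPolynomial (Fin n) R) :
    K.opL res (s :: t :: L) f =
      K.opL res (t :: L) (K.stepOp res (K.crossings res s.pos t.pos) (dotPoly R s.dots * f)) :=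
  rfl

theorem opL_zero_dots (z : Fin n → ℝ) (t : Slice n) (L : List (Slice n))
    (f : MvPolynomial (Fin n) R) : K.opL res (⟨z, 0⟩ :: t :: L) f =
      K.opL res (t :: L) (K.stepOp res (K.crossings res z t.pos) f) := by
  rw [opL_cons_cons, dotPoly_zero, one_mul]

theorem opL_add_dots (z : Fin n → ℝ) (a b : Fin n → ℕ) (T : List (Slice n))
    (f : MvPolynomial (Fin n) R) :
    K.opL res (⟨z, a + b⟩ :: T) f = K.opL res (⟨z, a⟩ :: T) (dotPoly R b * f) := by
  cases T with
  | nil => simp only [opL_singleton, dotPoly_add, mul_assoc]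
  | cons t T => simp only [opL_cons_cons, dotPoly_add, mul_assoc]

-- The step into a slice sees only its position, so the part of a diagram below that slice acts by
-- one fixed operator, whatever dots and slices follow. This makes the verification of the relations
-- local.
variable (K) in
theorem exists_opL_append (res : Fin n → I) (P : List (Slice n)) (z : Fin n → ℝ) :
    ∃ φ : MvPolynomial (Fin n) R →ₗ[R] MvPolynomial (Fin n) R, ∀ (a : Fin n → ℕ) T f,
      K.opL res (P ++ ⟨z, a⟩ :: T) f = K.opL res (⟨z, a⟩ :: T) (φ f) := by
  induction P with
  | nil => exact ⟨LinearMap.id, fun _ _ _ => rfl⟩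
  | cons u P ih =>
    obtain ⟨φ, hφ⟩ := ih
    cases P with
    | nil => exact ⟨K.stepOp res (K.crossings res u.pos z) ∘ₗ LinearMap.mulLeft R (dotPoly R u.dots),
        fun a T f => opL_cons_cons u ⟨z, a⟩ T f⟩
    | cons v P =>
      refine ⟨φ ∘ₗ K.stepOp res (K.crossings res u.pos v.pos) ∘ₗ
        LinearMap.mulLeft R (dotPoly R u.dots), fun a T f => ?_⟩
      simp only [List.cons_append, opL_cons_cons, LinearMap.comp_apply,
        LinearMap.mulLeft_apply] at hφ ⊢
      exact hφ _ _ _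

theorem opL_append {L : List (Slice n)} {s t : Slice n} (T : List (Slice n))
    (h : K.crossings res s.pos t.pos = ∅) (f : MvPolynomial (Fin n) R) :
    K.opL res (L ++ s :: t :: T) f = K.opL res (t :: T) (K.opL res (L ++ [s]) f) := by
  obtain ⟨φ, hφ⟩ := exists_opL_append K res L s.pos
  rw [hφ s.dots (t :: T), hφ s.dots [], opL_cons_cons, stepOp_empty h]
  rfl

/-- Variables are attached to strings, so renumbering the strings conjugates the operator by the
same permutation of the variables. Both gluing and resolving crossings need this. -/
theorem rename_opL_relabel {w : Equiv.Perm (Fin n)} {r r' : Fin n → I}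
    (h : ∀ k, r' (w k) = r k) {L : List (Slice n)}
    (hL : (L.map Slice.pos).IsChain (K.Simple r')) (f : MvPolynomial (Fin n) R) :
    rename w (K.opL r (L.map (Slice.relabel w)) f) = K.opL r' L (rename w f) := by
  induction L generalizing f with
  | nil => rfl
  | cons s L ih =>
    cases L with
    | nil =>
      simp only [List.map_cons, List.map_nil, opL_singleton, map_mul, Slice.relabel,
        rename_dotPoly]
    | cons t L =>
      simp only [List.map_cons, List.isChain_cons_cons] at hL ih ⊢
      rw [opL_cons_cons, opL_cons_cons, ih hL.2]
      simp only [Slice.relabel]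
      rw [rename_stepOp h hL.1, map_mul, rename_dotPoly]

/-- The operator of a diagram, the variables being numbered by the strings at the bottom and at the
top, respectively. -/
def Diagram.op {p q : K.Obj} (D : K.Diagram p q) :
    MvPolynomial (Fin n) R →ₗ[R] MvPolynomial (Fin n) R :=
  (rename D.perm).toLinearMap ∘ₗ K.opL p.res D.slices

theorem Diagram.op_apply {p q : K.Obj} (D : K.Diagram p q) (f : MvPolynomial (Fin n) R) :
    D.op f = rename D.perm (K.opL p.res D.slices f) := rfl

theorem op_dottedIdempotent (p : K.Obj) (a : Fin n → ℕ) (f : MvPolynomial (Fin n) R) :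
    (dottedIdempotent p a).op f = dotPoly R a * f := by
  rw [Diagram.op_apply]
  simp only [dottedIdempotent, opL_singleton, Equiv.Perm.coe_one, rename_id, AlgHom.id_apply]

/-- Gluing leaves two slices with equal positions at the seam, and the step between them acts as the
identity. The renumbering of the upper diagram is absorbed by the final permutation of the lower
one. -/
theorem op_comp {p q r : K.Obj} (F : K.Diagram q r) (D : K.Diagram p q)
    (f : MvPolynomial (Fin n) R) : (F.comp D).op f = F.op (D.op f) := by
  obtain ⟨L, s, hs⟩ : ∃ L s, D.slices = L ++ [s] := by
    rcases List.eq_nil_or_concat D.slices with h | ⟨L, s, h⟩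
    · have := D.top; simp [h] at this
    · exact ⟨L, s, by rw [h, List.concat_eq_append]⟩
  obtain ⟨t, T, ht⟩ : ∃ t T, F.slices = t :: T := by
    cases h : F.slices with
    | nil => have := F.bottom; simp [h] at this
    | cons t T => exact ⟨t, T, rfl⟩
  have hs' : s.pos = q.pos ∘ D.perm := by
    have := D.top; rw [hs] at this; simpa using this
  have ht' : t.pos = q.pos := by
    have := F.bottom; rw [ht] at this; simpa using this
  simp only [Diagram.op_apply]
  simp only [Diagram.comp]
  have h1 : K.crossings p.res s.pos (Slice.relabel D.perm t).pos = ∅ := by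
    simp only [Slice.relabel, hs', ht', crossings_self]
  have h2 := rename_opL_relabel D.res_eq F.simple (K.opL p.res D.slices f)
  rw [← h2, rename_rename, ht, hs, List.map_cons]
  rw [List.append_assoc, List.singleton_append, opL_append _ h1]
  rfl

theorem op_resolves {p q : K.Obj} {D D₀ : K.Diagram p q} {k k' : Fin n} {P S : List (Slice n)}
    {s t : Slice n} (hr : p.res k = p.res k') (h₀ : K.Resolves D D₀ k k' (P ++ [s]) (t :: S))
    (hS : ((t :: S).map Slice.pos).IsChain (K.Simple p.res))
    (he : K.crossings p.res s.pos (t.pos ∘ Equiv.swap k k') = ∅) (f : MvPolynomial (Fin n) R) :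
    D₀.op f = rename D.perm (K.opL p.res (t :: S)
      (rename (Equiv.swap k k') (K.opL p.res (P ++ [s]) f))) := by
  obtain ⟨h1, h2⟩ := h₀
  rw [Diagram.op_apply, h1, h2, List.map_cons, List.append_assoc, List.singleton_append,
    opL_append _ he, ← List.map_cons, ← rename_opL_relabel (res_swap hr) hS, rename_rename]
  rfl

theorem op_addDots {p q : K.Obj} {D : K.Diagram p q} {P T : List (Slice n)} {s : Slice n}
    (h : D.slices = P ++ s :: T) (e : Fin n → ℕ) (f : MvPolynomial (Fin n) R) :
    (D.addDots P.length e).op f =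
      rename D.perm (K.opL p.res (P ++ ⟨s.pos, s.dots + e⟩ :: T) f) := by
  rw [Diagram.op_apply]
  simp only [Diagram.addDots]
  rw [h, modify_length_append]

/-- Dots in a slice multiply by monomials, so putting a polynomial there means multiplying by it at
that height. -/
theorem sum_op_addDots {p q : K.Obj} {D : K.Diagram p q} {P T : List (Slice n)} {s : Slice n}
    (h : D.slices = P ++ s :: T) (g : MvPolynomial (Fin n) R)
    {φ : MvPolynomial (Fin n) R →ₗ[R] MvPolynomial (Fin n) R}
    (hφ : ∀ (a : Fin n → ℕ) T f,
      K.opL p.res (P ++ ⟨s.pos, a⟩ :: T) f = K.opL p.res (⟨s.pos, a⟩ :: T) (φ f))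
    (f : MvPolynomial (Fin n) R) :
    ∑ e ∈ g.support, g.coeff e • (D.addDots P.length e).op f =
      rename D.perm (K.opL p.res (s :: T) (g * φ f)) := by
  conv_rhs => rw [← sum_dotPoly g, Finset.sum_mul, map_sum, map_sum]
  refine Finset.sum_congr rfl fun e _ => ?_
  rw [op_addDots h, hφ, opL_add_dots, smul_mul_assoc, map_smul, map_smul]

variable (K) in
/-- The action of the free algebra on the direct sum of polynomial rings. -/
def freeRep : FreeAlgebra R K.Gen →ₐ[R] Module.End R (K.Obj → MvPolynomial (Fin n) R) :=
  FreeAlgebra.lift R fun g => K.blockOp g.1 g.2.1 g.2.2.op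

theorem freeRep_gen {p q : K.Obj} (D : K.Diagram p q) :
    K.freeRep (gen D) = K.blockOp p q D.op := by
  exact FreeAlgebra.lift_ι_apply (R := R)
    (fun g : K.Gen => K.blockOp g.1 g.2.1 g.2.2.op) ⟨p, q, D⟩

theorem freeRep_insertPoly {p q : K.Obj} (D : K.Diagram p q) (m : ℕ)
    (g : MvPolynomial (Fin n) R) :
    K.freeRep (insertPoly D m g) =
      K.blockOp p q (∑ e ∈ g.support, g.coeff e • (D.addDots m e).op) := by
  simp only [insertPoly, map_sum, map_smul, freeRep_gen, blockOp_sum, blockOp_smul]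

end Representation

end Datum

namespace Datum

/-! ### Local formulas for the operators -/

section Relations

open MvPolynomial

variable {R : Type*} [CommRing R] {I E : Type*} {n l : ℕ} {K : Datum R I E n l}
  {res : Fin n → I} {s t z z' : Fin n → ℝ}

/-- The crossings of a step are undone by the next one. -/
theorem crossings_eq_swap (hs : K.Generic res s) (ht : K.Generic res t)
    (h : K.crossings res s t = ∅) {a b : Str n l E} :
    (a, b) ∈ K.crossings res z t ↔ (b, a) ∈ K.crossings res s z := by
  rw [mem_crossings_symm, crossings_congr_left hs ht h]

theorem aeval_divDiff {k k' k'' : Fin n} (Q : MvPolynomial (Fin 2) R) :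
    aeval ![MvPolynomial.X k, MvPolynomial.X k', MvPolynomial.X k''] (divDiff Q) * (MvPolynomial.X k'' - MvPolynomial.X k : MvPolynomial (Fin n) R) =
      aeval ![MvPolynomial.X k, MvPolynomial.X k'] Q - aeval ![MvPolynomial.X k'', MvPolynomial.X k'] Q := by
  have h := congrArg (aeval ![(MvPolynomial.X k : MvPolynomial (Fin n) R), MvPolynomial.X k', MvPolynomial.X k'']) (divDiff_spec Q)
  simp only [map_mul, map_sub, aeval_X] at h
  simp only [Matrix.cons_val_zero, Matrix.cons_val] at h
  rw [h]
  congr 1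
  · rw [← AlgHom.comp_apply]; congr 1; ext i; fin_cases i <;> simp
  · rw [← AlgHom.comp_apply]; congr 1; ext i; fin_cases i <;> simp

theorem aeval_rename_swap {k k' : Fin n} (Q : MvPolynomial (Fin 2) R) :
    aeval ![MvPolynomial.X k, MvPolynomial.X k'] (rename (Equiv.swap 0 1) Q) =
      (aeval ![MvPolynomial.X k', MvPolynomial.X k] Q : MvPolynomial (Fin n) R) := by
  rw [← AlgHom.comp_apply]; congr 1; ext i; fin_cases i <;> simp

/-- The symmetry of the `Q_ij` allows the polynomial of a ghost-solid crossing to be read from the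
side of the solid string, as is needed when the ghost is the middle string of a triple. -/
theorem QPoly_symm {k k' : Fin n} (h : res k ≠ res k') :
    K.QPoly res k k' = K.QPoly res k' k := by
  rw [QPoly, QPoly, K.Q_symm _ _ h, aeval_rename_swap]

theorem GhostSolid.res_ne {k k' : Fin n} {e : E}
    (h : K.GhostSolid res (.ghost k e) (.solid k')) : res k ≠ res k' := by
  obtain ⟨_, _, _, h1, h2, h3, h4⟩ := h
  simp only [Str.ghost.injEq, Str.solid.injEq] at h1 h2
  obtain ⟨rfl, rfl⟩ := h1
  subst h2
  rw [← h3, ← h4]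
  exact owner_ne_partner e

theorem GhostSolid.partner_eq {k k' : Fin n} {e : E}
    (h : K.GhostSolid res (.ghost k e) (.solid k')) : K.partner e = res k' := by
  obtain ⟨_, _, _, h1, h2, h3, h4⟩ := h
  simp only [Str.ghost.injEq, Str.solid.injEq] at h1 h2
  obtain ⟨rfl, rfl⟩ := h1
  subst h2
  exact h4

theorem GhostSolid.owner_eq {k k' : Fin n} {e : E}
    (h : K.GhostSolid res (.ghost k e) (.solid k')) : K.owner e = res k := by
  obtain ⟨_, _, _, h1, h2, h3, h4⟩ := h
  simp only [Str.ghost.injEq, Str.solid.injEq] at h1 h2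
  obtain ⟨rfl, rfl⟩ := h1
  exact h3

theorem SolidRed.res_eq {k : Fin n} {m : Fin l}
    (h : K.SolidRed res (.solid k) (.red m)) : res k = K.rho m := by
  obtain ⟨_, _, h1, h2, h3⟩ := h
  simp only [Str.solid.injEq, Str.red.injEq] at h1 h2
  subst h1 h2
  exact h3

theorem not_solidSolid_ghost {k : Fin n} {e : E} {b : Str n l E} :
    ¬ SolidSolid res (.ghost k e) b ∧ ¬ SolidSolid res b (.ghost k e) := by
  constructor <;> rintro ⟨_, _, h1, h2, -⟩ <;> simp at h1 h2

theorem not_solidSolid_red {m : Fin l} {b : Str n l E} :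
    ¬ SolidSolid res (.red m) b ∧ ¬ SolidSolid res b (.red m) := by
  constructor <;> rintro ⟨_, _, h1, h2, -⟩ <;> simp at h1 h2

theorem Diagram.hexagon {p q : K.Obj} {D D' : K.Diagram p q} {P S : List (Slice n)}
    {s t : Slice n} {z₁ z₂ z₁' z₂' : Fin n → ℝ}
    (h : D.slices = P ++ s :: ⟨z₁, 0⟩ :: ⟨z₂, 0⟩ :: t :: S)
    (h' : D'.slices = P ++ s :: ⟨z₁', 0⟩ :: ⟨z₂', 0⟩ :: t :: S)
    (h₁ : K.crossings p.res s.pos z₁ = K.crossings p.res z₂' t.pos)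
    (h₂ : K.crossings p.res z₁ z₂ = K.crossings p.res z₁' z₂')
    (h₃ : K.crossings p.res z₂ t.pos = K.crossings p.res s.pos z₁') :
    K.Hexagon p.res s.pos t.pos z₁ z₂ z₁' z₂' := by
  have e1 := D.step_of_slices h
  have e2 := D.step_of_slices (P := P ++ [s]) (s := ⟨z₁, 0⟩) (t := ⟨z₂, 0⟩) (S := t :: S)
    (by rw [h]; simp)
  have e3 := D.step_of_slices (P := P ++ [s, ⟨z₁, 0⟩]) (s := ⟨z₂, 0⟩) (t := t) (S := S)
    (by rw [h]; simp)
  have f1 := D'.step_of_slices h'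
  have f2 := D'.step_of_slices (P := P ++ [s]) (s := ⟨z₁', 0⟩) (t := ⟨z₂', 0⟩) (S := t :: S)
    (by rw [h']; simp)
  exact ⟨e1.1, e3.2.1, e1.2.1, e2.2.1, f1.2.1, f2.2.1, e1.2.2.1, e2.2.2.1, e3.2.2.1, h₁, h₂, h₃⟩

variable [IsDomain R]

theorem stepOp_ghost_solid (hs : K.Simple res z z') {k k' : Fin n} {e : E}
    (h : K.GhostSolid res (.ghost k e) (.solid k'))
    (hc : (Str.ghost k e, Str.solid k') ∈ K.crossings res z z') :
    K.stepOp res (K.crossings res z z') = LinearMap.mulLeft R (K.QPoly res k k') := by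
  rw [stepOp_interact hs hc (Or.inr (Or.inl h)) not_solidSolid_ghost.1, weight,
    if_pos h.partner_eq]

theorem stepOp_solid_ghost (hs : K.Simple res z z') {k k' : Fin n} {e : E}
    (h : K.GhostSolid res (.ghost k e) (.solid k'))
    (hc : (Str.solid k', Str.ghost k e) ∈ K.crossings res z z') :
    K.stepOp res (K.crossings res z z') = LinearMap.id := by
  rw [stepOp_interact hs hc (Or.inr (Or.inr (Or.inl h))) not_solidSolid_ghost.2, weight]
  · ext; simp
  · simp
  · simp

theorem stepOp_solid_red (hs : K.Simple res z z') {k : Fin n} {m : Fin l}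
    (h : K.SolidRed res (.solid k) (.red m))
    (hc : (Str.solid k, Str.red m) ∈ K.crossings res z z') :
    K.stepOp res (K.crossings res z z') = LinearMap.mulLeft R (MvPolynomial.X k) := by
  rw [stepOp_interact hs hc (Or.inr (Or.inr (Or.inr (Or.inl h)))) not_solidSolid_red.2, weight,
    if_pos h.res_eq]

theorem stepOp_red_solid (hs : K.Simple res z z') {k : Fin n} {m : Fin l}
    (h : K.SolidRed res (.solid k) (.red m))
    (hc : (Str.red m, Str.solid k) ∈ K.crossings res z z') :
    K.stepOp res (K.crossings res z z') = LinearMap.id := by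
  rw [stepOp_interact hs hc (Or.inr (Or.inr (Or.inr (Or.inr h)))) not_solidSolid_red.1, weight]
  · ext; simp
  · simp
  · simp

/-- Dots commute with all steps in which their string does not cross a string of its residue. -/
theorem stepOp_X_mul (hs : K.Simple res z z') {k : Fin n}
    (hk : ∀ b, SolidSolid res (.solid k) b → ¬ K.Cross res z z' (.solid k) b)
    (f : MvPolynomial (Fin n) R) :
    K.stepOp res (K.crossings res z z') (MvPolynomial.X k * f) =
      MvPolynomial.X k * K.stepOp res (K.crossings res z z') f := by
  rcases stepOp_cases K res z z' with ⟨j, j', hr, hj⟩ | h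
  · have hne := solid_ne hj
    rw [stepOp_divided hs hr hj, divided_mul_of_symm hne]
    rw [rename_X, Equiv.swap_apply_of_ne_of_ne]
    · rintro rfl
      exact hk _ ⟨_, _, rfl, rfl, hne, hr⟩ (Or.inl hj)
    · rintro rfl
      exact hk _ ⟨_, _, rfl, rfl, hne.symm, hr.symm⟩ (Or.inr hj)
  · rw [stepOp_mul h]
    simp only [LinearMap.mulLeft_apply]
    ring

theorem freeRep_eq_of_op {p q : K.Obj} {D D' : K.Diagram p q}
    (h : ∀ f, D.op f = D'.op f) : K.freeRep (gen D) = K.freeRep (gen D') := by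
  rw [freeRep_gen, freeRep_gen, LinearMap.ext h]

theorem op_three {p q : K.Obj} (D : K.Diagram p q) {P S : List (Slice n)}
    {s t : Slice n} {z₁ z₂ : Fin n → ℝ}
    (h : D.slices = P ++ s :: ⟨z₁, 0⟩ :: ⟨z₂, 0⟩ :: t :: S)
    {φ : MvPolynomial (Fin n) R →ₗ[R] MvPolynomial (Fin n) R}
    (hφ : ∀ (a : Fin n → ℕ) T f,
      K.opL p.res (P ++ ⟨s.pos, a⟩ :: T) f = K.opL p.res (⟨s.pos, a⟩ :: T) (φ f))
    (f : MvPolynomial (Fin n) R) :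
    D.op f = rename D.perm (K.opL p.res (t :: S) (K.stepOp p.res (K.crossings p.res z₂ t.pos)
      (K.stepOp p.res (K.crossings p.res z₁ z₂) (K.stepOp p.res (K.crossings p.res s.pos z₁)
        (dotPoly R s.dots * φ f))))) := by
  rw [Diagram.op_apply, h, hφ s.dots, opL_cons_cons, opL_zero_dots, opL_zero_dots]

theorem op_two {p q : K.Obj} (D : K.Diagram p q) {P S : List (Slice n)}
    {s t : Slice n} {z : Fin n → ℝ}
    (h : D.slices = P ++ s :: ⟨z, 0⟩ :: t :: S)
    {φ : MvPolynomial (Fin n) R →ₗ[R] MvPolynomial (Fin n) R}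
    (hφ : ∀ (a : Fin n → ℕ) T f,
      K.opL p.res (P ++ ⟨s.pos, a⟩ :: T) f = K.opL p.res (⟨s.pos, a⟩ :: T) (φ f))
    (f : MvPolynomial (Fin n) R) :
    D.op f = rename D.perm (K.opL p.res (t :: S) (K.stepOp p.res (K.crossings p.res z t.pos)
      (K.stepOp p.res (K.crossings p.res s.pos z) (dotPoly R s.dots * φ f)))) := by
  rw [Diagram.op_apply, h, hφ s.dots, opL_cons_cons, opL_zero_dots]

theorem op_one {p q : K.Obj} (D : K.Diagram p q) {P S : List (Slice n)}
    {s t : Slice n} (h : D.slices = P ++ s :: t :: S)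
    {φ : MvPolynomial (Fin n) R →ₗ[R] MvPolynomial (Fin n) R}
    (hφ : ∀ (a : Fin n → ℕ) T f,
      K.opL p.res (P ++ ⟨s.pos, a⟩ :: T) f = K.opL p.res (⟨s.pos, a⟩ :: T) (φ f))
    (f : MvPolynomial (Fin n) R) :
    D.op f = rename D.perm (K.opL p.res (t :: S) (K.stepOp p.res (K.crossings p.res s.pos t.pos)
      (dotPoly R s.dots * φ f))) := by
  rw [Diagram.op_apply, h, hφ s.dots, opL_cons_cons]

theorem op_addDots_bottom {p q : K.Obj} (D : K.Diagram p q) {P S : List (Slice n)}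
    {s t : Slice n} (h : D.slices = P ++ s :: t :: S)
    {φ : MvPolynomial (Fin n) R →ₗ[R] MvPolynomial (Fin n) R}
    (hφ : ∀ (a : Fin n → ℕ) T f,
      K.opL p.res (P ++ ⟨s.pos, a⟩ :: T) f = K.opL p.res (⟨s.pos, a⟩ :: T) (φ f))
    (k : Fin n) (f : MvPolynomial (Fin n) R) :
    (D.addDots P.length (Pi.single k 1)).op f =
      rename D.perm (K.opL p.res (t :: S) (K.stepOp p.res (K.crossings p.res s.pos t.pos)
        (MvPolynomial.X k * (dotPoly R s.dots * φ f)))) := by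
  rw [op_addDots h, hφ, opL_cons_cons, dotPoly_add, dotPoly_single, mul_comm (dotPoly R s.dots),
    mul_assoc]

theorem op_addDots_top {p q : K.Obj} (D : K.Diagram p q) {P S : List (Slice n)}
    {s t : Slice n} (h : D.slices = P ++ s :: t :: S)
    {φ : MvPolynomial (Fin n) R →ₗ[R] MvPolynomial (Fin n) R}
    (hφ : ∀ (a : Fin n → ℕ) T f,
      K.opL p.res (P ++ ⟨s.pos, a⟩ :: T) f = K.opL p.res (⟨s.pos, a⟩ :: T) (φ f))
    (k : Fin n) (f : MvPolynomial (Fin n) R) :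
    (D.addDots (P.length + 1) (Pi.single k 1)).op f =
      rename D.perm (K.opL p.res (t :: S) (MvPolynomial.X k *
        (K.stepOp p.res (K.crossings p.res s.pos t.pos) (dotPoly R s.dots * φ f)))) := by
  have h' : D.slices = (P ++ [s]) ++ t :: S := by rw [h]; simp
  have := op_addDots h' (Pi.single k 1) f
  rw [List.length_append, List.length_singleton] at this
  rw [this, List.append_assoc, List.singleton_append, hφ s.dots, opL_cons_cons, opL_add_dots,
    dotPoly_single]

theorem op_resolves' {p q : K.Obj} {D D₀ : K.Diagram p q} {k k' : Fin n} {P S : List (Slice n)}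
    {s t : Slice n} (hr : p.res k = p.res k') (h₀ : K.Resolves D D₀ k k' (P ++ [s]) (t :: S))
    (hS : ((t :: S).map Slice.pos).IsChain (K.Simple p.res))
    (he : K.crossings p.res s.pos (t.pos ∘ Equiv.swap k k') = ∅)
    {φ : MvPolynomial (Fin n) R →ₗ[R] MvPolynomial (Fin n) R}
    (hφ : ∀ (a : Fin n → ℕ) T f,
      K.opL p.res (P ++ ⟨s.pos, a⟩ :: T) f = K.opL p.res (⟨s.pos, a⟩ :: T) (φ f))
    (f : MvPolynomial (Fin n) R) :
    D₀.op f = rename D.perm (K.opL p.res (t :: S)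
      (rename (Equiv.swap k k') (dotPoly R s.dots * φ f))) := by
  rw [op_resolves hr h₀ hS he, hφ s.dots, opL_singleton]

/-- The polynomial is inserted into the resolved diagram. -/
theorem sum_op_resolves {p q : K.Obj} {D D₀ : K.Diagram p q} {k k' : Fin n}
    {P S : List (Slice n)} {s t : Slice n} (hr : p.res k = p.res k')
    (h₀ : K.Resolves D D₀ k k' (P ++ [s]) (t :: S))
    (hS : ((t :: S).map Slice.pos).IsChain (K.Simple p.res))
    (he : K.crossings p.res s.pos (t.pos ∘ Equiv.swap k k') = ∅)
    {φ : MvPolynomial (Fin n) R →ₗ[R] MvPolynomial (Fin n) R}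
    (hφ : ∀ (a : Fin n → ℕ) T f,
      K.opL p.res (P ++ ⟨s.pos, a⟩ :: T) f = K.opL p.res (⟨s.pos, a⟩ :: T) (φ f))
    (g f : MvPolynomial (Fin n) R) :
    ∑ e ∈ g.support, g.coeff e • (D₀.addDots P.length e).op f =
      rename D.perm (K.opL p.res (t :: S)
        (rename (Equiv.swap k k') (g * (dotPoly R s.dots * φ f)))) := by
  have h2 : D₀.slices = P ++ s :: Slice.relabel (Equiv.swap k k') t ::
      S.map (Slice.relabel (Equiv.swap k k')) := by rw [h₀.2]; simp
  rw [sum_op_addDots h2 g hφ, opL_cons_cons]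
  have he' : K.crossings p.res s.pos (Slice.relabel (Equiv.swap k k') t).pos = ∅ := he
  rw [stepOp_empty he', LinearMap.id_apply, h₀.1, ← List.map_cons,
    ← rename_opL_relabel (res_swap hr) hS, rename_rename, ← Equiv.Perm.coe_mul]
  rw [mul_left_comm]

end Relations

end Datum

namespace Datum

/-! ### The relations hold in the polynomial representation -/

section Relations

open MvPolynomial

variable {R : Type*} [CommRing R] {I E : Type*} {n l : ℕ} {K : Datum R I E n l}
  {res : Fin n → I} {s t z z' : Fin n → ℝ}

theorem rename_swap_QPoly {k k' k'' : Fin n} (h : k' ≠ k) (h' : k' ≠ k'')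
    (hr : res k = res k'') :
    rename (Equiv.swap k k'') (K.QPoly res k k') = K.QPoly res k'' k' := by
  rw [QPoly, QPoly, ← AlgHom.comp_apply, hr]
  congr 1
  ext i
  fin_cases i
  · simp
  · simp [Equiv.swap_apply_of_ne_of_ne h h']

theorem GhostSolid.ne {k k' : Fin n} {e : E}
    (h : K.GhostSolid res (.ghost k e) (.solid k')) : k ≠ k' := fun hk => h.res_ne (hk ▸ rfl)

variable [IsDomain R]

/-- Both sides are the same difference quotient of `Q_ij`; the sign comes from the denominator `w -
u` in the definition of `Q_{i,j,i}`. -/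
theorem divided_QPoly {k k' k'' : Fin n} (hk : k ≠ k'') (h : k' ≠ k) (h' : k' ≠ k'')
    (hr : res k = res k'') :
    divided k k'' (K.QPoly res k k') = -K.QPoly₃ res k k' k'' := by
  refine divided_eq_of_mul_eq hk ?_
  rw [rename_swap_QPoly h h' hr]
  have := aeval_divDiff (k := k) (k' := k') (k'' := k'') (K.Q (res k) (res k'))
  rw [QPoly₃, QPoly, QPoly, ← hr, ← this]
  ring

theorem divided_QPoly' {k k' k'' : Fin n} (hk : k ≠ k'') (h : k' ≠ k) (h' : k' ≠ k'')
    (hr : res k = res k'') :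
    divided k k'' (K.QPoly res k'' k') = K.QPoly₃ res k k' k'' := by
  refine divided_eq_of_mul_eq hk ?_
  rw [Equiv.swap_comm, rename_swap_QPoly h' h hr.symm]
  have := aeval_divDiff (k := k) (k' := k') (k'' := k'') (K.Q (res k) (res k'))
  rw [QPoly₃, QPoly, QPoly, ← hr, ← neg_sub (aeval _ _), ← this]
  ring

/-- A divided difference is symmetric in its two variables. Hence it does not matter whether the
error polynomial is placed below or above the point where the two strings are exchanged. -/
theorem rename_swap_QPoly₃ {k k' k'' : Fin n} (hk : k ≠ k'') (h : k' ≠ k) (h' : k' ≠ k'')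
    (hr : res k = res k'') :
    rename (Equiv.swap k k'') (K.QPoly₃ res k k' k'') = K.QPoly₃ res k k' k'' := by
  rw [← divided_QPoly' hk h h' hr, rename_swap_divided hk]

theorem freeRep_one : K.freeRep (∑ p : K.Obj, gen (idempotent p)) = 1 := by
  classical
  simp only [map_sum, freeRep_gen]
  refine LinearMap.ext fun v => ?_
  simp only [LinearMap.sum_apply, blockOp_apply, Module.End.one_apply]
  have : ∀ p : K.Obj, (idempotent p).op (v p) = v p := fun p => by
    rw [idempotent, op_dottedIdempotent, dotPoly_zero, one_mul]
  simp only [this]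
  convert Finset.univ_sum_single v

theorem freeRep_mul {p q r : K.Obj} (F : K.Diagram q r) (D : K.Diagram p q) :
    K.freeRep (gen F * gen D) = K.freeRep (gen (F.comp D)) := by
  classical
  rw [map_mul, freeRep_gen, freeRep_gen, freeRep_gen]
  refine LinearMap.ext fun v => ?_
  simp only [Module.End.mul_apply, blockOp_apply, Pi.single_eq_same, op_comp]

theorem freeRep_mul_zero {p q q' r : K.Obj} (F : K.Diagram q' r) (D : K.Diagram p q)
    (h : q ≠ q') : K.freeRep (gen F * gen D) = 0 := by
  classical
  rw [map_mul, freeRep_gen, freeRep_gen]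
  refine LinearMap.ext fun v => ?_
  simp only [Module.End.mul_apply, blockOp_apply, Pi.single_eq_of_ne h.symm, map_zero,
    Pi.single_zero, LinearMap.zero_apply]

theorem freeRep_eq_zero_of_op {p q : K.Obj} {D : K.Diagram p q}
    (h : ∀ f, D.op f = 0) : K.freeRep (gen D) = 0 := by
  have : D.op = 0 := LinearMap.ext h
  rw [freeRep_gen, this, blockOp]
  simp

theorem freeRep_add_of_op {p q : K.Obj} {D D' D₀ : K.Diagram p q}
    (h : ∀ f, D.op f = D'.op f + D₀.op f) :
    K.freeRep (gen D) = K.freeRep (gen D' + gen D₀) := by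
  rw [map_add, freeRep_gen, freeRep_gen, freeRep_gen, ← blockOp_add]
  congr 1
  exact LinearMap.ext h

theorem freeRep_insertPoly_of_op {p q : K.Obj} {D D₀ : K.Diagram p q} {m : ℕ}
    {g : MvPolynomial (Fin n) R}
    (h : ∀ f, D.op f = ∑ e ∈ g.support, g.coeff e • (D₀.addDots m e).op f) :
    K.freeRep (gen D) = K.freeRep (insertPoly D₀ m g) := by
  rw [freeRep_insertPoly, freeRep_gen]
  congr 1
  refine LinearMap.ext fun f => ?_
  rw [h, LinearMap.sum_apply]
  rfl

theorem freeRep_sub_insertPoly_of_op {p q : K.Obj} {D D' D₀ : K.Diagram p q} {m : ℕ}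
    {g : MvPolynomial (Fin n) R}
    (h : ∀ f, D.op f = D'.op f - ∑ e ∈ g.support, g.coeff e • (D₀.addDots m e).op f) :
    K.freeRep (gen D) = K.freeRep (gen D' - insertPoly D₀ m g) := by
  rw [map_sub, freeRep_insertPoly, freeRep_gen, freeRep_gen, ← blockOp_sub]
  congr 1
  refine LinearMap.ext fun f => ?_
  rw [h, LinearMap.sub_apply, LinearMap.sum_apply]
  rfl

/-- The relations hold in the polynomial representation. -/
theorem freeRep_rel {x y : FreeAlgebra R K.Gen} (h : K.Rel x y) : K.freeRep x = K.freeRep y := by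
  cases h with
  | one => rw [freeRep_one, map_one]
  | mul F D => exact freeRep_mul F D
  | mul_zero F D h => rw [freeRep_mul_zero F D h, map_zero]
  | @straighten p q D D' P S s t z hw h h' hz =>
    obtain ⟨φ, hφ⟩ := exists_opL_append K p.res P s.pos
    obtain ⟨gs, gz, -, -⟩ := D.step_of_slices h
    obtain ⟨-, gt, -, -⟩ := D'.step_of_slices h'
    refine freeRep_eq_of_op fun f => ?_
    rw [op_two D h hφ, op_one D' h' hφ, hw]
    rcases hz with hz | hz
    · rw [stepOp_empty hz, crossings_congr_left gs gz hz]; rfl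
    · rw [stepOp_empty hz, crossings_congr_right gz gt hz]; rfl
  | @merge p q D D' P S z a b hw h h' =>
    obtain ⟨φ, hφ⟩ := exists_opL_append K p.res P z
    refine freeRep_eq_of_op fun f => ?_
    rw [Diagram.op_apply, Diagram.op_apply, h, h', hw, hφ, hφ, opL_cons_cons, add_comm a,
      opL_add_dots]
    rw [stepOp_empty (crossings_self _ _)]; rfl
  | @commute p q D D' P S s t z z' hw h h' h₁ h₂ =>
    obtain ⟨φ, hφ⟩ := exists_opL_append K p.res P s.pos
    have e1 := D.step_of_slices h
    have e2 := D.step_of_slices (P := P ++ [s]) (s := ⟨z, 0⟩) (t := t) (S := S)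
      (by rw [h]; simp)
    have f1 := D'.step_of_slices h'
    have H : K.Square p.res s.pos t.pos z z' :=
      ⟨e1.1, e2.2.1, e1.2.1, f1.2.1, e1.2.2.1, e2.2.2.1, h₁, h₂⟩
    refine freeRep_eq_of_op fun f => ?_
    rw [op_two D h hφ, op_two D' h' hφ, hw, H.stepOp_comm, ← h₁, ← h₂]
  | @dot_pass p q D P S s t h k hk =>
    obtain ⟨φ, hφ⟩ := exists_opL_append K p.res P s.pos
    obtain ⟨-, -, hs, -⟩ := D.step_of_slices h
    refine freeRep_eq_of_op fun f => ?_
    rw [op_addDots_bottom D h hφ, op_addDots_top D h hφ, stepOp_X_mul hs hk]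
  | @dot_left p q D D₀ P S s t h k k' hk hc h₀ =>
    obtain ⟨φ, hφ⟩ := exists_opL_append K p.res P s.pos
    obtain ⟨gs, gt, hs, hS⟩ := D.step_of_slices h
    have hne := solid_ne hc
    refine freeRep_add_of_op fun f => ?_
    -- The Leibniz rule with `∂(X k) = 1` leaves the swapped polynomial, which is the operator of
    -- the resolved diagram.
    rw [op_addDots_bottom D h hφ, op_addDots_top D h hφ,
      op_resolves' hk h₀ hS (crossings_swap_eq_empty_of_simple hk gs gt hs hc) hφ,
      stepOp_divided hs hk hc, divided_mul hne, divided_X_left hne, one_mul, ← map_add, ← map_add,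
      add_comm]
  | @dot_right p q D D₀ P S s t h k k' hk hc h₀ =>
    obtain ⟨φ, hφ⟩ := exists_opL_append K p.res P s.pos
    obtain ⟨gs, gt, hs, hS⟩ := D.step_of_slices h
    have hne := solid_ne hc
    refine freeRep_add_of_op fun f => ?_
    rw [op_addDots_bottom D h hφ, op_addDots_top D h hφ,
      op_resolves' hk h₀ hS (crossings_swap_eq_empty_of_simple hk gs gt hs hc) hφ,
      stepOp_divided hs hk hc, divided_mul hne (MvPolynomial.X k'), divided_X_right hne, ← map_add, ← map_add]
    congr 2
    ring
  | @reid₂ p q D D₀ P S s t z hw h h₀ hst hc =>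
    obtain ⟨φ, hφ⟩ := exists_opL_append K p.res P s.pos
    have e1 := D.step_of_slices h
    have f1 := D₀.step_of_slices h₀
    have key : ∀ a b, K.Cross p.res s.pos z a b → ¬ K.Interact p.res a b := fun a b hab hi => by
      obtain ⟨h1, h2, h3⟩ := hc a b hab
      obtain ⟨-, h4, h5⟩ := hc b a hab.symm
      rcases hi with hi | hi | hi | hi | hi <;> contradiction
    refine freeRep_eq_of_op fun f => ?_
    rw [op_two D h hφ, op_one D₀ h₀ hφ, hw, stepOp_empty hst,
      stepOp_id fun c hc => key _ _ (Or.inl hc), stepOp_id fun c hc => ?_]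
    · rfl
    · exact key _ _ (Or.inr ((crossings_eq_swap e1.1 f1.2.1 hst).1 hc))
  | @reid₂_solidSolid p q D P S s t z h hst a b hab hc =>
    obtain ⟨φ, hφ⟩ := exists_opL_append K p.res P s.pos
    have e1 := D.step_of_slices h
    have e2 := D.step_of_slices (P := P ++ [s]) (s := ⟨z, 0⟩) (t := t) (S := S)
      (by rw [h]; simp)
    have key : ∀ k k', k ≠ k' → p.res k = p.res k' →
        (Str.solid k, Str.solid k') ∈ K.crossings p.res s.pos z → ∀ f, D.op f = 0 := by
      intro k k' hne hr hc f
      have hc' := (crossings_eq_swap e1.1 e2.2.1 hst).2 hc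
      rw [op_two D h hφ, stepOp_divided e1.2.2.1 hr hc, stepOp_divided e2.2.2.1 hr.symm hc',
        divided_eq_zero hne.symm, map_zero, map_zero]
      -- The image of a divided difference is symmetric, so the second one kills it.
      rw [Equiv.swap_comm, rename_swap_divided hne]
    obtain ⟨k, k', rfl, rfl, hne, hr⟩ := hab
    rw [map_zero]
    rcases hc with hc | hc
    · exact freeRep_eq_zero_of_op (key k k' hne hr hc)
    · exact freeRep_eq_zero_of_op (key k' k hne.symm hr.symm hc)
  | @reid₂_ghostSolid p q D D₀ P S s t z hw h h₀ hst k k' e hab hc =>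
    obtain ⟨φ, hφ⟩ := exists_opL_append K p.res P s.pos
    have e1 := D.step_of_slices h
    have e2 := D.step_of_slices (P := P ++ [s]) (s := ⟨z, 0⟩) (t := t) (S := S)
      (by rw [h]; simp)
    have hsw := @crossings_eq_swap _ _ _ _ _ _ K p.res s.pos t.pos z e1.1 e2.2.1 hst
    refine freeRep_insertPoly_of_op fun f => ?_
    rw [sum_op_addDots h₀ _ hφ, op_two D h hφ, opL_cons_cons, stepOp_empty hst, hw]
    -- In exactly one of the two crossings does the ghost pass to the right, so `Q_ij` appears once
    -- in either case.
    rcases hc with hc | hc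
    · rw [stepOp_ghost_solid e1.2.2.1 hab hc, stepOp_solid_ghost e2.2.2.1 hab (hsw.2 hc)]
      simp only [LinearMap.id_apply, LinearMap.mulLeft_apply]
      congr 2
      ring
    · rw [stepOp_solid_ghost e1.2.2.1 hab hc, stepOp_ghost_solid e2.2.2.1 hab (hsw.2 hc)]
      simp only [LinearMap.id_apply, LinearMap.mulLeft_apply]
      congr 2
      ring
  | @reid₂_solidRed p q D D₀ P S s t z hw h h₀ hst k m hab hc =>
    obtain ⟨φ, hφ⟩ := exists_opL_append K p.res P s.pos
    have e1 := D.step_of_slices h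
    have e2 := D.step_of_slices (P := P ++ [s]) (s := ⟨z, 0⟩) (t := t) (S := S)
      (by rw [h]; simp)
    have hsw := @crossings_eq_swap _ _ _ _ _ _ K p.res s.pos t.pos z e1.1 e2.2.1 hst
    refine freeRep_eq_of_op fun f => ?_
    rw [op_addDots_bottom D₀ h₀ hφ, op_two D h hφ, stepOp_empty hst, hw]
    rcases hc with hc | hc
    · rw [stepOp_solid_red e1.2.2.1 hab hc, stepOp_red_solid e2.2.2.1 hab (hsw.2 hc)]
      rfl
    · rw [stepOp_red_solid e1.2.2.1 hab hc, stepOp_solid_red e2.2.2.1 hab (hsw.2 hc)]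
      rfl
  | @braid p q D D' P S s t z₁ z₂ z₁' z₂' hw h h' h₁ h₂ h₃ hc =>
    obtain ⟨φ, hφ⟩ := exists_opL_append K p.res P s.pos
    have H := Diagram.hexagon h h' h₁ h₂ h₃
    refine freeRep_eq_of_op fun f => ?_
    rw [op_three D h hφ, op_three D' h' hφ, hw, H.stepOp_braid hc, ← h₁, ← h₂, ← h₃]
  | @braid_ghostSolidGhost p q D D' D₀ P S s t z₁ z₂ z₁' z₂' hw h h' h₁ h₂ h₃ k k' k'' e hab hcb
      h_ab h_ac h_bc h₀ =>
    obtain ⟨φ, hφ⟩ := exists_opL_append K p.res P s.pos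
    have H := Diagram.hexagon h h' h₁ h₂ h₃
    have e1 := D.step_of_slices (P := P ++ [s, ⟨z₁, 0⟩]) (s := ⟨z₂, 0⟩) (t := t) (S := S)
      (by rw [h]; simp)
    have hr : p.res k = p.res k'' := hab.owner_eq.symm.trans hcb.owner_eq
    have hkk : (Str.solid k, Str.solid k'') ∈ K.crossings p.res z₁ z₂ :=
      ⟨trivial, trivial, by simpa [strPos] using h_ac.2.2.1, by simpa [strPos] using h_ac.2.2.2⟩
    have hne := solid_ne hkk
    have he := H.crossings_swap (a := Str.ghost k e) (c := Str.ghost k'' e) hr rfl rfl rfl h_ab h_ac h_bc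
    -- The two sides act by `∂ ∘ Q` and `Q ∘ ∂`. Their difference is the first Leibniz term, the
    -- divided difference of `Q` times the swapped argument.
    refine freeRep_sub_insertPoly_of_op fun f => ?_
    rw [sum_op_resolves hr h₀ e1.2.2.2 he hφ,
      op_three D h hφ, op_three D' h' hφ, ← h₁, ← h₂, ← h₃, hw,
      stepOp_ghost_solid H.s₁ hab h_ab, stepOp_divided H.s₂ hr hkk,
      stepOp_solid_ghost H.s₃ hcb h_bc, LinearMap.id_apply, LinearMap.id_apply,
      LinearMap.mulLeft_apply, LinearMap.mulLeft_apply, divided_mul hne,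
      divided_QPoly hne hab.ne.symm hcb.ne.symm hr, map_mul (rename (Equiv.swap k k'')) (K.QPoly₃ _ _ _ _),
      rename_swap_QPoly₃ hne hab.ne.symm hcb.ne.symm hr, ← map_sub, ← map_sub]
    congr 2
    ring
  | @braid_solidGhostSolid p q D D' D₀ P S s t z₁ z₂ z₁' z₂' hw h h' h₁ h₂ h₃ k k' k'' e hba hbc
      h_ab h_ac h_bc h₀ =>
    obtain ⟨φ, hφ⟩ := exists_opL_append K p.res P s.pos
    have H := Diagram.hexagon h h' h₁ h₂ h₃
    have e1 := D.step_of_slices (P := P ++ [s, ⟨z₁, 0⟩]) (s := ⟨z₂, 0⟩) (t := t) (S := S)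
      (by rw [h]; simp)
    have hr : p.res k = p.res k'' := hba.partner_eq.symm.trans hbc.partner_eq
    have hne := solid_ne h_ac
    have he := H.crossings_swap (a := Str.solid k) (c := Str.solid k'') hr rfl rfl rfl h_ab h_ac h_bc
    -- Here the polynomial belongs to the crossing with the right-hand solid string and acts after
    -- `∂` in `D` but before it in `D'`, so the Leibniz term enters with the opposite sign;
    -- `divided_QPoly'` compensates for this.
    refine freeRep_sub_insertPoly_of_op fun f => ?_
    rw [sum_op_resolves hr h₀ e1.2.2.2 he hφ,
      op_three D h hφ, op_three D' h' hφ, ← h₁, ← h₂, ← h₃, hw,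
      stepOp_solid_ghost H.s₁ hba h_ab, stepOp_divided H.s₂ hr h_ac,
      stepOp_ghost_solid H.s₃ hbc h_bc, LinearMap.id_apply, LinearMap.id_apply,
      LinearMap.mulLeft_apply, LinearMap.mulLeft_apply, QPoly_symm hbc.res_ne,
      divided_mul hne (K.QPoly p.res k'' k'),
      divided_QPoly' hne hba.ne hbc.ne hr, map_mul (rename (Equiv.swap k k'')) (K.QPoly₃ _ _ _ _),
      rename_swap_QPoly₃ hne hba.ne hbc.ne hr, ← map_sub, ← map_sub]
    congr 2
    ring
  | @braid_solidRedSolid p q D D' D₀ P S s t z₁ z₂ z₁' z₂' hw h h' h₁ h₂ h₃ k k'' m hab hcb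
      h_ab h_ac h_bc h₀ =>
    obtain ⟨φ, hφ⟩ := exists_opL_append K p.res P s.pos
    have H := Diagram.hexagon h h' h₁ h₂ h₃
    have e1 := D.step_of_slices (P := P ++ [s, ⟨z₁, 0⟩]) (s := ⟨z₂, 0⟩) (t := t) (S := S)
      (by rw [h]; simp)
    have hr : p.res k = p.res k'' := hab.res_eq.trans hcb.res_eq.symm
    have hne := solid_ne h_ac
    have he := H.crossings_swap (a := Str.solid k) (c := Str.solid k'') hr rfl rfl rfl h_ab h_ac h_bc
    -- The polynomial of the red crossing is a single variable with divided difference `1`, so the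
    -- error term is the resolved diagram without dots.
    refine freeRep_add_of_op fun f => ?_
    rw [op_resolves' hr h₀ e1.2.2.2 he hφ,
      op_three D h hφ, op_three D' h' hφ, ← h₁, ← h₂, ← h₃, hw,
      stepOp_solid_red H.s₁ hab h_ab, stepOp_divided H.s₂ hr h_ac,
      stepOp_red_solid H.s₃ hcb h_bc, LinearMap.id_apply, LinearMap.id_apply,
      LinearMap.mulLeft_apply, LinearMap.mulLeft_apply, divided_mul hne,
      divided_X_left hne, one_mul, ← map_add, ← map_add, add_comm]

variable (K) in
/-- The polynomial representation of the weighted KLRW algebra. -/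
def rep : K.Alg →ₐ[R] Module.End R (K.Obj → MvPolynomial (Fin n) R) :=
  RingQuot.liftAlgHom R ⟨K.freeRep, fun _ _ h => freeRep_rel h⟩

theorem rep_toAlg {p q : K.Obj} (D : K.Diagram p q) :
    K.rep D.toAlg = K.blockOp p q D.op := by
  rw [← freeRep_gen]
  exact RingQuot.liftAlgHom_mkAlgHom_apply R _ _ _

end Relations

end Datum

/-! ### Homogeneity of the structure polynomials -/

section Homogeneous

open MvPolynomial

variable {R : Type*} [CommRing R]

theorem isWeightedHomogeneous_aeval {σ τ M : Type*} [AddCommMonoid M] {w : σ → M} {w' : τ → M}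
    {φ : MvPolynomial σ R} {m : M} (hφ : IsWeightedHomogeneous w φ m)
    {v : σ → MvPolynomial τ R} (hv : ∀ i, IsWeightedHomogeneous w' (v i) (w i)) :
    IsWeightedHomogeneous w' (aeval v φ) m := by
  classical
  rw [aeval_def, eval₂_eq]
  refine IsWeightedHomogeneous.sum _ _ _ fun d hd => ?_
  have hd' : Finsupp.weight w d = m := hφ (mem_support_iff.1 hd)
  rw [algebraMap_eq]
  refine IsWeightedHomogeneous.C_mul ?_ _
  rw [← hd', Finsupp.weight_apply]
  exact IsWeightedHomogeneous.prod _ _ _ fun i _ => (hv i).pow _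

theorem isWeightedHomogeneous_divDiff {a b m : ℤ} {Q : MvPolynomial (Fin 2) R}
    (hQ : IsWeightedHomogeneous (![a, b] : Fin 2 → ℤ) Q m) :
    IsWeightedHomogeneous (![a, b, a] : Fin 3 → ℤ) (divDiff Q) (m - a) := by
  refine IsWeightedHomogeneous.neg ?_
  refine IsWeightedHomogeneous.sum _ _ _ fun d hd => ?_
  have hd' : Finsupp.weight (![a, b] : Fin 2 → ℤ) d = m := hQ (mem_support_iff.1 hd)
  rw [Finsupp.weight_apply, Finsupp.sum_fintype _ _ (by simp), Fin.sum_univ_two] at hd'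
  simp only [Matrix.cons_val_zero, Matrix.cons_val_one, nsmul_eq_mul] at hd'
  have hX : ∀ i : Fin 3, IsWeightedHomogeneous (![a, b, a] : Fin 3 → ℤ)
      (MvPolynomial.X i : MvPolynomial (Fin 3) R) ((![a, b, a] : Fin 3 → ℤ) i) := fun i =>
    isWeightedHomogeneous_X R _ i
  rw [Finset.mul_sum]
  refine IsWeightedHomogeneous.sum _ _ _ fun p hp => ?_
  have := (((isWeightedHomogeneous_C (![a, b, a] : Fin 3 → ℤ) (Q.coeff d)).mul
    ((hX 1).pow (d 1))).mul (((hX 2).pow p).mul ((hX 0).pow (d 0 - 1 - p))))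
  convert this using 1
  rw [Finset.mem_range] at hp
  -- Since `p < d 0`, the truncated subtraction is exact. Each term of the geometric sum has one
  -- factor of degree `a` less than the monomial it comes from.
  have e : ((d 0 - 1 - p : ℕ) : ℤ) = d 0 - 1 - p := by omega
  simp only [Matrix.cons_val_zero, Matrix.cons_val_one, Matrix.cons_val, nsmul_eq_mul, e]
  rw [← hd']
  ring

end Homogeneous

namespace Datum

/-! ### Degrees of diagrams -/

section Degree

open MvPolynomial

variable {R : Type*} [CommRing R] {I E : Type*} {n l : ℕ} {K : Datum R I E n l}
  {res : Fin n → I} {s t z z' : Fin n → ℝ}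

variable (K) in
/-- The total degree of a set of crossings. -/
def crossDegree (res : Fin n → I) (C : Set (Str n l E × Str n l E)) : ℤ :=
  ∑ᶠ c ∈ C, K.crossingDegree res c.1 c.2

variable (K) in
/-- The degrees of dots. -/
def dotDegree (res : Fin n → I) (k : Fin n) : ℤ := 2 * (K.quiver.d (res k) : ℤ)

variable (K) in
/-- The degree of a sequence of slices. -/
def listDegree (res : Fin n → I) : List (Slice n) → ℤ
  | [] => 0
  | [s] => ∑ k, (s.dots k : ℤ) * K.dotDegree res k
  | s :: t :: L => ∑ k, (s.dots k : ℤ) * K.dotDegree res k +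
      K.crossDegree res (K.crossings res s.pos t.pos) + listDegree res (t :: L)

theorem degree_eq_listDegree {p q : K.Obj} (D : K.Diagram p q) :
    D.degree = K.listDegree p.res D.slices := by
  rw [Diagram.degree]
  generalize D.slices = L
  induction L with
  | nil => rfl
  | cons s L ih =>
    cases L with
    | nil => simp [listDegree, dotDegree]
    | cons t L =>
      simp only [List.map_cons, List.sum_cons, List.tail_cons, List.zipWith_cons_cons,
        listDegree] at ih ⊢
      rw [← ih]
      simp only [stepDegree, crossDegree, dotDegree]
      ring

theorem listDegree_cons_cons (s t : Slice n) (L : List (Slice n)) :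
    K.listDegree res (s :: t :: L) = ∑ k, (s.dots k : ℤ) * K.dotDegree res k +
      K.crossDegree res (K.crossings res s.pos t.pos) + K.listDegree res (t :: L) := rfl

theorem listDegree_zero_dots (z : Fin n → ℝ) (t : Slice n) (L : List (Slice n)) :
    K.listDegree res (⟨z, 0⟩ :: t :: L) =
      K.crossDegree res (K.crossings res z t.pos) + K.listDegree res (t :: L) := by
  simp [listDegree_cons_cons]

theorem listDegree_add_dots (z : Fin n → ℝ) (a b : Fin n → ℕ) (T : List (Slice n)) :
    K.listDegree res (⟨z, a + b⟩ :: T) =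
      ∑ k, (b k : ℤ) * K.dotDegree res k + K.listDegree res (⟨z, a⟩ :: T) := by
  cases T <;>
    simp only [listDegree, Pi.add_apply, Nat.cast_add, add_mul, Finset.sum_add_distrib] <;> ring

-- The additive counterpart of `exists_opL_append`: the part below a slice contributes a constant to
-- the degree, so the relations need only be compared locally.
variable (K) in
theorem exists_listDegree_append (res : Fin n → I) (P : List (Slice n)) (z : Fin n → ℝ) :
    ∃ m : ℤ, ∀ (a : Fin n → ℕ) T,
      K.listDegree res (P ++ ⟨z, a⟩ :: T) = m + K.listDegree res (⟨z, a⟩ :: T) := by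
  induction P with
  | nil => exact ⟨0, fun _ _ => (zero_add _).symm⟩
  | cons u P ih =>
    obtain ⟨m, hm⟩ := ih
    cases P with
    | nil =>
      exact ⟨∑ k, (u.dots k : ℤ) * K.dotDegree res k + K.crossDegree res (K.crossings res u.pos z),
        fun a T => listDegree_cons_cons u ⟨z, a⟩ T⟩
    | cons v P =>
      refine ⟨∑ k, (u.dots k : ℤ) * K.dotDegree res k +
        K.crossDegree res (K.crossings res u.pos v.pos) + m, fun a T => ?_⟩
      simp only [List.cons_append, listDegree_cons_cons] at hm ⊢
      rw [hm, ← add_assoc]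

theorem crossDegree_empty (h : K.crossings res z z' = ∅) :
    K.crossDegree res (K.crossings res z z') = 0 := by
  rw [h]; exact finsum_mem_empty

theorem crossingDegree_eq_zero {c : Str n l E × Str n l E} (h1 : K.Active res c.1)
    (h2 : K.Active res c.2) (hne : c.1 ≠ c.2)
    (h : ¬ K.Interact res c.1 c.2) : K.crossingDegree res c.1 c.2 = 0 := by
  obtain ⟨a, b⟩ := c
  cases a <;> cases b <;> simp only [crossingDegree]
  · rw [if_neg]; exact fun h' => h (Or.inl ⟨_, _, rfl, rfl, fun e => hne (by rw [e]), h'⟩)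
  · rw [if_neg]; exact fun h' => h (Or.inr (Or.inr (Or.inl ⟨_, _, _, rfl, rfl, h2, h'⟩)))
  · rw [if_neg]; exact fun h' => h (Or.inr (Or.inr (Or.inr (Or.inl ⟨_, _, rfl, rfl, h'⟩))))
  · rw [if_neg]; exact fun h' => h (Or.inr (Or.inl ⟨_, _, _, rfl, rfl, h1, h'⟩))
  · rw [if_neg]; exact fun h' => h (Or.inr (Or.inr (Or.inr (Or.inr ⟨_, _, rfl, rfl, h'⟩))))

theorem crossDegree_eq (h : K.Simple res z z') {c : Str n l E × Str n l E}
    (hc : c ∈ K.crossings res z z') (hi : K.Interact res c.1 c.2) :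
    K.crossDegree res (K.crossings res z z') = K.crossingDegree res c.1 c.2 := by
  classical
  rw [crossDegree, finsum_eq_single _ c]
  · exact finsum_eq_if.trans (if_pos hc)
  · intro d hd
    rw [finsum_eq_if]
    split_ifs with hd'
    · exact crossingDegree_eq_zero hd'.1 hd'.2.1 (ne_of_mem_crossings hd')
        fun h' => hd (interact_unique h hd' hc h' hi)
    · rfl

theorem crossDegree_eq_zero (h : ∀ c ∈ K.crossings res z z', ¬ K.Interact res c.1 c.2) :
    K.crossDegree res (K.crossings res z z') = 0 :=
  finsum_mem_of_eqOn_zero fun c hc =>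
    crossingDegree_eq_zero hc.1 hc.2.1 (ne_of_mem_crossings hc) (h c hc)

theorem crossDegree_comp {w : Equiv.Perm (Fin n)} {r r' : Fin n → I} (h : ∀ k, r' (w k) = r k) :
    K.crossDegree r (K.crossings r (z ∘ w) (z' ∘ w)) =
      K.crossDegree r' (K.crossings r' z z') := by
  have : K.crossings r' z z' = (fun c : Str n l E × Str n l E =>
      (Str.rename w c.1, Str.rename w c.2)) '' K.crossings r (z ∘ w) (z' ∘ w) := by
    ext ⟨a, b⟩
    obtain ⟨a, rfl⟩ := exists_rename w a
    obtain ⟨b, rfl⟩ := exists_rename w b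
    rw [← mem_crossings_comp h]
    refine ⟨fun hc => ⟨_, hc, rfl⟩, ?_⟩
    rintro ⟨⟨a', b'⟩, hc, he⟩
    simp only [Prod.mk.injEq] at he
    rwa [← Str.rename_injective w he.1, ← Str.rename_injective w he.2]
  rw [crossDegree, crossDegree, this, finsum_mem_image]
  · refine finsum_mem_congr rfl fun c _ => ?_
    obtain ⟨a, b⟩ := c
    obtain rfl : r = fun k => r' (w k) := funext fun k => (h k).symm
    cases a <;> cases b <;> rfl
  · rintro ⟨a, b⟩ - ⟨a', b'⟩ - he
    simp only [Prod.mk.injEq] at he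
    rw [Str.rename_injective w he.1, Str.rename_injective w he.2]

theorem sum_relabel {w : Equiv.Perm (Fin n)} {r r' : Fin n → I} (h : ∀ k, r' (w k) = r k)
    (s : Slice n) : ∑ k, ((Slice.relabel w s).dots k : ℤ) * K.dotDegree r k =
      ∑ k, (s.dots k : ℤ) * K.dotDegree r' k := by
  rw [← Equiv.sum_comp w fun k => (s.dots k : ℤ) * K.dotDegree r' k]
  simp only [Slice.relabel, Function.comp_apply, dotDegree, h]

theorem listDegree_relabel {w : Equiv.Perm (Fin n)} {r r' : Fin n → I}
    (h : ∀ k, r' (w k) = r k) (L : List (Slice n)) :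
    K.listDegree r (L.map (Slice.relabel w)) = K.listDegree r' L := by
  induction L with
  | nil => rfl
  | cons s L ih =>
    cases L with
    | nil => exact sum_relabel h s
    | cons t L =>
      simp only [List.map_cons, listDegree_cons_cons] at ih ⊢
      rw [ih, sum_relabel h]
      simp only [Slice.relabel, crossDegree_comp h]

theorem listDegree_append {L : List (Slice n)} {s t : Slice n} (T : List (Slice n))
    (h : K.crossings res s.pos t.pos = ∅) :
    K.listDegree res (L ++ s :: t :: T) =
      K.listDegree res (L ++ [s]) + K.listDegree res (t :: T) := by
  obtain ⟨m, hm⟩ := exists_listDegree_append K res L s.pos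
  rw [hm s.dots (t :: T), hm s.dots [], listDegree_cons_cons, crossDegree_empty h, add_zero,
    add_assoc]
  rfl

theorem Diagram.exists_slices_eq_append {p q : K.Obj} (D : K.Diagram p q) :
    ∃ L s, D.slices = L ++ [s] ∧ s.pos = q.pos ∘ D.perm := by
  rcases List.eq_nil_or_concat D.slices with h | ⟨L, s, h⟩
  · have := D.top; simp [h] at this
  · have := D.top
    rw [List.concat_eq_append] at h
    rw [h] at this
    exact ⟨L, s, h, by simpa using this⟩

theorem Diagram.exists_slices_eq_cons {p q : K.Obj} (D : K.Diagram p q) :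
    ∃ t T, D.slices = t :: T ∧ t.pos = p.pos := by
  cases h : D.slices with
  | nil => have := D.bottom; simp [h] at this
  | cons t T =>
    have := D.bottom
    rw [h] at this
    exact ⟨t, T, rfl, by simpa using this⟩

theorem degree_comp {p q r : K.Obj} (F : K.Diagram q r) (D : K.Diagram p q) :
    (F.comp D).degree = F.degree + D.degree := by
  obtain ⟨L, s, hs, hs'⟩ := D.exists_slices_eq_append
  obtain ⟨t, T, ht, ht'⟩ := F.exists_slices_eq_cons
  rw [degree_eq_listDegree, degree_eq_listDegree, degree_eq_listDegree,
    ← listDegree_relabel D.res_eq F.slices]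
  simp only [Diagram.comp]
  have h1 : K.crossings p.res s.pos (Slice.relabel D.perm t).pos = ∅ := by
    simp only [Slice.relabel, hs', ht', crossings_self]
  rw [hs, ht, List.map_cons, List.append_assoc, List.singleton_append, listDegree_append _ h1,
    add_comm]

theorem degree_dottedIdempotent (p : K.Obj) (a : Fin n → ℕ) :
    (dottedIdempotent p a).degree = ∑ k, (a k : ℤ) * (2 * (K.quiver.d (p.res k) : ℤ)) := by
  rw [degree_eq_listDegree]; rfl

theorem degree_addDots {p q : K.Obj} {D : K.Diagram p q} {P T : List (Slice n)} {s : Slice n}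
    (h : D.slices = P ++ s :: T) (e : Fin n → ℕ) :
    (D.addDots P.length e).degree = D.degree + ∑ k, (e k : ℤ) * K.dotDegree p.res k := by
  obtain ⟨m, hm⟩ := exists_listDegree_append K p.res P s.pos
  rw [degree_eq_listDegree, degree_eq_listDegree]
  simp only [Diagram.addDots]
  rw [h, modify_length_append, hm, listDegree_add_dots, hm s.dots]
  ring

theorem degree_addDots_single {p q : K.Obj} {D : K.Diagram p q} {P T : List (Slice n)}
    {s : Slice n} (h : D.slices = P ++ s :: T) (k : Fin n) :
    (D.addDots P.length (Pi.single k 1)).degree = D.degree + K.dotDegree p.res k := by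
  rw [degree_addDots h, Finset.sum_eq_single k]
  · simp
  · intro j _ hj; simp [hj]
  · simp

theorem degree_resolves {p q : K.Obj} {D D₀ : K.Diagram p q} {k k' : Fin n} {P S : List (Slice n)}
    {s t : Slice n} (hr : p.res k = p.res k') (h₀ : K.Resolves D D₀ k k' (P ++ [s]) (t :: S))
    (he : K.crossings p.res s.pos (t.pos ∘ Equiv.swap k k') = ∅) :
    D₀.degree = K.listDegree p.res (P ++ [s]) + K.listDegree p.res (t :: S) := by
  rw [degree_eq_listDegree, h₀.2, List.map_cons, List.append_assoc, List.singleton_append,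
    listDegree_append _ he, ← List.map_cons, listDegree_relabel (res_swap hr)]

theorem isWeightedHomogeneous_QPoly {k k' : Fin n} (h : res k ≠ res k') :
    IsWeightedHomogeneous (K.dotDegree res) (K.QPoly res k k')
      (-2 * ((K.quiver.d (res k) : ℤ) * K.quiver.cartan (res k) (res k'))) := by
  refine isWeightedHomogeneous_aeval (K.Q_homogeneous _ _ h) fun i => ?_
  fin_cases i <;> exact isWeightedHomogeneous_X R _ _

theorem isWeightedHomogeneous_QPoly₃ {k k' k'' : Fin n} (h : res k ≠ res k')
    (hr : res k = res k'') :
    IsWeightedHomogeneous (K.dotDegree res) (K.QPoly₃ res k k' k'')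
      (-2 * ((K.quiver.d (res k) : ℤ) * K.quiver.cartan (res k) (res k')) -
        2 * (K.quiver.d (res k) : ℤ)) := by
  refine isWeightedHomogeneous_aeval (isWeightedHomogeneous_divDiff (K.Q_homogeneous _ _ h))
    fun i => ?_
  fin_cases i
  · exact isWeightedHomogeneous_X R _ _
  · exact isWeightedHomogeneous_X R _ _
  · change IsWeightedHomogeneous _ _ (2 * (K.quiver.d (res k) : ℤ))
    rw [hr]
    exact isWeightedHomogeneous_X R _ _

theorem crossDegree_solid_solid (hs : K.Simple res z z') {k k' : Fin n} (hr : res k = res k')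
    (h : (Str.solid k, Str.solid k') ∈ K.crossings res z z') :
    K.crossDegree res (K.crossings res z z') = -K.dotDegree res k := by
  rw [crossDegree_eq hs h (Or.inl ⟨_, _, rfl, rfl, fun e => ne_of_mem_crossings h (by rw [e]), hr⟩),
    crossingDegree, if_pos hr, dotDegree]
  ring

theorem crossDegree_ghost_solid (hs : K.Simple res z z') {k k' : Fin n} {e : E}
    (h : K.GhostSolid res (.ghost k e) (.solid k'))
    (hc : K.Cross res z z' (Str.ghost k e) (Str.solid k')) :
    K.crossDegree res (K.crossings res z z') =
      -((K.quiver.d (res k) : ℤ) * K.quiver.cartan (res k) (res k')) := by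
  rcases hc with hc | hc
  · rw [crossDegree_eq hs hc (Or.inr (Or.inl h)), crossingDegree, if_pos h.partner_eq]
  · rw [crossDegree_eq hs hc (Or.inr (Or.inr (Or.inl h))), crossingDegree, if_pos h.partner_eq]

theorem crossDegree_solid_red (hs : K.Simple res z z') {k : Fin n} {m : Fin l}
    (h : K.SolidRed res (.solid k) (.red m))
    (hc : K.Cross res z z' (Str.solid k) (Str.red m)) :
    K.crossDegree res (K.crossings res z z') = K.quiver.d (res k) := by
  rcases hc with hc | hc
  · rw [crossDegree_eq hs hc (Or.inr (Or.inr (Or.inr (Or.inl h)))), crossingDegree,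
      if_pos h.res_eq]
  · rw [crossDegree_eq hs hc (Or.inr (Or.inr (Or.inr (Or.inr h)))), crossingDegree,
      if_pos h.res_eq]

end Degree

end Datum

namespace Datum

/-! ### The grading -/

section Grading

open MvPolynomial DirectSum

variable {R : Type*} [CommRing R] {I E : Type*} {n l : ℕ} {K : Datum R I E n l}

variable (K) in
/-- The quotient map from the free algebra. -/
def proj : FreeAlgebra R K.Gen →ₐ[R] K.Alg := RingQuot.mkAlgHom R K.Rel

theorem proj_rel {x y : FreeAlgebra R K.Gen} (h : K.Rel x y) : K.proj x = K.proj y :=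
  RingQuot.mkAlgHom_rel R h

theorem proj_gen {p q : K.Obj} (D : K.Diagram p q) : K.proj (gen D) = D.toAlg := rfl

theorem toAlg_mul {p q r : K.Obj} (F : K.Diagram q r) (D : K.Diagram p q) :
    F.toAlg * D.toAlg = (F.comp D).toAlg := by
  rw [← proj_gen, ← proj_gen, ← proj_gen, ← map_mul, proj_rel (Rel.mul F D)]

theorem toAlg_mul_eq_zero {p q q' r : K.Obj} (F : K.Diagram q' r) (D : K.Diagram p q)
    (h : q ≠ q') : F.toAlg * D.toAlg = 0 := by
  rw [← proj_gen, ← proj_gen, ← map_mul, proj_rel (Rel.mul_zero F D h), map_zero]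

theorem sum_toAlg_idempotent : ∑ p : K.Obj, (idempotent p).toAlg = (1 : K.Alg) := by
  have := proj_rel (Rel.one (K := K))
  rwa [map_sum, map_one] at this

theorem toAlg_mem_component {p q : K.Obj} (D : K.Diagram p q) :
    D.toAlg ∈ K.component D.degree :=
  Submodule.subset_span ⟨p, q, D, rfl, rfl⟩

theorem degree_idempotent (p : K.Obj) : (idempotent p).degree = 0 := by
  rw [idempotent, degree_dottedIdempotent]
  simp

/-- Degrees add up when diagrams are glued. This needs only the spans; that their sum is direct is a
separate matter, settled by `decomposeAlg`. -/
instance : SetLike.GradedMonoid K.component where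
  one_mem := by
    rw [← sum_toAlg_idempotent]
    refine Submodule.sum_mem _ fun p _ => ?_
    rw [← degree_idempotent p]
    exact toAlg_mem_component _
  mul_mem := by
    intro i j a b ha hb
    refine Submodule.span_induction₂ (p := fun a b _ _ => a * b ∈ K.component (i + j))
      ?_ ?_ ?_ ?_ ?_ ?_ ?_ ha hb
    · rintro _ _ ⟨q', r, F, rfl, rfl⟩ ⟨p, q, D, rfl, rfl⟩
      by_cases h : q = q'
      · subst h
        rw [toAlg_mul, ← degree_comp]
        exact toAlg_mem_component _
      · rw [toAlg_mul_eq_zero _ _ h]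
        exact Submodule.zero_mem _
    · intro y _; rw [zero_mul]; exact Submodule.zero_mem _
    · intro x _; rw [mul_zero]; exact Submodule.zero_mem _
    · intro x y z _ _ _ h1 h2; rw [add_mul]; exact Submodule.add_mem _ h1 h2
    · intro x y z _ _ _ h1 h2; rw [mul_add]; exact Submodule.add_mem _ h1 h2
    · intro c x y _ _ h; rw [smul_mul_assoc]; exact Submodule.smul_mem _ _ h
    · intro c x y _ _ h; rw [mul_smul_comm]; exact Submodule.smul_mem _ _ h

variable (K) in
/-- Decomposing elements of the free algebra into their homogeneous components. -/
def freeDecompose : FreeAlgebra R K.Gen →ₐ[R] ⨁ m, K.component m :=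
  FreeAlgebra.lift R fun g =>
    DirectSum.of (fun m => K.component m) g.2.2.degree ⟨g.2.2.toAlg, toAlg_mem_component _⟩

variable (K) in
/-- The element is homogeneous of the given degree. -/
def IsHom (m : ℤ) (x : FreeAlgebra R K.Gen) : Prop :=
  ∃ h : K.proj x ∈ K.component m,
    K.freeDecompose x = DirectSum.of (fun m => K.component m) m ⟨_, h⟩

variable {m m' : ℤ} {x y : FreeAlgebra R K.Gen}

theorem isHom_gen {p q : K.Obj} (D : K.Diagram p q) : K.IsHom D.degree (gen D) :=
  ⟨toAlg_mem_component D, FreeAlgebra.lift_ι_apply (R := R) (fun g : K.Gen =>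
    DirectSum.of (fun m => K.component m) g.2.2.degree
      ⟨g.2.2.toAlg, toAlg_mem_component _⟩) ⟨p, q, D⟩⟩

theorem isHom_gen_of_eq {p q : K.Obj} {D : K.Diagram p q} (h : D.degree = m) :
    K.IsHom m (gen D) := h ▸ isHom_gen D

theorem isHom_zero : K.IsHom m 0 := by
  refine ⟨by rw [map_zero]; exact Submodule.zero_mem _, ?_⟩
  rw [map_zero, ← map_zero (DirectSum.of (fun m => K.component m) m)]
  congr 1
  exact Subtype.ext (map_zero _).symm

theorem IsHom.add (hx : K.IsHom m x) (hy : K.IsHom m y) : K.IsHom m (x + y) := by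
  obtain ⟨h1, h2⟩ := hx
  obtain ⟨h3, h4⟩ := hy
  refine ⟨by rw [map_add]; exact Submodule.add_mem _ h1 h3, ?_⟩
  rw [map_add, h2, h4, ← map_add]
  congr 1
  exact Subtype.ext (map_add _ _ _).symm

theorem IsHom.smul (c : R) (hx : K.IsHom m x) : K.IsHom m (c • x) := by
  obtain ⟨h1, h2⟩ := hx
  refine ⟨by rw [map_smul]; exact Submodule.smul_mem _ _ h1, ?_⟩
  rw [map_smul, h2, ← DirectSum.lof_eq_of R, ← DirectSum.lof_eq_of R, ← map_smul]
  congr 1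
  exact Subtype.ext (map_smul _ _ _).symm

theorem IsHom.sub (hx : K.IsHom m x) (hy : K.IsHom m y) : K.IsHom m (x - y) := by
  rw [sub_eq_add_neg, ← neg_one_smul R y]
  exact hx.add (hy.smul _)

theorem IsHom.sum {ι : Type*} (T : Finset ι) {f : ι → FreeAlgebra R K.Gen}
    (h : ∀ i ∈ T, K.IsHom m (f i)) : K.IsHom m (∑ i ∈ T, f i) := by
  classical
  induction T using Finset.induction_on with
  | empty => exact isHom_zero
  | insert i T hi ih =>
    rw [Finset.sum_insert hi]
    exact (h i (Finset.mem_insert_self i T)).add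
      (ih fun j hj => h j (Finset.mem_insert_of_mem hj))

theorem IsHom.mul (hx : K.IsHom m x) (hy : K.IsHom m' y) : K.IsHom (m + m') (x * y) := by
  obtain ⟨h1, h2⟩ := hx
  obtain ⟨h3, h4⟩ := hy
  refine ⟨by rw [map_mul]; exact SetLike.mul_mem_graded h1 h3, ?_⟩
  rw [map_mul, h2, h4, DirectSum.of_mul_of]
  congr 1
  exact Subtype.ext (map_mul _ _ _).symm

theorem isHom_one : K.IsHom 0 (1 : FreeAlgebra R K.Gen) := by
  refine ⟨by rw [map_one]; exact SetLike.GradedOne.one_mem, ?_⟩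
  rw [map_one, DirectSum.one_def]
  congr 1
  exact Subtype.ext (map_one _).symm

theorem isHom_insertPoly {p q : K.Obj} {D : K.Diagram p q} {P T : List (Slice n)} {s : Slice n}
    (h : D.slices = P ++ s :: T) {g : MvPolynomial (Fin n) R}
    (hg : IsWeightedHomogeneous (K.dotDegree p.res) g m') (hm : D.degree + m' = m) :
    K.IsHom m (insertPoly D P.length g) := by
  refine IsHom.sum _ fun e he => IsHom.smul _ (isHom_gen_of_eq ?_)
  rw [degree_addDots h, ← hm]
  congr 1
  have := hg (mem_support_iff.1 he)
  rw [Finsupp.weight_apply, Finsupp.sum_fintype _ _ (by simp)] at this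
  simpa only [nsmul_eq_mul] using this

theorem degree_eq_of_append {p q : K.Obj} {D D' : K.Diagram p q} {P : List (Slice n)}
    {s : Slice n} {T T' : List (Slice n)} (h : D.slices = P ++ s :: T)
    (h' : D'.slices = P ++ s :: T')
    (hT : K.listDegree p.res (s :: T) = K.listDegree p.res (s :: T')) : D.degree = D'.degree := by
  obtain ⟨m, hm⟩ := exists_listDegree_append K p.res P s.pos
  rw [degree_eq_listDegree, degree_eq_listDegree, h, h', hm s.dots, hm s.dots, hT]

theorem degree_resolves_eq {p q : K.Obj} {D D₀ : K.Diagram p q} {k k' : Fin n}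
    {P S T : List (Slice n)} {s t : Slice n} (hr : p.res k = p.res k')
    (h : D.slices = P ++ s :: T)
    (h₀ : K.Resolves D D₀ k k' (P ++ [s]) (t :: S))
    (he : K.crossings p.res s.pos (t.pos ∘ Equiv.swap k k') = ∅)
    (hT : K.listDegree p.res (s :: T) = m + (K.listDegree p.res [s] +
      K.listDegree p.res (t :: S))) :
    D.degree = m + D₀.degree := by
  obtain ⟨m', hm⟩ := exists_listDegree_append K p.res P s.pos
  rw [degree_eq_listDegree D, h, degree_resolves hr h₀ he, hm s.dots, hm s.dots, hT]
  ring

theorem algHom_ext {A : Type*} [Semiring A] [Algebra R A] {f g : K.Alg →ₐ[R] A}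
    (h : ∀ (p q : K.Obj) (D : K.Diagram p q), f D.toAlg = g D.toAlg) : f = g := by
  have : f.comp K.proj = g.comp K.proj := by
    apply FreeAlgebra.hom_ext
    funext x
    exact h x.1 x.2.1 x.2.2
  exact RingQuot.ringQuot_ext' R f g this

/-- The defining relations are homogeneous. -/
theorem exists_isHom (h : K.Rel x y) : ∃ m, K.IsHom m x ∧ K.IsHom m y := by
  cases h with
  | one =>
    exact ⟨0, IsHom.sum _ fun p _ => isHom_gen_of_eq (degree_idempotent p), isHom_one⟩
  | mul F D =>
    exact ⟨_, (isHom_gen F).mul (isHom_gen D), isHom_gen_of_eq (degree_comp F D)⟩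
  | mul_zero F D h => exact ⟨_, (isHom_gen F).mul (isHom_gen D), isHom_zero⟩
  | @straighten p q D D' P S s t z hw h h' hz =>
    obtain ⟨gs, gz, -, -⟩ := D.step_of_slices h
    obtain ⟨-, gt, -, -⟩ := D'.step_of_slices h'
    refine ⟨_, isHom_gen D, isHom_gen_of_eq (degree_eq_of_append h' h ?_)⟩
    rw [listDegree_cons_cons, listDegree_cons_cons, listDegree_zero_dots]
    rcases hz with hz | hz
    · rw [crossDegree_empty hz, crossings_congr_left gs gz hz]; ring
    · rw [crossDegree_empty hz, crossings_congr_right gz gt hz]; ring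
  | @merge p q D D' P S z a b hw h h' =>
    refine ⟨_, isHom_gen D, isHom_gen_of_eq ?_⟩
    obtain ⟨m', hm⟩ := exists_listDegree_append K p.res P z
    rw [degree_eq_listDegree, degree_eq_listDegree, h, h', hm, hm, listDegree_cons_cons,
      crossDegree_empty (crossings_self _ _), add_comm a, listDegree_add_dots]
    ring
  | @commute p q D D' P S s t z z' hw h h' h₁ h₂ =>
    refine ⟨_, isHom_gen D, isHom_gen_of_eq (degree_eq_of_append h' h ?_)⟩
    simp only [listDegree_cons_cons, Pi.zero_apply, Nat.cast_zero, zero_mul,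
      Finset.sum_const_zero, ← h₁, ← h₂]
    ring
  | @dot_pass p q D P S s t h k hk =>
    have h' : D.slices = (P ++ [s]) ++ t :: S := by rw [h]; simp
    have := degree_addDots_single h' k
    rw [List.length_append, List.length_singleton] at this
    exact ⟨_, isHom_gen _, isHom_gen_of_eq (this.trans (degree_addDots_single h k).symm)⟩
  | @dot_left p q D D₀ P S s t h k k' hk hc h₀ =>
    obtain ⟨gs, gt, hs, -⟩ := D.step_of_slices h
    have h' : D.slices = (P ++ [s]) ++ t :: S := by rw [h]; simp
    have e1 := degree_addDots_single h' k
    rw [List.length_append, List.length_singleton] at e1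
    refine ⟨_, isHom_gen _, (isHom_gen_of_eq (e1.trans (degree_addDots_single h k).symm)).add
      (isHom_gen_of_eq ?_)⟩
    rw [degree_addDots_single h, degree_resolves_eq (m := -K.dotDegree p.res k) hk h h₀
      (crossings_swap_eq_empty_of_simple hk gs gt hs hc)]
    · ring
    · rw [listDegree_cons_cons, crossDegree_solid_solid hs hk hc]
      simp only [listDegree]
      ring
  | @dot_right p q D D₀ P S s t h k k' hk hc h₀ =>
    obtain ⟨gs, gt, hs, -⟩ := D.step_of_slices h
    have h' : D.slices = (P ++ [s]) ++ t :: S := by rw [h]; simp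
    have e1 := degree_addDots_single h' k'
    rw [List.length_append, List.length_singleton] at e1
    refine ⟨_, isHom_gen _, (isHom_gen_of_eq ((degree_addDots_single h k').trans e1.symm)).add
      (isHom_gen_of_eq ?_)⟩
    rw [e1, degree_resolves_eq (m := -K.dotDegree p.res k) hk h h₀
      (crossings_swap_eq_empty_of_simple hk gs gt hs hc)]
    · simp only [dotDegree, hk]; ring
    · rw [listDegree_cons_cons, crossDegree_solid_solid hs hk hc]
      simp only [listDegree]
      ring
  | @reid₂ p q D D₀ P S s t z hw h h₀ hst hc =>
    have e1 := D.step_of_slices h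
    have f1 := D₀.step_of_slices h₀
    have key : ∀ a b, K.Cross p.res s.pos z a b → ¬ K.Interact p.res a b := fun a b hab hi => by
      obtain ⟨h1, h2, h3⟩ := hc a b hab
      obtain ⟨-, h4, h5⟩ := hc b a hab.symm
      rcases hi with hi | hi | hi | hi | hi <;> contradiction
    refine ⟨_, isHom_gen D, isHom_gen_of_eq (degree_eq_of_append h₀ h ?_)⟩
    rw [listDegree_cons_cons, listDegree_cons_cons, listDegree_zero_dots, crossDegree_empty hst,
      crossDegree_eq_zero fun c hc => key _ _ (Or.inl hc), crossDegree_eq_zero fun c hc => ?_]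
    · ring
    · exact key _ _ (Or.inr ((crossings_eq_swap e1.1 f1.2.1 hst).1 hc))
  | reid₂_solidSolid D => exact ⟨_, isHom_gen D, isHom_zero⟩
  | @reid₂_ghostSolid p q D D₀ P S s t z hw h h₀ hst k k' e hab hc =>
    have e1 := D.step_of_slices h
    have e2 := D.step_of_slices (P := P ++ [s]) (s := ⟨z, 0⟩) (t := t) (S := S)
      (by rw [h]; simp)
    have hsw := fun a b => @crossings_eq_swap _ _ _ _ _ _ K p.res s.pos t.pos z e1.1 e2.2.1 hst a b
    refine ⟨_, isHom_gen D, isHom_insertPoly h₀ (isWeightedHomogeneous_QPoly hab.res_ne) ?_⟩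
    obtain ⟨m', hm⟩ := exists_listDegree_append K p.res P s.pos
    rw [degree_eq_listDegree, degree_eq_listDegree, h, h₀, hm s.dots, hm s.dots,
      listDegree_cons_cons, listDegree_cons_cons, listDegree_zero_dots, crossDegree_empty hst,
      crossDegree_ghost_solid e1.2.2.1 hab hc, crossDegree_ghost_solid e2.2.2.1 hab]
    · ring
    · rcases hc with hc | hc
      · exact Or.inr ((hsw _ _).2 hc)
      · exact Or.inl ((hsw _ _).2 hc)
  | @reid₂_solidRed p q D D₀ P S s t z hw h h₀ hst k m hab hc =>
    have e1 := D.step_of_slices h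
    have e2 := D.step_of_slices (P := P ++ [s]) (s := ⟨z, 0⟩) (t := t) (S := S)
      (by rw [h]; simp)
    have hsw := fun a b => @crossings_eq_swap _ _ _ _ _ _ K p.res s.pos t.pos z e1.1 e2.2.1 hst a b
    refine ⟨_, isHom_gen D, isHom_gen_of_eq ?_⟩
    obtain ⟨m', hm⟩ := exists_listDegree_append K p.res P s.pos
    rw [degree_addDots_single h₀, degree_eq_listDegree, degree_eq_listDegree, h, h₀, hm s.dots,
      hm s.dots, listDegree_cons_cons, listDegree_cons_cons, listDegree_zero_dots,
      crossDegree_empty hst, crossDegree_solid_red e1.2.2.1 hab hc,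
      crossDegree_solid_red e2.2.2.1 hab]
    · simp only [dotDegree]; ring
    · rcases hc with hc | hc
      · exact Or.inr ((hsw _ _).2 hc)
      · exact Or.inl ((hsw _ _).2 hc)
  | @braid p q D D' P S s t z₁ z₂ z₁' z₂' hw h h' h₁ h₂ h₃ hc =>
    refine ⟨_, isHom_gen D, isHom_gen_of_eq (degree_eq_of_append h' h ?_)⟩
    simp only [listDegree_cons_cons, Pi.zero_apply, Nat.cast_zero, zero_mul,
        Finset.sum_const_zero, ← h₁, ← h₂, ← h₃]
    ring
  | @braid_ghostSolidGhost p q D D' D₀ P S s t z₁ z₂ z₁' z₂' hw h h' h₁ h₂ h₃ k k' k'' e hab hcb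
      h_ab h_ac h_bc h₀ =>
    have H := Diagram.hexagon h h' h₁ h₂ h₃
    have hr : p.res k = p.res k'' := hab.owner_eq.symm.trans hcb.owner_eq
    have hkk : (Str.solid k, Str.solid k'') ∈ K.crossings p.res z₁ z₂ :=
      ⟨trivial, trivial, by simpa [strPos] using h_ac.2.2.1, by simpa [strPos] using h_ac.2.2.2⟩
    have he := H.crossings_swap (a := Str.ghost k e) (c := Str.ghost k'' e) hr rfl rfl rfl
      h_ab h_ac h_bc
    have h₀' : D₀.slices = P ++ s :: (t :: S).map (Slice.relabel (Equiv.swap k k'')) := by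
      rw [h₀.2]; simp
    refine ⟨_, isHom_gen D, (isHom_gen_of_eq (degree_eq_of_append h' h ?_)).sub
      (isHom_insertPoly h₀' (isWeightedHomogeneous_QPoly₃ hab.res_ne hr) ?_)⟩
    · simp only [listDegree_cons_cons, Pi.zero_apply, Nat.cast_zero, zero_mul,
        Finset.sum_const_zero, ← h₁, ← h₂, ← h₃]
      ring
    · rw [degree_resolves_eq hr h h₀ he, add_comm]
      simp only [listDegree_cons_cons, Pi.zero_apply, Nat.cast_zero, zero_mul,
        Finset.sum_const_zero,
        crossDegree_ghost_solid H.s₁ hab (Or.inl h_ab), crossDegree_solid_solid H.s₂ hr hkk,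
        crossDegree_ghost_solid H.s₃ hcb (Or.inr h_bc), ← hr]
      simp only [listDegree, dotDegree]
      ring
  | @braid_solidGhostSolid p q D D' D₀ P S s t z₁ z₂ z₁' z₂' hw h h' h₁ h₂ h₃ k k' k'' e hba hbc
      h_ab h_ac h_bc h₀ =>
    have H := Diagram.hexagon h h' h₁ h₂ h₃
    have hr : p.res k = p.res k'' := hba.partner_eq.symm.trans hbc.partner_eq
    have he := H.crossings_swap (a := Str.solid k) (c := Str.solid k'') hr rfl rfl rfl
      h_ab h_ac h_bc
    have h₀' : D₀.slices = P ++ s :: (t :: S).map (Slice.relabel (Equiv.swap k k'')) := by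
      rw [h₀.2]; simp
    refine ⟨_, isHom_gen D, (isHom_gen_of_eq (degree_eq_of_append h' h ?_)).sub
      (isHom_insertPoly h₀' (isWeightedHomogeneous_QPoly₃ hba.res_ne.symm hr) ?_)⟩
    · simp only [listDegree_cons_cons, Pi.zero_apply, Nat.cast_zero, zero_mul,
        Finset.sum_const_zero, ← h₁, ← h₂, ← h₃]
      ring
    -- The ghost belongs to `k'`, while the degree of the error polynomial is expressed through the
    -- residue of `k`; symmetrizability `d_i a_ij = d_j a_ji` reconciles the two.
    · rw [degree_resolves_eq hr h h₀ he, add_comm]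
      simp only [listDegree_cons_cons, Pi.zero_apply, Nat.cast_zero, zero_mul,
        Finset.sum_const_zero,
        crossDegree_ghost_solid H.s₁ hba (Or.inr h_ab), crossDegree_solid_solid H.s₂ hr h_ac,
        crossDegree_ghost_solid H.s₃ hbc (Or.inl h_bc), ← hr, K.quiver.symm (p.res k')]
      simp only [listDegree, dotDegree]
      ring
  | @braid_solidRedSolid p q D D' D₀ P S s t z₁ z₂ z₁' z₂' hw h h' h₁ h₂ h₃ k k'' m hab hcb
      h_ab h_ac h_bc h₀ =>
    have H := Diagram.hexagon h h' h₁ h₂ h₃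
    have hr : p.res k = p.res k'' := hab.res_eq.trans hcb.res_eq.symm
    have he := H.crossings_swap (a := Str.solid k) (c := Str.solid k'') hr rfl rfl rfl
      h_ab h_ac h_bc
    refine ⟨_, isHom_gen D, (isHom_gen_of_eq (degree_eq_of_append h' h ?_)).add
      (isHom_gen_of_eq ?_)⟩
    · simp only [listDegree_cons_cons, Pi.zero_apply, Nat.cast_zero, zero_mul,
        Finset.sum_const_zero, ← h₁, ← h₂, ← h₃]
      ring
    · rw [degree_resolves_eq (m := 0) hr h h₀ he, zero_add]
      simp only [listDegree_cons_cons, Pi.zero_apply, Nat.cast_zero, zero_mul,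
        Finset.sum_const_zero,
        crossDegree_solid_red H.s₁ hab (Or.inl h_ab), crossDegree_solid_solid H.s₂ hr h_ac,
        crossDegree_solid_red H.s₃ hcb (Or.inr h_bc), ← hr]
      simp only [listDegree, dotDegree]
      ring

variable (K) in
/-- The decomposition into homogeneous components. -/
def decomposeAlg : K.Alg →ₐ[R] ⨁ m, K.component m :=
  RingQuot.liftAlgHom R ⟨K.freeDecompose, fun x y h => by
    obtain ⟨m, ⟨h1, h2⟩, h3, h4⟩ := exists_isHom h
    rw [h2, h4]
    congr 1
    exact Subtype.ext (proj_rel h)⟩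

theorem decomposeAlg_toAlg {p q : K.Obj} (D : K.Diagram p q) :
    K.decomposeAlg D.toAlg = DirectSum.of (fun m => K.component m) D.degree
      ⟨D.toAlg, toAlg_mem_component D⟩ :=
  (RingQuot.liftAlgHom_mkAlgHom_apply R _ _ _).trans (isHom_gen D).2

variable (K) in
/-- The weighted KLRW algebra is graded. -/
theorem nonempty_gradedAlgebra : Nonempty (GradedAlgebra K.component) :=
  -- Both composites with the summation map are determined by their values on diagrams, which
  -- generate the algebra and span each component.
  ⟨GradedAlgebra.ofAlgHom K.component K.decomposeAlg
    (by
      refine algHom_ext fun p q D => ?_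
      rw [AlgHom.comp_apply, decomposeAlg_toAlg, DirectSum.coeAlgHom_of]
      rfl)
    (by
      rintro m ⟨x, hx⟩
      have key : ∀ x (hx : x ∈ K.component m),
          K.decomposeAlg x = DirectSum.of (fun m => K.component m) m ⟨x, hx⟩ := by
        intro x hx
        refine Submodule.span_induction (p := fun x hx =>
          K.decomposeAlg x = DirectSum.of (fun m => K.component m) m ⟨x, hx⟩) ?_ ?_ ?_ ?_ hx
        · rintro _ ⟨p, q, D, rfl, rfl⟩
          exact decomposeAlg_toAlg D
        · rw [map_zero]
          exact (map_zero _).symm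
        · intro x y hx hy h1 h2
          rw [map_add, h1, h2, ← map_add]
          rfl
        · intro c x hx h
          rw [map_smul, h, ← DirectSum.lof_eq_of R, ← DirectSum.lof_eq_of R, ← map_smul]
          rfl
      exact key x hx)⟩

end Grading

end Datum

namespace Datum

/-! ### Counting crossings -/

section Counting

variable {R : Type*} [CommRing R] {I E : Type*} {n l : ℕ} {K : Datum R I E n l}
  {res : Fin n → I} {x y z : Fin n → ℝ}

variable (K) in
/-- The number of crossings on the way from one slice to another one. -/
def numCross (res : Fin n → I) (z z' : Fin n → ℝ) : ℕ := (K.crossings res z z').ncard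

variable (K) in
/-- The total number of crossings in a sequence of slices. -/
def totalCross (res : Fin n → I) : List (Fin n → ℝ) → ℕ
  | [] => 0
  | [_] => 0
  | x :: y :: L => K.numCross res x y + totalCross res (y :: L)

theorem totalCross_cons_cons (x y : Fin n → ℝ) (L : List (Fin n → ℝ)) :
    K.totalCross res (x :: y :: L) = K.numCross res x y + K.totalCross res (y :: L) := rfl

theorem numCross_self (z : Fin n → ℝ) : K.numCross res z z = 0 := by
  rw [numCross, crossings_self, Set.ncard_empty]

theorem numCross_eq_zero_iff : K.numCross res x y = 0 ↔ K.crossings res x y = ∅ :=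
  Set.ncard_eq_zero (finite_crossings ..)

/-- A pair in different orders at the two ends must be in different orders across one of the two
halves. The number of crossings thus behaves like the number of hyperplanes that separate two
chambers. -/
theorem numCross_triangle (hy : K.Generic res y) :
    K.numCross res x z ≤ K.numCross res x y + K.numCross res y z := by
  refine le_trans (Set.ncard_le_ncard (fun c hc => mem_crossings_or hy hc) ?_)
    (Set.ncard_union_le _ _)
  exact (finite_crossings ..).union (finite_crossings ..)

/-- The case of equality in the triangle inequality: no pair crosses and then crosses back. -/
theorem numCross_add (hx : K.Generic res x) (hy : K.Generic res y) (hz : K.Generic res z)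
    (h : ∀ a b, K.Active res a → K.Active res b →
      ¬ (K.strPos x a < K.strPos x b ∧ K.strPos y b < K.strPos y a ∧
        K.strPos z a < K.strPos z b)) :
    K.numCross res x y + K.numCross res y z = K.numCross res x z := by
  rw [numCross, numCross, numCross, ← Set.ncard_union_eq ?_ (finite_crossings ..)
    (finite_crossings ..)]
  · congr 1
    refine Set.Subset.antisymm ?_ fun c hc => mem_crossings_or hy hc
    rintro ⟨a, b⟩ (⟨h1, h2, h3, h4⟩ | ⟨h1, h2, h3, h4⟩)
    · refine ⟨h1, h2, h3, ?_⟩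
      rcases lt_trichotomy (K.strPos z a) (K.strPos z b) with h5 | h5 | h5
      · exact absurd ⟨h3, h4, h5⟩ (h a b h1 h2)
      · obtain rfl : a = b := hz a b h1 h2 h5
        exact absurd h3 (lt_irrefl _)
      · exact h5
    · refine ⟨h1, h2, ?_, h4⟩
      rcases lt_trichotomy (K.strPos x a) (K.strPos x b) with h5 | h5 | h5
      · exact h5
      · obtain rfl : a = b := hx a b h1 h2 h5
        exact absurd h3 (lt_irrefl _)
      · exact absurd ⟨h5, h3, h4⟩ (h b a h2 h1)
  · rw [Set.disjoint_left]
    rintro ⟨a, b⟩ ⟨_, _, _, h4⟩ ⟨_, _, h5, _⟩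
    exact lt_asymm h4 h5

theorem numCross_comp {w : Equiv.Perm (Fin n)} {r r' : Fin n → I} (h : ∀ k, r' (w k) = r k) :
    K.numCross r (x ∘ w) (y ∘ w) = K.numCross r' x y := by
  rw [numCross, numCross]
  refine Set.ncard_congr (fun c _ => (Str.rename w c.1, Str.rename w c.2)) ?_ ?_ ?_
  · exact fun c hc => (mem_crossings_comp h).1 hc
  · rintro ⟨a, b⟩ ⟨a', b'⟩ - - he
    simp only [Prod.mk.injEq] at he
    rw [Str.rename_injective w he.1, Str.rename_injective w he.2]
  · rintro ⟨a, b⟩ hab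
    obtain ⟨a, rfl⟩ := exists_rename w a
    obtain ⟨b, rfl⟩ := exists_rename w b
    exact ⟨(a, b), (mem_crossings_comp h).2 hab, rfl⟩

theorem totalCross_map_comp {w : Equiv.Perm (Fin n)} {r r' : Fin n → I}
    (h : ∀ k, r' (w k) = r k) (L : List (Fin n → ℝ)) :
    K.totalCross r (L.map fun z => z ∘ w) = K.totalCross r' L := by
  induction L with
  | nil => rfl
  | cons s L ih =>
    cases L with
    | nil => rfl
    | cons t L =>
      simp only [List.map_cons, totalCross_cons_cons] at ih ⊢
      rw [ih, numCross_comp h]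

theorem numCross_le_totalCross {L : List (Fin n → ℝ)}
    (hL : ∀ z ∈ x :: L, K.Generic res z) (hy : (x :: L).getLast? = some y) :
    K.numCross res x y ≤ K.totalCross res (x :: L) := by
  induction L generalizing x with
  | nil =>
    obtain rfl : x = y := by simpa using hy
    rw [numCross_self]; exact Nat.zero_le _
  | cons z L ih =>
    rw [List.getLast?_cons_cons] at hy
    refine (numCross_triangle (hL z (by simp))).trans ?_
    rw [totalCross_cons_cons]
    exact Nat.add_le_add_left (ih (fun u hu => hL u (List.mem_cons_of_mem _ hu)) hy) _

/-- If no two strings cross twice, then the total number of crossings is minimal. -/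
theorem totalCross_eq_numCross {L : List (Fin n → ℝ)}
    (hL : ∀ z ∈ x :: L, K.Generic res z) (hy : (x :: L).getLast? = some y)
    (h : ∀ s₁ s₂ s₃, [s₁, s₂, s₃].Sublist (x :: L) → ∀ a b, K.Active res a → K.Active res b →
      ¬ (K.strPos s₁ a < K.strPos s₁ b ∧ K.strPos s₂ b < K.strPos s₂ a ∧
        K.strPos s₃ a < K.strPos s₃ b)) :
    K.totalCross res (x :: L) = K.numCross res x y := by
  induction L generalizing x with
  | nil =>
    obtain rfl : x = y := by simpa using hy
    rw [numCross_self]; rfl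
  | cons z L ih =>
    rw [List.getLast?_cons_cons] at hy
    rw [totalCross_cons_cons, ih (fun u hu => hL u (List.mem_cons_of_mem _ hu)) hy
      fun s₁ s₂ s₃ hs => h s₁ s₂ s₃ (hs.trans (List.sublist_cons_self _ _))]
    have hyL : y ∈ z :: L := List.mem_of_getLast? hy
    refine numCross_add (hL x (by simp)) (hL z (by simp)) (hL y (List.mem_cons_of_mem _ hyL)) ?_
    rcases List.mem_cons.1 hyL with rfl | hyL'
    · rintro a b _ _ ⟨_, h1, h2⟩
      exact lt_asymm h1 h2
    · refine h x z y (List.Sublist.cons_cons _ (List.Sublist.cons_cons _ ?_))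
      exact List.singleton_sublist.2 hyL'

/-- As no pair crosses twice, the length is the minimum allowed by the end points and the
permutation. It is therefore independent of the chosen diagram, and it orders the permutations in
the triangularity argument. -/
theorem Diagram.IsPermutationDiagram.totalCross_eq {p q : K.Obj} {D : K.Diagram p q}
    {w : Equiv.Perm (Fin n)} (hD : D.IsPermutationDiagram w) :
    K.totalCross p.res (D.slices.map Slice.pos) = K.numCross p.res p.pos (q.pos ∘ w) := by
  obtain ⟨h1, -, h2⟩ := hD
  have hb := D.bottom
  have ht := D.top
  have hg := D.generic
  cases hs : D.slices with
  | nil => rw [hs] at hb; simp at hb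
  | cons s T =>
    rw [hs] at hb ht hg h2
    have hsp : s.pos = p.pos := by simpa using hb
    rw [List.map_cons] at ht hg ⊢
    rw [totalCross_eq_numCross hg ht, h1, hsp]
    intro s₁ s₂ s₃ hsub
    rw [← List.map_cons, List.sublist_map_iff] at hsub
    obtain ⟨L', hL', he⟩ := hsub
    match L', he with
    | [u₁, u₂, u₃], he =>
      simp only [List.map_cons, List.map_nil, List.cons.injEq, and_true] at he
      obtain ⟨rfl, rfl, rfl⟩ := he
      exact h2 _ _ _ hL'

end Counting

/-! ### Linear independence of the operators -/

section Independence

open MvPolynomial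

variable {R : Type*} [CommRing R] {I E : Type*} {n l : ℕ} {K : Datum R I E n l}
  {res : Fin n → I} {x y z : Fin n → ℝ}

/-- Different residues force `k ≠ k'`, so the substitution of variables is a renaming along an
injection and loses nothing. -/
theorem QPoly_ne_zero {k k' : Fin n} (h : res k ≠ res k') : K.QPoly res k k' ≠ 0 := by
  have h1 : K.QPoly res k k' = rename ![k, k'] (K.Q (res k) (res k')) := by
    rw [QPoly]
    refine DFunLike.congr_fun (f := aeval ![MvPolynomial.X k, MvPolynomial.X k'])
      (MvPolynomial.algHom_ext fun i => ?_) (K.Q (res k) (res k'))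
    fin_cases i <;> simp
  rw [h1]
  refine (map_ne_zero_iff _ (rename_injective _ ?_)).2 (K.Q_ne_zero _ _ h)
  have : k ≠ k' := fun e => h (by rw [e])
  intro i j hij
  fin_cases i <;> fin_cases j <;> simp_all [eq_comm]

variable [IsDomain R]

theorem totalWeight_ne_zero (hs : K.Simple res x y) :
    K.totalWeight res (K.crossings res x y) ≠ 0 := by
  by_cases h : ∃ c ∈ K.crossings res x y, K.Interact res c.1 c.2
  · obtain ⟨⟨a, b⟩, hc, hi⟩ := h
    rw [totalWeight_eq hs hc hi]
    cases a <;> cases b <;> simp only [weight] <;> try exact one_ne_zero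
    · split_ifs
      · exact X_ne_zero _
      · exact one_ne_zero
    · split_ifs with h1
      · refine QPoly_ne_zero ?_
        rw [← h1, ← show K.owner _ = res _ from hc.1]
        exact owner_ne_partner _
      · exact one_ne_zero
  · push Not at h
    rw [totalWeight_eq_one h]
    exact one_ne_zero

theorem dotPoly_ne_zero (a : Fin n → ℕ) : dotPoly R a ≠ 0 :=
  Finset.prod_ne_zero_iff.2 fun k _ => pow_ne_zero _ (X_ne_zero k)

/-- The operator of a sequence of slices is a linear combination of permutations of the variables
with coefficients in the field of rational functions, and the order of crossings bounds the
permutations that occur. -/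
theorem exists_opL_eq_sum {T : List (Slice n)} {s : Slice n} {b : Fin n → ℝ}
    (hg : ∀ z ∈ (s :: T).map Slice.pos, K.Generic res z)
    (hs : ((s :: T).map Slice.pos).IsChain (K.Simple res))
    (hb : ((s :: T).map Slice.pos).getLast? = some b) :
    ∃ (g : MvPolynomial (Fin n) R) (c : Equiv.Perm (Fin n) → MvPolynomial (Fin n) R), g ≠ 0 ∧
      (∀ f, g * K.opL res (s :: T) f = ∑ u, c u * rename u f) ∧
      (∀ u, c u ≠ 0 → (∀ k, res (u k) = res k) ∧
        (u = 1 ∨ K.numCross res s.pos (b ∘ u) < K.totalCross res ((s :: T).map Slice.pos))) ∧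
      (K.numCross res s.pos b = K.totalCross res ((s :: T).map Slice.pos) → c 1 ≠ 0) := by
  classical
  induction T generalizing s with
  | nil =>
    refine ⟨1, Pi.single 1 (dotPoly R s.dots), one_ne_zero, fun f => ?_, fun u hu => ?_,
      fun _ => ?_⟩
    · rw [Finset.sum_eq_single 1]
      · simp [opL_singleton]
      · intro u _ hu; simp [hu]
      · simp
    · have : u = 1 := by by_contra h; exact hu (by simp [h])
      subst this
      exact ⟨fun _ => rfl, Or.inl rfl⟩
    · rw [Pi.single_eq_same]; exact dotPoly_ne_zero _
  | cons t T ih =>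
    simp only [List.map_cons, List.getLast?_cons_cons, List.isChain_cons_cons] at hg hs hb ih ⊢
    have hg' : ∀ z ∈ t.pos :: T.map Slice.pos, K.Generic res z := fun z hz =>
      hg z (List.mem_cons_of_mem _ hz)
    obtain ⟨g, c, g0, h1, h2, h3⟩ := ih hg' hs.2 hb
    have gs : K.Generic res s.pos := hg _ (by simp)
    have gt : K.Generic res t.pos := hg' _ (by simp)
    have gb : K.Generic res b := hg' _ (List.mem_of_getLast? hb)
    have hle : K.numCross res t.pos b ≤ K.totalCross res (t.pos :: T.map Slice.pos) :=
      numCross_le_totalCross hg' hb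
    rw [totalCross_cons_cons]
    have old : ∀ u, c u ≠ 0 → (∀ k, res (u k) = res k) ∧
        (u = 1 ∨ K.numCross res s.pos (b ∘ u) < K.numCross res s.pos t.pos +
          K.totalCross res (t.pos :: T.map Slice.pos)) := fun u hu => by
      refine ⟨(h2 u hu).1, (h2 u hu).2.imp_right fun h => ?_⟩
      have := numCross_triangle (x := s.pos) (z := b ∘ u) gt
      omega
    have new : K.numCross res s.pos b = K.numCross res s.pos t.pos +
          K.totalCross res (t.pos :: T.map Slice.pos) → c 1 ≠ 0 := fun h => by
      refine h3 (le_antisymm hle ?_)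
      have := numCross_triangle (x := s.pos) (z := b) gt
      omega
    rcases stepOp_cases K res s.pos t.pos with ⟨k, k', hr, hk⟩ | hm
    · have hne := solid_ne hk
      set σ := Equiv.swap k k' with hσ
      have hσσ : σ * σ = 1 := Equiv.swap_mul_self k k'
      have hrσ : ∀ j, res (σ j) = res j := res_swap hr
      have hempty : K.numCross res s.pos (t.pos ∘ σ) = 0 :=
        numCross_eq_zero_iff.2 (crossings_swap_eq_empty_of_simple hr gs gt hs.1 hk)
      have hpos : 0 < K.numCross res s.pos t.pos := by
        rw [Nat.pos_iff_ne_zero, Ne, numCross_eq_zero_iff]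
        exact Set.nonempty_iff_ne_empty.1 ⟨_, hk⟩
      -- Resolving the crossing of the first step costs no crossings, so whatever is reached from
      -- `t` through `u * σ` is reached from `s` through `u` at no greater length.
      have tri : ∀ u : Equiv.Perm (Fin n),
          K.numCross res s.pos (b ∘ u) ≤ K.numCross res t.pos (b ∘ (u * σ : Equiv.Perm _)) := by
        intro u
        have e1 := numCross_triangle (x := s.pos) (z := b ∘ u)
          (gt.relabel (w := σ) (r := res) hrσ)
        have e2 : K.numCross res ((t.pos ∘ σ) ∘ σ) ((b ∘ u) ∘ σ) =
            K.numCross res (t.pos ∘ σ) (b ∘ u) := numCross_comp hrσ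
        have e3 : (t.pos ∘ σ) ∘ σ = t.pos := by
          funext j; simp [hσ]
        rw [e3] at e2
        rw [hempty, zero_add, ← e2] at e1
        exact e1
      -- Applying `u` to the divided difference produces the denominator `X (u k) - X (u k')`. The
      -- product over all permutations is a common denominator, and `P u` is the cofactor of the
      -- factor belonging to `u`.
      set P : Equiv.Perm (Fin n) → MvPolynomial (Fin n) R := fun u =>
        ∏ v ∈ Finset.univ.erase u, (MvPolynomial.X (v k) - MvPolynomial.X (v k')) with hP
      have hX : ∀ u : Equiv.Perm (Fin n),
          (MvPolynomial.X (u k) - MvPolynomial.X (u k') : MvPolynomial (Fin n) R) ≠ 0 :=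
        fun u => X_sub_X_ne_zero (u.injective.ne hne)
      have hP0 : ∀ u, P u ≠ 0 := fun u => Finset.prod_ne_zero_iff.2 fun v _ => hX v
      have hPX : ∀ u, (∏ v : Equiv.Perm (Fin n), (MvPolynomial.X (v k) - MvPolynomial.X (v k') :
          MvPolynomial (Fin n) R)) = P u * (MvPolynomial.X (u k) - MvPolynomial.X (u k')) :=
        fun u => (Finset.prod_erase_mul _ _ (Finset.mem_univ u)).symm
      -- The divided difference contributes to `u` from two sides: from `u` through the identity,
      -- and from `u * σ` through the swap with a minus sign.
      refine ⟨(∏ v : Equiv.Perm (Fin n), (MvPolynomial.X (v k) - MvPolynomial.X (v k'))) * g,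
        fun u => (c u * P u - c (u * σ) * P (u * σ)) * rename u (dotPoly R s.dots),
        mul_ne_zero (Finset.prod_ne_zero_iff.2 fun v _ => hX v) g0, fun f => ?_, fun u hu => ?_,
        fun h => ?_⟩
      · rw [opL_cons_cons, mul_assoc, h1, stepOp_divided hs.1 hr hk, Finset.mul_sum]
        have key : ∀ u, (∏ v : Equiv.Perm (Fin n), (MvPolynomial.X (v k) - MvPolynomial.X (v k') :
            MvPolynomial (Fin n) R)) * (c u * rename u (divided k k' (dotPoly R s.dots * f))) =
            c u * P u * rename u (dotPoly R s.dots * f) -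
              c u * P u * rename (u * σ) (dotPoly R s.dots * f) := by
          intro u
          have := congrArg (rename u) (mul_divided hne (dotPoly R s.dots * f))
          rw [map_mul, map_sub, map_sub, rename_X, rename_X, rename_rename] at this
          rw [hPX u, Equiv.Perm.coe_mul]
          linear_combination c u * P u * this
        rw [Finset.sum_congr rfl fun u _ => key u, Finset.sum_sub_distrib,
          ← Equiv.sum_comp (Equiv.mulRight σ) fun u =>
            c u * P u * rename (u * σ) (dotPoly R s.dots * f), ← Finset.sum_sub_distrib]
        refine Finset.sum_congr rfl fun u _ => ?_
        simp only [Equiv.coe_mulRight, mul_assoc u, hσσ, mul_one, map_mul]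
        ring
      · have hu' : c u ≠ 0 ∨ c (u * σ) ≠ 0 := by
          by_contra h
          push Not at h
          exact hu (by simp [h.1, h.2])
        rcases hu' with hu' | hu'
        · exact old u hu'
        · obtain ⟨h4, h5⟩ := h2 _ hu'
          refine ⟨fun j => ?_, Or.inr ?_⟩
          · have := h4 (σ j)
            rw [hrσ, Equiv.Perm.mul_apply] at this
            simpa [hσ] using this
          · have h6 := tri u
            rcases h5 with h5 | h5
            · rw [h5, Equiv.Perm.coe_one, Function.comp_id] at h6
              omega
            · omega
      -- A non-zero coefficient at `σ` would give, by `tri`, a way from `s` to `b` shorter than the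
      -- sequence, which is minimal. So nothing cancels the leading coefficient.
      · have hσ1 : c σ = 0 := by
          by_contra h4
          rcases (h2 _ h4).2 with h5 | h5
          · exact hne (Equiv.swap_eq_one_iff.1 h5)
          · have h6 := tri 1
            rw [one_mul, Equiv.Perm.coe_one, Function.comp_id] at h6
            omega
        simp only [one_mul, hσ1, zero_mul, sub_zero]
        refine mul_ne_zero (mul_ne_zero (new h) (hP0 1)) ?_
        exact (map_ne_zero_iff _ (rename_injective _ (Equiv.injective _))).2 (dotPoly_ne_zero _)
    · set m := K.totalWeight res (K.crossings res s.pos t.pos) * dotPoly R s.dots with hm'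
      have hm0 : ∀ u : Equiv.Perm (Fin n), rename u m ≠ 0 := fun u =>
        (map_ne_zero_iff _ (rename_injective _ (Equiv.injective _))).2
          (mul_ne_zero (totalWeight_ne_zero hs.1) (dotPoly_ne_zero _))
      refine ⟨g, fun u => c u * rename u m, g0, fun f => ?_, fun u hu => old u ?_, fun h => ?_⟩
      · rw [opL_cons_cons, h1, stepOp_mul hm]
        refine Finset.sum_congr rfl fun u _ => ?_
        rw [LinearMap.mulLeft_apply, ← mul_assoc, ← hm', map_mul, mul_assoc]
      · exact left_ne_zero_of_mul hu
      · exact mul_ne_zero (new h) (hm0 1)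

/-- Triangularity. It is `exists_opL_eq_sum` for a sequence of minimal length, transported by the
final renumbering, so that the leading permutation becomes `w` instead of the identity. -/
theorem exists_op_eq_sum {p q : K.Obj} {D : K.Diagram p q} {w : Equiv.Perm (Fin n)}
    (hD : D.IsPermutationDiagram w) :
    ∃ (g : MvPolynomial (Fin n) R) (c : Equiv.Perm (Fin n) → MvPolynomial (Fin n) R), g ≠ 0 ∧
      (∀ f, g * D.op f = ∑ u, c u * rename u f) ∧ c w ≠ 0 ∧
      (∀ u, c u ≠ 0 → u = w ∨
        K.numCross p.res p.pos (q.pos ∘ u) < K.numCross p.res p.pos (q.pos ∘ w)) := by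
  have hcount := hD.totalCross_eq
  have hb := D.bottom
  have ht := D.top
  have hg := D.generic
  have hs := D.simple
  obtain ⟨s, T, hsl, hsp⟩ := D.exists_slices_eq_cons
  rw [hsl] at hb ht hg hs hcount
  obtain ⟨g, c, h0, h1, h2, h3⟩ := exists_opL_eq_sum hg hs ht
  have hw : D.perm = w := hD.1
  subst hw
  rw [hsp, hcount] at h3
  rw [hcount, hsp] at h2
  have hinj : Function.Injective (rename D.perm : MvPolynomial (Fin n) R →ₐ[R] _) :=
    rename_injective _ (Equiv.injective _)
  refine ⟨rename D.perm g, fun u => rename D.perm (c (D.perm⁻¹ * u)),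
    (map_ne_zero_iff _ hinj).2 h0, fun f => ?_, ?_, fun u hu => ?_⟩
  · rw [Diagram.op_apply, hsl, ← map_mul, h1, map_sum,
      ← Equiv.sum_comp (Equiv.mulLeft D.perm) fun u =>
        rename D.perm (c (D.perm⁻¹ * u)) * rename u f]
    refine Finset.sum_congr rfl fun u _ => ?_
    simp only [Equiv.coe_mulLeft, inv_mul_cancel_left, map_mul, rename_rename,
      Equiv.Perm.coe_mul]
  · simp only [inv_mul_cancel]
    exact (map_ne_zero_iff _ hinj).2 (h3 rfl)
  · have := h2 _ ((map_ne_zero_iff _ hinj).1 hu)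
    rcases this.2 with h | h
    · left
      rwa [inv_mul_eq_one, eq_comm] at h
    · right
      convert h using 2
      funext k
      simp

/-- The homomorphism that permutes the variables. -/
def renameHom (R : Type*) [CommRing R] (u : Equiv.Perm (Fin n)) :
    MvPolynomial (Fin n) R →* MvPolynomial (Fin n) R :=
  (rename u : MvPolynomial (Fin n) R →ₐ[R] MvPolynomial (Fin n) R)

theorem renameHom_injective :
    Function.Injective (renameHom R : Equiv.Perm (Fin n) → _) := by
  intro u v huv
  refine Equiv.ext fun k => ?_
  have := DFunLike.congr_fun huv (MvPolynomial.X k)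
  have h2 : (MvPolynomial.X (u k) : MvPolynomial (Fin n) R) = MvPolynomial.X (v k) := by
    rw [← rename_X, ← rename_X]; exact this
  exact X_injective h2

/-- Dedekind's theorem on the independence of characters: permutations of the variables are distinct
multiplicative maps into a domain. -/
theorem linearIndependent_renameHom :
    LinearIndependent (MvPolynomial (Fin n) R) (fun (u : Equiv.Perm (Fin n)) =>
      (renameHom R u : MvPolynomial (Fin n) R → MvPolynomial (Fin n) R)) :=
  (linearIndependent_monoidHom (MvPolynomial (Fin n) R) (MvPolynomial (Fin n) R)).comp
    (renameHom R) renameHom_injective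

/-- The operators of the permutation diagrams with fixed end points are linearly independent over
the polynomials. -/
theorem eq_zero_of_sum_op_eq_zero {p q : K.Obj} {W : Finset (Equiv.Perm (Fin n))}
    {D : Equiv.Perm (Fin n) → K.Diagram p q} (hD : ∀ w ∈ W, (D w).IsPermutationDiagram w)
    {h : Equiv.Perm (Fin n) → MvPolynomial (Fin n) R}
    (h0 : ∀ f, ∑ w ∈ W, (D w).op (h w * f) = 0) : ∀ w ∈ W, h w = 0 := by
  classical
  by_contra hne
  push Not at hne
  -- Among the permutations with non-zero coefficient, one of maximal length is taken; no other
  -- operator in the sum can contain it.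
  obtain ⟨w₀, hw₀, hmax⟩ := Finset.exists_max_image (W.filter fun w => h w ≠ 0)
    (fun w => K.numCross p.res p.pos (q.pos ∘ w))
    (by obtain ⟨w, hw, hw'⟩ := hne; exact ⟨w, Finset.mem_filter.2 ⟨hw, hw'⟩⟩)
  rw [Finset.mem_filter] at hw₀
  have hall : ∀ w, ∃ (g : MvPolynomial (Fin n) R) (c : Equiv.Perm (Fin n) → MvPolynomial (Fin n) R),
      g ≠ 0 ∧ (w ∈ W → (∀ f, g * (D w).op f = ∑ u, c u * rename u f) ∧ c w ≠ 0 ∧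
      (∀ u, c u ≠ 0 → u = w ∨
        K.numCross p.res p.pos (q.pos ∘ u) < K.numCross p.res p.pos (q.pos ∘ w))) := by
    intro w
    by_cases hw : w ∈ W
    · obtain ⟨g, c, h1, h2, h3, h4⟩ := exists_op_eq_sum (hD w hw)
      exact ⟨g, c, h1, fun _ => ⟨h2, h3, h4⟩⟩
    · exact ⟨1, 0, one_ne_zero, fun h => absurd h hw⟩
  choose g c hg hc using hall
  -- The sum is multiplied by the product of all denominators; `G w` is what remains after
  -- cancelling that of `w`.
  set G : Equiv.Perm (Fin n) → MvPolynomial (Fin n) R := fun w => ∏ v ∈ W.erase w, g v with hG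
  have hG0 : ∀ w, G w ≠ 0 := fun w => Finset.prod_ne_zero_iff.2 fun v _ => hg v
  have key : ∑ u, (∑ w ∈ W, G w * c w u * rename u (h w)) •
      (renameHom R u : MvPolynomial (Fin n) R → MvPolynomial (Fin n) R) = 0 := by
    funext f
    have e1 : (∏ v ∈ W, g v) * ∑ w ∈ W, (D w).op (h w * f) = 0 := by rw [h0, mul_zero]
    rw [Finset.mul_sum] at e1
    have e2 : ∀ w ∈ W, (∏ v ∈ W, g v) * (D w).op (h w * f) =
        ∑ u, G w * c w u * rename u (h w) * rename u f := by
      intro w hw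
      rw [← Finset.prod_erase_mul _ _ hw, mul_assoc, (hc w hw).1, Finset.mul_sum]
      refine Finset.sum_congr rfl fun u _ => ?_
      rw [map_mul]
      ring
    rw [Finset.sum_congr rfl e2, Finset.sum_comm] at e1
    simp only [Finset.sum_apply, Pi.smul_apply, smul_eq_mul, Finset.sum_mul, Pi.zero_apply]
    exact e1
  -- In the coefficient of `w₀` only the summand of `w₀` survives: any other contributing `w` would
  -- be strictly longer than `w₀`.
  have h1 := Fintype.linearIndependent_iff.1 linearIndependent_renameHom _ key w₀
  rw [Finset.sum_eq_single w₀] at h1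
  · refine absurd h1 (mul_ne_zero (mul_ne_zero (hG0 _) (hc _ hw₀.1).2.1) ?_)
    exact (map_ne_zero_iff _ (rename_injective _ (Equiv.injective _))).2 hw₀.2
  · intro w hw hne'
    by_cases hw' : h w = 0
    · rw [hw', map_zero, mul_zero]
    · by_cases hcw : c w w₀ = 0
      · rw [hcw, mul_zero, zero_mul]
      · rcases (hc w hw).2.2 _ hcw with h2 | h2
        · exact absurd h2.symm hne'
        · exact absurd (hmax w (Finset.mem_filter.2 ⟨hw, hw'⟩)) (not_le.2 h2)
  · exact fun hw => absurd hw₀.1 hw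

end Independence

end Datum

/-! ### Generic chains of points for affine arrangements -/

section GenericChains

open Filter Topology

/-- An interval can be subdivided such that every part contains at most one point of a finite
set. -/
theorem exists_subdivision (Z : Finset ℝ) {s e : ℝ} (hse : s < e) (hs : s ∉ Z) (he : e ∉ Z) :
    ∃ T : List ℝ, T.head? = some s ∧ T.getLast? = some e ∧ T.Pairwise (· < ·) ∧
      (∀ t ∈ T, t ∉ Z ∧ s ≤ t ∧ t ≤ e) ∧
      T.IsChain fun u v => u < v ∧ ∀ z ∈ Z, ∀ z' ∈ Z, u < z → z < v → u < z' → z' < v → z = z' := by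
  induction h : (Z.filter fun z => s < z ∧ z < e).card using Nat.strong_induction_on
    generalizing s e with
  | _ N ih =>
    by_cases hz : ∀ z ∈ Z, ∀ z' ∈ Z, s < z → z < e → s < z' → z' < e → z = z'
    · exact ⟨[s, e], rfl, rfl, by simpa using hse, by simp [hs, he, hse.le],
        by simpa using ⟨hse, hz⟩⟩
    · obtain ⟨z, hz, z', hz', h1, h2, hlt⟩ :
          ∃ z ∈ Z, ∃ z' ∈ Z, s < z ∧ z' < e ∧ z < z' := by
        push Not at hz
        obtain ⟨z, hz, z', hz', h1, h2, h3, h4, h5⟩ := hz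
        rcases lt_or_gt_of_ne h5 with h6 | h6
        · exact ⟨z, hz, z', hz', h1, h4, h6⟩
        · exact ⟨z', hz', z, hz, h3, h2, h6⟩
      -- A division point outside `Z` and strictly between two points of `Z` leaves fewer of them in
      -- each half.
      obtain ⟨t, ⟨ht1, ht2⟩, ht⟩ := ((Set.Ioo_infinite hlt).sdiff Z.finite_toSet).nonempty
      have ht : t ∉ Z := ht
      have hst : s < t := h1.trans ht1
      have hte : t < e := ht2.trans h2
      have c1 : (Z.filter fun z => s < z ∧ z < t).card < N := by
        rw [← h]
        refine Finset.card_lt_card (Finset.ssubset_iff_of_subset ?_ |>.2 ⟨z', ?_, ?_⟩)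
        · intro u hu
          simp only [Finset.mem_filter] at hu ⊢
          exact ⟨hu.1, hu.2.1, hu.2.2.trans hte⟩
        · simp only [Finset.mem_filter]; exact ⟨hz', h1.trans hlt, h2⟩
        · simp only [Finset.mem_filter]; exact fun h => lt_asymm ht2 h.2.2
      have c2 : (Z.filter fun z => t < z ∧ z < e).card < N := by
        rw [← h]
        refine Finset.card_lt_card (Finset.ssubset_iff_of_subset ?_ |>.2 ⟨z, ?_, ?_⟩)
        · intro u hu
          simp only [Finset.mem_filter] at hu ⊢
          exact ⟨hu.1, hst.trans hu.2.1, hu.2.2⟩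
        · simp only [Finset.mem_filter]; exact ⟨hz, h1, hlt.trans h2⟩
        · simp only [Finset.mem_filter]; exact fun h => lt_asymm ht1 h.2.1
      obtain ⟨T₁, a1, a2, a3, a4, a5⟩ := ih _ c1 hst hs ht rfl
      obtain ⟨T₂, b1, b2, b3, b4, b5⟩ := ih _ c2 hte ht he rfl
      cases T₂ with
      | nil => simp at b1
      | cons t' T₂ =>
        obtain rfl : t' = t := by simpa using b1
        rw [List.pairwise_cons] at b3
        have hne : T₂ ≠ [] := by
          rintro rfl
          simp only [List.getLast?_singleton, Option.some.injEq] at b2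
          exact hte.ne b2
        refine ⟨T₁ ++ T₂, ?_, ?_, ?_, ?_, ?_⟩
        · rw [List.head?_append, a1]; rfl
        · rw [List.getLast?_append]
          cases T₂ with
          | nil => exact absurd rfl hne
          | cons u T₂ => rw [List.getLast?_cons_cons] at b2; rw [b2]; rfl
        · refine List.pairwise_append.2 ⟨a3, b3.2, fun u hu v hv => ?_⟩
          exact (a4 u hu).2.2.trans_lt (b3.1 v hv)
        · intro u hu
          rcases List.mem_append.1 hu with hu | hu
          · exact ⟨(a4 u hu).1, (a4 u hu).2.1, (a4 u hu).2.2.trans hte.le⟩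
          · obtain ⟨h3, h4, h5⟩ := b4 u (List.mem_cons_of_mem _ hu)
            exact ⟨h3, hst.le.trans h4, h5⟩
        · refine List.isChain_append.2 ⟨a5, b5.tail, fun u hu v hv => ?_⟩
          rw [a2] at hu
          obtain rfl : t' = u := by simpa using hu
          exact List.isChain_cons.1 b5 |>.1 v hv

variable {V : Type*} [AddCommGroup V] [Module ℝ V]

theorem apply_lineMap_eq (F : V →ᵃ[ℝ] ℝ) (p q : V) (t : ℝ) :
    F (AffineMap.lineMap p q t) = F p + t * (F q - F p) := by
  rw [AffineMap.apply_lineMap, AffineMap.lineMap_apply_module']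
  simp only [smul_eq_mul]
  ring

/-- An affine function that does not vanish on the whole line has at most one zero on it; near `p`
it keeps its sign by continuity. -/
theorem eventually_apply_lineMap_ne (F : V →ᵃ[ℝ] ℝ) {p q : V} (h : F p ≠ 0 ∨ F q ≠ 0) :
    ∀ᶠ t in 𝓝[>] (0 : ℝ), F (AffineMap.lineMap p q t) ≠ 0 ∧
      (F p ≠ 0 → 0 < F p * F (AffineMap.lineMap p q t)) := by
  simp only [apply_lineMap_eq]
  by_cases hp : F p = 0
  · filter_upwards [self_mem_nhdsWithin] with t ht
    have ht : (0 : ℝ) < t := ht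
    have hq : F q ≠ 0 := h.resolve_left (by simpa using hp)
    refine ⟨?_, fun h => absurd hp h⟩
    rw [hp, zero_add, sub_zero]
    exact mul_ne_zero ht.ne' hq
  · have : Tendsto (fun t : ℝ => F p * (F p + t * (F q - F p))) (𝓝 0) (𝓝 (F p * F p)) := by
      have : Continuous fun t : ℝ => F p * (F p + t * (F q - F p)) := by fun_prop
      simpa using this.tendsto 0
    have h2 := this.eventually (lt_mem_nhds (mul_self_pos.2 hp))
    filter_upwards [h2.filter_mono nhdsWithin_le_nhds] with t ht
    exact ⟨fun h => by rw [h, mul_zero] at ht; exact lt_irrefl _ ht, fun _ => ht⟩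

/-- A real vector space is not a finite union of hyperplanes: the hyperplanes are avoided one by
one, each time moving so little that the previous ones are not met again. -/
theorem exists_forall_apply_ne_zero (S : Finset (V →ᵃ[ℝ] ℝ)) (hS : ∀ F ∈ S, F ≠ 0) :
    ∃ p, ∀ F ∈ S, F p ≠ 0 := by
  classical
  induction S using Finset.induction_on with
  | empty => exact ⟨0, by simp⟩
  | insert F S _ ih =>
    obtain ⟨p, hp⟩ := ih fun G hG => hS G (Finset.mem_insert_of_mem hG)
    obtain ⟨q, hq⟩ : ∃ q, F q ≠ 0 := by
      by_contra h
      push Not at h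
      exact hS F (Finset.mem_insert_self F S) (AffineMap.ext h)
    have h1 : ∀ᶠ t in 𝓝[>] (0 : ℝ), ∀ G ∈ S, G (AffineMap.lineMap p q t) ≠ 0 :=
      (Finset.eventually_all S).2 fun G hG =>
        (eventually_apply_lineMap_ne G (Or.inl (hp G hG))).mono fun _ h => h.1
    obtain ⟨t, ht1, ht2⟩ := (h1.and (eventually_apply_lineMap_ne F (Or.inr hq))).exists
    refine ⟨AffineMap.lineMap p q t, fun G hG => ?_⟩
    rcases Finset.mem_insert.1 hG with rfl | hG
    · exact ht2.1
    · exact ht1 G hG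

/-- Every point can be moved into general position. -/
theorem exists_perturbation (S : Finset (V →ᵃ[ℝ] ℝ)) (hS : ∀ F ∈ S, F ≠ 0) (y : V) :
    ∃ y', ∀ F ∈ S, F y' ≠ 0 ∧ (F y ≠ 0 → 0 < F y * F y') := by
  obtain ⟨p, hp⟩ := exists_forall_apply_ne_zero S hS
  have h1 : ∀ᶠ t in 𝓝[>] (0 : ℝ), ∀ F ∈ S, F (AffineMap.lineMap y p t) ≠ 0 ∧
      (F y ≠ 0 → 0 < F y * F (AffineMap.lineMap y p t)) :=
    (Finset.eventually_all S).2 fun F hF => eventually_apply_lineMap_ne F (Or.inr (hp F hF))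
  obtain ⟨t, ht⟩ := h1.exists
  exact ⟨_, ht⟩

/-- Along a segment an affine function is monotone, so once it has changed its sign it does not
change back. -/
theorem apply_lineMap_mul_neg (F : V →ᵃ[ℝ] ℝ) {p q : V} {t t' : ℝ} (ht : 0 ≤ t) (htt : t ≤ t')
    (h : F p * F (AffineMap.lineMap p q t) < 0) : F p * F (AffineMap.lineMap p q t') < 0 := by
  rw [apply_lineMap_eq] at h ⊢
  have h1 : F p * (F q - F p) < 0 := by
    by_contra h1
    push Not at h1
    nlinarith [mul_nonneg ht h1, mul_self_nonneg (F p)]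
  nlinarith [mul_nonneg (sub_nonneg.2 htt) (neg_nonneg.2 h1.le)]

/-- A segment, given by a subdivision. -/
theorem exists_segment_chain (S : Finset (V →ᵃ[ℝ] ℝ)) {x y : V} (hx : ∀ F ∈ S, F x ≠ 0)
    (hy : ∀ F ∈ S, F y ≠ 0) :
    ∃ L : List V, L.head? = some x ∧ L.getLast? = some y ∧ (∀ z ∈ L, ∀ F ∈ S, F z ≠ 0) ∧
      L.Pairwise (fun u v => ∀ F : V →ᵃ[ℝ] ℝ, F x * F u < 0 → F x * F v < 0) ∧
      L.IsChain (fun u v => ∀ F ∈ S, ∀ G ∈ S, F u * F v < 0 → G u * G v < 0 →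
        F x * G y = G x * F y) ∧
      ∀ z ∈ L, ∃ t : ℝ, 0 ≤ t ∧ t ≤ 1 ∧ z = AffineMap.lineMap x y t := by
  classical
  -- The times at which the segment meets the hyperplanes.
  set Z : Finset ℝ := (S.filter fun F => F x ≠ F y).image fun F => F x / (F x - F y) with hZ
  have root : ∀ F ∈ S, ∀ t, F (AffineMap.lineMap x y t) = 0 → F x ≠ F y ∧
      t = F x / (F x - F y) := by
    intro F hF t ht
    rw [apply_lineMap_eq] at ht
    have hne : F x ≠ F y := fun h => by
      rw [h, sub_self, mul_zero, add_zero] at ht; exact hy F hF ht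
    refine ⟨hne, ?_⟩
    rw [eq_div_iff (sub_ne_zero.2 hne)]
    linarith
  have mem : ∀ F ∈ S, ∀ t, F (AffineMap.lineMap x y t) = 0 → t ∈ Z := fun F hF t ht =>
    Finset.mem_image.2 ⟨F, Finset.mem_filter.2 ⟨hF, (root F hF t ht).1⟩, (root F hF t ht).2.symm⟩
  have hzero : ∀ t ∈ Z, ∃ F ∈ S, F (AffineMap.lineMap x y t) = 0 := by
    intro t ht
    obtain ⟨F, hF, rfl⟩ := Finset.mem_image.1 ht
    rw [Finset.mem_filter] at hF
    refine ⟨F, hF.1, ?_⟩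
    rw [apply_lineMap_eq]
    have := sub_ne_zero.2 hF.2
    field_simp
    ring
  have h0 : (0 : ℝ) ∉ Z := fun h => by
    obtain ⟨F, hF, h⟩ := hzero _ h
    rw [AffineMap.lineMap_apply_zero] at h; exact hx F hF h
  have h1 : (1 : ℝ) ∉ Z := fun h => by
    obtain ⟨F, hF, h⟩ := hzero _ h
    rw [AffineMap.lineMap_apply_one] at h; exact hy F hF h
  obtain ⟨T, a1, a2, a3, a4, a5⟩ := exists_subdivision Z zero_lt_one h0 h1
  refine ⟨T.map (AffineMap.lineMap x y), ?_, ?_, ?_, ?_, ?_, ?_⟩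
  · rw [List.head?_map, a1]; simp
  · rw [List.getLast?_map, a2]; simp
  · intro z hz F hF h
    obtain ⟨t, ht, rfl⟩ := List.mem_map.1 hz
    exact (a4 t ht).1 (mem F hF t h)
  · rw [List.pairwise_map]
    have a3' := List.Pairwise.and_mem.1 a3
    exact a3'.imp fun {u v} h F hF => apply_lineMap_mul_neg F (a4 u h.1).2.1 h.2.2.le hF
  · rw [List.isChain_map]
    refine a5.imp ?_
    rintro u v ⟨huv, h⟩ F hF G hG hFuv hGuv
    have key : ∀ F ∈ S, F (AffineMap.lineMap x y u) * F (AffineMap.lineMap x y v) < 0 →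
        F x ≠ F y ∧ F x / (F x - F y) ∈ Z ∧ u < F x / (F x - F y) ∧ F x / (F x - F y) < v := by
      intro F hF hlt
      have hne : F x ≠ F y := fun h => by
        rw [apply_lineMap_eq, apply_lineMap_eq, h] at hlt
        simp only [sub_self, mul_zero, add_zero] at hlt
        exact absurd hlt (not_lt.2 (mul_self_nonneg _))
      refine ⟨hne, Finset.mem_image.2 ⟨F, Finset.mem_filter.2 ⟨hF, hne⟩, rfl⟩, ?_⟩
      have hd := sub_ne_zero.2 hne
      set τ := F x / (F x - F y) with hτ
      have e1 : F x = τ * (F x - F y) := by rw [hτ]; field_simp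
      have e2 : ∀ t, F (AffineMap.lineMap x y t) = (τ - t) * (F x - F y) := by
        intro t; rw [apply_lineMap_eq]; linear_combination e1
      rw [e2, e2] at hlt
      have e3 : (τ - u) * (τ - v) < 0 := by
        by_contra h
        push Not at h
        nlinarith [mul_nonneg h (mul_self_nonneg (F x - F y))]
      constructor
      · by_contra h; push Not at h
        nlinarith [mul_nonneg (sub_nonneg.2 h) (sub_nonneg.2 (h.trans huv.le))]
      · by_contra h; push Not at h
        nlinarith [mul_nonneg (sub_nonneg.2 h) (sub_nonneg.2 (huv.le.trans h))]
    obtain ⟨n1, f1, f2, f3⟩ := key F hF hFuv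
    obtain ⟨n2, g1, g2, g3⟩ := key G hG hGuv
    -- Both zeros lie between the same two division points, so they coincide; cross-multiplying
    -- yields the claim.
    have := h _ f1 _ g1 f2 f3 g2 g3
    rw [div_eq_div_iff (sub_ne_zero.2 n1) (sub_ne_zero.2 n2)] at this
    linear_combination -this
  · intro z hz
    obtain ⟨t, ht, rfl⟩ := List.mem_map.1 hz
    exact ⟨t, (a4 t ht).2.1, (a4 t ht).2.2, rfl⟩

/-- Two points are joined by a sequence of points such that every affine function changes its sign
at most once, and any two functions that change their signs in the same step are proportional. -/
theorem exists_generic_chain (S : Finset (V →ᵃ[ℝ] ℝ)) {x y : V} (hx : ∀ F ∈ S, F x ≠ 0)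
    (hy : ∀ F ∈ S, F y ≠ 0) :
    ∃ L : List V, L.head? = some x ∧ L.getLast? = some y ∧ (∀ z ∈ L, ∀ F ∈ S, F z ≠ 0) ∧
      L.Pairwise (fun u v => ∀ F ∈ S, F x * F u < 0 → F x * F v < 0) ∧
      L.IsChain (fun u v => ∀ F ∈ S, ∀ G ∈ S, F u * F v < 0 → G u * G v < 0 →
        ∃ c : ℝ, G = c • F) := by
  classical
  have hS : ∀ F ∈ S, F ≠ 0 := fun F hF h => hx F hF (by rw [h]; rfl)
  -- `F` and `G` vanish at the same time on the segment from `x` to `y'` only if `F x • G - G x • F`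
  -- vanishes at `y'`. A perturbation `y'` of `y` avoids this unless `F` and `G` are proportional.
  set S' : Finset (V →ᵃ[ℝ] ℝ) := S ∪ ((S ×ˢ S).image fun p => p.1 x • p.2 - p.2 x • p.1).filter
    fun F => F ≠ 0 with hS'
  obtain ⟨y', hy'⟩ := exists_perturbation S' (fun F hF => by
    rcases Finset.mem_union.1 hF with hF | hF
    · exact hS F hF
    · exact (Finset.mem_filter.1 hF).2) y
  have hyS : ∀ F ∈ S, F y' ≠ 0 := fun F hF => (hy' F (Finset.mem_union_left _ hF)).1
  have hyy : ∀ F ∈ S, 0 < F y * F y' := fun F hF =>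
    (hy' F (Finset.mem_union_left _ hF)).2 (hy F hF)
  obtain ⟨L, a1, a2, a3, a4, a5, -⟩ := exists_segment_chain S hx hyS
  -- The last step from `y'` back to `y` changes no signs.
  refine ⟨L ++ [y], ?_, ?_, ?_, ?_, ?_⟩
  · rw [List.head?_append, a1]; rfl
  · simp
  · intro z hz F hF
    rcases List.mem_append.1 hz with hz | hz
    · exact a3 z hz F hF
    · obtain rfl : z = y := by simpa using hz
      exact hy F hF
  · refine List.pairwise_append.2 ⟨a4.imp fun h F _ => h F, by simp, fun u hu v hv F hF h => ?_⟩
    obtain rfl : v = y := by simpa using hv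
    have h1 : F x * F y' < 0 := by
      obtain ⟨L', rfl⟩ : ∃ L', L = L' ++ [y'] := by
        rcases List.eq_nil_or_concat L with h | ⟨L', z, h⟩
        · rw [h] at a2; simp at a2
        · rw [List.concat_eq_append] at h
          rw [h] at a2
          obtain rfl : z = y' := by simpa using a2
          exact ⟨L', h⟩
      rcases List.mem_append.1 hu with hu | hu
      · exact (List.pairwise_append.1 a4).2.2 u hu y' (by simp) F h
      · obtain rfl : u = y' := by simpa using hu
        exact h
    have h2 := hyy F hF
    by_contra h3
    push Not at h3
    have h4 : 0 ≤ (F x * F v) * (F v * F y') := mul_nonneg h3 h2.le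
    have h5 : (F x * F v) * (F v * F y') = (F x * F y') * (F v * F v) := by ring
    rw [h5] at h4
    exact absurd h4 (not_le.2 (mul_neg_of_neg_of_pos h1 (mul_self_pos.2 (hy F hF))))
  · refine List.isChain_append.2 ⟨a5.imp fun u v h F hF G hG h1 h2 => ?_, by simp, ?_⟩
    · have h3 := h F hF G hG h1 h2
      by_cases h4 : F x • G - G x • F = 0
      · refine ⟨(F x)⁻¹ * G x, ?_⟩
        rw [sub_eq_zero] at h4
        rw [mul_smul, ← h4, inv_smul_smul₀ (hx F hF)]
      · have h5 := (hy' (F x • G - G x • F) (Finset.mem_union_right _ (Finset.mem_filter.2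
          ⟨Finset.mem_image.2 ⟨(F, G), Finset.mem_product.2 ⟨hF, hG⟩, rfl⟩, h4⟩))).1
        refine absurd ?_ h5
        simp only [AffineMap.coe_sub, AffineMap.coe_smul, Pi.sub_apply, Pi.smul_apply, smul_eq_mul]
        linarith
    · intro u hu v hv F hF G hG h1 h2
      rw [a2] at hu
      obtain rfl : y' = u := by simpa using hu
      obtain rfl : y = v := by simpa using hv
      have := hyy F hF
      rw [mul_comm] at this
      exact absurd h1 (not_lt.2 this.le)

end GenericChains

namespace Datum

/-! ### Pairs of strings as walls of an affine arrangement -/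

section Walls

variable {R : Type*} [CommRing R] {I E : Type*} {n l : ℕ} {K : Datum R I E n l}
  {res : Fin n → I} {b u v z : Fin n → ℝ} {c e : Str n l E × Str n l E}

/-- The coordinate of a carrier. -/
def coordMap : Option (Fin n) → ((Fin n → ℝ) →ₗ[ℝ] ℝ)
  | none => 0
  | some k => LinearMap.proj k

theorem coordMap_apply (o : Option (Fin n)) (z : Fin n → ℝ) : coordMap o z = coord z o := by
  cases o <;> rfl

variable (K) in
/-- The distance of two strings as an affine function of the positions. -/
def heightMap (c : Str n l E × Str n l E) : (Fin n → ℝ) →ᵃ[ℝ] ℝ :=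
  (coordMap c.2.carrier - coordMap c.1.carrier : (Fin n → ℝ) →ₗ[ℝ] ℝ).toAffineMap +
    AffineMap.const ℝ _ (K.off c.2 - K.off c.1)

theorem heightMap_apply (c : Str n l E × Str n l E) (z : Fin n → ℝ) :
    K.heightMap c z = K.strPos z c.2 - K.strPos z c.1 := by
  rw [strPos_eq, strPos_eq, ← coordMap_apply, ← coordMap_apply]
  simp only [heightMap, AffineMap.coe_add, Pi.add_apply, LinearMap.coe_toAffineMap,
    LinearMap.sub_apply, AffineMap.const_apply]
  ring

variable (K) in
/-- The distance of two strings, normalized to be `-1` at `b`. -/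
def wallMap (b : Fin n → ℝ) (c : Str n l E × Str n l E) : (Fin n → ℝ) →ᵃ[ℝ] ℝ :=
  -- With a common value at `b`, such functions vanish on the straight way from `u` to `b` in the
  -- order of their values at `u`.
  (-K.heightMap c b)⁻¹ • K.heightMap c

theorem wallMap_apply (b : Fin n → ℝ) (c : Str n l E × Str n l E) (z : Fin n → ℝ) :
    K.wallMap b c z = (K.strPos b c.1 - K.strPos b c.2)⁻¹ *
      (K.strPos z c.2 - K.strPos z c.1) := by
  simp only [wallMap, AffineMap.coe_smul, Pi.smul_apply, smul_eq_mul, heightMap_apply, neg_sub]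

variable (K) in
/-- The pairs of strings that may have to cross on the way to `b`. -/
def walls (res : Fin n → I) (b : Fin n → ℝ) : Set (Str n l E × Str n l E) :=
  {c | K.Active res c.1 ∧ K.Active res c.2 ∧ c.1.carrier ≠ c.2.carrier ∧
    K.strPos b c.2 < K.strPos b c.1}

theorem finite_walls (res : Fin n → I) (b : Fin n → ℝ) : (K.walls res b).Finite :=
  ((finite_active res).prod (finite_active res)).subset fun _ h => ⟨h.1, h.2.1⟩

theorem wallMap_pos_iff (hc : c ∈ K.walls res b) :
    0 < K.wallMap b c z ↔ K.strPos z c.1 < K.strPos z c.2 := by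
  rw [wallMap_apply, mul_pos_iff_of_pos_left (inv_pos.2 (sub_pos.2 hc.2.2.2)), sub_pos]

theorem wallMap_neg_iff (hc : c ∈ K.walls res b) :
    K.wallMap b c z < 0 ↔ K.strPos z c.2 < K.strPos z c.1 := by
  have h := inv_pos.2 (sub_pos.2 hc.2.2.2)
  rw [wallMap_apply, ← neg_pos, ← mul_neg, mul_pos_iff_of_pos_left h, neg_sub, sub_pos]

theorem wallMap_self (hc : c ∈ K.walls res b) : K.wallMap b c b = -1 := by
  have h := sub_pos.2 hc.2.2.2
  rw [wallMap_apply, ← neg_sub (K.strPos b c.1), mul_neg, inv_mul_cancel₀ h.ne']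

theorem wallMap_ne_zero (hz : K.Generic res z) (hc : c ∈ K.walls res b) :
    K.wallMap b c z ≠ 0 := by
  have hne : c.1 ≠ c.2 := fun h => hc.2.2.1 (by rw [h])
  rcases lt_or_gt_of_ne (strPos_ne hz hc.1 hc.2.1 hne) with h | h
  · exact ((wallMap_pos_iff hc).2 h).ne'
  · exact ((wallMap_neg_iff hc).2 h).ne

variable (K) in
/-- The pairs of strings that are already in the same order as in `b`. -/
def passed (res : Fin n → I) (b z : Fin n → ℝ) : Set (Str n l E × Str n l E) :=
  {c | c ∈ K.walls res b ∧ K.strPos z c.2 < K.strPos z c.1}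

theorem passed_subset : K.passed res b z ⊆ K.walls res b := fun _ h => h.1

theorem passed_self : K.passed res b b = K.walls res b :=
  Set.ext fun _ => ⟨fun h => h.1, fun h => ⟨h, h.2.2.2⟩⟩

theorem wallMap_pos_of_notMem (hz : K.Generic res z) (hc : c ∈ K.walls res b)
    (h : c ∉ K.passed res b z) : 0 < K.wallMap b c z := by
  rcases lt_or_gt_of_ne (wallMap_ne_zero hz hc) with h1 | h1
  · exact absurd ⟨hc, (wallMap_neg_iff hc).1 h1⟩ h
  · exact h1

theorem mem_passed_iff (hc : c ∈ K.walls res b) : c ∈ K.passed res b z ↔ K.wallMap b c z < 0 := by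
  rw [wallMap_neg_iff hc]; exact ⟨fun h => h.2, fun h => ⟨hc, h⟩⟩

/-- If no pair that already has the order of `b` is undone, the crossings of a step are exactly the
newly passed walls. Steps of monotone paths can thus be described by sets of walls. -/
theorem crossings_eq_diff (hb : K.Generic res b) (hu : K.Generic res u)
    (h : K.passed res b u ⊆ K.passed res b v) :
    K.crossings res u v = K.passed res b v \ K.passed res b u := by
  ext c
  constructor
  · intro hc
    have hne := carrier_ne_of_mem_crossings hc
    rcases lt_or_gt_of_ne (strPos_ne hb hc.1 hc.2.1 (ne_of_mem_crossings hc)) with h1 | h1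
    · have h2 : (c.2, c.1) ∈ K.passed res b u := ⟨⟨hc.2.1, hc.1, hne.symm, h1⟩, hc.2.2.1⟩
      exact absurd (h h2).2 (lt_asymm hc.2.2.2)
    · exact ⟨⟨⟨hc.1, hc.2.1, hne, h1⟩, hc.2.2.2⟩, fun h2 => lt_asymm h2.2 hc.2.2.1⟩
  · rintro ⟨h1, h2⟩
    exact ⟨h1.1.1, h1.1.2.1, (wallMap_pos_iff h1.1).1 (wallMap_pos_of_notMem hu h1.1 h2), h1.2⟩

theorem crossings_eq_empty_of_passed (hb : K.Generic res b) (hu : K.Generic res u)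
    (h : K.passed res b u = K.passed res b v) : K.crossings res u v = ∅ := by
  rw [crossings_eq_diff hb hu h.subset, h, Set.sdiff_self]

theorem passed_eq_of_empty (hu : K.Generic res u) (hv : K.Generic res v)
    (h : K.crossings res u v = ∅) : K.passed res b u = K.passed res b v := by
  ext c
  exact and_congr_right fun hc => strPos_lt_iff_of_empty hu hv hc.2.1 hc.1 h

variable (K) in
/-- The pairs of strings that have to cross at the same time as a given one. -/
def wallClass (res : Fin n → I) (b : Fin n → ℝ) (c : Str n l E × Str n l E) :
    Set (Str n l E × Str n l E) :=
  {e | e ∈ K.walls res b ∧ K.wallMap b e = K.wallMap b c}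

theorem wallMap_linear_single (k : Fin n) :
    (K.wallMap b c).linear (Pi.single k 1) = (K.strPos b c.1 - K.strPos b c.2)⁻¹ *
      ((if c.2.carrier = some k then 1 else 0) - (if c.1.carrier = some k then 1 else 0)) := by
  have h : ∀ o : Option (Fin n), coordMap o (Pi.single k (1 : ℝ)) =
      if o = some k then 1 else 0 := by
    intro o
    cases o with
    | none => simp [coordMap]
    | some j => simp [coordMap, Pi.single_apply]
  have h2 : (K.heightMap c).linear = coordMap c.2.carrier - coordMap c.1.carrier := by
    simp [heightMap]
  rw [wallMap, AffineMap.smul_linear, h2, LinearMap.smul_apply, LinearMap.sub_apply, h, h,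
    heightMap_apply, neg_sub, smul_eq_mul]

theorem wallMap_linear_pos_iff (hc : c ∈ K.walls res b) (k : Fin n) :
    0 < (K.wallMap b c).linear (Pi.single k 1) ↔ c.2.carrier = some k := by
  rw [wallMap_linear_single, mul_pos_iff_of_pos_left (inv_pos.2 (sub_pos.2 hc.2.2.2))]
  have := hc.2.2.1
  split_ifs with h1 h2 h2 <;> simp_all

theorem wallMap_linear_neg_iff (hc : c ∈ K.walls res b) (k : Fin n) :
    (K.wallMap b c).linear (Pi.single k 1) < 0 ↔ c.1.carrier = some k := by
  rw [wallMap_linear_single, ← neg_pos, ← mul_neg,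
    mul_pos_iff_of_pos_left (inv_pos.2 (sub_pos.2 hc.2.2.2))]
  have := hc.2.2.1
  split_ifs with h1 h2 h2 <;> simp_all

/-- The signs of the linear part reveal the two carriers, and its size reveals the distance at `b`,
hence the offsets. So equal functions belong to parallel pairs, which cross simultaneously. -/
theorem carrier_eq_of_wallMap_eq (hc : c ∈ K.walls res b) (he : e ∈ K.walls res b)
    (h : K.wallMap b e = K.wallMap b c) :
    e.1.carrier = c.1.carrier ∧ e.2.carrier = c.2.carrier ∧
      K.off e.2 - K.off e.1 = K.off c.2 - K.off c.1 := by
  have h1 : e.1.carrier = c.1.carrier := Option.ext fun k => by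
    rw [← wallMap_linear_neg_iff he, ← wallMap_linear_neg_iff hc, h]
  have h2 : e.2.carrier = c.2.carrier := Option.ext fun k => by
    rw [← wallMap_linear_pos_iff he, ← wallMap_linear_pos_iff hc, h]
  refine ⟨h1, h2, ?_⟩
  have hb1 := sub_pos.2 hc.2.2.2
  have hb2 := sub_pos.2 he.2.2.2
  have key : (K.strPos b e.1 - K.strPos b e.2)⁻¹ = (K.strPos b c.1 - K.strPos b c.2)⁻¹ := by
    have hne := hc.2.2.1
    obtain ⟨k, hk⟩ : ∃ k, c.1.carrier = some k ∨ c.2.carrier = some k := by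
      rcases h3 : c.1.carrier with _ | k
      · rcases h4 : c.2.carrier with _ | k
        · exact absurd (h3.trans h4.symm) hne
        · exact ⟨k, Or.inr rfl⟩
      · exact ⟨k, Or.inl rfl⟩
    have h5 := congrArg (fun F => F.linear (Pi.single k 1)) h
    simp only [wallMap_linear_single, h1, h2] at h5
    refine mul_right_cancel₀ ?_ h5
    rcases hk with hk | hk
    · rw [if_pos hk, if_neg fun h6 => hne (hk.trans h6.symm)]; norm_num
    · rw [if_pos hk, if_neg fun h6 => hne (h6.trans hk.symm)]; norm_num
  have h6 := congrArg (fun F => F b) h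
  have h7 := inv_inj.1 key
  simp only [strPos_eq, h1, h2] at h7
  linarith

theorem wallMap_eq_of_carrier_eq (h1 : e.1.carrier = c.1.carrier)
    (h2 : e.2.carrier = c.2.carrier) (h3 : K.off e.2 - K.off e.1 = K.off c.2 - K.off c.1) :
    K.wallMap b e = K.wallMap b c := by
  have : K.heightMap e = K.heightMap c := by
    rw [heightMap, heightMap, h1, h2, h3]
  rw [wallMap, wallMap, this]

theorem simple_of_passed (hb : K.Generic res b) (hu : K.Generic res u)
    (h : K.passed res b u ⊆ K.passed res b v)
    (h' : K.passed res b v ⊆ K.passed res b u ∪ K.wallClass res b c) : K.Simple res u v := by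
  rw [simple_iff, crossings_eq_diff hb hu h]
  intro d hd d' hd'
  have h1 := (h' hd.1).resolve_left hd.2
  have h2 := (h' hd'.1).resolve_left hd'.2
  exact carrier_eq_of_wallMap_eq h2.1 h1.1 (h1.2.trans h2.2.symm)

/-- Parallel pairs share their wall function, and a simple step crosses only parallel pairs, so a
non-trivial simple monotone step passes exactly one class of walls. -/
theorem passed_eq_union (hb : K.Generic res b) (hu : K.Generic res u)
    (hs : K.Simple res u v) (h : K.passed res b u ⊆ K.passed res b v)
    (hc : c ∈ K.crossings res u v) :
    K.passed res b v = K.passed res b u ∪ K.wallClass res b c := by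
  have hc' := hc
  rw [crossings_eq_diff hb hu h] at hc'
  ext d
  constructor
  · intro hd
    by_cases hd' : d ∈ K.passed res b u
    · exact Or.inl hd'
    · have hd2 : d ∈ K.crossings res u v := by
        rw [crossings_eq_diff hb hu h]; exact ⟨hd, hd'⟩
      obtain ⟨h1, h2, h3⟩ := simple_iff.1 hs d hd2 c hc
      exact Or.inr ⟨hd.1, wallMap_eq_of_carrier_eq h1 h2 h3⟩
  · rintro (hd | hd)
    · exact h hd
    · rw [mem_passed_iff hd.1, hd.2, ← mem_passed_iff hc'.1.1]
      exact hc'.1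

end Walls

/-! ### Equivalence of paths and galleries -/

section PathEquivalence

variable {R : Type*} [CommRing R] {I E : Type*} {n l : ℕ} (K : Datum R I E n l)

/-- A sequence of slices that belongs to a diagram. -/
def Path (res : Fin n → I) (L : List (Fin n → ℝ)) : Prop :=
  (∀ z ∈ L, K.Generic res z) ∧ L.IsChain (K.Simple res)

/-- Two sequences of slices are equivalent if they differ by isotopies and Reidemeister III moves. -/
inductive PathEquiv (res : Fin n → I) : List (Fin n → ℝ) → List (Fin n → ℝ) → Prop
  | refl {L} (h : K.Path res L) : PathEquiv res L L
  | symm {L L'} : PathEquiv res L L' → PathEquiv res L' L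
  | trans {L L' L''} : PathEquiv res L L' → PathEquiv res L' L'' → PathEquiv res L L''
  | cons {L L'} (u : Fin n → ℝ) (h : K.Path res (u :: L)) :
      PathEquiv res L L' → PathEquiv res (u :: L) (u :: L')
  | dup {z L} (h : K.Path res (z :: L)) : PathEquiv res (z :: z :: L) (z :: L)
  | straighten {s z t S} (h : K.Path res (s :: z :: t :: S)) (h' : K.Path res (s :: t :: S))
      (hz : K.crossings res s z = ∅ ∨ K.crossings res z t = ∅) :
      PathEquiv res (s :: z :: t :: S) (s :: t :: S)
  | commute {s z z' t S} (h : K.Path res (s :: z :: t :: S)) (h' : K.Path res (s :: z' :: t :: S))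
      (h₁ : K.crossings res s z = K.crossings res z' t)
      (h₂ : K.crossings res z t = K.crossings res s z') :
      PathEquiv res (s :: z :: t :: S) (s :: z' :: t :: S)
  | braid {s z₁ z₂ z₁' z₂' t S} (h : K.Path res (s :: z₁ :: z₂ :: t :: S))
      (h' : K.Path res (s :: z₁' :: z₂' :: t :: S))
      (h₁ : K.crossings res s z₁ = K.crossings res z₂' t)
      (h₂ : K.crossings res z₁ z₂ = K.crossings res z₁' z₂')
      (h₃ : K.crossings res z₂ t = K.crossings res s z₁') :
      PathEquiv res (s :: z₁ :: z₂ :: t :: S) (s :: z₁' :: z₂' :: t :: S)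

variable {K} {res : Fin n → I} {b s t u v z : Fin n → ℝ} {L L' S T : List (Fin n → ℝ)}

theorem path_cons_cons : K.Path res (u :: v :: L) ↔
    K.Generic res u ∧ K.Simple res u v ∧ K.Path res (v :: L) := by
  simp only [Path, List.isChain_cons_cons, List.mem_cons, forall_eq_or_imp]
  tauto

theorem Path.generic (h : K.Path res (u :: L)) : K.Generic res u := h.1 u (by simp)

theorem Path.tail (h : K.Path res (u :: L)) : K.Path res L :=
  ⟨fun z hz => h.1 z (List.mem_cons_of_mem _ hz), h.2.tail⟩

theorem Path.append_left {P : List (Fin n → ℝ)} (h : K.Path res (P ++ L)) : K.Path res L := by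
  induction P with
  | nil => exact h
  | cons u P ih => exact ih h.tail

theorem Path.congr_head {P : List (Fin n → ℝ)} (h : K.Path res (P ++ L)) (h' : K.Path res L')
    (hh : L'.head? = L.head?) : K.Path res (P ++ L') := by
  refine ⟨fun z hz => ?_, ?_⟩
  · rcases List.mem_append.1 hz with hz | hz
    · exact h.1 z (List.mem_append_left _ hz)
    · exact h'.1 z hz
  · have := List.isChain_append.1 h.2
    rw [List.isChain_append, hh]
    exact ⟨this.1, h'.2, this.2.2⟩

theorem Path.dup (h : K.Path res (z :: L)) : K.Path res (z :: z :: L) :=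
  path_cons_cons.2 ⟨h.generic, Simple.refl _ _, h⟩

/-- The end points and the number of crossings do not change. -/
theorem PathEquiv.invariant (h : K.PathEquiv res L L') :
    K.Path res L ∧ K.Path res L' ∧ L.head? = L'.head? ∧ L.getLast? = L'.getLast? ∧
      K.totalCross res L = K.totalCross res L' := by
  induction h with
  | refl h => exact ⟨h, h, rfl, rfl, rfl⟩
  | symm _ ih => exact ⟨ih.2.1, ih.1, ih.2.2.1.symm, ih.2.2.2.1.symm, ih.2.2.2.2.symm⟩
  | trans _ _ ih ih' =>
    exact ⟨ih.1, ih'.2.1, ih.2.2.1.trans ih'.2.2.1, ih.2.2.2.1.trans ih'.2.2.2.1,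
      ih.2.2.2.2.trans ih'.2.2.2.2⟩
  | @cons L L' u h _ ih =>
    obtain ⟨h1, h2, h3, h4, h5⟩ := ih
    refine ⟨h, Path.congr_head (P := [u]) h h2 h3.symm, rfl, ?_, ?_⟩
    · rw [List.getLast?_cons, List.getLast?_cons, h4]
    · cases L with
      | nil =>
        cases L' with
        | nil => rfl
        | cons v L' => simp at h3
      | cons v L =>
        cases L' with
        | nil => simp at h3
        | cons v' L' =>
          obtain rfl : v = v' := by simpa using h3
          rw [totalCross_cons_cons, totalCross_cons_cons, h5]
  | dup h =>
    refine ⟨h.dup, h, rfl, List.getLast?_cons_cons, ?_⟩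
    rw [totalCross_cons_cons, numCross_self, zero_add]
  | @straighten s z t S h h' hz =>
    refine ⟨h, h', rfl, by simp only [List.getLast?_cons_cons], ?_⟩
    have gs : K.Generic res s := h.generic
    have gz : K.Generic res z := h.tail.generic
    have gt : K.Generic res t := h.tail.tail.generic
    simp only [totalCross_cons_cons, numCross]
    rcases hz with hz | hz
    · rw [hz, crossings_congr_left gs gz hz, Set.ncard_empty, zero_add]
    · rw [hz, crossings_congr_right gz gt hz, Set.ncard_empty, zero_add]
  | commute h h' h₁ h₂ =>
    refine ⟨h, h', rfl, by simp only [List.getLast?_cons_cons], ?_⟩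
    simp only [totalCross_cons_cons, numCross, h₁, h₂]
    omega
  | braid h h' h₁ h₂ h₃ =>
    refine ⟨h, h', rfl, by simp only [List.getLast?_cons_cons], ?_⟩
    simp only [totalCross_cons_cons, numCross, h₁, h₂, h₃]
    omega

theorem PathEquiv.path_left (h : K.PathEquiv res L L') : K.Path res L := h.invariant.1

theorem PathEquiv.path_right (h : K.PathEquiv res L L') : K.Path res L' := h.invariant.2.1

/-- A slice in the same chamber as the next one may be inserted. -/
theorem PathEquiv.insert (h : K.Path res (s :: t :: S)) (hz : K.Generic res z)
    (he : K.crossings res z t = ∅) : K.PathEquiv res (s :: t :: S) (s :: z :: t :: S) := by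
  have h1 := path_cons_cons.1 h
  refine .symm (.straighten ?_ h (Or.inr he))
  refine path_cons_cons.2 ⟨h1.1, ?_, path_cons_cons.2 ⟨hz, simple_of_empty he, h1.2.2⟩⟩
  refine simple_of_subset h1.2.1 ?_
  rw [crossings_congr_right hz h1.2.2.generic he]

/-- Slices before the first crossing may be removed. -/
theorem exists_first_crossing (h : K.Path res (s :: t :: T)) :
    ∃ t' T', K.PathEquiv res (s :: t :: T) (s :: t' :: T') ∧ (t' :: T').Sublist (t :: T) ∧
      ((K.crossings res s t').Nonempty ∨ T' = []) := by
  induction T generalizing t with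
  | nil => exact ⟨t, [], .refl h, List.Sublist.refl _, Or.inr rfl⟩
  | cons t₂ T ih =>
    by_cases he : K.crossings res s t = ∅
    · have h1 := path_cons_cons.1 h
      have h2 := path_cons_cons.1 h1.2.2
      have h3 : K.Path res (s :: t₂ :: T) := by
        refine path_cons_cons.2 ⟨h1.1, simple_of_subset h2.2.1 ?_, h2.2.2⟩
        rw [crossings_congr_left h1.1 h2.1 he]
      obtain ⟨t', T', h4, h5, h6⟩ := ih h3
      exact ⟨t', T', .trans (.straighten h h3 (Or.inl he)) h4, h5.cons _, h6⟩
    · exact ⟨t, t₂ :: T, .refl h, List.Sublist.refl _,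
        Or.inl (Set.nonempty_iff_ne_empty.2 he)⟩

variable (K) in
/-- A sequence of slices from `s` to `b` in which the crossings take place one after another, in
the order given by a function on the pairs of strings. -/
structure Gallery (res : Fin n → I) (b : Fin n → ℝ) (ρ : Str n l E × Str n l E → ℝ)
    (L : List (Fin n → ℝ)) : Prop where
  path : K.Path res L
  last : L.getLast? = some b
  mono : L.Pairwise fun u v => K.passed res b u ⊆ K.passed res b v
  sorted : ∀ z ∈ L, ∀ c ∈ K.passed res b z, ∀ c' ∈ K.walls res b, ρ c' < ρ c →
    c' ∈ K.passed res b z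

variable {ρ ρ' : Str n l E × Str n l E → ℝ} {c c' d : Str n l E × Str n l E}

theorem Gallery.tail (h : K.Gallery res b ρ (s :: t :: T)) : K.Gallery res b ρ (t :: T) where
  path := h.path.tail
  last := by rw [← h.last, List.getLast?_cons_cons]
  mono := (List.pairwise_cons.1 h.mono).2
  sorted z hz := h.sorted z (List.mem_cons_of_mem _ hz)

theorem Gallery.of_sublist (h : K.Gallery res b ρ L) (hL : L'.Sublist L) (h' : K.Path res L')
    (hl : L'.getLast? = L.getLast?) : K.Gallery res b ρ L' where
  path := h'
  last := hl.trans h.last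
  mono := h.mono.sublist hL
  sorted z hz := h.sorted z (hL.subset hz)

theorem Gallery.cons_of_passed (h : K.Gallery res b ρ (t :: T)) (hs : K.Generic res s)
    (hb : K.Generic res b) (he : K.passed res b s = K.passed res b t) :
    K.Gallery res b ρ (s :: t :: T) where
  path := path_cons_cons.2
    ⟨hs, simple_of_empty (crossings_eq_empty_of_passed hb hs he), h.path⟩
  last := by rw [List.getLast?_cons_cons]; exact h.last
  mono := List.pairwise_cons.2 ⟨fun z hz => by
    rw [he]
    rcases List.mem_cons.1 hz with rfl | hz
    · exact subset_rfl
    · exact (List.pairwise_cons.1 h.mono).1 z hz, h.mono⟩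
  sorted z hz := by
    rcases List.mem_cons.1 hz with rfl | hz
    · rw [he]; exact h.sorted t (by simp)
    · exact h.sorted z hz

/-- The first crossing of a gallery. -/
theorem Gallery.exists_next (h : K.Gallery res b ρ (s :: T)) (hb : K.Generic res b)
    (hρ : ∀ c ∈ K.walls res b, ∀ c' ∈ K.walls res b, ρ c = ρ c' ↔ K.wallMap b c = K.wallMap b c')
    (hc : ¬ K.walls res b ⊆ K.passed res b s) :
    ∃ t T', K.PathEquiv res (s :: T) (s :: t :: T') ∧ K.Gallery res b ρ (s :: t :: T') ∧
      ∃ c ∈ K.walls res b, c ∉ K.passed res b s ∧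
        K.passed res b t = K.passed res b s ∪ K.wallClass res b c ∧
        ∀ e ∈ K.walls res b, e ∉ K.passed res b s → ρ c ≤ ρ e := by
  cases T with
  | nil =>
    have := h.last
    obtain rfl : s = b := by simpa using this
    exact absurd passed_self.symm.subset hc
  | cons t₀ T₀ =>
    obtain ⟨t, T', h1, h2, h3⟩ := exists_first_crossing h.path
    have hG : K.Gallery res b ρ (s :: t :: T') :=
      h.of_sublist (h2.cons_cons s) h1.path_right h1.invariant.2.2.2.1.symm
    have hsub : K.passed res b s ⊆ K.passed res b t :=
      (List.pairwise_cons.1 hG.mono).1 t (by simp)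
    have gs := h.path.generic
    have h4 : (K.crossings res s t).Nonempty := by
      rcases h3 with h3 | rfl
      · exact h3
      · have := hG.last
        obtain rfl : t = b := by simpa using this
        rw [crossings_eq_diff hb gs hsub, passed_self]
        exact Set.nonempty_iff_ne_empty.2 fun h => hc (Set.sdiff_eq_empty.1 h)
    obtain ⟨c, hct⟩ := h4
    have hct' := hct
    rw [crossings_eq_diff hb gs hsub] at hct'
    have h5 := passed_eq_union hb gs (path_cons_cons.1 hG.path).2.1 hsub hct
    refine ⟨t, T', h1, hG, c, hct'.1.1, hct'.2, h5, fun e he he' => ?_⟩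
    by_contra hlt
    push Not at hlt
    have h6 := hG.sorted t (by simp) c hct'.1 e he hlt
    rw [h5] at h6
    rcases h6 with h6 | h6
    · exact he' h6
    · exact hlt.ne ((hρ _ he _ hct'.1.1).2 h6.2)

/-- The first crossing of a gallery is the smallest one. -/
theorem Gallery.exists_next_of_min (h : K.Gallery res b ρ (s :: T)) (hb : K.Generic res b)
    (hρ : ∀ c ∈ K.walls res b, ∀ c' ∈ K.walls res b, ρ c = ρ c' ↔ K.wallMap b c = K.wallMap b c')
    (hc : c ∈ K.walls res b) (hc' : c ∉ K.passed res b s)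
    (hmin : ∀ e ∈ K.walls res b, e ∉ K.passed res b s → ρ c ≤ ρ e) :
    ∃ t T', K.PathEquiv res (s :: T) (s :: t :: T') ∧ K.Gallery res b ρ (s :: t :: T') ∧
      K.passed res b t = K.passed res b s ∪ K.wallClass res b c := by
  obtain ⟨t, T', h1, h2, e, he, he', h3, h4⟩ := h.exists_next hb hρ fun hsub => hc' (hsub hc)
  have h5 := (hρ _ he _ hc).1 (le_antisymm (h4 c hc hc') (hmin e he he'))
  refine ⟨t, T', h1, h2, ?_⟩
  rw [h3]
  simp only [wallClass, h5]

theorem Gallery.equiv_pair (h : K.Gallery res b ρ (s :: T)) (hb : K.Generic res b)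
    (hs : K.walls res b ⊆ K.passed res b s) : K.PathEquiv res (s :: T) [s, b] := by
  cases T with
  | nil =>
    have := h.last
    obtain rfl : s = b := by simpa using this
    exact .symm (.dup h.path)
  | cons t₀ T₀ =>
    obtain ⟨t, T', h1, h2, h3⟩ := exists_first_crossing h.path
    have hG : K.Gallery res b ρ (s :: t :: T') :=
      h.of_sublist (h2.cons_cons s) h1.path_right h1.invariant.2.2.2.1.symm
    rcases h3 with h3 | rfl
    · have hsub : K.passed res b s ⊆ K.passed res b t :=
        (List.pairwise_cons.1 hG.mono).1 t (by simp)
      rw [crossings_eq_diff hb h.path.generic hsub,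
        Set.sdiff_eq_empty.2 (passed_subset.trans hs)] at h3
      exact absurd h3 Set.not_nonempty_empty
    · have := hG.last
      obtain rfl : t = b := by simpa using this
      exact h1

/-- The pair of crossings takes place in different orders. -/
def Inverted (ρ ρ' : Str n l E × Str n l E → ℝ) (c c' : Str n l E × Str n l E) : Prop :=
  ρ c < ρ c' ∧ ρ' c' < ρ' c

theorem Inverted.trans {c₁ c₂ c₃ : Str n l E × Str n l E} (h : Inverted ρ ρ' c₁ c₂)
    (h' : Inverted ρ ρ' c₂ c₃) : Inverted ρ ρ' c₁ c₃ :=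
  ⟨h.1.trans h'.1, h'.2.trans h.2⟩

theorem union_diff_of_disjoint {α : Type*} {A C : Set α} (h : ∀ x ∈ C, x ∉ A) :
    (A ∪ C) \ A = C := by
  ext x
  have := h x
  simp only [Set.mem_sdiff, Set.mem_union]
  tauto

set_option maxHeartbeats 1000000 in
/-- Two galleries with the same end points are equivalent if all inversions between the orders of
their crossings come from commutations and Reidemeister III moves. -/
theorem Gallery.equiv (hb : K.Generic res b) {s : Fin n → ℝ} {T T' : List (Fin n → ℝ)}
    (hρ : ∀ c ∈ K.walls res b, ∀ c' ∈ K.walls res b, ρ c = ρ c' ↔ K.wallMap b c = K.wallMap b c')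
    (hρ' : ∀ c ∈ K.walls res b, ∀ c' ∈ K.walls res b,
      ρ' c = ρ' c' ↔ K.wallMap b c = K.wallMap b c')
    (h : K.Gallery res b ρ (s :: T)) (h' : K.Gallery res b ρ' (s :: T'))
    (hE : ∀ c₁ ∈ K.walls res b \ K.passed res b s, ∀ c₂ ∈ K.walls res b \ K.passed res b s,
      ∀ c₃ ∈ K.walls res b \ K.passed res b s,
      Inverted ρ ρ' c₁ c₂ ∨ Inverted ρ ρ' c₂ c₁ → Inverted ρ ρ' c₂ c₃ ∨ Inverted ρ ρ' c₃ c₂ →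
      K.wallMap b c₁ = K.wallMap b c₃ ∨ Inverted ρ ρ' c₁ c₃ ∨ Inverted ρ ρ' c₃ c₁)
    (hF : ∀ c₁ ∈ K.walls res b \ K.passed res b s, ∀ c₂ ∈ K.walls res b \ K.passed res b s,
      ∀ c₃ ∈ K.walls res b \ K.passed res b s, ∀ c₄ ∈ K.walls res b \ K.passed res b s,
      Inverted ρ ρ' c₁ c₂ → Inverted ρ ρ' c₂ c₃ → Inverted ρ ρ' c₃ c₄ → False) :
    K.PathEquiv res (s :: T) (s :: T') := by
  induction hN : (K.walls res b \ K.passed res b s).ncard using Nat.strong_induction_on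
    generalizing s T T' with
  | _ N ih =>
    by_cases hall : K.walls res b ⊆ K.passed res b s
    · exact (h.equiv_pair hb hall).trans (h'.equiv_pair hb hall).symm
    -- The induction counts the walls still to be passed, and `c` is one fewer after `t`. The
    -- conditions on inversions are inherited by the remaining walls.
    have ih' : ∀ {t U U'} {c}, K.Gallery res b ρ (t :: U) → K.Gallery res b ρ' (t :: U') →
        c ∈ K.walls res b → c ∉ K.passed res b s → K.passed res b s ⊆ K.passed res b t →
        c ∈ K.passed res b t → K.PathEquiv res (t :: U) (t :: U') := by
      intro t U U' c g g' hc hs hst hct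
      have hsub := Set.sdiff_subset_sdiff_right (s := K.walls res b) hst
      refine ih _ ?_ g g' (fun c₁ h1 c₂ h2 c₃ h3 => hE c₁ (hsub h1) c₂ (hsub h2) c₃ (hsub h3))
        (fun c₁ h1 c₂ h2 c₃ h3 c₄ h4 =>
          hF c₁ (hsub h1) c₂ (hsub h2) c₃ (hsub h3) c₄ (hsub h4)) rfl
      rw [← hN]
      exact Set.ncard_lt_ncard (Set.ssubset_iff_of_subset hsub |>.2
        ⟨c, ⟨hc, hs⟩, fun h' => h'.2 hct⟩) (finite_walls res b).sdiff
    have gs : K.Generic res s := h.path.generic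
    obtain ⟨t, U, e1, G, c, hc, hcs, hpt, hmin⟩ := h.exists_next hb hρ hall
    obtain ⟨t', U', e1', G', c', hc', hcs', hpt', hmin'⟩ := h'.exists_next hb hρ' hall
    have self : ∀ e ∈ K.walls res b, e ∈ K.wallClass res b e := fun e he => ⟨he, rfl⟩
    have gt : K.Generic res t := G.path.tail.generic
    have gt' : K.Generic res t' := G'.path.tail.generic
    -- If both galleries begin with the same class of crossings, that step is peeled off.
    by_cases hcc : ρ c = ρ c'
    · have hw := (hρ c hc c' hc').1 hcc
      have hp : K.passed res b t = K.passed res b t' := by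
        rw [hpt, hpt']; simp only [wallClass, hw]
      have he : K.crossings res t t' = ∅ := crossings_eq_empty_of_passed hb gt hp
      refine e1.trans (.trans (.cons s G.path ?_) (.symm
        (e1'.trans (.insert G'.path gt he))))
      refine ih' (c := c) G.tail (G'.tail.cons_of_passed gt hb hp) hc hcs ?_ ?_
      · rw [hpt]; exact Set.subset_union_left
      · rw [hpt]; exact Or.inr (self c hc)
    have hinv : Inverted ρ ρ' c c' := by
      refine ⟨lt_of_le_of_ne (hmin c' hc' hcs') hcc,
        lt_of_le_of_ne (hmin' c hc hcs) fun h => hcc ?_⟩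
      exact (hρ c hc c' hc').2 ((hρ' c' hc' c hc).1 h).symm
    have U₀ : ∀ {e}, e ∈ K.walls res b → e ∉ K.passed res b s →
        e ∈ K.walls res b \ K.passed res b s := fun h1 h2 => ⟨h1, h2⟩
    -- everything between the two crossings is inverted with both of them
    have btw : ∀ e ∈ K.walls res b, e ∉ K.passed res b s →
        (ρ c < ρ e ∧ ρ e < ρ c') ∨ (ρ' c' < ρ' e ∧ ρ' e < ρ' c) →
        Inverted ρ ρ' c e ∧ Inverted ρ ρ' e c' := by
      intro e he hes hbt
      have n1 : K.wallMap b e ≠ K.wallMap b c := fun h1 => by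
        have h2 := (hρ e he c hc).2 h1
        have h3 := (hρ' e he c hc).2 h1
        rcases hbt with hbt | hbt
        · exact hbt.1.ne h2.symm
        · exact hbt.2.ne h3
      have n2 : K.wallMap b e ≠ K.wallMap b c' := fun h1 => by
        have h2 := (hρ e he c' hc').2 h1
        have h3 := (hρ' e he c' hc').2 h1
        rcases hbt with hbt | hbt
        · exact hbt.2.ne h2
        · exact hbt.1.ne h3.symm
      have l1 : ρ c < ρ e :=
        lt_of_le_of_ne (hmin e he hes) fun h => n1 ((hρ c hc e he).1 h).symm
      have l2 : ρ' c' < ρ' e :=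
        lt_of_le_of_ne (hmin' e he hes) fun h => n2 ((hρ' c' hc' e he).1 h).symm
      have key : Inverted ρ ρ' c e ∨ Inverted ρ ρ' e c' := by
        rcases hbt with hbt | hbt
        · exact Or.inr ⟨hbt.2, l2⟩
        · exact Or.inl ⟨l1, hbt.2⟩
      rcases key with key | key
      · refine ⟨key, ?_⟩
        rcases hE e (U₀ he hes) c (U₀ hc hcs) c' (U₀ hc' hcs') (Or.inr key) (Or.inl hinv) with
          h1 | h1 | h1
        · exact absurd h1 n2
        · exact h1
        · exact absurd h1.2 (lt_asymm l2)
      · refine ⟨?_, key⟩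
        rcases hE c (U₀ hc hcs) c' (U₀ hc' hcs') e (U₀ he hes) (Or.inl hinv) (Or.inr key) with
          h1 | h1 | h1
        · exact absurd h1.symm n1
        · exact h1
        · exact absurd h1.1 (lt_asymm l1)
    -- Two different classes between `c` and `c'` would be inverted with each other by `hE`, giving
    -- a chain of four inversions that `hF` forbids.
    have btw_eq : ∀ d ∈ K.walls res b, d ∉ K.passed res b s → ∀ e ∈ K.walls res b,
        e ∉ K.passed res b s → Inverted ρ ρ' c d ∧ Inverted ρ ρ' d c' →
        Inverted ρ ρ' c e ∧ Inverted ρ ρ' e c' → K.wallMap b d = K.wallMap b e := by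
      intro d hd hds e he hes h1 h2
      rcases hE d (U₀ hd hds) c (U₀ hc hcs) e (U₀ he hes) (Or.inr h1.1) (Or.inl h2.1) with
        h3 | h3 | h3
      · exact h3
      · exact (hF c (U₀ hc hcs) d (U₀ hd hds) e (U₀ he hes) c' (U₀ hc' hcs') h1.1 h3 h2.2).elim
      · exact (hF c (U₀ hc hcs) e (U₀ he hes) d (U₀ hd hds) c' (U₀ hc' hcs') h2.1 h3 h1.2).elim
    have hwcc : K.wallMap b c ≠ K.wallMap b c' := fun h => hcc ((hρ c hc c' hc').2 h)
    have hc't : c' ∉ K.passed res b t := by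
      rw [hpt]
      rintro (h1 | h1)
      · exact hcs' h1
      · exact hwcc h1.2.symm
    have hct' : c ∉ K.passed res b t' := by
      rw [hpt']
      rintro (h1 | h1)
      · exact hcs h1
      · exact hwcc h1.2
    have disj : ∀ {e e'}, K.wallMap b e ≠ K.wallMap b e' → ∀ x, x ∈ K.wallClass res b e →
        x ∉ K.wallClass res b e' := fun h1 x h2 h3 => h1 (h2.2.symm.trans h3.2)
    have clsn : ∀ {e}, e ∈ K.walls res b → e ∉ K.passed res b s → ∀ x,
        x ∈ K.wallClass res b e → x ∉ K.passed res b s := by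
      intro e he hes x hx h1
      rw [mem_passed_iff hx.1, hx.2, ← mem_passed_iff he] at h1
      exact hes h1
    have st : K.passed res b s ⊆ K.passed res b t := by rw [hpt]; exact Set.subset_union_left
    have st' : K.passed res b s ⊆ K.passed res b t' := by rw [hpt']; exact Set.subset_union_left
    -- At most one class `d` lies between `c` and `c'`. If it exists, the galleries begin with `c`,
    -- `d`, `c'` and `c'`, `d`, `c`, related by Reidemeister III; otherwise with `c`, `c'` and `c'`,
    -- `c`, related by a commutation.
    by_cases hd : ∃ d ∈ K.walls res b, d ∉ K.passed res b s ∧ Inverted ρ ρ' c d ∧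
        Inverted ρ ρ' d c'
    · obtain ⟨d, hd, hds, hcd, hdc'⟩ := hd
      have hwcd : K.wallMap b c ≠ K.wallMap b d := fun h => hcd.1.ne ((hρ c hc d hd).2 h)
      have hwdc' : K.wallMap b d ≠ K.wallMap b c' := fun h => hdc'.1.ne ((hρ d hd c' hc').2 h)
      have hdt : d ∉ K.passed res b t := by
        rw [hpt]
        rintro (h1 | h1)
        · exact hds h1
        · exact hwcd h1.2.symm
      have hdt' : d ∉ K.passed res b t' := by
        rw [hpt']
        rintro (h1 | h1)
        · exact hds h1
        · exact hwdc' h1.2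
      obtain ⟨t₂, U₂, e2, G₂, hpt₂⟩ := G.tail.exists_next_of_min hb hρ hd hdt fun e he het => by
        by_contra hlt
        push Not at hlt
        have hes : e ∉ K.passed res b s := fun h => het (st h)
        have h1 : ρ c < ρ e := lt_of_le_of_ne (hmin e he hes) fun h => het (by
          rw [hpt]; exact Or.inr ⟨he, ((hρ c hc e he).1 h).symm⟩)
        have h2 := btw e he hes (Or.inl ⟨h1, hlt.trans hdc'.1⟩)
        exact hlt.ne ((hρ e he d hd).2 (btw_eq e he hes d hd hds h2 ⟨hcd, hdc'⟩))
      obtain ⟨t₂', U₂', e2', G₂', hpt₂'⟩ := G'.tail.exists_next_of_min hb hρ' hd hdt'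
        fun e he het => by
          by_contra hlt
          push Not at hlt
          have hes : e ∉ K.passed res b s := fun h => het (st' h)
          have h1 : ρ' c' < ρ' e := lt_of_le_of_ne (hmin' e he hes) fun h => het (by
            rw [hpt']; exact Or.inr ⟨he, ((hρ' c' hc' e he).1 h).symm⟩)
          have h2 := btw e he hes (Or.inr ⟨h1, hlt.trans hcd.2⟩)
          exact hlt.ne ((hρ' e he d hd).2 (btw_eq e he hes d hd hds h2 ⟨hcd, hdc'⟩))
      have gt₂ : K.Generic res t₂ := G₂.path.tail.generic
      have gt₂' : K.Generic res t₂' := G₂'.path.tail.generic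
      have hct₂ : c' ∉ K.passed res b t₂ := by
        rw [hpt₂]
        rintro (h1 | h1)
        · exact hc't h1
        · exact hwdc' h1.2.symm
      have hct₂' : c ∉ K.passed res b t₂' := by
        rw [hpt₂']
        rintro (h1 | h1)
        · exact hct' h1
        · exact hwcd h1.2
      have st₂ : K.passed res b s ⊆ K.passed res b t₂ := by
        rw [hpt₂]; exact st.trans Set.subset_union_left
      have st₂' : K.passed res b s ⊆ K.passed res b t₂' := by
        rw [hpt₂']; exact st'.trans Set.subset_union_left
      obtain ⟨t₃, U₃, e3, G₃, hpt₃⟩ := G₂.tail.exists_next_of_min hb hρ hc' hct₂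
        fun e he het => by
          by_contra hlt
          push Not at hlt
          have hes : e ∉ K.passed res b s := fun h => het (st₂ h)
          have h1 : ρ c < ρ e := lt_of_le_of_ne (hmin e he hes) fun h => het (by
            rw [hpt₂, hpt]; exact Or.inl (Or.inr ⟨he, ((hρ c hc e he).1 h).symm⟩))
          have h2 := btw e he hes (Or.inl ⟨h1, hlt⟩)
          refine het ?_
          rw [hpt₂]
          exact Or.inr ⟨he, btw_eq e he hes d hd hds h2 ⟨hcd, hdc'⟩⟩
      obtain ⟨t₃', U₃', e3', G₃', hpt₃'⟩ := G₂'.tail.exists_next_of_min hb hρ' hc hct₂'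
        fun e he het => by
          by_contra hlt
          push Not at hlt
          have hes : e ∉ K.passed res b s := fun h => het (st₂' h)
          have h1 : ρ' c' < ρ' e := lt_of_le_of_ne (hmin' e he hes) fun h => het (by
            rw [hpt₂', hpt']; exact Or.inl (Or.inr ⟨he, ((hρ' c' hc' e he).1 h).symm⟩))
          have h2 := btw e he hes (Or.inr ⟨h1, hlt⟩)
          refine het ?_
          rw [hpt₂']
          exact Or.inr ⟨he, btw_eq e he hes d hd hds h2 ⟨hcd, hdc'⟩⟩
      have gt₃ : K.Generic res t₃ := G₃.path.tail.generic
      have hp : K.passed res b t₃ = K.passed res b t₃' := by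
        rw [hpt₃, hpt₃', hpt₂, hpt₂', hpt, hpt', Set.union_right_comm _ _ (K.wallClass res b c'),
          Set.union_right_comm _ _ (K.wallClass res b c'), Set.union_right_comm _ (K.wallClass res b c)]
      have he : K.crossings res t₃ t₃' = ∅ := crossings_eq_empty_of_passed hb gt₃ hp
      have st₃ : K.passed res b s ⊆ K.passed res b t₃ := by
        rw [hpt₃]; exact st₂.trans Set.subset_union_left
      have hsub : K.passed res b t₂' ⊆ K.passed res b t₃ := by
        rw [hp, hpt₃']; exact Set.subset_union_left
      have P : K.Path res (s :: t :: t₂ :: t₃ :: U₃) := by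
        have h1 := path_cons_cons.1 G.path
        have h2 := path_cons_cons.1 G₂.path
        exact path_cons_cons.2 ⟨h1.1, h1.2.1, path_cons_cons.2 ⟨h2.1, h2.2.1, G₃.path⟩⟩
      have P' : K.Path res (s :: t' :: t₂' :: t₃' :: U₃') := by
        have h1 := path_cons_cons.1 G'.path
        have h2 := path_cons_cons.1 G₂'.path
        exact path_cons_cons.2 ⟨h1.1, h1.2.1, path_cons_cons.2 ⟨h2.1, h2.2.1, G₃'.path⟩⟩
      -- The mixed path takes the first crossings in the order of the second gallery and then
      -- continues along the first one. This is possible because `t₃` and `t₃'` lie in the same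
      -- chamber.
      have P'' : K.Path res (s :: t' :: t₂' :: t₃ :: U₃) := by
        have h1 := path_cons_cons.1 G'.path
        have h2 := path_cons_cons.1 G₂'.path
        refine path_cons_cons.2 ⟨h1.1, h1.2.1, path_cons_cons.2 ⟨h2.1, h2.2.1,
          path_cons_cons.2 ⟨gt₂', ?_, G₃.path.tail⟩⟩⟩
        exact simple_of_passed hb gt₂' hsub (c := c) (by rw [hp, hpt₃'])
      have B : K.PathEquiv res (s :: t :: t₂ :: t₃ :: U₃) (s :: t' :: t₂' :: t₃ :: U₃) := by
        refine .braid P P'' ?_ ?_ ?_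
        · rw [crossings_eq_diff hb gs st, crossings_eq_diff hb gt₂' hsub, hp, hpt₃', hpt,
            union_diff_of_disjoint (clsn hc hcs), union_diff_of_disjoint]
          rw [hpt₂', hpt']
          rintro x hx ((h1 | h1) | h1)
          · exact clsn hc hcs x hx h1
          · exact disj hwcc x hx h1
          · exact disj hwcd x hx h1
        · rw [crossings_eq_diff hb gt (by rw [hpt₂]; exact Set.subset_union_left),
            crossings_eq_diff hb gt' (by rw [hpt₂']; exact Set.subset_union_left), hpt₂, hpt₂',
            union_diff_of_disjoint, union_diff_of_disjoint]
          · rw [hpt']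
            rintro x hx (h1 | h1)
            · exact clsn hd hds x hx h1
            · exact disj hwdc' x hx h1
          · rw [hpt]
            rintro x hx (h1 | h1)
            · exact clsn hd hds x hx h1
            · exact disj hwcd.symm x hx h1
        · rw [crossings_eq_diff hb gt₂ (by rw [hpt₃]; exact Set.subset_union_left),
            crossings_eq_diff hb gs st', hpt₃, hpt', union_diff_of_disjoint (clsn hc' hcs'),
            union_diff_of_disjoint]
          rw [hpt₂, hpt]
          rintro x hx ((h1 | h1) | h1)
          · exact clsn hc' hcs' x hx h1
          · exact disj hwcc.symm x hx h1
          · exact disj hwdc'.symm x hx h1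
      have J := ih' (c := c) G₃.tail (G₃'.tail.cons_of_passed gt₃ hb hp) hc hcs st₃ (by
        rw [hpt₃, hpt₂, hpt]; exact Or.inl (Or.inl (Or.inr (self c hc))))
      refine e1.trans (.trans (.cons s G.path (e2.trans (.cons t G₂.path e3))) (.trans B ?_))
      refine .symm (e1'.trans (.trans (.cons s G'.path (e2'.trans (.cons t' G₂'.path e3'))) ?_))
      refine .symm (.cons s P'' (.cons t' P''.tail (.trans (.cons t₂' P''.tail.tail J) ?_)))
      exact .symm (.insert P'.tail.tail gt₃ he)
    · have nod : ∀ e ∈ K.walls res b, e ∉ K.passed res b s →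
          ¬ ((ρ c < ρ e ∧ ρ e < ρ c') ∨ (ρ' c' < ρ' e ∧ ρ' e < ρ' c)) :=
        fun e he hes h1 => hd ⟨e, he, hes, btw e he hes h1⟩
      obtain ⟨t₂, U₂, e2, G₂, hpt₂⟩ := G.tail.exists_next_of_min hb hρ hc' hc't
        fun e he het => by
          by_contra hlt
          push Not at hlt
          have hes : e ∉ K.passed res b s := fun h => het (st h)
          have h1 : ρ c < ρ e := lt_of_le_of_ne (hmin e he hes) fun h => het (by
            rw [hpt]; exact Or.inr ⟨he, ((hρ c hc e he).1 h).symm⟩)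
          exact nod e he hes (Or.inl ⟨h1, hlt⟩)
      obtain ⟨t₂', U₂', e2', G₂', hpt₂'⟩ := G'.tail.exists_next_of_min hb hρ' hc hct'
        fun e he het => by
          by_contra hlt
          push Not at hlt
          have hes : e ∉ K.passed res b s := fun h => het (st' h)
          have h1 : ρ' c' < ρ' e := lt_of_le_of_ne (hmin' e he hes) fun h => het (by
            rw [hpt']; exact Or.inr ⟨he, ((hρ' c' hc' e he).1 h).symm⟩)
          exact nod e he hes (Or.inr ⟨h1, hlt⟩)
      have gt₂ : K.Generic res t₂ := G₂.path.tail.generic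
      have hp : K.passed res b t₂ = K.passed res b t₂' := by
        rw [hpt₂, hpt₂', hpt, hpt', Set.union_right_comm]
      have he : K.crossings res t₂ t₂' = ∅ := crossings_eq_empty_of_passed hb gt₂ hp
      have hsub : K.passed res b t' ⊆ K.passed res b t₂ := by
        rw [hp, hpt₂']; exact Set.subset_union_left
      have st₂ : K.passed res b s ⊆ K.passed res b t₂ := by
        rw [hpt₂]; exact st.trans Set.subset_union_left
      have P : K.Path res (s :: t :: t₂ :: U₂) := by
        have h1 := path_cons_cons.1 G.path
        exact path_cons_cons.2 ⟨h1.1, h1.2.1, G₂.path⟩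
      have P' : K.Path res (s :: t' :: t₂' :: U₂') := by
        have h1 := path_cons_cons.1 G'.path
        exact path_cons_cons.2 ⟨h1.1, h1.2.1, G₂'.path⟩
      have P'' : K.Path res (s :: t' :: t₂ :: U₂) := by
        have h1 := path_cons_cons.1 G'.path
        refine path_cons_cons.2 ⟨h1.1, h1.2.1, path_cons_cons.2 ⟨gt', ?_, G₂.path.tail⟩⟩
        exact simple_of_passed hb gt' hsub (c := c) (by rw [hp, hpt₂'])
      have B : K.PathEquiv res (s :: t :: t₂ :: U₂) (s :: t' :: t₂ :: U₂) := by
        refine .commute P P'' ?_ ?_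
        · rw [crossings_eq_diff hb gs st, crossings_eq_diff hb gt' hsub, hp, hpt₂', hpt,
            union_diff_of_disjoint (clsn hc hcs), union_diff_of_disjoint]
          rw [hpt']
          rintro x hx (h1 | h1)
          · exact clsn hc hcs x hx h1
          · exact disj hwcc x hx h1
        · rw [crossings_eq_diff hb gt (by rw [hpt₂]; exact Set.subset_union_left),
            crossings_eq_diff hb gs st', hpt₂, hpt', union_diff_of_disjoint (clsn hc' hcs'),
            union_diff_of_disjoint]
          rw [hpt]
          rintro x hx (h1 | h1)
          · exact clsn hc' hcs' x hx h1
          · exact disj hwcc.symm x hx h1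
      have J := ih' (c := c) G₂.tail (G₂'.tail.cons_of_passed gt₂ hb hp) hc hcs st₂ (by
        rw [hpt₂, hpt]; exact Or.inl (Or.inr (self c hc)))
      refine e1.trans (.trans (.cons s G.path e2) (.trans B ?_))
      refine .symm (e1'.trans (.trans (.cons s G'.path e2') ?_))
      refine .symm (.cons s P'' (.trans (.cons t' P''.tail J) ?_))
      exact .symm (.insert P'.tail gt₂ he)

end PathEquivalence

end Datum

namespace Datum

/-! ### Normal form of a path -/

section NormalForm

variable {R : Type*} [CommRing R] {I E : Type*} {n l : ℕ} {K : Datum R I E n l}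
  {res : Fin n → I} {b s t u v x y z : Fin n → ℝ} {c d e : Str n l E × Str n l E}
  {L L' M P T : List (Fin n → ℝ)}

theorem mem_walls_or_swap (hb : K.Generic res b) (h1 : K.Active res c.1) (h2 : K.Active res c.2)
    (h : c.1.carrier ≠ c.2.carrier) : c ∈ K.walls res b ∨ c.swap ∈ K.walls res b := by
  have hne : c.1 ≠ c.2 := fun h3 => h (by rw [h3])
  rcases lt_or_gt_of_ne (strPos_ne hb h1 h2 hne) with h3 | h3
  · exact Or.inr ⟨h2, h1, h.symm, h3⟩
  · exact Or.inl ⟨h1, h2, h, h3⟩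

theorem mem_crossings_iff_wallMap (hc : c ∈ K.walls res b) :
    c ∈ K.crossings res u v ↔ 0 < K.wallMap b c u ∧ K.wallMap b c v < 0 := by
  rw [wallMap_pos_iff hc, wallMap_neg_iff hc]
  exact ⟨fun h => ⟨h.2.2.1, h.2.2.2⟩, fun h => ⟨hc.1, hc.2.1, h.1, h.2⟩⟩

theorem mem_crossings_iff_wallMap_swap (hc : c.swap ∈ K.walls res b) :
    c ∈ K.crossings res u v ↔ K.wallMap b c.swap u < 0 ∧ 0 < K.wallMap b c.swap v := by
  rw [wallMap_pos_iff hc, wallMap_neg_iff hc]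
  exact ⟨fun h => ⟨h.2.2.1, h.2.2.2⟩, fun h => ⟨hc.2.1, hc.1, h.1, h.2⟩⟩

theorem crossings_subset_of_wallMap (hb : K.Generic res b)
    (h : ∀ c ∈ K.walls res b, K.wallMap b c u * K.wallMap b c z < 0 →
      K.wallMap b c u * K.wallMap b c v < 0) : K.crossings res u z ⊆ K.crossings res u v := by
  intro c hc
  rcases mem_walls_or_swap hb hc.1 hc.2.1 (carrier_ne_of_mem_crossings hc) with hw | hw
  · rw [mem_crossings_iff_wallMap hw] at hc ⊢
    refine ⟨hc.1, ?_⟩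
    have := h c hw (mul_neg_of_pos_of_neg hc.1 hc.2)
    exact (pos_iff_neg_of_mul_neg this).1 hc.1
  · rw [mem_crossings_iff_wallMap_swap hw] at hc ⊢
    refine ⟨hc.1, ?_⟩
    have := h c.swap hw (mul_neg_of_neg_of_pos hc.1 hc.2)
    exact (neg_iff_pos_of_mul_neg this).1 hc.1

/-- Strings with different carriers are separated by the wall functions; strings with a common
carrier keep the distance that they have at `b`. -/
theorem generic_of_wallMap (hb : K.Generic res b)
    (h : ∀ c ∈ K.walls res b, K.wallMap b c z ≠ 0) : K.Generic res z := by
  intro a a' ha ha' he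
  by_contra hne
  by_cases hc : a.carrier = a'.carrier
  · refine hne (hb a a' ha ha' ?_)
    rw [strPos_eq, strPos_eq, hc] at he ⊢
    linarith
  · rcases mem_walls_or_swap (c := (a, a')) hb ha ha' hc with hw | hw
    · refine h _ hw ?_
      rw [wallMap_apply, he, sub_self, mul_zero]
    · refine h _ hw ?_
      rw [wallMap_apply, Prod.fst_swap, Prod.snd_swap, he, sub_self, mul_zero]

variable (K) in
/-- The affine functions that detect the crossings on the way to `b`. -/
def wallMaps (res : Fin n → I) (b : Fin n → ℝ) : Finset ((Fin n → ℝ) →ᵃ[ℝ] ℝ) :=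
  ((finite_walls (K := K) res b).image (K.wallMap b)).toFinset

theorem mem_wallMaps {F : (Fin n → ℝ) →ᵃ[ℝ] ℝ} :
    F ∈ K.wallMaps res b ↔ ∃ c ∈ K.walls res b, K.wallMap b c = F := by
  simp [wallMaps]

theorem finite_orderMaps (res : Fin n → I) (b : Fin n → ℝ) :
    (K.wallMap b '' K.walls res b ∪ {F | F ≠ 0 ∧ F ∈ Set.image2
      (fun c d => K.wallMap b c - K.wallMap b d) (K.walls res b) (K.walls res b)}).Finite :=
  ((finite_walls res b).image _).union
    (((finite_walls res b).image2 _ (finite_walls res b)).subset fun _ h => h.2)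

variable (K) in
/-- The affine functions that detect the order of the crossings on the straight way to `b`. -/
def orderMaps (res : Fin n → I) (b : Fin n → ℝ) : Finset ((Fin n → ℝ) →ᵃ[ℝ] ℝ) :=
  (finite_orderMaps (K := K) res b).toFinset

theorem wallMap_mem_orderMaps (hc : c ∈ K.walls res b) : K.wallMap b c ∈ K.orderMaps res b :=
  (finite_orderMaps res b).mem_toFinset.2 (Or.inl ⟨c, hc, rfl⟩)

theorem sub_mem_orderMaps (hc : c ∈ K.walls res b) (hd : d ∈ K.walls res b)
    (h : K.wallMap b c ≠ K.wallMap b d) : K.wallMap b c - K.wallMap b d ∈ K.orderMaps res b :=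
  (finite_orderMaps res b).mem_toFinset.2 (Or.inr ⟨sub_ne_zero.2 h, c, hc, d, hd, rfl⟩)

theorem orderMaps_ne_zero : ∀ F ∈ K.orderMaps res b, F ≠ 0 := by
  intro F hF h
  rcases (finite_orderMaps res b).mem_toFinset.1 hF with ⟨c, hc, rfl⟩ | h1
  · have := wallMap_self hc
    rw [h] at this
    simp at this
  · exact h1.1 h

variable (K) in
/-- No two different walls are met at the same time on the straight way from `u` to `b`. -/
def Regular (res : Fin n → I) (b u : Fin n → ℝ) : Prop := ∀ F ∈ K.orderMaps res b, F u ≠ 0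

theorem Regular.generic (h : K.Regular res b u) (hb : K.Generic res b) : K.Generic res u :=
  generic_of_wallMap hb fun _ hc => h _ (wallMap_mem_orderMaps hc)

theorem Regular.eq_iff (h : K.Regular res b u) : ∀ c ∈ K.walls res b, ∀ d ∈ K.walls res b,
    K.wallMap b c u = K.wallMap b d u ↔ K.wallMap b c = K.wallMap b d := by
  refine fun c hc d hd => ⟨fun h1 => ?_, fun h1 => by rw [h1]⟩
  by_contra h2
  refine h _ (sub_mem_orderMaps hc hd h2) ?_
  rw [AffineMap.coe_sub, Pi.sub_apply, h1, sub_self]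

/-- Every slice has a regular slice next to it. -/
theorem exists_regular (hb : K.Generic res b) (hy : K.Generic res y) :
    ∃ y', K.Regular res b y' ∧ K.crossings res y y' = ∅ := by
  obtain ⟨y', h⟩ := exists_perturbation (K.orderMaps res b) orderMaps_ne_zero y
  refine ⟨y', fun F hF => (h F hF).1, crossings_eq_empty_of_passed hb hy ?_⟩
  ext c
  by_cases hc : c ∈ K.walls res b
  · rw [mem_passed_iff hc, mem_passed_iff hc]
    have := (h _ (wallMap_mem_orderMaps hc)).2 (wallMap_ne_zero hy hc)
    exact neg_iff_neg_of_mul_pos this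
  · exact ⟨fun h => absurd h.1 hc, fun h => absurd h.1 hc⟩

theorem isChain_and {α : Type*} {r r' : α → α → Prop} {L : List α} (h : L.IsChain r)
    (h' : L.IsChain r') : L.IsChain fun x y => r x y ∧ r' x y := by
  induction L with
  | nil => simp
  | cons x L ih =>
    cases L with
    | nil => simp
    | cons y L =>
      rw [List.isChain_cons_cons] at h h' ⊢
      exact ⟨⟨h.1, h'.1⟩, ih h.2 h'.2⟩

/-- The straight way from a regular slice to `b`. -/
theorem Regular.exists_gallery (hu : K.Regular res b u) (hb : K.Generic res b) :
    ∃ T, K.Gallery res b (fun c => K.wallMap b c u) (u :: T) := by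
  obtain ⟨L, h1, h2, h3, h4, h5, h6⟩ := exists_segment_chain (K.wallMaps res b) (x := u) (y := b)
    (fun F hF => by
      obtain ⟨c, hc, rfl⟩ := mem_wallMaps.1 hF
      exact hu _ (wallMap_mem_orderMaps hc)) (fun F hF => by
      obtain ⟨c, hc, rfl⟩ := mem_wallMaps.1 hF
      rw [wallMap_self hc]; norm_num)
  obtain ⟨T, rfl⟩ : ∃ T, L = u :: T := by
    cases L with
    | nil => simp at h1
    | cons v T => exact ⟨T, by simpa using h1⟩
  have g : ∀ z ∈ u :: T, K.Generic res z := fun z hz => generic_of_wallMap hb fun c hc =>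
    h3 z hz _ (mem_wallMaps.2 ⟨c, hc, rfl⟩)
  have mono : (u :: T).Pairwise fun z v => K.passed res b z ⊆ K.passed res b v := by
    refine h4.imp_of_mem fun {z v} hz hv hzv c hc => ?_
    have hw := hc.1
    rw [mem_passed_iff hw] at hc ⊢
    rcases lt_or_gt_of_ne (wallMap_ne_zero (g u (by simp)) hw) with hu' | hu'
    · obtain ⟨t, ht0, ht1, rfl⟩ := h6 v hv
      rw [apply_lineMap_eq, wallMap_self hw]
      rcases ht0.eq_or_lt with rfl | ht
      · linarith
      · nlinarith [mul_nonneg (sub_nonneg.2 ht1) (neg_nonneg.2 hu'.le)]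
    · exact (pos_iff_neg_of_mul_neg (hzv _ (mul_neg_of_pos_of_neg hu' hc))).1 hu'
  refine ⟨T, ⟨⟨g, ?_⟩, h2, mono, ?_⟩⟩
  · have h7 : (u :: T).IsChain fun z v => K.passed res b z ⊆ K.passed res b v := mono.isChain
    refine (isChain_and h5 h7).imp_of_mem_imp fun z v hz hv h8 => ?_
    rw [simple_iff, crossings_eq_diff hb (g z hz) h8.2]
    intro c hc d hd
    have key : ∀ e ∈ K.passed res b v \ K.passed res b z,
        K.wallMap b e z * K.wallMap b e v < 0 := fun e he => mul_neg_of_pos_of_neg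
      (wallMap_pos_of_notMem (g z hz) he.1.1 he.2) ((mem_passed_iff he.1.1).1 he.1)
    have h9 := h8.1 _ (mem_wallMaps.2 ⟨c, hc.1.1, rfl⟩) _ (mem_wallMaps.2 ⟨d, hd.1.1, rfl⟩)
      (key c hc) (key d hd)
    rw [wallMap_self hc.1.1, wallMap_self hd.1.1] at h9
    exact carrier_eq_of_wallMap_eq hd.1.1 hc.1.1
      ((hu.eq_iff c hc.1.1 d hd.1.1).1 (by linarith))
  -- At time `t` a wall function equals `(1 - t)` times its value at `u`, minus `t`. A smaller value
  -- at `u` therefore becomes negative no later.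
  · intro z hz c hc d hd hlt
    have hw := hc.1
    obtain ⟨t, ht0, ht1, rfl⟩ := h6 z hz
    rw [mem_passed_iff hw, apply_lineMap_eq, wallMap_self hw] at hc
    rw [mem_passed_iff hd, apply_lineMap_eq, wallMap_self hd]
    nlinarith [mul_le_mul_of_nonneg_left hlt.le (sub_nonneg.2 ht1)]

/-! ### Bigons -/

variable (K) in
/-- There are two consecutive crossings that cancel. -/
def HasBigon (res : Fin n → I) (L : List (Fin n → ℝ)) : Prop :=
  ∃ P s z t S, L = P ++ s :: z :: t :: S ∧ K.crossings res s t = ∅ ∧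
    (K.crossings res s z).Nonempty

theorem HasBigon.cons (h : K.HasBigon res L) (u : Fin n → ℝ) : K.HasBigon res (u :: L) := by
  obtain ⟨P, s, z, t, S, rfl, h1, h2⟩ := h
  exact ⟨u :: P, s, z, t, S, rfl, h1, h2⟩

/-- Cutting out the two cancelling steps gives a shorter sequence with the same ends, so a path with
a bigon is never minimal. -/
theorem HasBigon.numCross_lt (h : K.HasBigon res L) (hL : ∀ z ∈ L, K.Generic res z)
    (hx : L.head? = some x) (hy : L.getLast? = some y) :
    K.numCross res x y < K.totalCross res L := by
  obtain ⟨P, s, z, t, S, rfl, h1, h2⟩ := h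
  induction P generalizing x with
  | nil =>
    obtain rfl : s = x := by simpa using hx
    simp only [List.nil_append] at hL hy ⊢
    rw [totalCross_cons_cons, totalCross_cons_cons]
    have gt : K.Generic res t := hL t (by simp)
    rw [List.getLast?_cons_cons, List.getLast?_cons_cons] at hy
    have h3 := numCross_le_totalCross (K := K) (res := res) (fun z hz => hL z (by
      simp only [List.mem_cons] at hz ⊢; tauto)) hy
    have h4 : K.numCross res s y = K.numCross res t y := by
      rw [numCross, numCross, crossings_congr_left (hL s (by simp)) gt h1]
    have h5 : 0 < K.numCross res s z := (Set.ncard_pos (finite_crossings ..)).2 h2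
    omega
  | cons u P ih =>
    obtain rfl : u = x := by simpa using hx
    obtain ⟨v, Q, hQ⟩ : ∃ v Q, P ++ s :: z :: t :: S = v :: Q := by
      cases P with
      | nil => exact ⟨_, _, rfl⟩
      | cons v P => exact ⟨_, _, rfl⟩
    rw [List.cons_append, hQ] at hL hy ⊢
    rw [hQ] at ih
    rw [List.getLast?_cons_cons] at hy
    have h3 := ih (fun z hz => hL z (List.mem_cons_of_mem _ hz)) rfl hy
    have h4 := numCross_triangle (K := K) (res := res) (x := u) (z := y) (hL v (by simp))
    rw [totalCross_cons_cons]
    omega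

variable (K) in
/-- The first sequence of slices is equivalent to the second one, or to one with a bigon. -/
def Reduces (res : Fin n → I) (L M : List (Fin n → ℝ)) : Prop :=
  K.PathEquiv res L M ∨ ∃ M', K.PathEquiv res L M' ∧ K.HasBigon res M'

theorem Reduces.cons (h : K.Reduces res L M) (hu : K.Path res (u :: L)) :
    K.Reduces res (u :: L) (u :: M) := by
  rcases h with h | ⟨M', h, h'⟩
  · exact Or.inl (.cons u hu h)
  · exact Or.inr ⟨_, .cons u hu h, h'.cons u⟩

theorem PathEquiv.reduces (h : K.PathEquiv res L L') (h' : K.Reduces res L' M) :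
    K.Reduces res L M := by
  rcases h' with h' | ⟨M', h', h''⟩
  · exact Or.inl (h.trans h')
  · exact Or.inr ⟨_, h.trans h', h''⟩

theorem Reduces.trans (h : K.Reduces res L L') (h' : K.Reduces res L' M) :
    K.Reduces res L M := by
  rcases h with h | h
  · exact h.reduces h'
  · exact Or.inr h

theorem PathEquiv.append_left (h : K.PathEquiv res L L') (hP : K.Path res (P ++ L)) :
    K.PathEquiv res (P ++ L) (P ++ L') := by
  induction P with
  | nil => exact h
  | cons u P ih => exact .cons u hP (ih hP.tail)

/-! ### Single steps -/

/-- Without inversions, two galleries are equivalent. -/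
theorem Gallery.equiv_of_sorted {ρ : Str n l E × Str n l E → ℝ} (hb : K.Generic res b)
    (hρ : ∀ c ∈ K.walls res b, ∀ c' ∈ K.walls res b, ρ c = ρ c' ↔ K.wallMap b c = K.wallMap b c')
    (h : K.Gallery res b ρ (s :: T)) (h' : K.Gallery res b ρ (s :: L)) :
    K.PathEquiv res (s :: T) (s :: L) :=
  Gallery.equiv hb hρ hρ h h'
    (fun _ _ _ _ _ _ h => absurd h (by rintro (h | h) <;> exact lt_asymm h.1 h.2))
    (fun _ _ _ _ _ _ _ _ h => absurd h.2 (lt_asymm h.1))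

/-- Measured from `b`, the normalized function depends linearly on the relative displacement of the
two carriers; the offsets enter only through the positive factor. -/
theorem wallMap_add_one (hc : c ∈ K.walls res b) : K.wallMap b c z + 1 =
    (K.strPos b c.1 - K.strPos b c.2)⁻¹ *
      (coord z c.2.carrier - coord b c.2.carrier - (coord z c.1.carrier - coord b c.1.carrier)) := by
  have h := wallMap_self hc
  rw [wallMap_apply] at h ⊢
  rw [← sub_neg_eq_add, ← h, ← mul_sub]
  simp only [strPos_eq]
  ring

/-- Crossings of strings with the same carriers are never exchanged. -/
theorem Inverted.carrier_ne (hc : c ∈ K.walls res b) (hd : d ∈ K.walls res b)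
    (hcu : 0 < K.wallMap b c u) (hcv : 0 < K.wallMap b c v) (_ : 0 < K.wallMap b d u)
    (h : Inverted (fun c => K.wallMap b c u) (fun c => K.wallMap b c v) c d) :
    ¬ ((c.1.carrier = d.1.carrier ∧ c.2.carrier = d.2.carrier) ∨
      (c.1.carrier = d.2.carrier ∧ c.2.carrier = d.1.carrier)) := by
  obtain ⟨h1, h2⟩ := h
  dsimp only at h1 h2
  have kc := inv_pos.2 (sub_pos.2 hc.2.2.2)
  have kd := inv_pos.2 (sub_pos.2 hd.2.2.2)
  have e1 := wallMap_add_one (z := u) hc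
  have e2 := wallMap_add_one (z := v) hc
  have e3 := wallMap_add_one (z := u) hd
  have e4 := wallMap_add_one (z := v) hd
  set κ := (K.strPos b c.1 - K.strPos b c.2)⁻¹
  set κ' := (K.strPos b d.1 - K.strPos b d.2)⁻¹
  -- For equal carriers the order is that of the constants `κ` and `κ'`, both at `u` and at `v`. For
  -- interchanged carriers the displacements at `u` are opposite, so both functions cannot be
  -- positive there.
  rintro (⟨h3, h4⟩ | ⟨h3, h4⟩)
  · rw [h3, h4] at e1 e2
    set τ := coord u d.2.carrier - coord b d.2.carrier - (coord u d.1.carrier - coord b d.1.carrier)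
    set τ' := coord v d.2.carrier - coord b d.2.carrier - (coord v d.1.carrier - coord b d.1.carrier)
    have t1 : 0 < τ := (mul_pos_iff_of_pos_left kc).1 (by linarith)
    have t2 : 0 < τ' := (mul_pos_iff_of_pos_left kc).1 (by linarith)
    have l1 : κ < κ' := lt_of_mul_lt_mul_right (by linarith) t1.le
    have l2 : κ' < κ := lt_of_mul_lt_mul_right (by linarith) t2.le
    exact lt_asymm l1 l2
  · rw [h3, h4] at e1
    have t1 := (mul_pos_iff_of_pos_left kc).1 (lt_of_lt_of_eq (by linarith : 0 < K.wallMap b c u + 1) e1)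
    have t2 := (mul_pos_iff_of_pos_left kd).1 (lt_of_lt_of_eq (by linarith : 0 < K.wallMap b d u + 1) e3)
    linarith

theorem wallMap_linear_apply (v : Fin n → ℝ) : (K.wallMap b c).linear v =
    (K.strPos b c.1 - K.strPos b c.2)⁻¹ * (coord v c.2.carrier - coord v c.1.carrier) := by
  have h2 : (K.heightMap c).linear = coordMap c.2.carrier - coordMap c.1.carrier := by
    simp [heightMap]
  rw [wallMap, AffineMap.smul_linear, h2, LinearMap.smul_apply, LinearMap.sub_apply,
    coordMap_apply, coordMap_apply, heightMap_apply, neg_sub, smul_eq_mul]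

/-- A direction in which exactly the strings with a given carrier move relative to the others. -/
theorem exists_direction (res : Fin n → I) (b : Fin n → ℝ) (o : Option (Fin n)) :
    ∃ v : Fin n → ℝ, ∀ c ∈ K.walls res b,
      (K.wallMap b c).linear v = 0 ↔ o ≠ c.1.carrier ∧ o ≠ c.2.carrier := by
  have key : ∃ v : Fin n → ℝ, ∀ p q : Option (Fin n), p ≠ q →
      (coord v q - coord v p = 0 ↔ o ≠ p ∧ o ≠ q) := by
    cases o with
    | none =>
      -- Shifting all solid strings together moves them relative to the red strings only.
      refine ⟨fun _ => 1, fun p q hpq => ?_⟩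
      cases p <;> cases q <;> simp_all [coord]
    | some k =>
      refine ⟨Pi.single k 1, fun p q hpq => ?_⟩
      have h : ∀ o' : Option (Fin n), coord (Pi.single k (1 : ℝ)) o' =
          if some k = o' then 1 else 0 := by
        intro o'
        cases o' with
        | none => simp [coord]
        | some j => simp [coord, Pi.single_apply, eq_comm]
      rw [h, h]
      split_ifs with h1 h2 h2
      · exact absurd (h2.symm.trans h1) hpq
      · simp [h1]
      · simp [h2]
      · simp [h1, h2]
  obtain ⟨v, hv⟩ := key
  refine ⟨v, fun c hc => ?_⟩
  rw [wallMap_linear_apply, mul_eq_zero, or_iff_right (inv_pos.2 (sub_pos.2 hc.2.2.2)).ne']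
  exact hv _ _ hc.2.2.1

/-- In the direction given by `exists_direction` for `o`, walls not involving `o` have derivative
zero. If neither `d` nor `e` involved `o`, proportionality would make the derivative of `c` zero as
well. -/
theorem carrier_mem_of_proportional {o : Option (Fin n)} {r : ℝ} (hr : r ≠ 0)
    (hc : c ∈ K.walls res b) (hd : d ∈ K.walls res b) (he : e ∈ K.walls res b)
    (h : K.wallMap b d - K.wallMap b e = r • (K.wallMap b c - K.wallMap b d))
    (ho : o = c.1.carrier ∨ o = c.2.carrier) :
    (o = d.1.carrier ∨ o = d.2.carrier) ∨ (o = e.1.carrier ∨ o = e.2.carrier) := by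
  obtain ⟨v, hv⟩ := exists_direction (K := K) res b o
  by_contra hne
  push Not at hne
  have h1 := congrArg (fun F => F.linear v) h
  simp only [AffineMap.sub_linear, AffineMap.smul_linear, LinearMap.sub_apply,
    LinearMap.smul_apply, (hv d hd).2 hne.1, (hv e he).2 hne.2, sub_zero, smul_eq_mul] at h1
  have h2 := (hv c hc).1 ((mul_eq_zero.1 h1.symm).resolve_left hr)
  exact ho.elim h2.1 h2.2

theorem inverted_or_iff : (Inverted (fun c => K.wallMap b c u) (fun c => K.wallMap b c v) c d ∨
      Inverted (fun c => K.wallMap b c u) (fun c => K.wallMap b c v) d c) ↔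
    (K.wallMap b c - K.wallMap b d) u * (K.wallMap b c - K.wallMap b d) v < 0 := by
  rw [mul_neg_iff, AffineMap.coe_sub, Pi.sub_apply, Pi.sub_apply, sub_pos, sub_neg, sub_pos,
    sub_neg, or_comm]
  rfl

variable (K) in
/-- At most one wall is met between two slices. -/
def OneWall (res : Fin n → I) (b u v : Fin n → ℝ) : Prop :=
  ∀ F ∈ K.orderMaps res b, ∀ G ∈ K.orderMaps res b, F u * F v < 0 → G u * G v < 0 →
    ∃ r : ℝ, G = r • F

theorem OneWall.exists_proportional (h : K.OneWall res b u v)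
    (hc : c ∈ K.walls res b) (hd : d ∈ K.walls res b) (he : e ∈ K.walls res b)
    (h1 : (K.wallMap b c - K.wallMap b d) u * (K.wallMap b c - K.wallMap b d) v < 0)
    (h2 : (K.wallMap b d - K.wallMap b e) u * (K.wallMap b d - K.wallMap b e) v < 0) :
    ∃ r : ℝ, r ≠ 0 ∧ K.wallMap b d - K.wallMap b e = r • (K.wallMap b c - K.wallMap b d) := by
  have ne : ∀ {F G : (Fin n → ℝ) →ᵃ[ℝ] ℝ}, (F - G) u * (F - G) v < 0 → F ≠ G := by
    rintro F G h rfl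
    simp at h
  obtain ⟨r, hr⟩ := h _ (sub_mem_orderMaps hc hd (ne h1)) _ (sub_mem_orderMaps hd he (ne h2)) h1 h2
  refine ⟨r, ?_, hr⟩
  rintro rfl
  rw [zero_smul] at hr
  exact ne h2 (sub_eq_zero.1 hr)

/-- Of three walls, at least two contain the first carrier of a given one and at least two contain
the second carrier, so some wall contains both. -/
theorem false_of_pigeonhole {p₁ p₂ p₃ q₁ q₂ q₃ : Prop} (h₁ : p₁ ∨ p₂) (h₂ : p₁ ∨ p₃)
    (h₃ : p₂ ∨ p₃) (h₁' : q₁ ∨ q₂) (h₂' : q₁ ∨ q₃) (h₃' : q₂ ∨ q₃) (k₁ : ¬ (p₁ ∧ q₁))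
    (k₂ : ¬ (p₂ ∧ q₂)) (k₃ : ¬ (p₃ ∧ q₃)) : False := by
  tauto

/-- Passing from `u` to `v` without any crossings. -/
theorem equiv_of_passed_eq (hb : K.Generic res b) (hu : K.Regular res b u)
    (hv : K.Regular res b v) (h : K.OneWall res b u v)
    (hT : K.Gallery res b (fun c => K.wallMap b c u) (u :: T))
    (hL : K.Gallery res b (fun c => K.wallMap b c v) (v :: L))
    (hp : K.passed res b u = K.passed res b v) : K.PathEquiv res (u :: v :: L) (u :: T) := by
  have gu := hu.generic hb
  have gv := hv.generic hb
  refine .symm (Gallery.equiv hb hu.eq_iff hv.eq_iff hT (hL.cons_of_passed gu hb hp) ?_ ?_)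
  -- Both differences are multiples of one function, hence so is their sum: it is zero or changes
  -- its sign together with them.
  · intro c₁ h1 c₂ h2 c₃ h3 h12 h23
    rw [inverted_or_iff] at h12 h23 ⊢
    obtain ⟨r, -, hr⟩ := h.exists_proportional h1.1 h2.1 h3.1 h12 h23
    have h13 : K.wallMap b c₁ - K.wallMap b c₃ = (1 + r) • (K.wallMap b c₁ - K.wallMap b c₂) := by
      rw [add_smul, one_smul, ← hr]; abel
    by_cases h0 : 1 + r = 0
    · rw [h0, zero_smul] at h13
      exact Or.inl (sub_eq_zero.1 h13)
    · refine Or.inr ?_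
      rw [h13, AffineMap.coe_smul, Pi.smul_apply, Pi.smul_apply, smul_eq_mul, smul_eq_mul,
        mul_mul_mul_comm]
      exact mul_neg_of_pos_of_neg (mul_self_pos.2 h0) h12
  -- In a chain of four inversions, each carrier of `c₁` occurs in at least two of the other three
  -- walls (`share`), but none of these contains both carriers (`dist`).
  · intro c₁ h1 c₂ h2 c₃ h3 c₄ h4 h12 h23 h34
    have share : ∀ {c d e}, c ∈ K.walls res b \ K.passed res b u →
        d ∈ K.walls res b \ K.passed res b u → e ∈ K.walls res b \ K.passed res b u →
        Inverted (fun c => K.wallMap b c u) (fun c => K.wallMap b c v) c d →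
        Inverted (fun c => K.wallMap b c u) (fun c => K.wallMap b c v) d e →
        ∀ o, (o = c.1.carrier ∨ o = c.2.carrier) →
        (o = d.1.carrier ∨ o = d.2.carrier) ∨ (o = e.1.carrier ∨ o = e.2.carrier) := by
      intro c d e hc hd he hcd hde o ho
      obtain ⟨r, hr, hr'⟩ := h.exists_proportional hc.1 hd.1 he.1
        (inverted_or_iff.1 (Or.inl hcd)) (inverted_or_iff.1 (Or.inl hde))
      exact carrier_mem_of_proportional hr hc.1 hd.1 he.1 hr' ho
    have dist : ∀ {c d}, c ∈ K.walls res b \ K.passed res b u →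
        d ∈ K.walls res b \ K.passed res b u →
        Inverted (fun c => K.wallMap b c u) (fun c => K.wallMap b c v) c d →
        ¬ ((c.1.carrier = d.1.carrier ∨ c.1.carrier = d.2.carrier) ∧
          (c.2.carrier = d.1.carrier ∨ c.2.carrier = d.2.carrier)) := by
      intro c d hc hd hcd h0
      have := Inverted.carrier_ne hc.1 hd.1 (wallMap_pos_of_notMem gu hc.1 hc.2)
        (wallMap_pos_of_notMem gv hc.1 (hp ▸ hc.2)) (wallMap_pos_of_notMem gu hd.1 hd.2) hcd
      have hne := hc.1.2.2.1
      grind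
    have a1 := share h1 h2 h3 h12 h23
    have a2 := share h1 h2 h4 h12 (h23.trans h34)
    have a3 := share h1 h3 h4 (h12.trans h23) h34
    have b1 := dist h1 h2 h12
    have b2 := dist h1 h3 (h12.trans h23)
    have b3 := dist h1 h4 (h12.trans (h23.trans h34))
    exact false_of_pigeonhole (a1 _ (Or.inl rfl)) (a2 _ (Or.inl rfl)) (a3 _ (Or.inl rfl))
      (a1 _ (Or.inr rfl)) (a2 _ (Or.inr rfl)) (a3 _ (Or.inr rfl)) b1 b2 b3

/-- Passing from one regular slice to the next one. -/
theorem reduces_cons_cons (hb : K.Generic res b) (hu : K.Regular res b u)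
    (hv : K.Regular res b v) (h : K.OneWall res b u v)
    (hT : K.Gallery res b (fun c => K.wallMap b c u) (u :: T))
    (hL : K.Gallery res b (fun c => K.wallMap b c v) (v :: L)) :
    K.Reduces res (u :: v :: L) (u :: T) := by
  have gu := hu.generic hb
  have gv := hv.generic hb
  by_cases hp : K.passed res b u = K.passed res b v
  · exact Or.inl (equiv_of_passed_eq hb hu hv h hT hL hp)
  obtain ⟨c, hc, hcs⟩ : ∃ c ∈ K.walls res b, K.wallMap b c u * K.wallMap b c v < 0 := by
    by_contra hne
    push Not at hne
    refine hp (Set.ext fun c => ?_)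
    by_cases hc : c ∈ K.walls res b
    · rw [mem_passed_iff hc, mem_passed_iff hc]
      exact neg_iff_neg_of_mul_pos (lt_of_le_of_ne (hne c hc)
        (mul_ne_zero (wallMap_ne_zero gu hc) (wallMap_ne_zero gv hc)).symm)
    · exact ⟨fun h => absurd h.1 hc, fun h => absurd h.1 hc⟩
  -- All functions that change their sign are proportional, and wall functions agree at `b`, so the
  -- factor is `1`.
  have cls : ∀ d ∈ K.walls res b, K.wallMap b d u * K.wallMap b d v < 0 →
      K.wallMap b d = K.wallMap b c := by
    intro d hd hds
    obtain ⟨r, hr⟩ := h _ (wallMap_mem_orderMaps hc) _ (wallMap_mem_orderMaps hd) hcs hds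
    have h1 := congrArg (fun F => F b) hr
    simp only [AffineMap.coe_smul, Pi.smul_apply, wallMap_self hc, wallMap_self hd,
      smul_eq_mul] at h1
    obtain rfl : r = 1 := by linarith
    rw [hr, one_smul]
  -- A difference of two wall functions vanishes at `b`, where that of `c` does not, so it cannot be
  -- a non-zero multiple of the latter. Hence no order changes in this step.
  have order : ∀ d ∈ K.walls res b, ∀ e ∈ K.walls res b,
      K.wallMap b d u < K.wallMap b e u → K.wallMap b d v < K.wallMap b e v := by
    intro d hd e he hlt
    by_contra hle
    push Not at hle
    have hne : K.wallMap b d ≠ K.wallMap b e := fun h => by rw [h] at hlt; exact lt_irrefl _ hlt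
    have hlt' := lt_of_le_of_ne hle fun h => hne ((hv.eq_iff d hd e he).1 h.symm)
    obtain ⟨r, hr⟩ := h _ (wallMap_mem_orderMaps hc) _ (sub_mem_orderMaps hd he hne) hcs
      (inverted_or_iff.1 (Or.inl ⟨hlt, hlt'⟩))
    have h1 := congrArg (fun F => F b) hr
    simp only [AffineMap.coe_smul, AffineMap.coe_sub, Pi.sub_apply, Pi.smul_apply,
      wallMap_self hc, wallMap_self hd, wallMap_self he, smul_eq_mul] at h1
    obtain rfl : r = 0 := by linarith
    rw [zero_smul] at hr
    exact hne (sub_eq_zero.1 hr)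
  have same : ∀ d ∈ K.walls res b, K.wallMap b d ≠ K.wallMap b c →
      (d ∈ K.passed res b u ↔ d ∈ K.passed res b v) := by
    intro d hd hdc
    rw [mem_passed_iff hd, mem_passed_iff hd]
    refine neg_iff_neg_of_mul_pos (lt_of_le_of_ne ?_
      (mul_ne_zero (wallMap_ne_zero gu hd) (wallMap_ne_zero gv hd)).symm)
    by_contra hlt
    exact hdc (cls d hd (not_le.1 hlt))
  -- If the step passes the wall towards `b`, the whole path is already a gallery with the order
  -- given by `u`.
  rcases mul_neg_iff.1 hcs with ⟨c1, c2⟩ | ⟨c1, c2⟩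
  · have hsub : K.passed res b u ⊆ K.passed res b v := by
      intro d hd
      by_cases hdc : K.wallMap b d = K.wallMap b c
      · rw [mem_passed_iff hd.1, hdc]; exact c2
      · exact (same d hd.1 hdc).1 hd
    have hsub' : K.passed res b v ⊆ K.passed res b u ∪ K.wallClass res b c := by
      intro d hd
      by_cases hdc : K.wallMap b d = K.wallMap b c
      · exact Or.inr ⟨hd.1, hdc⟩
      · exact Or.inl ((same d hd.1 hdc).2 hd)
    refine Or.inl (.symm (hT.equiv_of_sorted hb hu.eq_iff ⟨?_, ?_, ?_, ?_⟩))
    · exact path_cons_cons.2 ⟨gu, simple_of_passed hb gu hsub hsub', hL.path⟩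
    · rw [List.getLast?_cons_cons]; exact hL.last
    · refine List.pairwise_cons.2 ⟨fun z hz => ?_, hL.mono⟩
      rcases List.mem_cons.1 hz with rfl | hz
      · exact hsub
      · exact hsub.trans ((List.pairwise_cons.1 hL.mono).1 z hz)
    · intro z hz d hd e he hlt
      rcases List.mem_cons.1 hz with rfl | hz
      · rw [mem_passed_iff hd.1] at hd
        rw [mem_passed_iff he]
        exact hlt.trans hd
      · exact hL.sorted z hz d hd e he (order e he d hd.1 hlt)
  -- If the step moves away from `b`, the wall has to be crossed again. It is then the first wall on
  -- the straight way from `v`, so the two crossings form a bigon.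
  · have hcv : c ∉ K.passed res b v := by
      rw [mem_passed_iff hc]; exact lt_asymm c2
    obtain ⟨t, T', h1, h2, h3⟩ := hL.exists_next_of_min hb hv.eq_iff hc hcv fun e he hev => by
      by_cases hec : K.wallMap b e = K.wallMap b c
      · rw [hec]
      · refine (order c hc e he (c1.trans ?_)).le
        exact wallMap_pos_of_notMem gu he fun h => hev ((same e he hec).1 h)
    have hpt : K.passed res b u = K.passed res b t := by
      rw [h3]
      ext d
      by_cases hd : d ∈ K.walls res b
      · by_cases hdc : K.wallMap b d = K.wallMap b c
        · refine ⟨fun _ => Or.inr ⟨hd, hdc⟩, fun _ => ?_⟩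
          rw [mem_passed_iff hd, hdc]; exact c1
        · exact (same d hd hdc).trans ⟨Or.inl, fun h => h.resolve_right fun h => hdc h.2⟩
      · exact ⟨fun h => absurd h.1 hd, fun h => h.elim (fun h => absurd h.1 hd)
          fun h => absurd h.1 hd⟩
    have hcr : ∀ d ∈ K.crossings res u v, d.swap ∈ K.walls res b ∧
        K.wallMap b d.swap = K.wallMap b c := by
      intro d hd
      rcases mem_walls_or_swap hb hd.1 hd.2.1 (carrier_ne_of_mem_crossings hd) with hw | hw
      · rw [mem_crossings_iff_wallMap hw] at hd
        have := cls d hw (mul_neg_of_pos_of_neg hd.1 hd.2)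
        rw [this] at hd
        exact absurd hd.1 (lt_asymm c1)
      · rw [mem_crossings_iff_wallMap_swap hw] at hd
        exact ⟨hw, cls _ hw (mul_neg_of_neg_of_pos hd.1 hd.2)⟩
    have P : K.Path res (u :: v :: L) := by
      refine path_cons_cons.2 ⟨gu, simple_iff.2 fun d hd e he => ?_, hL.path⟩
      obtain ⟨d1, d2⟩ := hcr d hd
      obtain ⟨e1, e2⟩ := hcr e he
      obtain ⟨k1, k2, k3⟩ := carrier_eq_of_wallMap_eq e1 d1 (d2.trans e2.symm)
      refine ⟨k2, k1, ?_⟩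
      simp only [Prod.fst_swap, Prod.snd_swap] at k3
      linarith
    refine Or.inr ⟨_, .cons u P h1, [], u, v, t, T', rfl,
      crossings_eq_empty_of_passed hb gu hpt, c.swap, ?_⟩
    rw [mem_crossings_iff_wallMap_swap (c := c.swap) (by rwa [Prod.swap_swap]), Prod.swap_swap]
    exact ⟨c1, c2⟩

/-! ### The normal form -/

/-- A subdivision of a single step. -/
theorem equiv_of_subdivision {S : List (Fin n → ℝ)} (hu : K.Generic res u)
    (hP : K.Path res (y :: S))
    (hs : K.Simple res u y) (hM : ∀ z ∈ M, K.Generic res z) (hl : M.getLast? = some y)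
    (hmono : M.Pairwise fun z v => K.crossings res u z ⊆ K.crossings res u v) :
    K.PathEquiv res (u :: (M ++ S)) (u :: y :: S) := by
  induction M with
  | nil => simp at hl
  | cons m M ih =>
    cases M with
    | nil =>
      obtain rfl : m = y := by simpa using hl
      exact .refl (path_cons_cons.2 ⟨hu, hs, hP⟩)
    | cons m' M =>
      have hm := List.pairwise_cons.1 hmono
      have gm := hM m (by simp)
      have ih' := ih (fun z hz => hM z (List.mem_cons_of_mem _ hz)) hl hm.2
      have hy : y ∈ m' :: M := List.mem_of_getLast? hl
      have s1 : K.crossings res u m ⊆ K.crossings res u y := hm.1 y hy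
      have s2 : K.crossings res m m' ⊆ K.crossings res u m' := by
        intro d hd
        rcases lt_or_gt_of_ne (strPos_ne hu hd.1 hd.2.1 (ne_of_mem_crossings hd)) with h1 | h1
        · exact ⟨hd.1, hd.2.1, h1, hd.2.2.2⟩
        · have h2 : d.swap ∈ K.crossings res u m := ⟨hd.2.1, hd.1, h1, hd.2.2.1⟩
          exact absurd (hm.1 m' (by simp) h2).2.2.2 (lt_asymm hd.2.2.2)
      have s3 : K.crossings res u m' ⊆ K.crossings res u y := by
        rcases List.mem_cons.1 hy with rfl | hy
        · exact subset_rfl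
        · exact (List.pairwise_cons.1 hm.2).1 y hy
      have P : K.Path res (u :: m :: m' :: (M ++ S)) :=
        path_cons_cons.2 ⟨hu, simple_of_subset hs s1, path_cons_cons.2
          ⟨gm, simple_of_subset hs (s2.trans s3), ih'.path_left.tail⟩⟩
      refine .trans (.straighten P ih'.path_left ?_) ih'
      -- All crossings of a simple step are parallel, so the subdivision puts them into a single
      -- part. Two consecutive parts cannot both contain crossings.
      by_contra hne
      push Not at hne
      obtain ⟨⟨c, hc⟩, d, hd⟩ := hne
      obtain ⟨h1, h2, h3⟩ := simple_iff.1 hs c (s1 hc) d (s3 (s2 hd))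
      have := mem_crossings_of_parallel hc hd.1 hd.2.1 h1 h2 h3
      exact lt_asymm this.2.2.2 hd.2.2.1

/-- Several steps in regular slices. -/
theorem reduces_append (hb : K.Generic res b) (hM : ∀ z ∈ u :: M, K.Regular res b z)
    (hc : (u :: M).IsChain (K.OneWall res b)) (hl : (u :: M).getLast? = some y)
    (hL : K.Gallery res b (fun c => K.wallMap b c y) (y :: L))
    (hT : K.Gallery res b (fun c => K.wallMap b c u) (u :: T))
    (hP : K.Path res (u :: (M ++ L))) : K.Reduces res (u :: (M ++ L)) (u :: T) := by
  induction M generalizing u T with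
  | nil =>
    obtain rfl : u = y := by simpa using hl
    exact Or.inl (hL.equiv_of_sorted hb (hM u (by simp)).eq_iff hT)
  | cons m M ih =>
    have hm : K.Regular res b m := hM m (by simp)
    obtain ⟨T', hT'⟩ := hm.exists_gallery hb
    rw [List.isChain_cons_cons] at hc
    rw [List.getLast?_cons_cons] at hl
    have h1 := ih (fun z hz => hM z (List.mem_cons_of_mem _ hz)) hc.2 hl hT' hP.tail
    exact (h1.cons hP).trans (reduces_cons_cons hb (hM u (by simp)) hm hc.1 hT hT')

/-- The step is replaced by a generic chain that meets one wall of `orderMaps` at a time. It is a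
subdivision with monotone crossings, hence equivalent to the original step, and `reduces_append`
handles its parts one after another. -/
theorem reduces_of_simple (hb : K.Generic res b) (hu : K.Regular res b u)
    (hy : K.Regular res b y) (hP : K.Path res (u :: y :: L))
    (hL : K.Gallery res b (fun c => K.wallMap b c y) (y :: L))
    (hT : K.Gallery res b (fun c => K.wallMap b c u) (u :: T)) :
    K.Reduces res (u :: y :: L) (u :: T) := by
  obtain ⟨M, h1, h2, h3, h4, h5⟩ := exists_generic_chain (K.orderMaps res b) hu hy
  obtain ⟨M, rfl⟩ : ∃ M', M = u :: M' := by
    cases M with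
    | nil => simp at h1
    | cons v M => exact ⟨M, by simpa using h1⟩
  have hPu := path_cons_cons.1 hP
  cases M with
  | nil =>
    obtain rfl : u = y := by simpa using h2
    have h6 := reduces_append (M := []) hb (by simpa using hu) (by simp) rfl hL hT
      (by simpa using hL.path)
    exact (PathEquiv.dup hL.path).reduces h6
  | cons m M =>
    have h6 : K.PathEquiv res (u :: ((m :: M) ++ L)) (u :: y :: L) := by
      refine equiv_of_subdivision hPu.1 hPu.2.2 hPu.2.1
        (fun z hz => Regular.generic (fun F hF => h3 z (List.mem_cons_of_mem _ hz) F hF) hb)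
        (by rwa [List.getLast?_cons_cons] at h2) ?_
      refine (List.pairwise_cons.1 h4).2.imp fun {z v} h => ?_
      exact crossings_subset_of_wallMap hb fun c hc => h _ (wallMap_mem_orderMaps hc)
    exact h6.symm.reduces (reduces_append hb (fun z hz F hF => h3 z hz F hF) h5 h2 hL hT
      h6.path_left)

/-- Straightens from the end: the second slice is moved to a regular point of its chamber, the rest
of the path is straightened by induction, and then a single step in front of a straight path
remains. -/
theorem Regular.reduces (hb : K.Generic res b) (hu : K.Regular res b u)
    (hP : K.Path res (u :: y :: L)) (hl : (y :: L).getLast? = some b)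
    (hT : K.Gallery res b (fun c => K.wallMap b c u) (u :: T)) :
    K.Reduces res (u :: y :: L) (u :: T) := by
  induction L generalizing u y T with
  | nil =>
    obtain rfl : y = b := by simpa using hl
    refine Or.inl (Gallery.equiv_of_sorted hb hu.eq_iff ⟨hP, rfl, ?_, ?_⟩ hT)
    · refine List.pairwise_cons.2 ⟨fun z hz => ?_, by simp⟩
      obtain rfl : z = y := by simpa using hz
      rw [passed_self]; exact passed_subset
    · intro z hz c hc d hd hlt
      rcases List.mem_cons.1 hz with rfl | hz
      · rw [mem_passed_iff hc.1] at hc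
        rw [mem_passed_iff hd]
        exact hlt.trans hc
      · obtain rfl : z = y := by simpa using hz
        rwa [passed_self]
  | cons y₂ L ih =>
    obtain ⟨y', hy', he⟩ := exists_regular hb hP.tail.generic
    have gy' := hy'.generic hb
    obtain ⟨T', hT'⟩ := hy'.exists_gallery hb
    have h1 := path_cons_cons.1 hP
    have h2 := path_cons_cons.1 h1.2.2
    have P' : K.Path res (y' :: y₂ :: L) := by
      refine path_cons_cons.2 ⟨gy', simple_of_subset h2.2.1 ?_, h2.2.2⟩
      rw [crossings_congr_left h2.1 gy' he]
    have P'' : K.Path res (u :: y' :: y₂ :: L) := by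
      refine path_cons_cons.2 ⟨h1.1, simple_of_subset h1.2.1 ?_, P'⟩
      rw [crossings_congr_right h2.1 gy' he]
    have e1 := PathEquiv.insert hP gy' (crossings_symm_eq_empty he)
    have e2 := PathEquiv.cons u e1.path_right (PathEquiv.straighten e1.path_right.tail P'
      (Or.inl (crossings_symm_eq_empty he)))
    · rw [List.getLast?_cons_cons] at hl
      have h3 := (ih hy' P' hl hT').cons P''
      have h4 : K.Path res (u :: y' :: T') := by
        have := path_cons_cons.1 P''
        exact path_cons_cons.2 ⟨this.1, this.2.1, hT'.path⟩
      exact (e1.trans e2).reduces (h3.trans (reduces_of_simple hb hu hy' h4 hT' hT))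

/-- Every sequence of slices with fixed end points can be brought to a normal form, unless a bigon
can be produced. -/
theorem exists_normalForm (hb : K.Generic res b) (hx : K.Generic res x) :
    ∃ N, K.Path res (x :: N) ∧ (x :: N).getLast? = some b ∧
      (x :: N).Pairwise (fun z v => K.passed res b z ⊆ K.passed res b v) ∧
      ∀ L, K.Path res (x :: L) → (x :: L).getLast? = some b → K.Reduces res (x :: L) (x :: N) := by
  obtain ⟨u, hu, he⟩ := exists_regular hb hx
  have gu := hu.generic hb
  obtain ⟨T, hT⟩ := hu.exists_gallery hb
  have hp := passed_eq_of_empty (b := b) hx gu he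
  have G := hT.cons_of_passed hx hb hp
  refine ⟨u :: T, G.path, G.last, G.mono, fun L hL hl => ?_⟩
  have e1 := PathEquiv.dup hL
  have e2 := PathEquiv.insert hL.dup gu (crossings_symm_eq_empty he)
  exact (e1.symm.trans e2).reduces ((hu.reduces hb e2.path_right.tail hl hT).cons e2.path_right)

/-- There are no double crossings in a monotone sequence of slices. -/
theorem not_double_of_passed (hb : K.Generic res b)
    (hL : L.Pairwise fun z v => K.passed res b z ⊆ K.passed res b v) :
    ∀ s₁ s₂ s₃, [s₁, s₂, s₃].Sublist L → ∀ a a', K.Active res a → K.Active res a' →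
      ¬ (K.strPos s₁ a < K.strPos s₁ a' ∧ K.strPos s₂ a' < K.strPos s₂ a ∧
        K.strPos s₃ a < K.strPos s₃ a') := by
  rintro s₁ s₂ s₃ hs a a' ha ha' ⟨h1, h2, h3⟩
  have h4 := hL.sublist hs
  simp only [List.pairwise_cons, List.mem_cons, List.not_mem_nil, or_false,
    forall_eq_or_imp, forall_eq] at h4
  have hc : a.carrier ≠ a'.carrier := fun hc => by
    rw [strPos_eq, strPos_eq, hc] at h1 h2
    linarith
  rcases mem_walls_or_swap (c := (a, a')) hb ha ha' hc with hw | hw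
  · exact lt_asymm h3 (h4.2.1 ⟨hw, h2⟩).2
  · exact lt_asymm h2 (h4.1.1 ⟨hw, h1⟩).2

end NormalForm

end Datum

/-- A slice without dots. -/
abbrev Slice.bare {n : ℕ} (z : Fin n → ℝ) : Slice n := ⟨z, 0⟩

theorem map_pos_bare {n : ℕ} (L : List (Fin n → ℝ)) : (L.map Slice.bare).map Slice.pos = L := by
  simp [Function.comp_def]

namespace Datum

/-! ### Diagrams modulo fewer crossings -/

section Spanning

variable {R : Type*} [CommRing R] {I E : Type*} {n l : ℕ} {K : Datum R I E n l}
  {res : Fin n → I} {p q : K.Obj}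

theorem totalCross_append (P : List (Fin n → ℝ)) (s : Fin n → ℝ) (T : List (Fin n → ℝ)) :
    K.totalCross res (P ++ s :: T) = K.totalCross res (P ++ [s]) + K.totalCross res (s :: T) := by
  induction P with
  | nil => exact (Nat.zero_add _).symm
  | cons u P ih =>
    cases P with
    | nil => simp [totalCross]
    | cons v P =>
      simp only [List.cons_append] at ih ⊢
      rw [totalCross_cons_cons, totalCross_cons_cons, ih, add_assoc]

/-- The number of crossings of a diagram. -/
def Diagram.cross (D : K.Diagram p q) : ℕ := K.totalCross p.res (D.slices.map Slice.pos)

theorem Diagram.path (D : K.Diagram p q) : K.Path p.res (D.slices.map Slice.pos) :=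
  ⟨D.generic, D.simple⟩

theorem Diagram.cross_addDots (D : K.Diagram p q) (m : ℕ) (e : Fin n → ℕ) :
    (D.addDots m e).cross = D.cross := by
  rw [cross, cross, Diagram.addDots, map_pos_modify]

theorem Diagram.exists_of_slices (D : K.Diagram p q) {T : List (Slice n)}
    (hP : K.Path p.res (T.map Slice.pos))
    (hh : (T.map Slice.pos).head? = (D.slices.map Slice.pos).head?)
    (hl : (T.map Slice.pos).getLast? = (D.slices.map Slice.pos).getLast?) :
    ∃ D' : K.Diagram p q, D'.perm = D.perm ∧ D'.slices = T :=
  ⟨⟨D.perm, T, D.res_eq, hh.trans D.bottom, hl.trans D.top, hP.1, hP.2⟩, rfl, rfl⟩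

variable (K) in
/-- The span of the diagrams with fewer than `N` crossings. -/
def lower (p q : K.Obj) (N : ℕ) : Submodule R K.Alg :=
  Submodule.span R {a | ∃ D : K.Diagram p q, D.cross < N ∧ a = D.toAlg}

theorem toAlg_mem_lower {D : K.Diagram p q} {N : ℕ} (h : D.cross < N) : D.toAlg ∈ K.lower p q N :=
  Submodule.subset_span ⟨D, h, rfl⟩

theorem insertPoly_mem_lower {D : K.Diagram p q} {N : ℕ} (h : D.cross < N) (m : ℕ)
    (f : MvPolynomial (Fin n) R) : K.proj (insertPoly D m f) ∈ K.lower p q N := by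
  rw [insertPoly, map_sum]
  refine Submodule.sum_mem _ fun e _ => ?_
  rw [map_smul, proj_gen]
  exact Submodule.smul_mem _ _ (toAlg_mem_lower (by rwa [Diagram.cross_addDots]))

/-! ### Resolving crossings -/

/-- The part up to `s` is glued directly to the part from `t` on, in which the two strings are
exchanged. By `he` the new step is free of crossings, so everything that crossed between `s` and `t`
is saved. -/
theorem Diagram.exists_resolves {D : K.Diagram p q} {P Z S : List (Slice n)} {s t : Slice n}
    (h : D.slices = P ++ s :: (Z ++ t :: S)) {k k' : Fin n} (hr : p.res k = p.res k')
    (he : K.crossings p.res s.pos (t.pos ∘ Equiv.swap k k') = ∅)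
    (hlt : 0 < K.totalCross p.res (s.pos :: (Z.map Slice.pos ++ [t.pos]))) :
    ∃ D₀ : K.Diagram p q, K.Resolves D D₀ k k' (P ++ [s]) (t :: S) ∧ D₀.cross < D.cross := by
  have hP := D.path
  have hb := D.bottom
  have ht := D.top
  have hc : D.cross = K.totalCross p.res ((P ++ s :: (Z ++ t :: S)).map Slice.pos) := by
    rw [Diagram.cross, h]
  rw [h] at hP hb ht
  simp only [List.map_append, List.map_cons] at hP hb ht hc
  have hc' := totalCross_append (K := K) (res := p.res) (s.pos :: Z.map Slice.pos) t.pos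
    (S.map Slice.pos)
  rw [List.cons_append, List.cons_append] at hc'
  rw [totalCross_append, hc'] at hc
  have hS : K.Path p.res (t.pos :: S.map Slice.pos) := by
    have := hP.append_left.tail.append_left
    exact this
  have hs : K.Path p.res (P.map Slice.pos ++ [s.pos]) := by
    have h1 := List.isChain_append.1 hP.2
    refine ⟨fun z hz => hP.1 z ?_, List.isChain_append.2 ⟨h1.1, by simp, ?_⟩⟩
    · rcases List.mem_append.1 hz with hz | hz
      · exact List.mem_append_left _ hz
      · exact List.mem_append_right _ (by simp_all)
    · intro x hx y hy
      exact h1.2.2 x hx y (by simpa using hy)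
  have hres := res_swap hr
  have hS' : K.Path p.res ((t.pos ∘ Equiv.swap k k') ::
      (S.map Slice.pos).map fun z => z ∘ Equiv.swap k k') := by
    rw [← List.map_cons (f := fun z : Fin n → ℝ => z ∘ Equiv.swap k k')]
    refine ⟨fun z hz => ?_, ?_⟩
    · obtain ⟨z', hz', rfl⟩ := List.mem_map.1 hz
      exact (hS.1 z' hz').relabel hres
    · rw [List.isChain_map]
      exact hS.2.imp fun _ _ h => h.relabel hres
  refine ⟨⟨D.perm * Equiv.swap k k', (P ++ [s]) ++ (t :: S).map (Slice.relabel (Equiv.swap k k')),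
    fun j => ?_, ?_, ?_, ?_, ?_⟩, ⟨rfl, rfl⟩, ?_⟩
  · rw [Equiv.Perm.mul_apply, D.res_eq, hres]
  · rw [← hb]
    cases P <;> simp
  · rw [List.map_append, List.getLast?_append, map_relabel, List.getLast?_map]
    have h1 : ((t :: S).map Slice.pos).getLast? = some (q.pos ∘ D.perm) := by
      rw [← ht, List.getLast?_append, List.map_cons]
      simp [List.getLast?_cons, List.getLast?_append]
    rw [h1]
    rfl
  · intro z hz
    rw [List.map_append, map_relabel, List.mem_append] at hz
    rcases hz with hz | hz
    · exact hs.1 z (by simpa using hz)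
    · exact hS'.1 z hz
  · rw [List.map_append, map_relabel, List.isChain_append]
    refine ⟨by simpa using hs.2, hS'.2, ?_⟩
    intro x hx y hy
    simp only [List.map_append, List.map_cons, List.map_nil, List.getLast?_concat,
      Option.mem_def, Option.some_inj] at hx
    simp only [List.map_cons, List.head?_cons, Option.mem_def, Option.some_inj] at hy
    subst hx hy
    exact simple_of_empty he
  · refine lt_of_lt_of_eq ?_ hc.symm
    change K.totalCross p.res (((P ++ [s]) ++
      (t :: S).map (Slice.relabel (Equiv.swap k k'))).map Slice.pos) < _
    rw [List.map_append, map_relabel, List.map_append, List.append_assoc, List.map_cons,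
      List.map_nil, List.singleton_append, totalCross_append, List.map_cons, List.map_cons,
      totalCross_cons_cons, numCross_eq_zero_iff.2 he,
      ← List.map_cons (f := fun z : Fin n → ℝ => z ∘ Equiv.swap k k'),
      totalCross_map_comp hres]
    omega

/-! ### Reidemeister III -/

/-- In an exceptional triple the middle string crosses one of the outer strings before and the
other one after these cross each other. -/
theorem Hexagon.exceptional_first {s t z₁ z₂ z₁' z₂' : Fin n → ℝ}
    (H : K.Hexagon res s t z₁ z₂ z₁' z₂') {a b c : Str n l E} (hab : a.carrier ≠ b.carrier)
    (hbc : b.carrier ≠ c.carrier) (h_ac : (a, c) ∈ K.crossings res z₁ z₂)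
    (h_ab : K.Cross res s z₁ a b) (h_bc : K.Cross res z₂ t b c) :
    (a, b) ∈ K.crossings res s z₁ ∧ (b, c) ∈ K.crossings res z₂ t := by
  have hac := carrier_ne_of_mem_crossings h_ac
  simp only at hac
  have ha := h_ac.1
  have hc := h_ac.2.1
  have hb : K.Active res b := h_ab.elim (fun h => h.2.1) fun h => h.1
  have par : ∀ {u v : Fin n → ℝ} {d d' : Str n l E × Str n l E}, K.Simple res u v →
      d ∈ K.crossings res u v → d' ∈ K.crossings res u v →
      d.1.carrier = d'.1.carrier ∧ d.2.carrier = d'.2.carrier :=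
    fun hs hd hd' => ⟨(hs _ hd _ hd').1, (hs _ hd _ hd').2.1⟩
  have s_ac : K.strPos s a < K.strPos s c := by
    refine (strPos_lt_iff H.gs H.g₁ ha hc (fun h => ?_) fun h => ?_).2 h_ac.2.2.1 <;>
    rcases h_ab with h' | h' <;> have := par H.s₁ h h' <;> simp_all
  have z_ab : K.strPos z₁ a < K.strPos z₁ b ↔ K.strPos z₂ a < K.strPos z₂ b := by
    refine strPos_lt_iff H.g₁ H.g₂ ha hb (fun h => ?_) fun h => ?_ <;>
    have := par H.s₂ h h_ac <;> simp_all
  have z_cb : K.strPos z₁ c < K.strPos z₁ b ↔ K.strPos z₂ c < K.strPos z₂ b := by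
    refine strPos_lt_iff H.g₁ H.g₂ hc hb (fun h => ?_) fun h => ?_ <;>
    have := par H.s₂ h h_ac <;> simp_all
  have s_cb : K.strPos s c < K.strPos s b ↔ K.strPos z₁ c < K.strPos z₁ b := by
    refine strPos_lt_iff H.gs H.g₁ hc hb (fun h => ?_) fun h => ?_ <;>
    rcases h_ab with h' | h' <;> have := par H.s₁ h h' <;> simp_all
  have z_ca := h_ac.2.2.2
  have h1 : (a, b) ∈ K.crossings res s z₁ := by
    rcases h_ab with h | h
    · exact h
    · have h2 := z_ab.1 h.2.2.2
      have h3 := s_cb.2 (z_cb.2 (z_ca.trans h2))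
      exact absurd (s_ac.trans h3) (lt_asymm h.2.2.1)
  refine ⟨h1, ?_⟩
  rcases h_bc with h | h
  · exact h
  · have h2 := z_cb.2 h.2.2.1
    exact absurd (h_ac.2.2.1.trans h2) (lt_asymm h1.2.2.2)

/-- The middle step is taken by the outer strings, and one simple step cannot contain both crossings
of the middle string. So these fill the outer steps in one of two orders, and the second is the
order of the opposite sequence. One of the two diagrams therefore has the form required by the
exceptional relations. -/
theorem Hexagon.exceptional_or {s t z₁ z₂ z₁' z₂' : Fin n → ℝ}
    (H : K.Hexagon res s t z₁ z₂ z₁' z₂') {a b c : Str n l E} (hab : a.carrier ≠ b.carrier)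
    (hbc : b.carrier ≠ c.carrier) (h_ac : (a, c) ∈ K.crossings res z₁ z₂)
    (h_ab : K.Cross res s t a b) (h_bc : K.Cross res s t b c) :
    ((a, b) ∈ K.crossings res s z₁ ∧ (b, c) ∈ K.crossings res z₂ t) ∨
    ((a, b) ∈ K.crossings res s z₁' ∧ (b, c) ∈ K.crossings res z₂' t) := by
  have hac := carrier_ne_of_mem_crossings h_ac
  simp only at hac
  have par : ∀ {u v : Fin n → ℝ} {d d' : Str n l E × Str n l E}, K.Simple res u v →
      d ∈ K.crossings res u v → d' ∈ K.crossings res u v →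
      d.1.carrier = d'.1.carrier ∧ d.2.carrier = d'.2.carrier :=
    fun hs hd hd' => ⟨(hs _ hd _ hd').1, (hs _ hd _ hd').2.1⟩
  have k_ab : K.Cross res s z₁ a b ∨ K.Cross res z₂ t a b := by
    rcases h_ab with h | h <;> rcases H.mem_or h with h' | h' | h'
    · exact Or.inl (Or.inl h')
    · have := par H.s₂ h' h_ac; simp_all
    · exact Or.inr (Or.inl h')
    · exact Or.inl (Or.inr h')
    · have := par H.s₂ h' h_ac; simp_all
    · exact Or.inr (Or.inr h')
  have k_bc : K.Cross res s z₁ b c ∨ K.Cross res z₂ t b c := by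
    rcases h_bc with h | h <;> rcases H.mem_or h with h' | h' | h'
    · exact Or.inl (Or.inl h')
    · have := par H.s₂ h' h_ac; simp_all
    · exact Or.inr (Or.inl h')
    · exact Or.inl (Or.inr h')
    · have := par H.s₂ h' h_ac; simp_all
    · exact Or.inr (Or.inr h')
  have no : ∀ {u v}, K.Simple res u v → K.Cross res u v a b → K.Cross res u v b c → False := by
    intro u v hs h h'
    rcases h with h | h <;> rcases h' with h' | h' <;> have := par hs h h' <;> simp_all
  rcases k_ab with h | h <;> rcases k_bc with h' | h'
  · exact (no H.s₁ h h').elim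
  · exact Or.inl (H.exceptional_first hab hbc h_ac h h')
  · refine Or.inr (H.symm.exceptional_first hab hbc (H.h₂ ▸ h_ac) ?_ ?_)
    · rw [Cross, ← H.h₃]; exact h
    · rw [Cross, ← H.h₁]; exact h'
  · exact (no H.s₃ h h').elim

theorem ExceptionalTriple.carrier_ne {a b c : Str n l E} (h : K.ExceptionalTriple res a b c) :
    a.carrier ≠ b.carrier ∧ b.carrier ≠ c.carrier := by
  have gs : ∀ {a b : Str n l E}, K.GhostSolid res a b → a.carrier ≠ b.carrier := by
    rintro _ _ ⟨k, e, k', rfl, rfl, h1, h2⟩ h3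
    have h4 : k = k' := Option.some.inj h3
    exact owner_ne_partner e (h1.trans ((congrArg res h4).trans h2.symm))
  have sr : ∀ {a b : Str n l E}, K.SolidRed res a b → a.carrier ≠ b.carrier := by
    rintro _ _ ⟨k, m, rfl, rfl, -⟩ h
    exact Option.some_ne_none k h
  rcases h with ⟨_, _, _, _, _, h1, h2⟩ | ⟨_, h1, h2⟩ | ⟨_, h1, h2⟩
  · exact ⟨gs h1, (gs h2).symm⟩
  · exact ⟨(gs h1).symm, gs h2⟩
  · exact ⟨sr h1, (sr h2).symm⟩

/-- The Reidemeister III relation with an error term. -/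
theorem braid_sub_mem_lower {D D' : K.Diagram p q} (P S : List (Slice n)) (s t : Slice n)
    (z₁ z₂ z₁' z₂' : Fin n → ℝ) (hw : D'.perm = D.perm)
    (h : D.slices = P ++ s :: ⟨z₁, 0⟩ :: ⟨z₂, 0⟩ :: t :: S)
    (h' : D'.slices = P ++ s :: ⟨z₁', 0⟩ :: ⟨z₂', 0⟩ :: t :: S)
    (h₁ : K.crossings p.res s.pos z₁ = K.crossings p.res z₂' t.pos)
    (h₂ : K.crossings p.res z₁ z₂ = K.crossings p.res z₁' z₂')
    (h₃ : K.crossings p.res z₂ t.pos = K.crossings p.res s.pos z₁') {a b c : Str n l E}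
    (he : K.ExceptionalTriple p.res a b c)
    (h_ab : (a, b) ∈ K.crossings p.res s.pos z₁)
    (h_ac : (a, c) ∈ K.crossings p.res z₁ z₂)
    (h_bc : (b, c) ∈ K.crossings p.res z₂ t.pos) :
    D.toAlg - D'.toAlg ∈ K.lower p q D.cross := by
  have H := Diagram.hexagon h h' h₁ h₂ h₃
  have hlt : 0 < K.totalCross p.res
      (s.pos :: (([⟨z₁, 0⟩, ⟨z₂, 0⟩] : List (Slice n)).map Slice.pos ++ [t.pos])) := by
    have : 0 < K.numCross p.res s.pos z₁ :=
      (Set.ncard_pos (finite_crossings ..)).2 ⟨_, h_ab⟩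
    simp only [List.map_cons, List.map_nil, List.cons_append, totalCross_cons_cons]
    omega
  have res : ∀ {k k' : Fin n}, p.res k = p.res k' → a.carrier = some k → c.carrier = some k' →
      K.off a = K.off c → ∃ D₀ : K.Diagram p q,
        K.Resolves D D₀ k k' (P ++ [s]) (t :: S) ∧ D₀.cross < D.cross :=
    fun hr hk hk' ho => Diagram.exists_resolves (Z := [⟨z₁, 0⟩, ⟨z₂, 0⟩]) h hr
      (H.crossings_swap hr hk hk' ho h_ab h_ac h_bc) hlt
  rcases he with ⟨k, k'', e, rfl, rfl, hab, hcb⟩ | ⟨⟨k, k'', rfl, rfl, -, hr⟩, hba, hbc⟩ |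
    ⟨⟨k, k'', rfl, rfl, -, hr⟩, hab, hcb⟩
  · obtain ⟨_, _, k', -, rfl, -, -⟩ := id hab
    obtain ⟨D₀, h0, hc⟩ := res (hab.owner_eq.symm.trans hcb.owner_eq) rfl rfl rfl
    have := proj_rel (Rel.braid_ghostSolidGhost D D' D₀ P S s t z₁ z₂ z₁' z₂' hw h h' h₁ h₂ h₃
      k k' k'' e hab hcb h_ab h_ac h_bc h0)
    rw [map_sub, proj_gen, proj_gen] at this
    rw [this, sub_sub_cancel_left]
    exact Submodule.neg_mem _ (insertPoly_mem_lower hc _ _)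
  · obtain ⟨k', e, _, rfl, -, -, -⟩ := id hba
    obtain ⟨D₀, h0, hc⟩ := res hr rfl rfl rfl
    have := proj_rel (Rel.braid_solidGhostSolid D D' D₀ P S s t z₁ z₂ z₁' z₂' hw h h' h₁ h₂ h₃
      k k' k'' e hba hbc h_ab h_ac h_bc h0)
    rw [map_sub, proj_gen, proj_gen] at this
    rw [this, sub_sub_cancel_left]
    exact Submodule.neg_mem _ (insertPoly_mem_lower hc _ _)
  · obtain ⟨_, m, -, rfl, -⟩ := id hab
    obtain ⟨D₀, h0, hc⟩ := res hr rfl rfl rfl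
    have := proj_rel (Rel.braid_solidRedSolid D D' D₀ P S s t z₁ z₂ z₁' z₂' hw h h' h₁ h₂ h₃
      k k'' m hab hcb h_ab h_ac h_bc h0)
    rw [map_add, proj_gen, proj_gen, proj_gen] at this
    rw [this, add_sub_cancel_left]
    exact toAlg_mem_lower hc

/-- Equivalent sequences of slices give the same element up to diagrams with fewer crossings. -/
theorem PathEquiv.sub_mem_lower {L L' : List (Fin n → ℝ)} (h : K.PathEquiv p.res L L')
    {P : List (Slice n)} {D D' : K.Diagram p q} (hD : D.slices = P ++ L.map Slice.bare)
    (hD' : D'.slices = P ++ L'.map Slice.bare) (hw : D'.perm = D.perm) :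
    D.toAlg - D'.toAlg ∈ K.lower p q D.cross := by
  have inv : ∀ {L L' : List (Fin n → ℝ)} {P : List (Slice n)} {D : K.Diagram p q},
      K.PathEquiv p.res L L' → D.slices = P ++ L.map Slice.bare →
      K.PathEquiv p.res (D.slices.map Slice.pos) ((P ++ L'.map Slice.bare).map Slice.pos) := by
    intro L L' P D h hD
    have hp := D.path
    rw [hD, List.map_append, map_pos_bare] at hp ⊢
    rw [List.map_append, map_pos_bare]
    exact h.append_left hp
  have ceq : ∀ {L L' : List (Fin n → ℝ)} {P : List (Slice n)} {D D' : K.Diagram p q},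
      K.PathEquiv p.res L L' → D.slices = P ++ L.map Slice.bare →
      D'.slices = P ++ L'.map Slice.bare → D.cross = D'.cross := by
    intro L L' P D D' h hD hD'
    rw [Diagram.cross, Diagram.cross, hD', (inv h hD).invariant.2.2.2.2]
  induction h generalizing P D D' with
  | refl h =>
    have : D = D' := Diagram.ext hw.symm (hD.trans hD'.symm)
    rw [this, sub_self]
    exact Submodule.zero_mem _
  | symm h ih =>
    rw [← ceq h hD' hD, ← neg_sub]
    exact Submodule.neg_mem _ (ih hD' hD hw.symm)
  | trans h1 h2 ih1 ih2 =>
    have h3 := (inv h1 hD).invariant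
    obtain ⟨D₁, h4, h5⟩ := D.exists_of_slices h3.2.1 h3.2.2.1.symm h3.2.2.2.1.symm
    rw [← sub_add_sub_cancel D.toAlg D₁.toAlg]
    refine Submodule.add_mem _ (ih1 hD h5 h4) ?_
    rw [ceq h1 hD h5]
    exact ih2 h5 hD' (hw.trans h4.symm)
  | @cons L L' u hP h ih =>
    -- The untouched slice joins the fixed part at the bottom.
    exact ih (P := P ++ [Slice.bare u]) (by rw [hD]; simp) (by rw [hD']; simp) hw
  | @dup z L h =>
    have := proj_rel (Rel.merge D D' P (L.map Slice.bare) z 0 0 hw hD (by rw [hD', add_zero]; rfl))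
    rw [proj_gen, proj_gen] at this
    rw [this, sub_self]
    exact Submodule.zero_mem _
  | @straighten s z t S h h' hz =>
    have := proj_rel (Rel.straighten D D' P (S.map Slice.bare) (.bare s) (.bare t) z hw hD hD' hz)
    rw [proj_gen, proj_gen] at this
    rw [this, sub_self]
    exact Submodule.zero_mem _
  | @commute s z z' t S h h' h₁ h₂ =>
    have := proj_rel (Rel.commute D D' P (S.map Slice.bare) (.bare s) (.bare t) z z' hw hD hD' h₁ h₂)
    rw [proj_gen, proj_gen] at this
    rw [this, sub_self]
    exact Submodule.zero_mem _
  | @braid s z₁ z₂ z₁' z₂' t S h h' h₁ h₂ h₃ =>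
    by_cases hex : ∃ a b c, K.ExceptionalTriple p.res a b c ∧ (a, c) ∈ K.crossings p.res z₁ z₂ ∧
        K.Cross p.res s t a b ∧ K.Cross p.res s t b c
    · obtain ⟨a, b, c, he, h_ac, h_ab, h_bc⟩ := hex
      have H := Diagram.hexagon (s := .bare s) (t := .bare t) (S := S.map Slice.bare)
        hD hD' h₁ h₂ h₃
      obtain ⟨n1, n2⟩ := he.carrier_ne
      rcases H.exceptional_or n1 n2 h_ac h_ab h_bc with ⟨k1, k2⟩ | ⟨k1, k2⟩
      · exact braid_sub_mem_lower P (S.map Slice.bare) (.bare s) (.bare t) z₁ z₂ z₁' z₂' hw hD hD'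
          h₁ h₂ h₃ he k1 h_ac k2
      · rw [ceq (.braid h h' h₁ h₂ h₃) hD hD', ← neg_sub]
        exact Submodule.neg_mem _ (braid_sub_mem_lower P (S.map Slice.bare) (.bare s) (.bare t)
          z₁' z₂' z₁ z₂ hw.symm hD' hD h₃.symm h₂.symm h₁.symm he k1 (h₂ ▸ h_ac) k2)
    · have := proj_rel (Rel.braid D D' P (S.map Slice.bare) (.bare s) (.bare t) z₁ z₂ z₁' z₂' hw
        hD hD' h₁ h₂ h₃ fun a b c h1 h2 => hex ⟨a, b, c, h1, h2⟩)
      rw [proj_gen, proj_gen] at this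
      rw [this, sub_self]
      exact Submodule.zero_mem _

/-- A diagram with a bigon is a linear combination of diagrams with fewer crossings. -/
theorem HasBigon.toAlg_mem_lower {L : List (Fin n → ℝ)} (h : K.HasBigon p.res L)
    {P : List (Slice n)} {D : K.Diagram p q} (hD : D.slices = P ++ L.map Slice.bare) :
    D.toAlg ∈ K.lower p q D.cross := by
  obtain ⟨Q, s, z, t, S, rfl, h1, c, hc⟩ := h
  obtain ⟨P', hP'⟩ : ∃ P', P' = P ++ Q.map Slice.bare := ⟨_, rfl⟩
  have hs : D.slices = P' ++ Slice.bare s :: ⟨z, 0⟩ :: Slice.bare t :: S.map Slice.bare := by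
    rw [hD, hP']; simp
  have hp := D.path
  have hcr : D.cross = K.totalCross p.res (D.slices.map Slice.pos) := rfl
  have hb := congrArg (fun T => (T.map Slice.pos).head?) hs
  have ht := congrArg (fun T => (T.map Slice.pos).getLast?) hs
  rw [hs] at hp hcr
  simp only [List.map_append, List.map_cons, map_pos_bare] at hp hcr hb ht
  rw [totalCross_append] at hcr
  obtain ⟨gs, -, hp'⟩ := path_cons_cons.1 hp.append_left
  -- The diagram with the bigon cut out. Each Reidemeister II relation yields zero or this diagram,
  -- possibly with dots.
  obtain ⟨D₀, hw, hs₀⟩ := D.exists_of_slices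
    (T := P' ++ Slice.bare s :: Slice.bare t :: S.map Slice.bare) (by
      simp only [List.map_append, List.map_cons, map_pos_bare]
      exact hp.congr_head (path_cons_cons.2 ⟨gs, simple_of_empty h1, hp'.tail⟩) rfl) (by
      simp only [List.map_append, List.map_cons, map_pos_bare]
      rw [hb, List.head?_append, List.head?_append]; rfl) (by
      simp only [List.map_append, List.map_cons, map_pos_bare]
      rw [ht, List.getLast?_append, List.getLast?_append]
      simp only [List.getLast?_cons_cons])
  have hlt : D₀.cross < D.cross := by
    rw [hcr, Diagram.cross, hs₀]
    simp only [List.map_append, List.map_cons, map_pos_bare]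
    rw [totalCross_append, totalCross_cons_cons, totalCross_cons_cons, totalCross_cons_cons,
      numCross_eq_zero_iff.2 h1]
    have : 0 < K.numCross p.res s z := (Set.ncard_pos (finite_crossings ..)).2 ⟨c, hc⟩
    omega
  by_cases e1 : ∃ a b, K.Cross p.res s z a b ∧ SolidSolid p.res a b
  · obtain ⟨a, b, h2, h3⟩ := e1
    have := proj_rel (Rel.reid₂_solidSolid D P' _ (.bare s) (.bare t) z hs h1 a b h3 h2)
    rw [proj_gen, map_zero] at this
    rw [this]
    exact Submodule.zero_mem _
  by_cases e2 : ∃ a b, K.Cross p.res s z a b ∧ K.GhostSolid p.res a b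
  · obtain ⟨a, b, h2, h3⟩ := e2
    obtain ⟨k, e, k', rfl, rfl, -, -⟩ := id h3
    have := proj_rel (Rel.reid₂_ghostSolid D D₀ P' _ (.bare s) (.bare t) z hw hs hs₀ h1 k k' e h3 h2)
    rw [proj_gen] at this
    rw [this]
    exact insertPoly_mem_lower hlt _ _
  by_cases e3 : ∃ a b, K.Cross p.res s z a b ∧ K.SolidRed p.res a b
  · obtain ⟨a, b, h2, h3⟩ := e3
    obtain ⟨k, m, rfl, rfl, -⟩ := id h3
    have := proj_rel (Rel.reid₂_solidRed D D₀ P' _ (.bare s) (.bare t) z hw hs hs₀ h1 k m h3 h2)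
    rw [proj_gen, proj_gen] at this
    rw [this]
    exact Datum.toAlg_mem_lower (by rwa [Diagram.cross_addDots])
  · have := proj_rel (Rel.reid₂ D D₀ P' _ (.bare s) (.bare t) z hw hs hs₀ h1 fun a b h2 =>
      ⟨fun h3 => e1 ⟨a, b, h2, h3⟩, fun h3 => e2 ⟨a, b, h2, h3⟩, fun h3 => e3 ⟨a, b, h2, h3⟩⟩)
    rw [proj_gen, proj_gen] at this
    rw [this]
    exact Datum.toAlg_mem_lower hlt

end Spanning

end Datum

namespace Datum

/-! ### Moving dots, spanning and existence -/

section Spanning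

variable {R : Type*} [CommRing R] {I E : Type*} {n l : ℕ} {K : Datum R I E n l} {p q : K.Obj}

/-! ### Moving dots -/

/-- A dot slides through the step freely, except when its string crosses one of the same residue;
then the correction is the resolved diagram, which has fewer crossings. -/
theorem addDots_succ_sub_mem_lower {D : K.Diagram p q} {P S : List (Slice n)} {s t : Slice n}
    (h : D.slices = P ++ s :: t :: S) (k : Fin n) :
    (D.addDots (P.length + 1) (Pi.single k 1)).toAlg - (D.addDots P.length (Pi.single k 1)).toAlg ∈
      K.lower p q D.cross := by
  obtain ⟨gs, gt, hs, -⟩ := D.step_of_slices h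
  have res : ∀ {k k' : Fin n}, p.res k = p.res k' →
      (Str.solid k, Str.solid k') ∈ K.crossings p.res s.pos t.pos → ∃ D₀ : K.Diagram p q,
        K.Resolves D D₀ k k' (P ++ [s]) (t :: S) ∧ D₀.cross < D.cross := by
    intro k k' hr hc
    refine Diagram.exists_resolves (Z := []) h hr
      (crossings_swap_eq_empty_of_simple hr gs gt hs hc) ?_
    have : 0 < K.numCross p.res s.pos t.pos := (Set.ncard_pos (finite_crossings ..)).2 ⟨_, hc⟩
    simp only [List.map_nil, List.nil_append, totalCross_cons_cons]
    omega
  by_cases h1 : ∃ k', p.res k = p.res k' ∧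
      (Str.solid k, Str.solid k') ∈ K.crossings p.res s.pos t.pos
  · obtain ⟨k', hr, hc⟩ := h1
    obtain ⟨D₀, h0, hlt⟩ := res hr hc
    have := proj_rel (Rel.dot_left D D₀ P S s t h k k' hr hc h0)
    rw [map_add, proj_gen, proj_gen, proj_gen] at this
    rw [this, sub_add_cancel_left]
    exact Submodule.neg_mem _ (toAlg_mem_lower hlt)
  by_cases h2 : ∃ k', p.res k' = p.res k ∧
      (Str.solid k', Str.solid k) ∈ K.crossings p.res s.pos t.pos
  · obtain ⟨k', hr, hc⟩ := h2
    obtain ⟨D₀, h0, hlt⟩ := res hr hc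
    have := proj_rel (Rel.dot_right D D₀ P S s t h k' k hr hc h0)
    rw [map_add, proj_gen, proj_gen, proj_gen] at this
    rw [this, add_sub_cancel_left]
    exact toAlg_mem_lower hlt
  · have := proj_rel (Rel.dot_pass D P S s t h k (by
      rintro b ⟨_, k', hk, rfl, -, hr⟩ hc
      obtain rfl := Str.solid.inj hk
      rcases hc with hc | hc
      · exact h1 ⟨k', hr, hc⟩
      · exact h2 ⟨k', hr.symm, hc⟩))
    rw [proj_gen, proj_gen] at this
    rw [this, sub_self]
    exact Submodule.zero_mem _

theorem move_dots_sub_mem_lower {D D' : K.Diagram p q} {P T : List (Slice n)} {r : Slice n}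
    {z : Fin n → ℝ} {e : Fin n → ℕ} (hw : D'.perm = D.perm)
    (h : D.slices = P ++ r :: ⟨z, e⟩ :: T)
    (h' : D'.slices = P ++ ⟨r.pos, r.dots + e⟩ :: ⟨z, 0⟩ :: T) :
    D.toAlg - D'.toAlg ∈ K.lower p q D.cross := by
  induction hm : ∑ k, e k generalizing e r D with
  | zero =>
    have he : e = 0 := funext fun k => by
      have := Finset.sum_eq_zero_iff.1 hm k (Finset.mem_univ k)
      exact this
    subst he
    have : D = D' := Diagram.ext hw.symm (by rw [h, h', add_zero])
    rw [this, sub_self]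
    exact Submodule.zero_mem _
  | succ m ih =>
    obtain ⟨k, hk⟩ : ∃ k, e k ≠ 0 := by
      by_contra hne
      push Not at hne
      simp [hne] at hm
    obtain ⟨e', rfl⟩ : ∃ e', e = e' + Pi.single k 1 := ⟨e - Pi.single k 1, by
      ext j
      by_cases hj : j = k
      · subst hj; simp; omega
      · simp [hj]⟩
    have hp := D.path
    obtain ⟨D₁, hw₁, h₁⟩ := D.exists_of_slices (T := P ++ r :: ⟨z, e'⟩ :: T)
      (by rw [h] at hp; simpa using hp) (by rw [h]; simp) (by rw [h]; simp)
    have e1 : D = D₁.addDots (P.length + 1) (Pi.single k 1) := by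
      refine Diagram.ext hw₁.symm ?_
      have := modify_length_append (P ++ [r]) ⟨z, e'⟩ T fun s => ⟨s.pos, s.dots + Pi.single k 1⟩
      simp only [List.append_assoc, List.singleton_append, List.length_append,
        List.length_singleton] at this
      rw [h, Diagram.addDots]
      dsimp only
      rw [h₁, this]
    have e2 : (D₁.addDots P.length (Pi.single k 1)).slices =
        P ++ ⟨r.pos, r.dots + Pi.single k 1⟩ :: ⟨z, e'⟩ :: T := by
      rw [Diagram.addDots]
      dsimp only
      rw [h₁, modify_length_append]
    have e3 := ih (D := D₁.addDots P.length (Pi.single k 1)) (hw.trans hw₁.symm) e2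
      (by rw [h', add_assoc, add_comm e']) (by
        rw [Finset.sum_congr rfl fun j _ => Pi.add_apply e' (Pi.single k 1) j,
          Finset.sum_add_distrib] at hm
        simpa using hm)
    have e4 := addDots_succ_sub_mem_lower h₁ k
    rw [Diagram.cross_addDots] at e3
    have e5 : D.cross = D₁.cross := by rw [e1, Diagram.cross_addDots]
    rw [e5]
    rw [← e1] at e4
    rw [← sub_add_sub_cancel]
    exact Submodule.add_mem _ e4 e3

/-- The invariant is that all slices above `s` are already free of dots; the dots of `s` are pushed
down one slice at a time. -/
theorem exists_dots_at_bottom {D : K.Diagram p q} {P : List (Slice n)} {s : Slice n}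
    {L : List (Fin n → ℝ)} (h : D.slices = P ++ s :: L.map Slice.bare) :
    ∃ (D' : K.Diagram p q) (a : Fin n → ℕ) (L' : List (Fin n → ℝ)), D'.perm = D.perm ∧
      D'.slices = ⟨p.pos, a⟩ :: L'.map Slice.bare ∧ D'.cross = D.cross ∧
      D.toAlg - D'.toAlg ∈ K.lower p q D.cross := by
  induction P using List.reverseRecOn generalizing s L D with
  | nil =>
    have hb := D.bottom
    rw [h] at hb
    refine ⟨D, s.dots, L, rfl, ?_, rfl, by rw [sub_self]; exact Submodule.zero_mem _⟩
    have e : p.pos = s.pos := by simpa using hb.symm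
    rw [h, e]
    rfl
  | append_singleton P r ih =>
    have hp := D.path
    have h' : D.slices = P ++ r :: ⟨s.pos, s.dots⟩ :: L.map Slice.bare := by rw [h]; simp
    obtain ⟨D₁, hw₁, h₁⟩ := D.exists_of_slices
      (T := P ++ ⟨r.pos, r.dots + s.dots⟩ :: ⟨s.pos, 0⟩ :: L.map Slice.bare)
      (by rw [h] at hp; simpa using hp) (by rw [h]; simp) (by rw [h]; simp)
    have hc : D₁.cross = D.cross := by
      rw [Diagram.cross, Diagram.cross, h₁, h]; simp
    obtain ⟨D', a, L', h1, h2, h3, h4⟩ := ih (L := s.pos :: L) h₁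
    refine ⟨D', a, L', h1.trans hw₁, h2, h3.trans hc, ?_⟩
    rw [← sub_add_sub_cancel]
    exact Submodule.add_mem _ (move_dots_sub_mem_lower hw₁ h' h₁) (hc ▸ h4)

/-! ### Spanning -/

theorem PathEquiv.cross_eq {L L' : List (Fin n → ℝ)} (h : K.PathEquiv p.res L L')
    {P : List (Slice n)} {D D' : K.Diagram p q} (hD : D.slices = P ++ L.map Slice.bare)
    (hD' : D'.slices = P ++ L'.map Slice.bare) : D.cross = D'.cross := by
  have hp := D.path
  rw [hD, List.map_append, map_pos_bare] at hp
  rw [Diagram.cross, Diagram.cross, hD, hD', List.map_append, List.map_append, map_pos_bare,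
    map_pos_bare, (h.append_left hp).invariant.2.2.2.2]

theorem comp_dottedIdempotent_slices (F : K.Diagram p q) (a : Fin n → ℕ) :
    (F.comp (dottedIdempotent p a)).slices = ⟨p.pos, a⟩ :: F.slices := by
  have : F.slices.map (Slice.relabel 1) = F.slices := by
    rw [show Slice.relabel (n := n) 1 = id from rfl, List.map_id]
  simp only [Diagram.comp, dottedIdempotent, this, List.singleton_append]

/-- Every diagram is a permutation diagram with dots at the bottom, up to diagrams with fewer
crossings. -/
theorem mem_lower_or_sub_mem_lower (D F : K.Diagram p q) (hF : F.IsPermutationDiagram D.perm) :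
    D.toAlg ∈ K.lower p q D.cross ∨
      ∃ a, D.toAlg - (F.comp (dottedIdempotent p a)).toAlg ∈ K.lower p q D.cross := by
  obtain ⟨L, s, hL, -⟩ := D.exists_slices_eq_append
  obtain ⟨D', a, L', h1, h2, h3, h4⟩ := exists_dots_at_bottom (L := []) hL
  have hp := D'.path
  have ht := D'.top
  have h2' : D'.slices.map Slice.pos = p.pos :: L' := by rw [h2, List.map_cons, map_pos_bare]
  rw [h2'] at hp ht
  -- The bottom slice is doubled: one copy keeps the dots and the other begins a path without dots,
  -- to which the path equivalences apply.
  obtain ⟨D₁, h5, h6⟩ := D'.exists_of_slices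
    (T := [⟨p.pos, a⟩] ++ (p.pos :: L').map Slice.bare)
    (by rw [List.map_append, map_pos_bare]; exact hp.dup)
    (by rw [h2]; rfl)
    (by rw [List.map_append, map_pos_bare, h2']
        exact List.getLast?_cons_cons)
  have e1 : D₁.toAlg = D'.toAlg := by
    have := proj_rel (Rel.merge D₁ D' [] (L'.map Slice.bare) p.pos a 0 h5.symm h6
      (by rw [h2, add_zero]; rfl))
    rwa [proj_gen, proj_gen] at this
  have e2 : D₁.cross = D.cross := by
    rw [← h3, Diagram.cross, Diagram.cross, h6, h2', List.map_append, map_pos_bare]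
    exact (totalCross_cons_cons ..).trans (by rw [numCross_self, zero_add])
  rw [← e1] at h4
  have gb : K.Generic p.res (q.pos ∘ D.perm) := q.generic.relabel D.res_eq
  rw [h1] at ht
  obtain ⟨N, -, -, -, hN⟩ := exists_normalForm gb p.generic
  have hpF := F.path
  have hbF := F.bottom
  have htF := F.top
  have hgF := F.generic
  obtain ⟨M, hM⟩ : ∃ M, F.slices.map Slice.pos = p.pos :: M := by
    obtain ⟨t, T, h7, h8⟩ := F.exists_slices_eq_cons
    exact ⟨T.map Slice.pos, by rw [h7, List.map_cons, h8]⟩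
  have hMb : F.slices = (p.pos :: M).map Slice.bare := by
    rw [← hM, List.map_map]
    refine (List.map_id _).symm.trans (List.map_congr_left fun s hs => ?_)
    exact Slice.ext rfl (hF.2.1 s hs)
  rw [hM] at hpF htF hgF
  rw [hF.1] at htF
  -- The permutation diagram has the minimal number of crossings and equivalence preserves this
  -- number, so the alternative with a bigon is impossible.
  have r1 : K.PathEquiv p.res (p.pos :: M) (p.pos :: N) := by
    rcases hN M hpF htF with h7 | ⟨M', h7, h8⟩
    · exact h7
    · exfalso
      obtain ⟨-, i1, i2, i3, i4⟩ := h7.invariant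
      have h9 := h8.numCross_lt i1.1 i2.symm (i3.symm.trans htF)
      have h10 := hF.totalCross_eq
      rw [hM, i4] at h10
      omega
  rcases hN L' hp ht with h7 | ⟨M', h7, h8⟩
  · refine Or.inr ⟨a, ?_⟩
    have h9 := (h7.trans r1.symm).sub_mem_lower (D' := F.comp (dottedIdempotent p a)) h6
      (by rw [comp_dottedIdempotent_slices, hMb]; rfl) (by
        rw [h5, h1, ← hF.1]; exact mul_one _)
    rw [← sub_add_sub_cancel]
    exact Submodule.add_mem _ h4 (e2 ▸ h9)
  · left
    have hp₁ := D₁.path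
    rw [h6, List.map_append, map_pos_bare] at hp₁
    have h9 := (h7.append_left hp₁).invariant
    obtain ⟨D₂, h10, h11⟩ := D₁.exists_of_slices (T := [⟨p.pos, a⟩] ++ M'.map Slice.bare)
      (by rw [List.map_append, map_pos_bare]; exact h9.2.1)
      (by rw [h6, List.map_append, map_pos_bare, List.map_append, map_pos_bare]
          exact h9.2.2.1.symm)
      (by rw [h6, List.map_append, map_pos_bare, List.map_append, map_pos_bare]
          exact h9.2.2.2.1.symm)
    have h12 := h7.sub_mem_lower h6 h11 h10
    have h13 := h8.toAlg_mem_lower h11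
    rw [← h7.cross_eq h6 h11] at h13
    rw [e2] at h12 h13
    have := Submodule.add_mem _ h4 (Submodule.add_mem _ h12 h13)
    rwa [sub_add_cancel, sub_add_cancel] at this

/-- The diagrams span the algebra. -/
theorem span_toAlg : Submodule.span R {a | ∃ (p q : K.Obj) (D : K.Diagram p q), a = D.toAlg} = ⊤ := by
  set S := Submodule.span R {a | ∃ (p q : K.Obj) (D : K.Diagram p q), a = D.toAlg} with hS
  have one : (1 : K.Alg) ∈ S := by
    rw [← sum_toAlg_idempotent]
    exact Submodule.sum_mem _ fun p _ => Submodule.subset_span ⟨p, p, _, rfl⟩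
  refine eq_top_iff.2 ?_
  rintro x -
  obtain ⟨x, rfl⟩ := RingQuot.mkAlgHom_surjective R K.Rel x
  change K.proj x ∈ S
  induction x using FreeAlgebra.induction with
  | grade0 r =>
    rw [AlgHom.commutes, Algebra.algebraMap_eq_smul_one]
    exact Submodule.smul_mem _ _ one
  | grade1 g => exact Submodule.subset_span ⟨g.1, g.2.1, g.2.2, rfl⟩
  | add x y hx hy => rw [map_add]; exact Submodule.add_mem _ hx hy
  | mul x y hx hy =>
    rw [map_mul]
    refine Submodule.span_induction₂ (p := fun a b _ _ => a * b ∈ S) ?_ ?_ ?_ ?_ ?_ ?_ ?_ hx hy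
    · rintro _ _ ⟨q', r, F, rfl⟩ ⟨p, q, D, rfl⟩
      by_cases h : q = q'
      · subst h
        rw [toAlg_mul]
        exact Submodule.subset_span ⟨_, _, _, rfl⟩
      · rw [toAlg_mul_eq_zero _ _ h]
        exact Submodule.zero_mem _
    · intro y _; rw [zero_mul]; exact Submodule.zero_mem _
    · intro x _; rw [mul_zero]; exact Submodule.zero_mem _
    · intro x y z _ _ _ h1 h2; rw [add_mul]; exact Submodule.add_mem _ h1 h2
    · intro x y z _ _ _ h1 h2; rw [mul_add]; exact Submodule.add_mem _ h1 h2
    · intro c x y _ _ h; rw [smul_mul_assoc]; exact Submodule.smul_mem _ _ h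
    · intro c x y _ _ h; rw [mul_smul_comm]; exact Submodule.smul_mem _ _ h

/-- Strong induction on the number of crossings: the error terms in `mem_lower_or_sub_mem_lower`
have the same end points and fewer crossings, whatever permutation diagrams were chosen. -/
theorem span_permutationDiagrams (D : (x : K.PermIndex) → K.Diagram x.bot x.top)
    (hD : ∀ x, (D x).IsPermutationDiagram x.w) :
    Submodule.span R (Set.range fun x : K.PermIndex × (Fin n → ℕ) =>
      ((D x.1).comp (dottedIdempotent x.1.bot x.2)).toAlg) = ⊤ := by
  set S := Submodule.span R (Set.range fun x : K.PermIndex × (Fin n → ℕ) =>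
      ((D x.1).comp (dottedIdempotent x.1.bot x.2)).toAlg) with hS
  have key : ∀ (N : ℕ) (p q : K.Obj) (F : K.Diagram p q), F.cross = N → F.toAlg ∈ S := by
    intro N
    induction N using Nat.strong_induction_on with
    | _ N ih =>
      intro p q F hF
      have hl : K.lower p q F.cross ≤ S := by
        refine Submodule.span_le.2 ?_
        rintro _ ⟨F', h, rfl⟩
        exact ih _ (hF ▸ h) p q F' rfl
      rcases mem_lower_or_sub_mem_lower F (D ⟨p, q, F.perm, F.res_eq⟩) (hD _) with h | ⟨a, h⟩
      · exact hl h
      · have h1 : ((D ⟨p, q, F.perm, F.res_eq⟩).comp (dottedIdempotent p a)).toAlg ∈ S :=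
          Submodule.subset_span ⟨(⟨p, q, F.perm, F.res_eq⟩, a), rfl⟩
        have := Submodule.add_mem _ (hl h) h1
        rwa [sub_add_cancel] at this
  rw [eq_top_iff, ← span_toAlg]
  refine Submodule.span_le.2 ?_
  rintro _ ⟨p, q, F, rfl⟩
  exact key _ p q F rfl

/-- Permutation diagrams exist. -/
theorem exists_permutationDiagram (x : K.PermIndex) :
    ∃ D : K.Diagram x.bot x.top, D.IsPermutationDiagram x.w := by
  have gb : K.Generic x.bot.res (x.top.pos ∘ x.w) := x.top.generic.relabel x.res_eq
  -- The normal form only ever passes walls towards its end point, so no two of its strings cross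
  -- twice.
  obtain ⟨N, h1, h2, h3, -⟩ := exists_normalForm gb x.bot.generic
  refine ⟨⟨x.w, (x.bot.pos :: N).map Slice.bare, x.res_eq, ?_, ?_, ?_, ?_⟩, rfl, ?_, ?_⟩
  · rfl
  · rw [map_pos_bare]; exact h2
  · rw [map_pos_bare]; exact h1.1
  · rw [map_pos_bare]; exact h1.2
  · intro s hs
    obtain ⟨z, -, rfl⟩ := List.mem_map.1 hs
    rfl
  · intro s₁ s₂ s₃ hs
    refine not_double_of_passed gb h3 s₁.pos s₂.pos s₃.pos ?_
    have := hs.map Slice.pos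
    rwa [map_pos_bare] at this

end Spanning

end Datum

namespace Datum

/-! ### The basis -/

section Basis

variable {R : Type*} [CommRing R] {I E : Type*} {n l : ℕ} {K : Datum R I E n l}

theorem idempotent_mul_toAlg {p q : K.Obj} (D : K.Diagram p q) :
    (idempotent q).toAlg * D.toAlg = D.toAlg := by
  conv_rhs => rw [← one_mul D.toAlg, ← sum_toAlg_idempotent, Finset.sum_mul]
  exact (Finset.sum_eq_single q (fun r _ h => toAlg_mul_eq_zero _ _ h.symm) (by simp)).symm

theorem toAlg_mul_idempotent {p q : K.Obj} (D : K.Diagram p q) :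
    D.toAlg * (idempotent p).toAlg = D.toAlg := by
  conv_rhs => rw [← mul_one D.toAlg, ← sum_toAlg_idempotent, Finset.mul_sum]
  exact (Finset.sum_eq_single p (fun r _ h => toAlg_mul_eq_zero _ _ h) (by simp)).symm

theorem dotPoly_eq_monomial (a : Fin n → ℕ) :
    dotPoly R a = MvPolynomial.monomial (Finsupp.equivFunOnFinite.symm a) 1 := by
  rw [MvPolynomial.monomial_eq, Finsupp.prod_fintype _ _ fun _ => pow_zero _, map_one, one_mul]
  rfl

/-- The representation separates different end points. For fixed end points, the dots at the bottom
combine into one polynomial for each permutation, and these vanish by `eq_zero_of_sum_op_eq_zero`;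
their coefficients are those of the relation. -/
theorem linearIndependent_permutationDiagrams [IsDomain R]
    (D : (x : K.PermIndex) → K.Diagram x.bot x.top)
    (hD : ∀ x, (D x).IsPermutationDiagram x.w) :
    LinearIndependent R fun x : K.PermIndex × (Fin n → ℕ) =>
      ((D x.1).comp (dottedIdempotent x.1.bot x.2)).toAlg := by
  classical
  rw [linearIndependent_iff']
  rintro s g hg ⟨⟨p, q, w₀, hw₀⟩, a₀⟩ hi
  set W : Finset (Equiv.Perm (Fin n)) :=
    Finset.univ.filter fun w => ∀ k, q.res (w k) = p.res k with hW
  -- Outside `W` no permutation diagram with these end points exists; the diagram of `w₀` only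
  -- serves as a default value there.
  set D' : Equiv.Perm (Fin n) → K.Diagram p q := fun w =>
    if h : ∀ k, q.res (w k) = p.res k then D ⟨p, q, w, h⟩ else D ⟨p, q, w₀, hw₀⟩ with hD'
  set s' := s.filter fun i => i.1.bot = p ∧ i.1.top = q with hs'
  have m₀ : ((⟨p, q, w₀, hw₀⟩, a₀) : K.PermIndex × (Fin n → ℕ)) ∈ s' := by
    rw [hs', Finset.mem_filter]
    exact ⟨hi, rfl, rfl⟩
  set h : Equiv.Perm (Fin n) → MvPolynomial (Fin n) R := fun w =>
    ∑ i ∈ s' with i.1.w = w, g i • dotPoly R i.2 with hh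
  have key : ∀ w ∈ W, h w = 0 := by
    refine eq_zero_of_sum_op_eq_zero (D := D') (fun w hw => ?_) fun f => ?_
    · have h1 : ∀ k, q.res (w k) = p.res k := (Finset.mem_filter.1 hw).2
      simp only [hD', dif_pos h1]
      exact hD ⟨p, q, w, h1⟩
    -- The relation is applied to a vector supported at `p`, and its component at `q` is read off;
    -- this leaves only diagrams from `p` to `q`.
    · have h1 : ∑ i ∈ s, g i • (K.rep ((D i.1).comp (dottedIdempotent i.1.bot i.2)).toAlg
          (Pi.single p f)) q = 0 := by
        have := congrArg (fun x => (K.rep x (Pi.single p f)) q) hg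
        simpa only [map_sum, map_smul, LinearMap.sum_apply, LinearMap.smul_apply,
          Finset.sum_apply, Pi.smul_apply, map_zero, LinearMap.zero_apply, Pi.zero_apply] using this
      have h2 : ∀ i ∈ s, i ∉ s' → g i • (K.rep ((D i.1).comp
          (dottedIdempotent i.1.bot i.2)).toAlg (Pi.single p f)) q = 0 := by
        intro i his hi'
        have h3 : ¬ (i.1.bot = p ∧ i.1.top = q) := fun h => hi' (Finset.mem_filter.2 ⟨his, h⟩)
        rw [rep_toAlg, blockOp_apply]
        by_cases h4 : i.1.bot = p
        · rw [Pi.single_eq_of_ne fun h5 => h3 ⟨h4, h5.symm⟩, smul_zero]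
        · rw [Pi.single_eq_of_ne h4, map_zero, Pi.single_zero, Pi.zero_apply, smul_zero]
      rw [← Finset.sum_subset (Finset.filter_subset _ s) h2] at h1
      have h3 : ∀ i ∈ s', i.1.w ∈ W := by
        rintro ⟨⟨p', q', w, hw⟩, a⟩ hi'
        obtain ⟨rfl, rfl⟩ := (Finset.mem_filter.1 hi').2
        exact Finset.mem_filter.2 ⟨Finset.mem_univ _, hw⟩
      rw [← Finset.sum_fiberwise_of_maps_to h3] at h1
      rw [← h1]
      refine Finset.sum_congr rfl fun w hw => ?_
      have h4 : ∀ k, q.res (w k) = p.res k := (Finset.mem_filter.1 hw).2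
      simp only [hh, hD', dif_pos h4]
      rw [Finset.sum_mul, map_sum]
      refine Finset.sum_congr rfl ?_
      rintro ⟨⟨p', q', w', hw'⟩, a⟩ hi'
      obtain ⟨h5, h6⟩ := Finset.mem_filter.1 hi'
      obtain ⟨rfl, rfl⟩ := (Finset.mem_filter.1 h5).2
      obtain rfl : w' = w := h6
      rw [rep_toAlg, blockOp_apply, Pi.single_eq_same, Pi.single_eq_same, op_comp,
        op_dottedIdempotent, smul_mul_assoc, map_smul]
  have h1 := key w₀ (Finset.mem_filter.2 ⟨Finset.mem_univ _, hw₀⟩)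
  -- Different numbers of dots give different monomials, so this coefficient is the scalar in
  -- question.
  have h2 := congrArg (MvPolynomial.coeff (Finsupp.equivFunOnFinite.symm a₀)) h1
  simp only [hh, MvPolynomial.coeff_sum, MvPolynomial.coeff_zero] at h2
  rw [Finset.sum_eq_single (⟨p, q, w₀, hw₀⟩, a₀)] at h2
  · simpa [dotPoly_eq_monomial] using h2
  · rintro ⟨⟨p', q', w', hw'⟩, a⟩ hi' hne
    obtain ⟨h5, h6⟩ := Finset.mem_filter.1 hi'
    obtain ⟨rfl, rfl⟩ := (Finset.mem_filter.1 h5).2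
    obtain rfl : w' = w₀ := h6
    have h7 : Finsupp.equivFunOnFinite.symm a ≠ Finsupp.equivFunOnFinite.symm a₀ :=
      fun h => hne (by rw [Finsupp.equivFunOnFinite.symm.injective h])
    rw [MvPolynomial.coeff_smul, dotPoly_eq_monomial, MvPolynomial.coeff_monomial, if_neg h7,
      smul_zero]
  · intro h5
    rw [Finset.mem_filter] at h5
    exact absurd ⟨m₀, rfl⟩ h5

/-- The basis of permutation diagrams with dots at the bottom. -/
theorem exists_basis [IsDomain R] (D : (x : K.PermIndex) → K.Diagram x.bot x.top)
    (hD : ∀ x, (D x).IsPermutationDiagram x.w) :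
    ∃ b : Module.Basis (K.PermIndex × (Fin n → ℕ)) R K.Alg,
      ∀ (x : K.PermIndex) (a : Fin n → ℕ),
        b (x, a) = (idempotent x.top).toAlg * (D x).toAlg *
          (dottedIdempotent x.bot a).toAlg * (idempotent x.bot).toAlg ∧
        b (x, a) ∈ K.component
          ((D x).degree + ∑ k, (a k : ℤ) * (2 * (K.quiver.d (x.bot.res k) : ℤ))) := by
  refine ⟨Module.Basis.mk (linearIndependent_permutationDiagrams D hD)
    (span_permutationDiagrams D hD).ge, fun x a => ?_⟩
  rw [Module.Basis.mk_apply]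
  constructor
  · rw [idempotent_mul_toAlg, toAlg_mul, toAlg_mul_idempotent]
  · rw [← degree_dottedIdempotent, ← degree_comp]
    exact toAlg_mem_component _

end Basis

end Datum

end WeightedKLRW

end

/-- The weighted KLRW algebra is a graded algebra, and it is free as an `R`-module with a
homogeneous basis `1_{y,j} D(w) y₁^{a₁} ⋯ yₙ^{aₙ} 1_{x,i}`, for any choice of permutation
diagrams `D(w)`; such choices exist. -/
theorem propositionP {R : Type*} [CommRing R] [IsDomain R] {I E : Type*} {n l : ℕ}
    (K : WeightedKLRW.Datum R I E n l) :
    Nonempty (GradedAlgebra K.component) ∧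
    (∀ x : K.PermIndex, ∃ D : K.Diagram x.bot x.top, D.IsPermutationDiagram x.w) ∧
    ∀ D : (x : K.PermIndex) → K.Diagram x.bot x.top,
      (∀ x, (D x).IsPermutationDiagram x.w) →
      ∃ b : Module.Basis (K.PermIndex × (Fin n → ℕ)) R K.Alg,
        ∀ (x : K.PermIndex) (a : Fin n → ℕ),
          b (x, a) = (WeightedKLRW.Datum.idempotent x.top).toAlg * (D x).toAlg *
            (WeightedKLRW.Datum.dottedIdempotent x.bot a).toAlg *
            (WeightedKLRW.Datum.idempotent x.bot).toAlg ∧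
          b (x, a) ∈ K.component
            ((D x).degree + ∑ k, (a k : ℤ) * (2 * (K.quiver.d (x.bot.res k) : ℤ))) := by
  exact ⟨WeightedKLRW.Datum.nonempty_gradedAlgebra K, WeightedKLRW.Datum.exists_permutationDiagram,
    WeightedKLRW.Datum.exists_basis⟩
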